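/- **Setting.** For $\sigma\in\{1,-1\}$ and $\alpha>0$ interpret $t^\alpha$ on $\mathbb R$ as $t^\alpha$ for $t\ge 0$ and as $\sigma|t|^\alpha$ for $t<0$. Let $\rho\in C_0^\infty(\mathbb R)$ be real and odd with $\operatorname{supp}\rho\subseteq\{\frac14<|t|<4\}$ and $\frac1t=\sum_{j\in\mathbb Z}2^j\rho(2^jt)$ for $t\ne0$. Let $\phi\in C_0^\infty(\mathbb R)$ be even and non-negative with $\operatorname{supp}\phi\subseteq\{\frac14<|x|<4\}$ and $\sum_{n\in\mathbb Z}\phi(x/2^n)=1$ for $x\neq0$. For $a\in\mathbb R$, $j\in\mathbb Z$, $m\in\mathbb N=\{0,1,2,\dots\}$ put $$m_{j,m,m}(\xi,\eta)=\Big(\int_{\mathbb R}e^{-i\frac{\xi-a\eta}{2^j}t}\,e^{i\frac{\eta}{2^{\alpha j}}t^\alpha}\rho(t)\,dt\Big)\,\phi\Big(\frac{\xi-a\eta}{2^{j+m}}\Big)\,\phi\Big(\frac{\alpha\eta}{2^{\alpha j+m}}\Big),$$ and, with $\hat f(\xi)=\int f(x)e^{-ix\xi}dx$ extended to $L^2$,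 for $f,g\in L^2(\mathbb R)$ and $h\in L^\infty(\mathbb R)$, $$\Lambda_{j,m,m}(f,g,h)=\int_{\mathbb R}\Big(\int_{\mathbb R}\int_{\mathbb R}\hat f(\xi)\,\hat g(\eta)\,m_{j,m,m}(\xi,\eta)\,e^{i(\xi+\eta)x}\,d\eta\,d\xi\Big)h(x)\,dx .$$ For $C_0\in\mathbb R$ the $m$-th stationary form is $$\Lambda^S_m(f,g,h)=\sum_{j\in\mathbb Z,\ |j|\ge C_0}\Lambda_{j,m,m}(f,g,h).$$ **Proposition.** (i) There is an absolute $\delta>0$ such that for every $a\in\mathbb R\setminus\{-1\}$ and $\alpha\in(0,\infty)\setminus\{1,2\}$ there is a threshold $C_{\min}=C_{\min}(a,\alpha)>0$ with the following property. For all $\rho,\phi,\sigma$ as above there is a constant $C=C(a,\alpha,\rho,\phi,\sigma)$ such that for all $C_0\ge C_{\min}$, all $m\in\mathbb N$, all $f,g\in L^2(\mathbb R)$ and all $h\in L^\infty(\mathbb R)$, the integrals over $x$ defining $\Lambda_{j,m,m}(f,g,h)$ with $|j|\ge C_0$ converge absolutely, the series defining $\Lambda^S_m(f,g,h)$ converges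 absolutely, and $$|\Lambda^S_m(f,g,h)|\le C\,2^{-\delta m}\,\|f\|_2\,\|g\|_2\,\|h\|_\infty .$$ (ii) For $\alpha=2$ there is no decay in $m$: let $a\in\mathbb R\setminus\{0,-1\}$, let $\rho,\phi,\sigma$ be as above with $\rho(1)\ne0$ and $\phi(1)\neq0$, and let $C_0\in\mathbb R$. Then there are $c>0$ and $m_0\in\mathbb N$ such that for every $m\ge m_0$ there are $f,g\in L^2(\mathbb R)$ and $h\in L^\infty(\mathbb R)$ with $$|\Lambda^S_m(f,g,h)|>c\,\|f\|_2\,\|g\|_2\,\|h\|_\infty .$$ -/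

import Mathlib

open MeasureTheory FourierTransform
open scoped ENNReal

noncomputable section

/-- The power `t ^ α` on the whole real line: the usual one for `t ≥ 0`, and `σ * |t| ^ α` for
`t < 0`. The sign `σ = 1` gives `|t| ^ α`, the sign `σ = -1` gives `sgn t * |t| ^ α`. -/
def signedPow (σ α t : ℝ) : ℝ :=
  if 0 ≤ t then t ^ α else σ * (-t) ^ α

/-- Spatial cutoffs: smooth odd functions `ρ` supported in `{1/4 < |t| < 4}` such that
`1 / t = ∑ j, 2 ^ j * ρ (2 ^ j * t)` for `t ≠ 0`. (Oddness gives mean zero.) -/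
structure IsSpatialCutoff (ρ : ℝ → ℝ) : Prop where
  contDiff : ContDiff ℝ ((⊤ : ℕ∞) : WithTop ℕ∞) ρ
  tsupport_subset : tsupport ρ ⊆ {t : ℝ | 1 / 4 < |t| ∧ |t| < 4}
  odd : ∀ t : ℝ, ρ (-t) = -ρ t
  hasSum : ∀ t : ℝ, t ≠ 0 → HasSum (fun j : ℤ => (2 : ℝ) ^ j * ρ ((2 : ℝ) ^ j * t)) (1 / t)

/-- Frequency cutoffs: smooth even nonnegative functions `φ` supported in `{1/4 < |x| < 4}` such
that `∑ n, φ (x / 2 ^ n) = 1` for `x ≠ 0`. -/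
structure IsFrequencyCutoff (φ : ℝ → ℝ) : Prop where
  contDiff : ContDiff ℝ ((⊤ : ℕ∞) : WithTop ℕ∞) φ
  tsupport_subset : tsupport φ ⊆ {x : ℝ | 1 / 4 < |x| ∧ |x| < 4}
  nonneg : ∀ x : ℝ, 0 ≤ φ x
  even : ∀ x : ℝ, φ (-x) = φ x
  hasSum : ∀ x : ℝ, x ≠ 0 → HasSum (fun n : ℤ => φ (x / (2 : ℝ) ^ n)) 1

/-- The phase `-(ξ - a η) / 2 ^ j * t + η / 2 ^ (α j) * t ^ α`. -/
def phase (σ a α : ℝ) (j : ℤ) (ξ η t : ℝ) : ℝ :=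
  -((ξ - a * η) / (2 : ℝ) ^ j) * t + η / (2 : ℝ) ^ (α * (j : ℝ)) * signedPow σ α t

/-- The multiplier of the bilinear Hilbert transform along `a t + t ^ α` at spatial scale
`2 ^ (-j)`. -/
def scaleMultiplier (ρ : ℝ → ℝ) (σ a α : ℝ) (j : ℤ) (ξ η : ℝ) : ℂ :=
  ∫ t : ℝ, Complex.exp (Complex.I * (phase σ a α j ξ η t : ℂ)) * (ρ t : ℂ)

/-- The multiplier `m_{j,m,n}`: the scale `j` multiplier, localized to
`|ξ - a η| ∼ 2 ^ (j + m)` and `|α η| ∼ 2 ^ (α j + n)`. -/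
def pieceMultiplier (ρ φ : ℝ → ℝ) (σ a α : ℝ) (j m n : ℤ) (ξ η : ℝ) : ℂ :=
  scaleMultiplier ρ σ a α j ξ η
    * (φ ((ξ - a * η) / (2 : ℝ) ^ (j + m)) : ℂ)
    * (φ (α * η / (2 : ℝ) ^ (α * (j : ℝ) + (n : ℝ))) : ℂ)

/-- The `L²` Fourier transform in the normalization `∫ f x * exp (-i x ξ) dx`; Mathlib's `𝓕` has
kernel `exp (-2 π i x ξ)`. -/
def angularFourier (f : Lp ℂ 2 (volume : Measure ℝ)) (ξ : ℝ) : ℂ :=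
  (𝓕 f : Lp ℂ 2 (volume : Measure ℝ)) (ξ / (2 * Real.pi))

/-- The bilinear operator with multiplier `m_{j,m,n}`. -/
def pieceOperator (ρ φ : ℝ → ℝ) (σ a α : ℝ) (j m n : ℤ)
    (f g : Lp ℂ 2 (volume : Measure ℝ)) (x : ℝ) : ℂ :=
  ∫ ξ : ℝ, ∫ η : ℝ, angularFourier f ξ * angularFourier g η
    * pieceMultiplier ρ φ σ a α j m n ξ η * Complex.exp (Complex.I * (((ξ + η) * x : ℝ) : ℂ))

/-- The trilinear form with multiplier `m_{j,m,n}`. The factor `ĥ` of a bounded `h`, which is only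
a distribution, is removed by pairing the bilinear operator with `h` in the space variable. -/
def pieceForm (ρ φ : ℝ → ℝ) (σ a α : ℝ) (j m n : ℤ)
    (f g : Lp ℂ 2 (volume : Measure ℝ)) (h : Lp ℂ ∞ (volume : Measure ℝ)) : ℂ :=
  ∫ x : ℝ, pieceOperator ρ φ σ a α j m n f g x * h x

/-- The `m`-th stationary form `Λ^S_m = ∑_{|j| ≥ C₀} Λ_{j,m,m}`. -/
def stationaryForm (ρ φ : ℝ → ℝ) (σ a α C₀ : ℝ) (m : ℕ)
    (f g : Lp ℂ 2 (volume : Measure ℝ)) (h : Lp ℂ ∞ (volume : Measure ℝ)) : ℂ :=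
  ∑' j : {j : ℤ // C₀ ≤ |(j : ℝ)|}, pieceForm ρ φ σ a α j m m f g h

end

/-!
With `L = 2 ^ m` the multiplier is, after dilation, a sum of kernels in multiples `P` of `ξ - a η`
and `Q` of `η`, one of them carrying a small factor `e` of size `2 ^ (-|α - 1| |j|)`. The
substitution `u = t ^ α` exchanges the frequencies (`oscInt_eq_powSubst`), which covers both signs
of `(α - 1) j`.

*Decay.* Stationary phase in `t` leaves an amplitude of size `L ^ (-1/2)` with controlled
derivatives (`exists_oscAmp_bounds`) times the exponential of the critical value of the phase.
Squaring the bilinear operator twice (`lintegral_freqOp_sq_le`) leads to correlations of four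
translates, whose phase has mixed derivative of order `mixSize a e`; for `a ≠ 0` this is where
`α ≠ 2` and `a ≠ -1` enter, since for `α = 2` the critical value is a quadratic form up to `O(e)`.
Their decay (`exists_quadCorr_bounds`) improves the trivial `L²` bound by a power of `L`
(`exists_freqBound_stationary`). The operators are essentially local at length `L`, so
Cauchy–Schwarz on cells of that length turns this into an `L¹` bound
(`exists_spaceBound_of_mixSize`). If `a = 0` and `e` is tiny, the mixed derivative degenerates;
then one function is nearly constant on short cells, and the frozen kernels are almost orthogonal
(`exists_sampleGram_bound`, `IsCcKernel.sampleBound`). If `t` has no stationary point, the kernel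
is small by itself (`exists_spaceBound_nonstationary`). The bands of `ξ` and `η` seen by different
scales overlap boundedly, so the pieces can be summed (`exists_stationaryForm_le`), with
`δ = 1/80`.

*Resonance.* For `α = 2` chirps `f`, `g` and a Gaussian `h` complete the square in the phase
(`chirp_mul_pieceMultiplier`, `IsCcKernel.integral_spaceOp_mul_gaussian`). At a scale with `e`
small against `1 / L` there remains one Fresnel integral of size `L ^ (-1/2)`
(`le_norm_integral_fresnel`) times an integral of constant sign, negative `t` being nonstationary
(`norm_integral_chirpInt_neg_le`); the Gaussian restores the factor `L ^ (1/2)`. Only this scale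
meets the supports of `f` and `g` (`exists_pieceForm_ge`), so nothing can cancel in the sum over
`j`.
-/

noncomputable section

open scoped ComplexConjugate
open Set (Icc Ico Ioc Ioi Ioo indicator_of_mem indicator_of_notMem uIcc uIcc_of_le uIoc_of_le
  univ)
open intervalIntegral (continuous_parametric_intervalIntegral_of_continuous'
  integral_add_adjacent_intervals integral_congr integral_eq_sub_of_hasDerivAt integral_mono_on
  integral_of_le integral_same)
open Complex (I I_ne_zero I_sq conj_I conj_conj conj_ofReal continuous_conj continuous_ofReal exp
  exp_add exp_conj exp_zero inv_re norm_I norm_exp norm_real ofRealCLM ofReal_ne_zero ofReal_neg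
  ofReal_re real_smul)
open Real (continuous_rpow_const cos div_rpow logb norm_eq_abs norm_of_nonneg one_rpow pi
  pi_ne_zero rpow_add rpow_natCast rpow_neg rpow_one rpow_pos_of_pos rpow_sub sq_sqrt
  sqrt_eq_zero_of_nonpos sqrt_le_iff sqrt_le_sqrt sqrt_mul sqrt_nonneg sqrt_pos)
open ENNReal (mul_ne_top mul_rpow_of_nonneg ofReal ofReal_add ofReal_le_ofReal ofReal_mul
  ofReal_natCast ofReal_ne_top ofReal_one ofReal_pow rpow_lt_top_of_nonneg rpow_mul rpow_two
  tsum_le_tsum tsum_prod')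
open Filter (Tendsto atTop liminf univ_mem)
open Finset (measurable_sum mem_univ mul_sum range sum_add_distrib sum_comm sum_congr sum_div
  sum_le_sum sum_nonneg)

local notation "L²" => Lp ℂ 2 (volume : Measure ℝ)
local notation "L^∞" => Lp ℂ ∞ (volume : Measure ℝ)
local notation "Smooth" => ContDiff ℝ ((⊤ : ℕ∞) : WithTop ℕ∞)
local notation "SmoothAt" => ContDiffAt ℝ ((⊤ : ℕ∞) : WithTop ℕ∞)
local notation "SmoothOn" => ContDiffOn ℝ ((⊤ : ℕ∞) : WithTop ℕ∞)
/-- The oscillating factor with a real phase. -/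
local notation "expI(" x ")" => Complex.exp (I * ((x : ℝ) : ℂ))

/-! ### Oscillatory integrals in one variable -/

theorem hasDerivAt_affine (A B u : ℝ) : HasDerivAt (fun u => A + B * u) B u :=
  (((hasDerivAt_id u).const_mul B).const_add A).congr_deriv (mul_one B)

theorem norm_expI (x : ℝ) : ‖expI(x)‖ = 1 := by rw [mul_comm]; exact Complex.norm_exp_ofReal_mul_I x

theorem norm_intervalIntegral_le {f : ℝ → ℂ} {c d A : ℝ} (hcd : c ≤ d)
    (h : ∀ x ∈ Icc c d, ‖f x‖ ≤ A) : ‖∫ x in c..d, f x‖ ≤ A * (d - c) := by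
  rw [← abs_of_nonneg (sub_nonneg.2 hcd)]
  exact intervalIntegral.norm_integral_le_of_norm_le_const fun x hx =>
    h x (Set.Ioc_subset_Icc_self (by rwa [uIoc_of_le hcd] at hx))

theorem conj_expI (x : ℝ) : conj (expI(x)) = expI(-x) := by rw [← exp_conj]; simp

theorem hasDerivAt_exp_I_mul {D : ℝ → ℝ} {D' x : ℝ} (h : HasDerivAt D D' x) :
    HasDerivAt (fun x => expI(D x)) (I * (D' : ℂ) * expI(D x)) x := by
  have := (h.ofReal_comp.const_mul I).cexp
  rw [mul_comm]; exact this

/-- A bounded function that is the derivative of `f` on an interval is integrable there: no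
continuity of the derivative is needed, because derivatives are measurable. -/
theorem intervalIntegrable_of_hasDerivAt_of_bound {f f' : ℝ → ℂ} {c d A : ℝ} (hcd : c ≤ d)
    (hf : ∀ x ∈ Icc c d, HasDerivAt f (f' x) x) (hb : ∀ x ∈ Icc c d, ‖f' x‖ ≤ A) :
    IntervalIntegrable f' volume c d := by
  rw [intervalIntegrable_iff_integrableOn_Icc_of_le hcd]
  refine Integrable.mono' (g := fun _ => A) (by simp) ?_ ?_
  · refine (aestronglyMeasurable_deriv f _).congr ?_
    filter_upwards [ae_restrict_mem measurableSet_Icc] with x hx using (hf x hx).deriv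
  · filter_upwards [ae_restrict_mem measurableSet_Icc] with x hx using hb x hx

/-- First-derivative test with an amplitude: no monotonicity of `D'` is assumed, its variation is
controlled by the bound `ν` for `D''` instead. -/
theorem norm_integral_exp_le_of_first_deriv {c d : ℝ} (hcd : c ≤ d) {D D' D'' : ℝ → ℝ}
    {a a' : ℝ → ℂ} {μ ν A₀ A₁ : ℝ} (hμ : 0 < μ)
    (hD : ∀ x ∈ Icc c d, HasDerivAt D (D' x) x)
    (hD' : ∀ x ∈ Icc c d, HasDerivAt D' (D'' x) x)
    (ha : ∀ x ∈ Icc c d, HasDerivAt a (a' x) x)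
    (h1 : ∀ x ∈ Icc c d, μ ≤ |D' x|) (h2 : ∀ x ∈ Icc c d, |D'' x| ≤ ν)
    (h3 : ∀ x ∈ Icc c d, ‖a x‖ ≤ A₀) (h4 : ∀ x ∈ Icc c d, ‖a' x‖ ≤ A₁) :
    ‖∫ x in c..d, expI(D x) * a x‖ ≤ (2 * A₀ + (d - c) * (A₁ + A₀ * ν / μ)) / μ := by
  have hne : ∀ x ∈ Icc c d, (I * (D' x : ℂ)) ≠ 0 := by
    intro x hx
    have : D' x ≠ 0 := by intro h0; have := h1 x hx; rw [h0, abs_zero] at this; linarith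
    simp [this]
  have hA0 : 0 ≤ A₀ := (norm_nonneg _).trans (h3 c (by simp [hcd]))
  have hν : 0 ≤ ν := (abs_nonneg _).trans (h2 c (by simp [hcd]))
  have hA1 : 0 ≤ A₁ := (norm_nonneg _).trans (h4 c (by simp [hcd]))
  set u : ℝ → ℂ := fun x => a x / (I * (D' x : ℂ)) with hu
  set u' : ℝ → ℂ := fun x => (a' x * (I * (D' x : ℂ)) - a x * (I * (D'' x : ℂ))) /
    (I * (D' x : ℂ)) ^ 2 with hu'
  have hud : ∀ x ∈ Icc c d, HasDerivAt u (u' x) x := fun x hx =>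
    (ha x hx).div ((hD' x hx).ofReal_comp.const_mul I) (hne x hx)
  have hnD : ∀ x ∈ Icc c d, μ ≤ ‖I * (D' x : ℂ)‖ := by intro x hx; simpa using h1 x hx
  have hub : ∀ x ∈ Icc c d, ‖u x‖ ≤ A₀ / μ := by
    intro x hx
    rw [hu]; simp only [norm_div]
    exact div_le_div₀ hA0 (h3 x hx) hμ (hnD x hx)
  have hu'b : ∀ x ∈ Icc c d, ‖u' x‖ ≤ (A₁ + A₀ * ν / μ) / μ := by
    intro x hx
    have e : u' x = a' x / (I * (D' x : ℂ)) -
        a x / (I * (D' x : ℂ)) * ((I * (D'' x : ℂ)) / (I * (D' x : ℂ))) := by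
      have := hne x hx
      rw [hu']; field_simp
    rw [e]
    refine (norm_sub_le _ _).trans ?_
    rw [norm_mul]
    have b1 : ‖a' x / (I * (D' x : ℂ))‖ ≤ A₁ / μ := by
      rw [norm_div]; exact div_le_div₀ hA1 (h4 x hx) hμ (hnD x hx)
    have b2 : ‖(I * (D'' x : ℂ)) / (I * (D' x : ℂ))‖ ≤ ν / μ := by
      rw [norm_div]; exact div_le_div₀ hν (by simpa using h2 x hx) hμ (hnD x hx)
    have b3 := mul_le_mul (hub x hx) b2 (norm_nonneg _) (by positivity)
    calc _ ≤ A₁ / μ + A₀ / μ * (ν / μ) := add_le_add b1 b3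
      _ = _ := by ring
  have hII : uIcc c d = Icc c d := uIcc_of_le hcd
  have hu'i := intervalIntegrable_of_hasDerivAt_of_bound hcd hud hu'b
  have hvd : ∀ x ∈ Icc c d, HasDerivAt (fun x => expI(D x))
      (I * (D' x : ℂ) * expI(D x)) x := fun x hx => hasDerivAt_exp_I_mul (hD x hx)
  have hvi : IntervalIntegrable (fun x => I * (D' x : ℂ) * expI(D x)) volume c d := by
    apply ContinuousOn.intervalIntegrable
    rw [hII]
    intro x hx
    exact ContinuousAt.continuousWithinAt
      ((continuousAt_const.mul (hD' x hx).ofReal_comp.continuousAt).mul (hvd x hx).continuousAt)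
  have key := intervalIntegral.integral_mul_deriv_eq_deriv_mul
    (by rwa [hII]) (by rwa [hII]) hu'i hvi
  have e1 : ∫ x in c..d, expI(D x) * a x = ∫ x in c..d, u x * (I * (D' x : ℂ) * expI(D x)) := by
    apply integral_congr
    intro x hx
    rw [hII] at hx
    have := hne x hx
    simp only [hu]
    rw [← mul_assoc, div_mul_cancel₀ _ this, mul_comm]
  rw [e1, key]
  have hc : c ∈ Icc c d := by simp [hcd]
  have hd : d ∈ Icc c d := by simp [hcd]
  have i1 : ‖∫ x in c..d, u' x * expI(D x)‖ ≤ (A₁ + A₀ * ν / μ) / μ * (d - c) :=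
    norm_intervalIntegral_le hcd fun x hx => by rw [norm_mul, norm_expI, mul_one]; exact hu'b x hx
  refine (norm_sub_le _ _).trans ((add_le_add (norm_sub_le _ _) i1).trans ?_)
  rw [norm_mul, norm_mul, norm_expI, norm_expI]
  have := hub c hc
  have := hub d hd
  calc _ ≤ A₀ / μ * 1 + A₀ / μ * 1 + (A₁ + A₀ * ν / μ) / μ * (d - c) := by gcongr
    _ = _ := by ring

/-- Monotone first-derivative test. -/
theorem norm_integral_exp_le_of_monotone_deriv {c d : ℝ} (hcd : c ≤ d) {P P' P'' : ℝ → ℝ} {μ : ℝ}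
    (hμ : 0 < μ) (hP : ∀ x ∈ Icc c d, HasDerivAt P (P' x) x)
    (hP' : ∀ x ∈ Icc c d, HasDerivAt P' (P'' x) x) (hc : ContinuousOn P'' (Icc c d))
    (h1 : ∀ x ∈ Icc c d, μ ≤ |P' x|) (h2 : ∀ x ∈ Icc c d, 0 ≤ P'' x) :
    ‖∫ x in c..d, expI(P x)‖ ≤ 4 / μ := by
  have hne : ∀ x ∈ Icc c d, P' x ≠ 0 := by
    intro x hx h0; have := h1 x hx; rw [h0, abs_zero] at this; linarith
  have hneC : ∀ x ∈ Icc c d, (I * (P' x : ℂ)) ≠ 0 := by intro x hx; simp [hne x hx]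
  have hII : uIcc c d = Icc c d := uIcc_of_le hcd
  set u : ℝ → ℂ := fun x => (I * (P' x : ℂ))⁻¹ with hu
  set u' : ℝ → ℂ := fun x => -(I * (P'' x : ℂ)) / (I * (P' x : ℂ)) ^ 2 with hu'
  have hud : ∀ x ∈ Icc c d, HasDerivAt u (u' x) x := fun x hx =>
    ((hP' x hx).ofReal_comp.const_mul I).inv (hneC x hx)
  have hcP' : ContinuousOn P' (Icc c d) := fun x hx => (hP' x hx).continuousAt.continuousWithinAt
  have hcu' : ContinuousOn u' (Icc c d) := by
    apply ContinuousOn.div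
    · exact (continuousOn_const.mul (continuous_ofReal.comp_continuousOn hc)).neg
    · exact (continuousOn_const.mul (continuous_ofReal.comp_continuousOn hcP')).pow 2
    · intro x hx; exact pow_ne_zero _ (hneC x hx)
  have hvd : ∀ x ∈ Icc c d, HasDerivAt (fun x => expI(P x))
      (I * (P' x : ℂ) * expI(P x)) x := fun x hx => hasDerivAt_exp_I_mul (hP x hx)
  have hvi : IntervalIntegrable (fun x => I * (P' x : ℂ) * expI(P x)) volume c d := by
    apply ContinuousOn.intervalIntegrable
    rw [hII]
    intro x hx
    exact ContinuousAt.continuousWithinAt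
      ((continuousAt_const.mul (hP' x hx).ofReal_comp.continuousAt).mul (hvd x hx).continuousAt)
  have key := intervalIntegral.integral_mul_deriv_eq_deriv_mul (u := u) (u' := u')
    (by rwa [hII]) (by rwa [hII]) (by rw [← hII] at hcu'; exact hcu'.intervalIntegrable) hvi
  have e1 : ∫ x in c..d, expI(P x) = ∫ x in c..d, u x * (I * (P' x : ℂ) * expI(P x)) := by
    apply integral_congr
    intro x hx
    rw [hII] at hx
    have := hneC x hx
    simp only [hu]
    rw [← mul_assoc, inv_mul_cancel₀ this, one_mul]
  have hc' : c ∈ Icc c d := by simp [hcd]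
  have hd' : d ∈ Icc c d := by simp [hcd]
  have hub : ∀ x ∈ Icc c d, ‖u x‖ ≤ 1 / μ := by
    intro x hx
    rw [hu]; simp only [norm_inv, norm_mul, norm_I, one_mul, norm_real, norm_eq_abs]
    rw [← one_div]; exact one_div_le_one_div_of_le hμ (h1 x hx)
  -- `|u'|` is the derivative of `-1 / P'`, so its integral is a difference of end point values
  have hq : ∀ x ∈ Icc c d, HasDerivAt (fun x => -(P' x)⁻¹) (P'' x / P' x ^ 2) x := by
    intro x hx
    exact ((hP' x hx).inv (hne x hx)).neg.congr_deriv (by rw [neg_div, neg_neg])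
  have hqc : ContinuousOn (fun x => P'' x / P' x ^ 2) (Icc c d) :=
    hc.div (hcP'.pow 2) (fun x hx => pow_ne_zero _ (hne x hx))
  have i1 : ‖∫ x in c..d, u' x * expI(P x)‖ ≤ 2 / μ := by
    refine (intervalIntegral.norm_integral_le_integral_norm hcd).trans ?_
    have : ∫ x in c..d, ‖u' x * expI(P x)‖ = ∫ x in c..d, P'' x / P' x ^ 2 := by
      apply integral_congr
      intro x hx
      rw [hII] at hx
      simp only [hu', norm_mul, norm_expI, mul_one, norm_div, norm_neg, norm_I,
        one_mul, norm_real, norm_eq_abs, norm_pow, sq_abs, abs_of_nonneg (h2 x hx)]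
    rw [this, integral_eq_sub_of_hasDerivAt (by rwa [hII])
      (by rw [← hII] at hqc; exact hqc.intervalIntegrable)]
    have b : ∀ x ∈ Icc c d, |(P' x)⁻¹| ≤ 1 / μ := by
      intro x hx; rw [abs_inv, ← one_div]; exact one_div_le_one_div_of_le hμ (h1 x hx)
    have b1 := abs_le.1 (b c hc')
    have b2 := abs_le.1 (b d hd')
    have : 2 / μ = 1 / μ + 1 / μ := by ring
    linarith [b1.1, b1.2, b2.1, b2.2]
  rw [e1, key]
  refine (norm_sub_le _ _).trans ((add_le_add (norm_sub_le _ _) i1).trans ?_)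
  rw [norm_mul, norm_mul, norm_expI, norm_expI]
  have := hub c hc'
  have := hub d hd'
  calc _ ≤ 1 / μ * 1 + 1 / μ * 1 + 2 / μ := by gcongr
    _ = _ := by ring

/-- Van der Corput's second-derivative test for a convex phase. -/
theorem norm_integral_exp_le_of_second_deriv_pos {c d : ℝ} (hcd : c ≤ d) {P P' P'' : ℝ → ℝ} {μ : ℝ}
    (hμ : 0 < μ) (hP : ∀ x ∈ Icc c d, HasDerivAt P (P' x) x)
    (hP' : ∀ x ∈ Icc c d, HasDerivAt P' (P'' x) x) (hc : ContinuousOn P'' (Icc c d))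
    (h2 : ∀ x ∈ Icc c d, μ ≤ P'' x) :
    ‖∫ x in c..d, expI(P x)‖ ≤ 10 / √μ := by
  have hs : 0 < √μ := sqrt_pos.2 hμ
  have hss : √μ * √μ = μ := Real.mul_self_sqrt hμ.le
  have hcP' : ContinuousOn P' (Icc c d) := fun x hx => (hP' x hx).continuousAt.continuousWithinAt
  have hmono : ∀ x ∈ Icc c d, ∀ y ∈ Icc c d, x ≤ y → μ * (y - x) ≤ P' y - P' x := by
    apply (convex_Icc c d).mul_sub_le_image_sub_of_le_deriv hcP'
    · intro x hx; rw [interior_Icc] at hx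
      exact (hP' x ⟨hx.1.le, hx.2.le⟩).differentiableAt.differentiableWithinAt
    · intro x hx; rw [interior_Icc] at hx
      rw [(hP' x ⟨hx.1.le, hx.2.le⟩).deriv]; exact h2 x ⟨hx.1.le, hx.2.le⟩
  -- a point at which `|P'|` is smallest
  obtain ⟨x₀, hx₀, hlow⟩ : ∃ x₀ ∈ Icc c d, ∀ x ∈ Icc c d, μ * |x - x₀| ≤ |P' x| := by
    have hc' : c ∈ Icc c d := by simp [hcd]
    have hd' : d ∈ Icc c d := by simp [hcd]
    by_cases h : 0 ≤ P' c
    · refine ⟨c, hc', fun x hx => ?_⟩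
      have := hmono c hc' x hx hx.1
      rw [abs_of_nonneg (by linarith [hx.1])]
      exact le_trans (by linarith) (le_abs_self _)
    by_cases h' : P' d ≤ 0
    · refine ⟨d, hd', fun x hx => ?_⟩
      have := hmono x hx d hd' hx.2
      rw [abs_of_nonpos (by linarith [hx.2])]
      exact le_trans (by linarith) (neg_le_abs _)
    push Not at h h'
    obtain ⟨z, hz, hz0⟩ := intermediate_value_Icc hcd hcP' ⟨h.le, h'.le⟩
    refine ⟨z, hz, fun x hx => ?_⟩
    rcases le_total x z with hxz | hxz
    · have := hmono x hx z hz hxz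
      rw [abs_of_nonpos (by linarith)]
      exact le_trans (by linarith) (neg_le_abs _)
    · have := hmono z hz x hx hxz
      rw [abs_of_nonneg (by linarith)]
      exact le_trans (by linarith) (le_abs_self _)
  set δ := 1 / √μ with hδ
  have hδ0 : 0 < δ := by positivity
  have hμδ : μ * δ = √μ := by rw [hδ, mul_one_div, div_eq_iff hs.ne', hss]
  set p := max c (x₀ - δ)
  set q := min d (x₀ + δ)
  have hcp : c ≤ p := le_max_left _ _
  have hqd : q ≤ d := min_le_left _ _
  have hpx : p ≤ x₀ := max_le hx₀.1 (by linarith)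
  have hxq : x₀ ≤ q := le_min hx₀.2 (by linarith)
  have hcont : ContinuousOn (fun x => expI(P x)) (Icc c d) :=
    fun x hx => (hasDerivAt_exp_I_mul (hP x hx)).continuousAt.continuousWithinAt
  have hint : ∀ x ∈ Icc c d, ∀ y ∈ Icc c d, IntervalIntegrable (fun x => expI(P x)) volume x y := by
    intro x hx y hy
    apply ContinuousOn.intervalIntegrable
    exact hcont.mono (Set.uIcc_subset_Icc hx hy)
  have mp : p ∈ Icc c d := ⟨hcp, by linarith⟩
  have mq : q ∈ Icc c d := ⟨by linarith, hqd⟩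
  have mc : c ∈ Icc c d := by simp [hcd]
  have md : d ∈ Icc c d := by simp [hcd]
  have hsplit : ∫ x in c..d, expI(P x) = (∫ x in c..p, expI(P x)) + (∫ x in p..q, expI(P x)) +
      ∫ x in q..d, expI(P x) := by
    rw [integral_add_adjacent_intervals (hint c mc p mp) (hint p mp q mq),
      integral_add_adjacent_intervals (hint c mc q mq) (hint q mq d md)]
  have h4 : 4 / √μ = 4 / (μ * δ) := by rw [hμδ]
  have b1 : ‖∫ x in c..p, expI(P x)‖ ≤ 4 / √μ := by
    rcases le_or_gt (x₀ - δ) c with h | h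
    · have : p = c := max_eq_left h
      rw [this, integral_same, norm_zero]; positivity
    · have hp : p = x₀ - δ := max_eq_right h.le
      have hsub : ∀ x ∈ Icc c p, x ∈ Icc c d := fun x hx => ⟨hx.1, hx.2.trans mp.2⟩
      rw [h4]
      refine norm_integral_exp_le_of_monotone_deriv hcp (by positivity)
        (fun x hx => hP x (hsub x hx)) (fun x hx => hP' x (hsub x hx))
        (hc.mono hsub) (fun x hx => ?_) (fun x hx => hμ.le.trans (h2 x (hsub x hx)))
      refine le_trans ?_ (hlow x (hsub x hx))
      gcongr
      rw [abs_of_nonpos (by linarith [hx.2])]; linarith [hx.2]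
  have b3 : ‖∫ x in q..d, expI(P x)‖ ≤ 4 / √μ := by
    rcases le_or_gt d (x₀ + δ) with h | h
    · have : q = d := min_eq_left h
      rw [this, integral_same, norm_zero]; positivity
    · have hp : q = x₀ + δ := min_eq_right h.le
      have hsub : ∀ x ∈ Icc q d, x ∈ Icc c d := fun x hx => ⟨mq.1.trans hx.1, hx.2⟩
      rw [h4]
      refine norm_integral_exp_le_of_monotone_deriv hqd (by positivity)
        (fun x hx => hP x (hsub x hx)) (fun x hx => hP' x (hsub x hx))
        (hc.mono hsub) (fun x hx => ?_) (fun x hx => hμ.le.trans (h2 x (hsub x hx)))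
      refine le_trans ?_ (hlow x (hsub x hx))
      gcongr
      rw [abs_of_nonneg (by linarith [hx.1])]; linarith [hx.1]
  have b2 : ‖∫ x in p..q, expI(P x)‖ ≤ 2 / √μ := by
    refine (norm_intervalIntegral_le (A := 1) (by linarith) fun x _ => (norm_expI _).le).trans ?_
    rw [one_mul]
    have h1 : q ≤ x₀ + δ := min_le_right _ _
    have h2 : x₀ - δ ≤ p := le_max_right _ _
    have : 2 / √μ = 2 * δ := by rw [hδ]; ring
    linarith
  rw [hsplit]
  refine (norm_add₃_le).trans ((add_le_add (add_le_add b1 b2) b3).trans ?_)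
  apply le_of_eq; ring

/-- Van der Corput's second-derivative test, with an amplitude. -/
theorem norm_integral_exp_mul_le_of_second_deriv {c d : ℝ} (hcd : c ≤ d) {P P' P'' : ℝ → ℝ}
    {a a' : ℝ → ℂ} {μ A₀ A₁ : ℝ} (hμ : 0 < μ)
    (hP : ∀ x ∈ Icc c d, HasDerivAt P (P' x) x)
    (hP' : ∀ x ∈ Icc c d, HasDerivAt P' (P'' x) x) (hc : ContinuousOn P'' (Icc c d))
    (h2 : ∀ x ∈ Icc c d, μ ≤ |P'' x|)
    (ha : ∀ x ∈ Icc c d, HasDerivAt a (a' x) x)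
    (h3 : ∀ x ∈ Icc c d, ‖a x‖ ≤ A₀) (h4 : ∀ x ∈ Icc c d, ‖a' x‖ ≤ A₁) :
    ‖∫ x in c..d, expI(P x) * a x‖ ≤ 10 / √μ * (A₀ + (d - c) * A₁) := by
  have hII : uIcc c d = Icc c d := uIcc_of_le hcd
  have hs : 0 < √μ := sqrt_pos.2 hμ
  have hcd' : c ∈ Icc c d := by simp [hcd]
  have hdd' : d ∈ Icc c d := by simp [hcd]
  have hA0 : 0 ≤ A₀ := (norm_nonneg _).trans (h3 c hcd')
  have hA1 : 0 ≤ A₁ := (norm_nonneg _).trans (h4 c hcd')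
  -- the test without amplitude on all subintervals `[c, y]`
  have hbase : ∀ y ∈ Icc c d, ‖∫ x in c..y, expI(P x)‖ ≤ 10 / √μ := by
    intro y hy
    have hsub : ∀ x ∈ Icc c y, x ∈ Icc c d := fun x hx => ⟨hx.1, hx.2.trans hy.2⟩
    have hsign : (∀ x ∈ Icc c d, μ ≤ P'' x) ∨ (∀ x ∈ Icc c d, μ ≤ - P'' x) := by
      by_contra hcon
      push Not at hcon
      obtain ⟨⟨x, hx, hx'⟩, ⟨z, hz, hz'⟩⟩ := hcon
      have hx0 : P'' x ≤ 0 := by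
        by_contra h; push Not at h
        have := h2 x hx; rw [abs_of_pos h] at this; linarith
      have hz0 : 0 ≤ P'' z := by
        by_contra h; push Not at h
        have := h2 z hz; rw [abs_of_neg h] at this; linarith
      have hcc : ContinuousOn P'' (uIcc x z) := hc.mono (Set.uIcc_subset_Icc hx hz)
      obtain ⟨w, hw, hw0⟩ := intermediate_value_uIcc hcc
        (show (0 : ℝ) ∈ uIcc (P'' x) (P'' z) by rw [uIcc_of_le (by linarith)]; exact ⟨hx0, hz0⟩)
      have := h2 w (Set.uIcc_subset_Icc hx hz hw)
      rw [hw0, abs_zero] at this; linarith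
    rcases hsign with hpos | hneg
    · exact norm_integral_exp_le_of_second_deriv_pos hy.1 hμ (fun x hx => hP x (hsub x hx))
        (fun x hx => hP' x (hsub x hx)) (hc.mono hsub) (fun x hx => hpos x (hsub x hx))
    · have := norm_integral_exp_le_of_second_deriv_pos (P := fun x => -P x) (P' := fun x => -P' x)
        (P'' := fun x => -P'' x) hy.1 hμ (fun x hx => (hP x (hsub x hx)).neg)
        (fun x hx => (hP' x (hsub x hx)).neg) (hc.mono hsub).neg (fun x hx => hneg x (hsub x hx))
      rw [integral_of_le hy.1] at this ⊢
      rw [← Complex.norm_conj, ← integral_conj] at this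
      simpa only [conj_expI, neg_neg] using this
  set Φ : ℝ → ℂ := fun y => ∫ x in c..y, expI(P x) with hΦ
  have hcont : ContinuousOn (fun x => expI(P x)) (Icc c d) :=
    fun x hx => (hasDerivAt_exp_I_mul (hP x hx)).continuousAt.continuousWithinAt
  have hΦd : ∀ x ∈ Icc c d, HasDerivWithinAt Φ (expI(P x)) (Icc c d) x := by
    intro x hx
    have : Fact (x ∈ Icc c d) := ⟨hx⟩
    apply intervalIntegral.integral_hasDerivWithinAt_right (s := Icc c d) (t := Icc c d)
    · apply ContinuousOn.intervalIntegrable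
      exact hcont.mono (Set.uIcc_subset_Icc hcd' hx)
    · exact hcont.stronglyMeasurableAtFilter_nhdsWithin measurableSet_Icc x
    · exact hcont x hx
  have ha'i := intervalIntegrable_of_hasDerivAt_of_bound hcd ha h4
  have hvi : IntervalIntegrable (fun x => expI(P x)) volume c d := by
    apply ContinuousOn.intervalIntegrable; rwa [hII]
  have key := intervalIntegral.integral_mul_deriv_eq_deriv_mul_of_hasDerivWithinAt
    (u := a) (v := Φ) (u' := a') (v' := fun x => expI(P x)) (a := c) (b := d)
    (by rw [hII]; exact fun x hx => (ha x hx).hasDerivWithinAt) (by rwa [hII]) ha'i hvi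
  have e1 : ∫ x in c..d, expI(P x) * a x = ∫ x in c..d, a x * expI(P x) := by simp_rw [mul_comm]
  rw [e1, key]
  have i1 : ‖∫ x in c..d, a' x * Φ x‖ ≤ A₁ * (10 / √μ) * (d - c) :=
    norm_intervalIntegral_le hcd fun x hx => by
      rw [norm_mul]; exact mul_le_mul (h4 x hx) (hbase x hx) (norm_nonneg _) hA1
  have hΦc : Φ c = 0 := by simp [hΦ]
  rw [hΦc, mul_zero, sub_zero]
  have i2 : ‖a d * Φ d‖ ≤ A₀ * (10 / √μ) := by
    rw [norm_mul]
    exact mul_le_mul (h3 d hdd') (hbase d hdd') (norm_nonneg _) hA0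
  refine (norm_sub_le _ _).trans ((add_le_add i2 i1).trans (le_of_eq ?_))
  ring

/-! ### One-dimensional phase integrals `∫ exp (i s L (-P t + ι Q t ^ α)) ρ t dt` -/

/-- Smooth amplitudes with compact support in `(0, ∞)`. -/
structure IsPosBump (ρ : ℝ → ℂ) : Prop where
  contDiff : Smooth ρ
  compact : HasCompactSupport ρ
  pos : tsupport ρ ⊆ Ioi 0

theorem IsPosBump.exists_interval {ρ : ℝ → ℂ} (h : IsPosBump ρ) :
    ∃ t₁ t₂ : ℝ, 0 < t₁ ∧ t₁ < t₂ ∧ ∀ t, t ∉ Ioo t₁ t₂ → ρ t = 0 := by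
  obtain ⟨a, ha0, ha⟩ := h.compact.exists_forall_le' continuousOn_id h.pos
  obtain ⟨b, hb⟩ := h.compact.bddAbove
  have hab := le_max_left a b
  refine ⟨a / 2, max a b + 1, half_pos ha0, by linarith, fun t ht =>
    image_eq_zero_of_notMem_tsupport fun htm => ht ⟨(half_lt_self ha0).trans_le (ha t htm), ?_⟩⟩
  linarith [hb htm, le_max_right a b]

/-- Multiplying by a function that is smooth on `(0, ∞)` keeps the class of amplitudes. -/
theorem IsPosBump.mul {ρ g : ℝ → ℂ} (h : IsPosBump ρ)
    (hg : SmoothOn g (Ioi 0)) : IsPosBump (fun t => g t * ρ t) := by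
  refine ⟨?_, h.compact.mul_left, (tsupport_mul_subset_right (f := g) (g := ρ)).trans h.pos⟩
  rw [contDiff_iff_contDiffAt]
  intro t
  by_cases ht : t ∈ tsupport ρ
  · exact (hg.contDiffAt (isOpen_Ioi.mem_nhds (h.pos ht))).mul h.contDiff.contDiffAt
  · have : (fun t => g t * ρ t) =ᶠ[nhds t] fun _ => 0 := by
      have := (isClosed_tsupport ρ).isOpen_compl.mem_nhds ht
      filter_upwards [this] with x hx
      rw [image_eq_zero_of_notMem_tsupport hx, mul_zero]
    exact contDiffAt_const.congr_of_eventuallyEq this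

/-- The phase `-P t + ι Q t ^ α`. -/
def oscPhase (α ι P Q t : ℝ) : ℝ := -P * t + ι * Q * t ^ α

/-- The oscillatory integral with phase `s L (-P t + ι Q t ^ α)` and amplitude `ρ`. -/
def oscInt (α s ι : ℝ) (ρ : ℝ → ℂ) (L P Q : ℝ) : ℂ :=
  ∫ t : ℝ, expI(s * L * oscPhase α ι P Q t) * ρ t

theorem continuous_oscPhase {α : ℝ} (hα : 0 < α) (ι P Q : ℝ) : Continuous (oscPhase α ι P Q) := by
  unfold oscPhase
  have := continuous_rpow_const (q := α) hα.le
  fun_prop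

theorem integral_eq_interval_of_zero_off {g : ℝ → ℂ} {t₁ t₂ : ℝ} (h : t₁ < t₂)
    (hg : ∀ t, t ∉ Ioo t₁ t₂ → g t = 0) : ∫ t, g t = ∫ t in t₁..t₂, g t := by
  rw [integral_of_le h.le, setIntegral_eq_integral_of_forall_compl_eq_zero]
  intro t ht
  exact hg t (fun h => ht ⟨h.1, h.2.le⟩)

theorem hasDerivAt_oscPhase (α ι P Q : ℝ) {t : ℝ} (ht : 0 < t) :
    HasDerivAt (oscPhase α ι P Q) (-P + ι * Q * (α * t ^ (α - 1))) t := by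
  unfold oscPhase
  have h1 := (hasDerivAt_id t).const_mul (-P)
  have h2 := (Real.hasDerivAt_rpow_const (p := α) (Or.inl ht.ne')).const_mul (ι * Q)
  exact (h1.add h2).congr_deriv (by simp)

theorem hasDerivAt_oscPhase_deriv (α ι P Q : ℝ) {t : ℝ} (ht : 0 < t) :
    HasDerivAt (fun t => -P + ι * Q * (α * t ^ (α - 1)))
      (ι * Q * (α * ((α - 1) * t ^ (α - 2)))) t := by
  have h2 := (((Real.hasDerivAt_rpow_const (p := α - 1) (Or.inl ht.ne')).const_mul α).const_mul
    (ι * Q)).const_add (-P)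
  refine h2.congr_deriv ?_
  rw [show α - 1 - 1 = α - 2 by ring]

/-- The second derivative of the phase does not vanish on a compact part of `(0, ∞)`, so the
integral decays like `L ^ (-1/2)`, uniformly in `P` and in `Q ≥ q₁`. -/
theorem exists_oscPhase_second_deriv_bound {α : ℝ} (hα : 0 < α) (hα1 : α ≠ 1) {t₁ t₂ q₁ : ℝ}
    (ht₁ : 0 < t₁) (ht : t₁ < t₂) (hq : 0 < q₁) :
    ∃ C : ℝ, 0 < C ∧ ∀ (L s ι P Q A₀ A₁ : ℝ) (a a' : ℝ → ℂ), 1 ≤ L → |s| = 1 → |ι| = 1 → q₁ ≤ Q →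
      (∀ x ∈ Icc t₁ t₂, HasDerivAt a (a' x) x) → (∀ x ∈ Icc t₁ t₂, ‖a x‖ ≤ A₀) →
      (∀ x ∈ Icc t₁ t₂, ‖a' x‖ ≤ A₁) →
      ‖∫ t in t₁..t₂, expI(s * L * oscPhase α ι P Q t) * a t‖ ≤ C * (A₀ + A₁) / √L := by
  obtain ⟨t₀, ht₀, hmin⟩ := isCompact_Icc.exists_isMinOn (s := Icc t₁ t₂)
    (f := fun t : ℝ => t ^ (α - 2)) ⟨t₁, by simp [ht.le]⟩
    (fun x hx => (Real.continuousAt_rpow_const x _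
      (Or.inl (by linarith [hx.1]))).continuousWithinAt)
  have ht0 : 0 < t₀ := by linarith [ht₀.1]
  set w := q₁ * (|α * (α - 1)| * t₀ ^ (α - 2)) with hw
  have hw0 : 0 < w := by
    have : 0 < |α * (α - 1)| := abs_pos.2 (mul_ne_zero hα.ne' (sub_ne_zero.2 hα1))
    have := rpow_pos_of_pos ht0 (α - 2)
    positivity
  refine ⟨10 / √w * (1 + (t₂ - t₁)), ?_, ?_⟩
  · have : 0 < t₂ - t₁ := by linarith
    positivity
  intro L s ι P Q A₀ A₁ a a' hL hs hι hQ ha h3 h4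
  have hL0 : 0 < L := by linarith
  have hpos : ∀ x ∈ Icc t₁ t₂, 0 < x := fun x hx => by linarith [hx.1]
  have hA0 : 0 ≤ A₀ := (norm_nonneg _).trans (h3 t₁ (by simp [ht.le]))
  have hA1 : 0 ≤ A₁ := (norm_nonneg _).trans (h4 t₁ (by simp [ht.le]))
  have key := norm_integral_exp_mul_le_of_second_deriv (μ := L * w) ht.le (by positivity)
    (P := fun t => s * L * oscPhase α ι P Q t)
    (fun x hx => (hasDerivAt_oscPhase α ι P Q (hpos x hx)).const_mul (s * L))
    (fun x hx => (hasDerivAt_oscPhase_deriv α ι P Q (hpos x hx)).const_mul (s * L))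
    (by
      intro x hx
      have := (Real.continuousAt_rpow_const x (α - 2) (Or.inl (hpos x hx).ne'))
      exact ContinuousAt.continuousWithinAt (by fun_prop))
    (by
      intro x hx
      have e : |s * L * (ι * Q * (α * ((α - 1) * x ^ (α - 2))))| =
          L * (|Q| * (|α * (α - 1)| * x ^ (α - 2))) := by
        rw [abs_mul, abs_mul, hs, abs_of_pos hL0, abs_mul, abs_mul ι, hι, ← mul_assoc α, abs_mul,
          abs_of_pos (rpow_pos_of_pos (hpos x hx) _)]
        ring
      rw [e, hw]
      have h1 : t₀ ^ (α - 2) ≤ x ^ (α - 2) := hmin hx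
      have h2 : q₁ ≤ |Q| := hQ.trans (le_abs_self _)
      have h5 := (rpow_pos_of_pos ht0 (α - 2)).le
      gcongr)
    ha h3 h4
  refine key.trans ?_
  rw [sqrt_mul hL0.le]
  have hsL : 0 < √L := sqrt_pos.2 hL0
  have hsw : 0 < √w := sqrt_pos.2 hw0
  have : A₀ + (t₂ - t₁) * A₁ ≤ (1 + (t₂ - t₁)) * (A₀ + A₁) := by nlinarith
  calc 10 / (√L * √w) * (A₀ + (t₂ - t₁) * A₁)
      ≤ 10 / (√L * √w) * ((1 + (t₂ - t₁)) * (A₀ + A₁)) := by gcongr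
    _ = _ := by field_simp

/-- In the absence of a stationary point the integral is `O(1 / L)`. -/
theorem exists_oscInt_nonstationary_bound {α : ℝ} (hα : 0 < α) {p₁ q₂ : ℝ}
    (hp : 0 < p₁) {ρ : ℝ → ℂ} (hρ : IsPosBump ρ) :
    ∃ C : ℝ, 0 < C ∧ ∀ (L s P Q : ℝ), 1 ≤ L → |s| = 1 → p₁ ≤ P → 0 ≤ Q → Q ≤ q₂ →
      ‖oscInt α s (-1) ρ L P Q‖ ≤ C / L := by
  obtain ⟨t₁, t₂, ht₁, ht, hz⟩ := hρ.exists_interval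
  have hcd : ContDiff ℝ 1 ρ := hρ.contDiff.of_le (by exact_mod_cast le_top)
  obtain ⟨A₀, hA₀⟩ := hρ.compact.exists_bound_of_continuous hρ.contDiff.continuous
  obtain ⟨A₁, hA₁⟩ := hρ.compact.deriv.exists_bound_of_continuous (hcd.continuous_deriv le_rfl)
  obtain ⟨K, hK⟩ := isCompact_Icc.exists_bound_of_continuousOn (s := Icc t₁ t₂)
    (f := fun t : ℝ => α * ((α - 1) * t ^ (α - 2))) (fun x hx => ContinuousAt.continuousWithinAt (by
      have := (Real.continuousAt_rpow_const x (α - 2) (Or.inl (by linarith [hx.1] : x ≠ 0)))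
      fun_prop))
  have hK0 : 0 ≤ K := (norm_nonneg _).trans (hK t₁ (by simp [ht.le]))
  have hA0 : 0 ≤ A₀ := (norm_nonneg _).trans (hA₀ 0)
  have hA1 : 0 ≤ A₁ := (norm_nonneg _).trans (hA₁ 0)
  have htt : 0 < t₂ - t₁ := by linarith
  refine ⟨(2 * A₀ + (t₂ - t₁) * (A₁ + A₀ * (|q₂| * K) / p₁)) / p₁ + 1, by positivity, ?_⟩
  intro L s P Q hL hs hP hQ hQ2
  have hL0 : 0 < L := by linarith
  have hpos : ∀ x ∈ Icc t₁ t₂, 0 < x := fun x hx => by linarith [hx.1]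
  unfold oscInt
  rw [integral_eq_interval_of_zero_off ht (fun t h => by rw [hz t h, mul_zero])]
  have key := norm_integral_exp_le_of_first_deriv ht.le (μ := L * p₁) (ν := L * (|q₂| * K))
    (A₀ := A₀) (A₁ := A₁) (a := ρ) (a' := deriv ρ) (by positivity)
    (D := fun t => s * L * oscPhase α (-1) P Q t)
    (fun x hx => (hasDerivAt_oscPhase α (-1) P Q (hpos x hx)).const_mul (s * L))
    (fun x hx => (hasDerivAt_oscPhase_deriv α (-1) P Q (hpos x hx)).const_mul (s * L))
    (fun x _ => ((hcd.differentiable one_ne_zero) x).hasDerivAt)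
    (by
      intro x hx
      have h1 := rpow_pos_of_pos (hpos x hx) (α - 1)
      have h2 : 0 ≤ Q * (α * x ^ (α - 1)) := by positivity
      rw [abs_mul, abs_mul, hs, abs_of_pos hL0, one_mul, abs_of_nonpos (by nlinarith)]
      gcongr
      nlinarith)
    (by
      intro x hx
      have h1 := hK x hx
      rw [norm_eq_abs] at h1
      rw [abs_mul, abs_mul, hs, abs_of_pos hL0, one_mul, abs_mul, abs_mul]
      have h2 : |Q| ≤ |q₂| := by rw [abs_of_nonneg hQ]; exact hQ2.trans (le_abs_self _)
      have h3 : |(-1 : ℝ)| = 1 := by norm_num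
      rw [h3, one_mul]
      gcongr)
    (fun x _ => hA₀ x) (fun x _ => hA₁ x)
  refine key.trans ?_
  have e : (2 * A₀ + (t₂ - t₁) * (A₁ + A₀ * (L * (|q₂| * K)) / (L * p₁))) / (L * p₁) =
      ((2 * A₀ + (t₂ - t₁) * (A₁ + A₀ * (|q₂| * K) / p₁)) / p₁) / L := by
    field_simp
  rw [e]
  gcongr
  linarith

/-! ### The stationary point -/

/-- The stationary point of `-P t + Q t ^ α`. -/
def statPoint (α P Q : ℝ) : ℝ := (P / (α * Q)) ^ (1 / (α - 1))

theorem statPoint_pos {α P Q : ℝ} (hα : 0 < α) (hP : 0 < P) (hQ : 0 < Q) : 0 < statPoint α P Q :=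
  rpow_pos_of_pos (by positivity) _

theorem statPoint_rpow {α P Q : ℝ} (hα : 0 < α) (hα1 : α ≠ 1) (hP : 0 < P) (hQ : 0 < Q) :
    α * Q * statPoint α P Q ^ (α - 1) = P := by
  have h1 : α - 1 ≠ 0 := sub_ne_zero.2 hα1
  unfold statPoint
  rw [← Real.rpow_mul (by positivity), one_div, inv_mul_cancel₀ h1, rpow_one]
  field_simp

theorem exists_statPoint_bounds {α p₁ p₂ q₁ q₂ : ℝ} (hα : 0 < α) (hp : 0 < p₁) (hq : 0 < q₁) :
    ∃ c₁ c₂ : ℝ, 0 < c₁ ∧ ∀ P ∈ Icc p₁ p₂, ∀ Q ∈ Icc q₁ q₂, statPoint α P Q ∈ Icc c₁ c₂ := by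
  have hcont : ContinuousOn (fun z : ℝ × ℝ => statPoint α z.1 z.2) (Icc p₁ p₂ ×ˢ Icc q₁ q₂) := by
    rintro ⟨P, Q⟩ ⟨hP, hQ⟩
    have hP0 : 0 < P := by linarith [hP.1]
    have hQ0 : 0 < Q := by linarith [hQ.1]
    have h1 : α * Q ≠ 0 := by positivity
    have h2 : P / (α * Q) ≠ 0 := by positivity
    apply ContinuousAt.continuousWithinAt
    unfold statPoint
    refine ContinuousAt.rpow_const ?_ (Or.inl h2)
    exact ContinuousAt.div (by fun_prop) (by fun_prop) h1
  obtain ⟨c₁, hc₁, h1⟩ := (isCompact_Icc.prod isCompact_Icc).exists_forall_le' hcont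
    fun z hz => statPoint_pos hα (by linarith [hz.1.1]) (by linarith [hz.2.1])
  obtain ⟨c₂, h2⟩ := (isCompact_Icc.prod isCompact_Icc).exists_bound_of_continuousOn hcont
  exact ⟨c₁, c₂, hc₁, fun P hP Q hQ =>
    ⟨h1 (P, Q) ⟨hP, hQ⟩, (le_abs_self _).trans (h2 (P, Q) ⟨hP, hQ⟩)⟩⟩

/-- The difference quotient of a smooth power at `1` is smooth, including at `1`. -/
theorem contDiffOn_dslope_rpow (κ : ℝ) :
    SmoothOn (dslope (fun u : ℝ => u ^ κ) 1) (Ioi 0) := by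
  intro u hu
  apply ContDiffAt.contDiffWithinAt
  have hu0 : (0 : ℝ) < u := hu
  by_cases h1 : u = 1
  · subst h1
    have han : AnalyticAt ℝ (fun u : ℝ => u ^ κ) 1 := by
      have : AnalyticAt ℝ (fun u : ℝ => Real.exp (κ * Real.log u)) 1 := by
        have := analyticAt_log one_pos
        fun_prop
      refine this.congr ?_
      filter_upwards [isOpen_Ioi.mem_nhds (show (1 : ℝ) ∈ Ioi 0 by simp)] with x hx
      rw [Real.rpow_def_of_pos hx, mul_comm]
    obtain ⟨p, hp⟩ := han
    exact (hp.has_fpower_series_dslope_fslope).analyticAt.contDiffAt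
  · have : dslope (fun u : ℝ => u ^ κ) 1 =ᶠ[nhds u] fun x => (x - 1)⁻¹ * (x ^ κ - 1 ^ κ) := by
      filter_upwards [isOpen_ne.mem_nhds h1] with x hx
      rw [dslope_of_ne _ hx, slope_def_field]; field_simp
    refine ContDiffAt.congr_of_eventuallyEq ?_ this
    have h2 : SmoothAt (fun x : ℝ => x ^ κ) u := Real.contDiffAt_rpow_const_of_ne hu0.ne'
    have h3 : SmoothAt (fun x : ℝ => (x - 1)⁻¹) u :=
      (contDiffAt_id.sub contDiffAt_const).inv (sub_ne_zero.2 h1)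
    exact h3.mul (h2.sub contDiffAt_const)

theorem dslope_rpow_ne_zero {κ : ℝ} (hκ : κ ≠ 0) {u : ℝ} (hu : 0 < u) :
    dslope (fun u : ℝ => u ^ κ) 1 u ≠ 0 := by
  by_cases h1 : u = 1
  · subst h1
    rw [dslope_same, Real.deriv_rpow_const]; simpa using hκ
  · have := sub_smul_dslope (fun u : ℝ => u ^ κ) 1 u
    intro h0
    rw [h0, smul_zero, one_rpow] at this
    have h2 : u ^ κ = 1 := by linarith
    exact h1 ((Real.rpow_left_inj hu.le zero_le_one hκ).1 (h2.trans (one_rpow κ).symm))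

theorem mul_dslope_rpow (κ : ℝ) {t c : ℝ} (ht : 0 < t) (hc : 0 < c) :
    (t - c) * dslope (fun u : ℝ => u ^ κ) 1 (t / c) = c ^ (1 - κ) * (t ^ κ - c ^ κ) := by
  have := sub_smul_dslope (fun u : ℝ => u ^ κ) 1 (t / c)
  rw [smul_eq_mul, one_rpow, div_rpow ht.le hc.le] at this
  have hk := rpow_pos_of_pos hc κ
  have e : t - c = c * (t / c - 1) := by field_simp
  rw [e, mul_assoc, this, rpow_sub hc, rpow_one]
  field_simp

/-- An amplitude that vanishes at the stationary point gains a factor `1 / L`: integrate by parts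
once, after division by the derivative of the phase. -/
theorem exists_vanishing_amplitude_bound {α : ℝ} (hα : 0 < α) (hα1 : α ≠ 1) {c₁ c₂ q₁ : ℝ}
    (hc₁ : 0 < c₁) (hq : 0 < q₁) {ρ : ℝ → ℂ} (hρ : IsPosBump ρ) {ν : ℝ → ℝ}
    (hν : SmoothOn ν (Ioi 0)) :
    ∃ C : ℝ, 0 < C ∧ ∀ (L s P Q c : ℝ), 1 ≤ L → |s| = 1 → q₁ ≤ Q → c ∈ Icc c₁ c₂ →
      α * Q * c ^ (α - 1) = P →
      ‖∫ t, expI(s * L * oscPhase α 1 P Q t) *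
        (((t ^ (α - 1) - c ^ (α - 1)) * ν (t / c) : ℝ) * ρ t)‖ ≤ C / (L * √L) := by
  obtain ⟨t₁, t₂, ht₁, ht, hz⟩ := hρ.exists_interval
  obtain ⟨C, hC0, hC⟩ := exists_oscPhase_second_deriv_bound hα hα1 ht₁ ht hq
  have hνo : ContDiffOn ℝ 2 ν (Ioi 0) := hν.of_le (WithTop.coe_le_coe.2 le_top)
  have hν1 : ContDiffOn ℝ 1 (deriv ν) (Ioi 0) := hνo.deriv_of_isOpen isOpen_Ioi (by norm_num)
  have hν2 : ContDiffOn ℝ 0 (deriv (deriv ν)) (Ioi 0) :=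
    hν1.deriv_of_isOpen isOpen_Ioi (by norm_num)
  have hρ2 : ContDiff ℝ 2 ρ := hρ.contDiff.of_le (WithTop.coe_le_coe.2 le_top)
  have hρ1 : ContDiff ℝ 1 (deriv ρ) := by
    have : ContDiff ℝ (1 + 1) ρ := hρ2
    exact (contDiff_succ_iff_deriv.1 this).2.2
  have hρ0 : Continuous (deriv (deriv ρ)) := hρ1.continuous_deriv le_rfl
  have hsub : Icc (t₁ / c₂) (t₂ / c₁) ⊆ Ioi 0 ∨ c₂ < c₁ := by
    by_cases h : c₂ < c₁
    · exact Or.inr h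
    · push Not at h
      have : 0 < c₂ := by linarith
      exact Or.inl fun x hx => lt_of_lt_of_le (by positivity) hx.1
  rcases hsub with hsub | hemp
  swap
  · exact ⟨1, one_pos, fun L s P Q c _ _ _ hc => absurd (hc.1.trans hc.2) (not_le.2 hemp)⟩
  obtain ⟨B₀, hB₀⟩ := isCompact_Icc.exists_bound_of_continuousOn (hν.continuousOn.mono hsub)
  obtain ⟨B₁, hB₁⟩ := isCompact_Icc.exists_bound_of_continuousOn (hν1.continuousOn.mono hsub)
  obtain ⟨B₂, hB₂⟩ := isCompact_Icc.exists_bound_of_continuousOn (hν2.continuousOn.mono hsub)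
  obtain ⟨R₀, hR₀⟩ := hρ.compact.exists_bound_of_continuous hρ2.continuous
  obtain ⟨R₁, hR₁⟩ := hρ.compact.deriv.exists_bound_of_continuous hρ1.continuous
  obtain ⟨R₂, hR₂⟩ := hρ.compact.deriv.deriv.exists_bound_of_continuous hρ0
  set A₀ := |B₁| * c₁⁻¹ * R₀ + |B₀| * R₁
  set A₁ := (|B₂| * c₁⁻¹ * c₁⁻¹ * R₀ + |B₁| * c₁⁻¹ * R₁) + (|B₁| * c₁⁻¹ * R₁ + |B₀| * R₂)
  have hR0 : 0 ≤ R₀ := (norm_nonneg _).trans (hR₀ 0)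
  have hR1 : 0 ≤ R₁ := (norm_nonneg _).trans (hR₁ 0)
  have hR2 : 0 ≤ R₂ := (norm_nonneg _).trans (hR₂ 0)
  refine ⟨C * (A₀ + A₁) / (α * q₁) + 1, by positivity, ?_⟩
  intro L s P Q c hL hs hQ hc hP
  have hL0 : 0 < L := by linarith
  have hc0 : 0 < c := by linarith [hc.1]
  have hQ0 : 0 < Q := by linarith
  have hs0 : s ≠ 0 := by rintro rfl; simp at hs
  have hpos : ∀ x ∈ Icc t₁ t₂, 0 < x := fun x hx => by linarith [hx.1]
  have hmem : ∀ x ∈ Icc t₁ t₂, x / c ∈ Icc (t₁ / c₂) (t₂ / c₁) := by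
    intro x hx
    exact ⟨div_le_div₀ (hpos x hx).le hx.1 hc0 hc.2, div_le_div₀ (by linarith) hx.2 hc₁ hc.1⟩
  have hdc : ∀ x, HasDerivAt (fun t : ℝ => t / c) c⁻¹ x := fun x => by
    simpa using (hasDerivAt_id x).div_const c
  have hd0 : ∀ x ∈ Icc t₁ t₂, HasDerivAt (fun t => (ν (t / c) : ℂ))
      ((deriv ν (x / c) * c⁻¹ : ℝ) : ℂ) x := by
    intro x hx
    have h1 : HasDerivAt ν (deriv ν (x / c)) (x / c) :=
      ((hνo.differentiableOn (by norm_num)).differentiableAt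
        (isOpen_Ioi.mem_nhds (hsub (hmem x hx)))).hasDerivAt
    exact (h1.comp x (hdc x)).ofReal_comp
  have hd1 : ∀ x ∈ Icc t₁ t₂, HasDerivAt (fun t => ((deriv ν (t / c) * c⁻¹ : ℝ) : ℂ))
      ((deriv (deriv ν) (x / c) * c⁻¹ * c⁻¹ : ℝ) : ℂ) x := by
    intro x hx
    have h1 : HasDerivAt (deriv ν) (deriv (deriv ν) (x / c)) (x / c) :=
      ((hν1.differentiableOn (by norm_num)).differentiableAt
        (isOpen_Ioi.mem_nhds (hsub (hmem x hx)))).hasDerivAt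
    exact ((h1.comp x (hdc x)).mul_const _).ofReal_comp
  have hr0 : ∀ x, HasDerivAt ρ (deriv ρ x) x := fun x =>
    (hρ2.differentiable (by norm_num) x).hasDerivAt
  have hr1 : ∀ x, HasDerivAt (deriv ρ) (deriv (deriv ρ) x) x := fun x =>
    (hρ1.differentiable (by norm_num) x).hasDerivAt
  set g : ℝ → ℂ := fun t => (ν (t / c) : ℂ) * ρ t with hg
  set g' : ℝ → ℂ := fun t => ((deriv ν (t / c) * c⁻¹ : ℝ) : ℂ) * ρ t + (ν (t / c) : ℂ) * deriv ρ t
  set g'' : ℝ → ℂ := fun t => (((deriv (deriv ν) (t / c) * c⁻¹ * c⁻¹ : ℝ) : ℂ) * ρ t +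
    ((deriv ν (t / c) * c⁻¹ : ℝ) : ℂ) * deriv ρ t) +
    (((deriv ν (t / c) * c⁻¹ : ℝ) : ℂ) * deriv ρ t + (ν (t / c) : ℂ) * deriv (deriv ρ) t)
  have hgd : ∀ x ∈ Icc t₁ t₂, HasDerivAt g (g' x) x := fun x hx => (hd0 x hx).mul (hr0 x)
  have hgd' : ∀ x ∈ Icc t₁ t₂, HasDerivAt g' (g'' x) x := fun x hx =>
    ((hd1 x hx).mul (hr0 x)).add ((hd0 x hx).mul (hr1 x))
  have hci : c⁻¹ ≤ c₁⁻¹ := inv_anti₀ hc₁ hc.1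
  have n0 : ∀ x ∈ Icc t₁ t₂, ‖(ν (x / c) : ℂ)‖ ≤ |B₀| := fun x hx => by
    rw [norm_real]; exact (hB₀ _ (hmem x hx)).trans (le_abs_self _)
  have n1 : ∀ x ∈ Icc t₁ t₂, ‖((deriv ν (x / c) * c⁻¹ : ℝ) : ℂ)‖ ≤ |B₁| * c₁⁻¹ := fun x hx => by
    rw [norm_real, norm_mul, norm_of_nonneg (inv_nonneg.2 hc0.le)]
    exact mul_le_mul ((hB₁ _ (hmem x hx)).trans (le_abs_self _)) hci (by positivity) (by positivity)
  have n2 : ∀ x ∈ Icc t₁ t₂,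
      ‖((deriv (deriv ν) (x / c) * c⁻¹ * c⁻¹ : ℝ) : ℂ)‖ ≤ |B₂| * c₁⁻¹ * c₁⁻¹ := fun x hx => by
    rw [norm_real, norm_mul, norm_mul, norm_of_nonneg (inv_nonneg.2 hc0.le)]
    have := (hB₂ _ (hmem x hx)).trans (le_abs_self _)
    gcongr
  have hgb' : ∀ x ∈ Icc t₁ t₂, ‖g' x‖ ≤ A₀ := by
    intro x hx
    refine (norm_add_le _ _).trans ?_
    rw [norm_mul, norm_mul]
    exact add_le_add (mul_le_mul (n1 x hx) (hR₀ x) (norm_nonneg _) (by positivity))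
      (mul_le_mul (n0 x hx) (hR₁ x) (norm_nonneg _) (by positivity))
  have hgb'' : ∀ x ∈ Icc t₁ t₂, ‖g'' x‖ ≤ A₁ := by
    intro x hx
    refine (norm_add_le _ _).trans (add_le_add ((norm_add_le _ _).trans ?_)
      ((norm_add_le _ _).trans ?_))
    · rw [norm_mul, norm_mul]
      exact add_le_add (mul_le_mul (n2 x hx) (hR₀ x) (norm_nonneg _) (by positivity))
        (mul_le_mul (n1 x hx) (hR₁ x) (norm_nonneg _) (by positivity))
    · rw [norm_mul, norm_mul]
      exact add_le_add (mul_le_mul (n1 x hx) (hR₁ x) (norm_nonneg _) (by positivity))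
        (mul_le_mul (n0 x hx) (hR₂ x) (norm_nonneg _) (by positivity))
  set E : ℝ → ℂ := fun t => expI(s * L * oscPhase α 1 P Q t)
  have hEd : ∀ x ∈ Icc t₁ t₂, HasDerivAt E (I *
      ((s * L * (-P + 1 * Q * (α * x ^ (α - 1))) : ℝ) : ℂ) * E x) x := fun x hx =>
    hasDerivAt_exp_I_mul ((hasDerivAt_oscPhase α 1 P Q (hpos x hx)).const_mul (s * L))
  have hII : uIcc t₁ t₂ = Icc t₁ t₂ := uIcc_of_le ht.le
  rw [integral_eq_interval_of_zero_off ht (fun t h => by rw [hz t h, mul_zero, mul_zero])]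
  have e1 : ∫ t in t₁..t₂, E t * (((t ^ (α - 1) - c ^ (α - 1)) * ν (t / c) : ℝ) * ρ t) =
      (I * ((s * L * (α * Q) : ℝ) : ℂ))⁻¹ * ∫ t in t₁..t₂, g t * (I *
      ((s * L * (-P + 1 * Q * (α * t ^ (α - 1))) : ℝ) : ℂ) * E t) := by
    rw [← intervalIntegral.integral_const_mul]
    apply integral_congr
    intro t _
    have hne : ((s * L * (α * Q) : ℝ) : ℂ) ≠ 0 := by
      exact_mod_cast mul_ne_zero (mul_ne_zero hs0 hL0.ne') (by positivity)
    have e2 : s * L * (-P + 1 * Q * (α * t ^ (α - 1))) =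
        (s * L * (α * Q)) * (t ^ (α - 1) - c ^ (α - 1)) := by rw [← hP]; ring
    simp only [e2, hg]
    rw [Complex.ofReal_mul (s * L * (α * Q)), Complex.ofReal_mul (t ^ (α - 1) - c ^ (α - 1))]
    have hI := I_ne_zero
    generalize ((s * L * (α * Q) : ℝ) : ℂ) = X at hne
    field_simp
  rw [e1]
  have hcE : ContinuousOn E (Icc t₁ t₂) := fun x hx => (hEd x hx).continuousAt.continuousWithinAt
  have key := intervalIntegral.integral_mul_deriv_eq_deriv_mul (u := g) (u' := g') (v := E)
    (v' := fun x => I * ((s * L * (-P + 1 * Q * (α * x ^ (α - 1))) : ℝ) : ℂ) * E x)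
    (a := t₁) (b := t₂)
    (by rwa [hII]) (by rwa [hII]) (intervalIntegrable_of_hasDerivAt_of_bound ht.le hgd hgb')
    (by
      apply ContinuousOn.intervalIntegrable
      rw [hII]
      intro x hx
      have h1 := (hEd x hx).continuousAt
      have h2 := Real.continuousAt_rpow_const x (α - 1) (Or.inl (hpos x hx).ne')
      exact ContinuousAt.continuousWithinAt (by fun_prop))
  have g1 : g t₁ = 0 := by simp [hg, hz t₁ (by simp)]
  have g2 : g t₂ = 0 := by simp [hg, hz t₂ (by simp)]
  rw [key, g1, g2, zero_mul, zero_mul, sub_zero, zero_sub, norm_mul, norm_neg, norm_inv, norm_mul,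
    norm_I, one_mul, norm_real, norm_eq_abs, abs_mul, abs_mul, hs,
    abs_of_pos hL0, abs_of_pos (by positivity : 0 < α * Q), one_mul]
  have hb := hC L s 1 P Q A₀ A₁ g' g'' hL hs (by norm_num) hQ hgd' hgb' hgb''
  have e3 : ∫ t in t₁..t₂, g' t * E t = ∫ t in t₁..t₂, E t * g' t := by simp_rw [mul_comm]
  rw [e3]
  have hsL : 0 < √L := sqrt_pos.2 hL0
  have hA00 : 0 ≤ A₀ := by positivity
  have hA10 : 0 ≤ A₁ := by positivity
  calc (L * (α * Q))⁻¹ * ‖∫ t in t₁..t₂, E t * g' t‖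
      ≤ (L * (α * q₁))⁻¹ * (C * (A₀ + A₁) / √L) := by gcongr
    _ = (C * (A₀ + A₁) / (α * q₁)) / (L * √L) := by field_simp
    _ ≤ _ := by gcongr; linarith

/-- Size of the stationary phase integral, and of the two integrals that arise when it is
differentiated after removal of its oscillating factor. -/
theorem exists_oscInt_stationary_bounds {α : ℝ} (hα : 0 < α) (hα1 : α ≠ 1) {p₁ p₂ q₁ q₂ : ℝ}
    (hp : 0 < p₁) (hq : 0 < q₁) {ρ : ℝ → ℂ} (hρ : IsPosBump ρ) :
    ∃ C : ℝ, 0 < C ∧ ∀ (L s P Q : ℝ), 1 ≤ L → |s| = 1 → P ∈ Icc p₁ p₂ → Q ∈ Icc q₁ q₂ →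
      ‖oscInt α s 1 ρ L P Q‖ ≤ C / √L ∧
      ‖oscInt α s 1 (fun t => ((t - statPoint α P Q : ℝ) : ℂ) * ρ t) L P Q‖ ≤ C / (L * √L) ∧
      ‖oscInt α s 1 (fun t => ((t ^ α - statPoint α P Q ^ α : ℝ) : ℂ) * ρ t) L P Q‖
        ≤ C / (L * √L) := by
  obtain ⟨c₁, c₂, hc₁, hc⟩ := exists_statPoint_bounds (p₂ := p₂) (q₂ := q₂) hα hp hq
  obtain ⟨t₁, t₂, ht₁, ht, hz⟩ := hρ.exists_interval
  obtain ⟨C₀, hC₀, h0⟩ := exists_oscPhase_second_deriv_bound hα hα1 ht₁ ht hq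
  have hcd : ContDiff ℝ 1 ρ := hρ.contDiff.of_le (by exact_mod_cast le_top)
  obtain ⟨A₀, hA₀⟩ := hρ.compact.exists_bound_of_continuous hρ.contDiff.continuous
  obtain ⟨A₁, hA₁⟩ := hρ.compact.deriv.exists_bound_of_continuous (hcd.continuous_deriv le_rfl)
  have hA0 : 0 ≤ A₀ := (norm_nonneg _).trans (hA₀ 0)
  have hA1 : 0 ≤ A₁ := (norm_nonneg _).trans (hA₁ 0)
  have hα1' : α - 1 ≠ 0 := sub_ne_zero.2 hα1
  have hν : SmoothOn (fun u => (dslope (fun u : ℝ => u ^ (α - 1)) 1 u)⁻¹) (Ioi 0) :=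
    (contDiffOn_dslope_rpow (α - 1)).inv fun u hu => dslope_rpow_ne_zero hα1' hu
  obtain ⟨C₁, hC₁, h1⟩ := exists_vanishing_amplitude_bound (c₂ := c₂) hα hα1 hc₁ hq hρ hν
  obtain ⟨C₂, hC₂, h2⟩ := exists_vanishing_amplitude_bound (c₂ := c₂) hα hα1 hc₁ hq hρ
    ((contDiffOn_dslope_rpow α).mul hν)
  obtain ⟨K, hK⟩ := isCompact_Icc.exists_bound_of_continuousOn (s := Icc c₁ c₂)
    (f := fun c : ℝ => c ^ (1 - (α - 1))) (fun x hx => (Real.continuousAt_rpow_const x _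
      (Or.inl (by linarith [hx.1]))).continuousWithinAt)
  refine ⟨C₀ * (A₀ + A₁) + |K| * C₁ + |c₂| * C₂ + 1, by positivity, ?_⟩
  intro L s P Q hL hs hP hQ
  have hP0 : 0 < P := by linarith [hP.1]
  have hQ0 : 0 < Q := by linarith [hQ.1]
  have hL0 : 0 < L := by linarith
  have hsL : 0 < √L := sqrt_pos.2 hL0
  set c := statPoint α P Q
  have hcm : c ∈ Icc c₁ c₂ := hc P hP Q hQ
  have hc0 : 0 < c := statPoint_pos hα hP0 hQ0
  have hrel : α * Q * c ^ (α - 1) = P := statPoint_rpow hα hα1 hP0 hQ0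
  have n1 : 0 ≤ C₀ * (A₀ + A₁) := by positivity
  have n2 : 0 ≤ |K| * C₁ := by positivity
  have n3 : 0 ≤ |c₂| * C₂ := by positivity
  have hDne : ∀ t, 0 < t → dslope (fun u : ℝ => u ^ (α - 1)) 1 (t / c) ≠ 0 := fun t ht =>
    dslope_rpow_ne_zero hα1' (by positivity)
  refine ⟨?_, ?_, ?_⟩
  · unfold oscInt
    rw [integral_eq_interval_of_zero_off ht (fun t h => by rw [hz t h, mul_zero])]
    refine (h0 L s 1 P Q A₀ A₁ ρ (deriv ρ) hL hs (by norm_num) hQ.1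
      (fun x _ => ((hcd.differentiable one_ne_zero) x).hasDerivAt) (fun x _ => hA₀ x)
      (fun x _ => hA₁ x)).trans ?_
    gcongr; linarith
  · have e : oscInt α s 1 (fun t => ((t - c : ℝ) : ℂ) * ρ t) L P Q = ((c ^ (1 - (α - 1)) : ℝ) : ℂ) *
        ∫ t, expI(s * L * oscPhase α 1 P Q t) * (((t ^ (α - 1) - c ^ (α - 1)) *
          (dslope (fun u : ℝ => u ^ (α - 1)) 1 (t / c))⁻¹ : ℝ) * ρ t) := by
      unfold oscInt
      rw [← integral_const_mul]
      congr 1; ext t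
      by_cases htm : t ∈ Ioo t₁ t₂
      · have ht0 : 0 < t := ht₁.trans htm.1
        have := mul_dslope_rpow (α - 1) ht0 hc0
        have e' : t - c = c ^ (1 - (α - 1)) * ((t ^ (α - 1) - c ^ (α - 1)) *
          (dslope (fun u : ℝ => u ^ (α - 1)) 1 (t / c))⁻¹) := by
          rw [← mul_assoc, ← this, mul_inv_cancel_right₀ (hDne t ht0)]
        simp only [e', Complex.ofReal_mul]; ring
      · simp [hz t htm]
    rw [e, norm_mul, norm_real]
    have := h1 L s P Q c hL hs hQ.1 hcm hrel
    calc _ ≤ |K| * (C₁ / (L * √L)) :=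
          mul_le_mul ((hK c hcm).trans (le_abs_self _)) this (norm_nonneg _) (abs_nonneg _)
      _ = (|K| * C₁) / (L * √L) := by ring
      _ ≤ _ := by gcongr; linarith
  · have e : oscInt α s 1 (fun t => ((t ^ α - c ^ α : ℝ) : ℂ) * ρ t) L P Q = (c : ℂ) *
        ∫ t, expI(s * L * oscPhase α 1 P Q t) *
        (((t ^ (α - 1) - c ^ (α - 1)) * (dslope (fun u : ℝ => u ^ α) 1 (t / c) *
          (dslope (fun u : ℝ => u ^ (α - 1)) 1 (t / c))⁻¹) : ℝ) * ρ t) := by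
      unfold oscInt
      rw [← integral_const_mul]
      congr 1; ext t
      by_cases htm : t ∈ Ioo t₁ t₂
      · have ht0 : 0 < t := ht₁.trans htm.1
        have m1 := mul_dslope_rpow (α - 1) ht0 hc0
        have m2 := mul_dslope_rpow α ht0 hc0
        have hD := hDne t ht0
        have hca : c ^ (1 - (α - 1)) = c * c ^ (1 - α) := by
          rw [show 1 - (α - 1) = 1 + (1 - α) by ring, rpow_add hc0, rpow_one]
        have hck : c ^ (1 - α) ≠ 0 := (rpow_pos_of_pos hc0 _).ne'
        have e' : t ^ α - c ^ α = c * ((t ^ (α - 1) - c ^ (α - 1)) *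
          (dslope (fun u : ℝ => u ^ α) 1 (t / c) *
            (dslope (fun u : ℝ => u ^ (α - 1)) 1 (t / c))⁻¹)) := by
          apply mul_left_cancel₀ hck
          rw [← m2]
          rw [hca] at m1
          field_simp
          linear_combination (dslope (fun u : ℝ => u ^ α) 1 (t / c)) * m1
        simp only [e', Complex.ofReal_mul]; ring
      · simp [hz t htm]
    rw [e, norm_mul, norm_real]
    have := h2 L s P Q c hL hs hQ.1 hcm hrel
    have hcc : ‖c‖ ≤ |c₂| := by rw [norm_of_nonneg hc0.le]; exact hcm.2.trans (le_abs_self _)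
    calc _ ≤ |c₂| * (C₂ / (L * √L)) :=
          mul_le_mul hcc this (norm_nonneg _) (abs_nonneg _)
      _ = (|c₂| * C₂) / (L * √L) := by ring
      _ ≤ _ := by gcongr; linarith

/-! ### Derivatives of the critical value of the phase -/

/-- The critical value `-P t + Q t ^ α` at the stationary point. -/
def critPhase (α P Q : ℝ) : ℝ := oscPhase α 1 P Q (statPoint α P Q)

/-- The derivative of `critPhase` in the direction `x`. -/
def critPhase₁ (α : ℝ) (x : ℝ × ℝ) (P Q : ℝ) : ℝ :=
  -x.1 * statPoint α P Q + x.2 * statPoint α P Q ^ α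

/-- The determinant of a direction against the radial direction `(P, Q)`. The critical value is
homogeneous of degree one, so its Hessian is a multiple of `radDet x * radDet y`. -/
def radDet (x : ℝ × ℝ) (P Q : ℝ) : ℝ := x.1 * Q - x.2 * P

/-- The determinant of two directions. -/
def dirDet (x y : ℝ × ℝ) : ℝ := x.1 * y.2 - x.2 * y.1

/-- The second derivative of `critPhase` in the directions `x`, `y`. -/
def critPhase₂ (α : ℝ) (x y : ℝ × ℝ) (P Q : ℝ) : ℝ :=
  -(1 / (α - 1)) * statPoint α P Q * (radDet x P Q * radDet y P Q) / (P * Q ^ 2)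

/-- The polynomial factor of the third derivative of `critPhase`. -/
def critPoly₃ (α : ℝ) (x y z : ℝ × ℝ) (P Q : ℝ) : ℝ :=
  radDet x P Q * radDet y P Q * ((1 / (α - 1) - 1) * z.1 * Q - (1 / (α - 1) + 2) * z.2 * P)
    + P * Q * (dirDet x z * radDet y P Q + radDet x P Q * dirDet y z)

/-- The third derivative of `critPhase` in the directions `x`, `y`, `z`. -/
def critPhase₃ (α : ℝ) (x y z : ℝ × ℝ) (P Q : ℝ) : ℝ :=
  -(1 / (α - 1)) * statPoint α P Q * critPoly₃ α x y z P Q / (P ^ 2 * Q ^ 3)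

/-- The derivative of `critPoly₃` in the direction `w`. -/
def critPoly₃' (α : ℝ) (x y z w : ℝ × ℝ) (P Q : ℝ) : ℝ :=
  (dirDet x w * radDet y P Q + radDet x P Q * dirDet y w) *
      ((1 / (α - 1) - 1) * z.1 * Q - (1 / (α - 1) + 2) * z.2 * P)
    + radDet x P Q * radDet y P Q * ((1 / (α - 1) - 1) * z.1 * w.2 - (1 / (α - 1) + 2) * z.2 * w.1)
    + (w.1 * Q + P * w.2) * (dirDet x z * radDet y P Q + radDet x P Q * dirDet y z)
    + P * Q * (dirDet x z * dirDet y w + dirDet x w * dirDet y z)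

/-- The fourth derivative of `critPhase` in the directions `x`, `y`, `z`, `w`. -/
def critPhase₄ (α : ℝ) (x y z w : ℝ × ℝ) (P Q : ℝ) : ℝ :=
  -(1 / (α - 1)) * statPoint α P Q *
    (critPoly₃ α x y z P Q * ((1 / (α - 1) - 2) * w.1 * Q - (1 / (α - 1) + 3) * w.2 * P)
      + P * Q * critPoly₃' α x y z w P Q) / (P ^ 3 * Q ^ 4)

/-- On the open quadrant, `g'` is the derivative of `g` in the direction `v`, stated along curves
with velocity `v`. -/
def IsDirDeriv (v : ℝ × ℝ) (g g' : ℝ → ℝ → ℝ) : Prop :=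
  ∀ ⦃P Q : ℝ → ℝ⦄ ⦃u : ℝ⦄, 0 < P u → 0 < Q u → HasDerivAt P v.1 u → HasDerivAt Q v.2 u →
    HasDerivAt (fun u => g (P u) (Q u)) (g' (P u) (Q u)) u

section Derivatives

variable {α : ℝ} {P Q : ℝ → ℝ} {v : ℝ × ℝ} {u : ℝ}

theorem hasDerivAt_statPoint (hα : 0 < α) (hP0 : 0 < P u) (hQ0 : 0 < Q u)
    (hP : HasDerivAt P v.1 u) (hQ : HasDerivAt Q v.2 u) :
    HasDerivAt (fun u => statPoint α (P u) (Q u))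
      (1 / (α - 1) * statPoint α (P u) (Q u) * (v.1 / P u - v.2 / Q u)) u := by
  unfold statPoint
  have h0 : 0 < P u / (α * Q u) := by positivity
  have h1 : α * Q u ≠ 0 := by positivity
  have := (hP.div (hQ.const_mul α) h1).rpow_const (p := 1 / (α - 1)) (Or.inl h0.ne')
  refine this.congr_deriv ?_
  simp only [Pi.div_apply]
  rw [rpow_sub h0, rpow_one]
  field_simp

theorem hasDerivAt_statPoint_rpow (hα : 0 < α) (hα1 : α ≠ 1) (hP0 : 0 < P u) (hQ0 : 0 < Q u)
    (hP : HasDerivAt P v.1 u) (hQ : HasDerivAt Q v.2 u) :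
    HasDerivAt (fun u => statPoint α (P u) (Q u) ^ α)
      (1 / (α - 1) * statPoint α (P u) (Q u) * (v.1 / P u - v.2 / Q u) * (P u / Q u)) u := by
  have h0 := statPoint_pos hα hP0 hQ0
  have h1 := (hasDerivAt_statPoint hα hP0 hQ0 hP hQ).rpow_const (p := α) (Or.inl h0.ne')
  refine h1.congr_deriv ?_
  have h2 : P u / Q u = α * statPoint α (P u) (Q u) ^ (α - 1) := by
    rw [div_eq_iff hQ0.ne']
    linear_combination -(statPoint_rpow hα hα1 hP0 hQ0)
  rw [h2]; ring

theorem hasDerivAt_critPhase (hα : 0 < α) (hα1 : α ≠ 1) :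
    IsDirDeriv v (critPhase α) (critPhase₁ α v) := by
  intro P Q u hP0 hQ0 hP hQ
  unfold critPhase oscPhase critPhase₁
  have h1 := hasDerivAt_statPoint hα hP0 hQ0 hP hQ
  have h2 := hasDerivAt_statPoint_rpow hα hα1 hP0 hQ0 hP hQ
  refine ((hP.neg.mul h1).add ((hQ.const_mul 1).mul h2)).congr_deriv ?_
  simp only [Pi.neg_apply]
  field_simp
  ring

theorem hasDerivAt_critPhase₁ (hα : 0 < α) (hα1 : α ≠ 1) (x : ℝ × ℝ) :
    IsDirDeriv v (critPhase₁ α x) (critPhase₂ α x v) := by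
  intro P Q u hP0 hQ0 hP hQ
  unfold critPhase₁ critPhase₂ radDet
  have h1 := hasDerivAt_statPoint hα hP0 hQ0 hP hQ
  have h2 := hasDerivAt_statPoint_rpow hα hα1 hP0 hQ0 hP hQ
  refine ((h1.const_mul _).add (h2.const_mul _)).congr_deriv ?_
  have : α - 1 ≠ 0 := sub_ne_zero.2 hα1
  field_simp
  ring

theorem hasDerivAt_radDet (x : ℝ × ℝ) (hP : HasDerivAt P v.1 u) (hQ : HasDerivAt Q v.2 u) :
    HasDerivAt (fun u => radDet x (P u) (Q u)) (dirDet x v) u :=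
  (hQ.const_mul x.1).sub (hP.const_mul x.2)

theorem hasDerivAt_critPhase₂ (hα : 0 < α) (hα1 : α ≠ 1) (x y : ℝ × ℝ) :
    IsDirDeriv v (critPhase₂ α x y) (critPhase₃ α x y v) := by
  intro P Q u hP0 hQ0 hP hQ
  unfold critPhase₂ critPhase₃ critPoly₃
  have h1 := hasDerivAt_statPoint hα hP0 hQ0 hP hQ
  have h2 := hasDerivAt_radDet x hP hQ
  have h3 := hasDerivAt_radDet y hP hQ
  have h4 : P u * Q u ^ 2 ≠ 0 := by positivity
  refine (((h1.const_mul _).mul (h2.mul h3)).div (hP.mul (hQ.pow 2)) h4).congr_deriv ?_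
  have : α - 1 ≠ 0 := sub_ne_zero.2 hα1
  simp only [Pi.mul_apply, Pi.pow_apply]
  generalize radDet x (P u) (Q u) = A
  generalize radDet y (P u) (Q u) = B
  field_simp
  ring

theorem hasDerivAt_critPoly₃ (x y z : ℝ × ℝ) (hP : HasDerivAt P v.1 u) (hQ : HasDerivAt Q v.2 u) :
    HasDerivAt (fun u => critPoly₃ α x y z (P u) (Q u)) (critPoly₃' α x y z v (P u) (Q u)) u := by
  unfold critPoly₃ critPoly₃'
  have h2 := hasDerivAt_radDet x hP hQ
  have h3 := hasDerivAt_radDet y hP hQ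
  refine (((h2.mul h3).mul ((hQ.const_mul _).sub (hP.const_mul _))).add
    ((hP.mul hQ).mul ((h3.const_mul _).add (h2.mul_const _)))).congr_deriv ?_
  simp only [Pi.mul_apply, Pi.sub_apply, Pi.add_apply]
  ring

theorem hasDerivAt_critPhase₃ (hα : 0 < α) (hα1 : α ≠ 1) (x y z : ℝ × ℝ) :
    IsDirDeriv v (critPhase₃ α x y z) (critPhase₄ α x y z v) := by
  intro P Q u hP0 hQ0 hP hQ
  unfold critPhase₃ critPhase₄
  have h1 := hasDerivAt_statPoint hα hP0 hQ0 hP hQ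
  have h2 := hasDerivAt_critPoly₃ (α := α) x y z hP hQ
  have h4 : P u ^ 2 * Q u ^ 3 ≠ 0 := by positivity
  refine (((h1.const_mul _).mul h2).div ((hP.pow 2).mul (hQ.pow 3)) h4).congr_deriv ?_
  have : α - 1 ≠ 0 := sub_ne_zero.2 hα1
  simp only [Pi.mul_apply, Pi.pow_apply]
  generalize critPoly₃ α x y z (P u) (Q u) = A
  generalize critPoly₃' α x y z v (P u) (Q u) = B
  field_simp
  ring

end Derivatives

theorem critPhase₂_smul (α c : ℝ) (x y : ℝ × ℝ) (P Q : ℝ) :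
    critPhase₂ α x (c • y) P Q = c * critPhase₂ α x y P Q := by
  simp only [critPhase₂, radDet, Prod.smul_fst, Prod.smul_snd, smul_eq_mul]; ring

theorem critPhase₃_smul (α c : ℝ) (x y z : ℝ × ℝ) (P Q : ℝ) :
    critPhase₃ α x (c • y) z P Q = c * critPhase₃ α x y z P Q := by
  simp only [critPhase₃, critPoly₃, dirDet, radDet, Prod.smul_fst, Prod.smul_snd, smul_eq_mul]; ring

theorem critPhase₄_smul (α c : ℝ) (x y z w : ℝ × ℝ) (P Q : ℝ) :
    critPhase₄ α x (c • y) z w P Q = c * critPhase₄ α x y z w P Q := by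
  simp only [critPhase₄, critPoly₃, critPoly₃', dirDet, radDet, Prod.smul_fst, Prod.smul_snd,
    smul_eq_mul]; ring

theorem exists_lower_bound_near_zero {K : Set (ℝ × ℝ)} (hK : IsCompact K) {f : ℝ × ℝ × ℝ → ℝ}
    (hf : ContinuousOn f (Icc (-1) 1 ×ˢ K)) (h0 : ∀ z ∈ K, f (0, z) ≠ 0) :
    ∃ e₀ c : ℝ, 0 < e₀ ∧ e₀ ≤ 1 ∧ 0 < c ∧ ∀ e : ℝ, |e| ≤ e₀ → ∀ z ∈ K, c ≤ |f (e, z)| := by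
  rcases K.eq_empty_or_nonempty with rfl | hne
  · exact ⟨1, 1, one_pos, le_rfl, one_pos, by simp⟩
  have hm : ∀ z ∈ K, ((0 : ℝ), z) ∈ Icc (-1 : ℝ) 1 ×ˢ K := fun z hz => ⟨by simp, hz⟩
  have hc0 : ContinuousOn (fun z => |f (0, z)|) K := (hf.comp (by fun_prop) hm).abs
  obtain ⟨z₀, hz₀, hmin⟩ := hK.exists_isMinOn hne hc0
  have hpos : 0 < |f (0, z₀)| := abs_pos.2 (h0 z₀ hz₀)
  have hu := (isCompact_Icc.prod hK).uniformContinuousOn_of_continuous hf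
  obtain ⟨δ, hδ, hd⟩ := Metric.uniformContinuousOn_iff.1 hu (|f (0, z₀)| / 2) (by positivity)
  refine ⟨min 1 (δ / 2), |f (0, z₀)| / 2, by positivity, min_le_left _ _, by positivity, ?_⟩
  intro e he z hz
  have h1 : |e| ≤ 1 := he.trans (min_le_left _ _)
  have h2 : |e| < δ := lt_of_le_of_lt (he.trans (min_le_right _ _)) (by linarith)
  have := hd (e, z) ⟨abs_le.1 h1, hz⟩ (0, z) (hm z hz) (by rw [Prod.dist_eq]; simp [h2])
  rw [Real.dist_eq] at this
  have h3 : |f (0, z₀)| ≤ |f (0, z)| := hmin hz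
  have h4 := abs_sub_abs_le_abs_sub (f (0, z)) (f (e, z))
  rw [abs_sub_comm] at h4
  linarith

/-- The direction of `∂/∂ξ` for the linear forms `P = κ (ξ - a η)`, `Q = e (η - b ξ)`. -/
def dirXi (κ b e : ℝ) : ℝ × ℝ := (κ, -(e * b))

/-- The direction of `∂/∂η`. -/
def dirEta (κ a e : ℝ) : ℝ × ℝ := (-(κ * a), e)

/-- The direction of `∂/∂ξ - ∂/∂η`, along which `ξ + η` is constant. -/
def dirDiff (κ a b e : ℝ) : ℝ × ℝ := (κ * (1 + a), -(e * (1 + b)))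

/-- The two geometries of linear forms `P = κ (ξ - a η)`, `Q = e (η - b ξ)` with small `e`. -/
def AdmissibleForms (α a b : ℝ) : Prop := (b = 0 ∧ a ≠ 0 ∧ a ≠ -1 ∧ α ≠ 2) ∨ a = 0

theorem AdmissibleForms.one_sub_mul_ne_zero {α a b : ℝ} (h : AdmissibleForms α a b) :
    1 - a * b ≠ 0 := by
  rcases h with h | h
  · simp [h.1]
  · simp [h]

open Classical in
/-- The size of the mixed derivatives of the phase: `1` if `P` depends on `η`, and `|e|` if
only `Q` does. -/
def mixSize (a e : ℝ) : ℝ := if a = 0 then |e| else 1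

theorem continuousOn_statPoint_box {α p₁ p₂ q₁ q₂ : ℝ} (hα : 0 < α) (hp : 0 < p₁) (hq : 0 < q₁)
    (s : Set ℝ) :
    ContinuousOn (fun z : ℝ × ℝ × ℝ => statPoint α z.2.1 z.2.2)
      (s ×ˢ (Icc p₁ p₂ ×ˢ Icc q₁ q₂)) := by
  rintro ⟨e, P, Q⟩ ⟨_, hP, hQ⟩
  have hP0 : 0 < P := by linarith [hP.1]
  have hQ0 : 0 < Q := by linarith [hQ.1]
  have h1 : α * Q ≠ 0 := by positivity
  have h2 : P / (α * Q) ≠ 0 := by positivity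
  apply ContinuousAt.continuousWithinAt
  unfold statPoint
  refine ContinuousAt.rpow_const ?_ (Or.inl h2)
  exact ContinuousAt.div (by fun_prop) (by fun_prop) h1

/-- Nondegeneracy of the phase: the derivative along `ξ`, `η` and `ξ - η` of the critical value is
of exact order `mixSize a e`. -/
theorem exists_phase_bounds {α κ a b p₁ p₂ q₁ q₂ : ℝ} (hα : 0 < α) (hα1 : α ≠ 1)
    (hab : AdmissibleForms α a b) (hκ : κ ≠ 0) (hp : 0 < p₁) (hq : 0 < q₁) :
    ∃ e₀ c C : ℝ, 0 < e₀ ∧ e₀ ≤ 1 ∧ 0 < c ∧ 0 < C ∧ ∀ e : ℝ, |e| ≤ e₀ →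
      ∀ P ∈ Icc p₁ p₂, ∀ Q ∈ Icc q₁ q₂,
      c * mixSize a e ≤ |critPhase₃ α (dirXi κ b e) (dirEta κ a e) (dirDiff κ a b e) P Q| ∧
      |critPhase₄ α (dirXi κ b e) (dirEta κ a e) (dirDiff κ a b e) (dirXi κ b e) P Q|
        ≤ C * mixSize a e := by
  have hα1' : α - 1 ≠ 0 := sub_ne_zero.2 hα1
  set K := Icc p₁ p₂ ×ˢ Icc q₁ q₂
  have hK : IsCompact K := isCompact_Icc.prod isCompact_Icc
  -- in the second geometry the direction of `η` is `e` times a fixed one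
  obtain ⟨y, hy, hcy⟩ : ∃ y : ℝ → ℝ × ℝ,
      (∀ e, y e = if a = 0 then (0, 1) else dirEta κ a e) ∧ Continuous y := by
    refine ⟨fun e => if a = 0 then (0, 1) else dirEta κ a e, fun _ => rfl, ?_⟩
    simp only [dirEta]; split_ifs <;> fun_prop
  have hy2 : ∀ e, |e| ≤ 1 → ∃ c : ℝ, |c| = mixSize a e ∧ dirEta κ a e = c • y e := by
    intro e _
    by_cases ha : a = 0
    · exact ⟨e, by simp [mixSize, ha], by simp [hy, ha, dirEta]⟩
    · exact ⟨1, by simp [mixSize, ha], by simp [hy, ha]⟩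
  have hsp := continuousOn_statPoint_box (p₂ := p₂) (q₂ := q₂) hα hp hq (Icc (-1) 1)
  have hdet : ∀ z ∈ Icc (-1 : ℝ) 1 ×ˢ K, z.2.1 ≠ 0 ∧ z.2.2 ≠ 0 := by
    rintro ⟨e, P, Q⟩ ⟨_, hP, hQ⟩
    exact ⟨by have := hP.1; simp only; linarith, by have := hQ.1; simp only; linarith⟩
  have c3 : ContinuousOn (fun z : ℝ × ℝ × ℝ =>
      critPhase₃ α (dirXi κ b z.1) (y z.1) (dirDiff κ a b z.1) z.2.1 z.2.2) (Icc (-1) 1 ×ˢ K) := by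
    unfold critPhase₃ critPoly₃ radDet dirDet dirXi dirDiff
    refine ContinuousOn.div ?_ (by fun_prop) fun z hz => ?_
    · refine (continuousOn_const.mul hsp).mul (Continuous.continuousOn ?_)
      fun_prop
    · have := hdet z hz
      exact mul_ne_zero (pow_ne_zero _ this.1) (pow_ne_zero _ this.2)
  have c4 : ContinuousOn (fun z : ℝ × ℝ × ℝ =>
      critPhase₄ α (dirXi κ b z.1) (y z.1) (dirDiff κ a b z.1) (dirXi κ b z.1) z.2.1 z.2.2)
      (Icc (-1) 1 ×ˢ K) := by
    unfold critPhase₄ critPoly₃ critPoly₃' radDet dirDet dirXi dirDiff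
    refine ContinuousOn.div ?_ (by fun_prop) fun z hz => ?_
    · refine (continuousOn_const.mul hsp).mul (Continuous.continuousOn ?_)
      fun_prop
    · have := hdet z hz
      exact mul_ne_zero (pow_ne_zero _ this.1) (pow_ne_zero _ this.2)
  have hne : ∀ z ∈ K, critPhase₃ α (dirXi κ b 0) (y 0) (dirDiff κ a b 0) z.1 z.2 ≠ 0 := by
    rintro ⟨P, Q⟩ ⟨hP, hQ⟩
    have hP0 : 0 < P := by have := hP.1; simp only at this; linarith
    have hQ0 : 0 < Q := by have := hQ.1; simp only at this; linarith
    have hs := statPoint_pos hα hP0 hQ0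
    have hpoly : critPoly₃ α (dirXi κ b 0) (y 0) (dirDiff κ a b 0) P Q ≠ 0 := by
      unfold critPoly₃ radDet dirDet dirXi dirDiff
      by_cases ha : a = 0
      · have e : (κ * Q - -(0 * b) * P) * ((0 : ℝ) * Q - 1 * P) *
            ((1 / (α - 1) - 1) * (κ * (1 + a)) * Q - (1 / (α - 1) + 2) * -(0 * (1 + b)) * P) +
            P * Q * ((κ * -(0 * (1 + b)) - -(0 * b) * (κ * (1 + a))) * (0 * Q - 1 * P) +
            (κ * Q - -(0 * b) * P) * (0 * -(0 * (1 + b)) - 1 * (κ * (1 + a)))) =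
            -(κ ^ 2 * P * Q ^ 2 * (1 / (α - 1))) := by rw [ha]; ring
        simp only [hy, if_pos ha]
        rw [e]
        have : 1 / (α - 1) ≠ 0 := one_div_ne_zero hα1'
        exact neg_ne_zero.2 (by positivity)
      · obtain ⟨hb, _, ha1, hα2⟩ : b = 0 ∧ a ≠ 0 ∧ a ≠ -1 ∧ α ≠ 2 := by
          rcases hab with h | h
          · exact h
          · exact absurd h ha
        simp only [hy, if_neg ha, dirEta, zero_mul, neg_zero, sub_zero, mul_zero, add_zero]
        have h1 : 1 / (α - 1) - 1 ≠ 0 := by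
          intro h
          have : 1 / (α - 1) = 1 := by linarith
          rw [div_eq_one_iff_eq hα1'] at this
          exact hα2 (by linarith)
        have h2 : 1 + a ≠ 0 := fun h => ha1 (by linarith)
        exact mul_ne_zero (mul_ne_zero (mul_ne_zero hκ hQ0.ne') (mul_ne_zero
          (neg_ne_zero.2 (mul_ne_zero hκ ha)) hQ0.ne'))
          (mul_ne_zero (mul_ne_zero h1 (mul_ne_zero hκ h2)) hQ0.ne')
    unfold critPhase₃
    refine div_ne_zero (mul_ne_zero (mul_ne_zero ?_ hs.ne') hpoly) (by positivity)
    exact neg_ne_zero.2 (one_div_ne_zero hα1')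
  obtain ⟨e₀, c, he₀, he1, hc, hlow⟩ := exists_lower_bound_near_zero hK c3 hne
  obtain ⟨C, hC⟩ := (isCompact_Icc.prod hK).exists_bound_of_continuousOn c4
  refine ⟨e₀, c, |C| + 1, he₀, he1, hc, by positivity, fun e he P hP Q hQ => ?_⟩
  obtain ⟨r, hr, hyr⟩ := hy2 e (he.trans he1)
  have hz : (P, Q) ∈ K := ⟨hP, hQ⟩
  rw [hyr, critPhase₃_smul, critPhase₄_smul, abs_mul, abs_mul, hr]
  have hm : 0 ≤ mixSize a e := hr ▸ abs_nonneg r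
  refine ⟨?_, ?_⟩
  · rw [mul_comm c]; exact mul_le_mul_of_nonneg_left (hlow e he _ hz) hm
  · rw [mul_comm _ (mixSize a e)]
    have := hC (e, P, Q) ⟨abs_le.1 (he.trans he1), hz⟩
    rw [norm_eq_abs] at this
    exact mul_le_mul_of_nonneg_left (this.trans (by linarith [le_abs_self C])) hm

/-- When `P` depends on `ξ` alone, the `η`-derivative of the first two `ξ`-derivatives of the
critical value is of order `e`, exactly so for the second one. -/
theorem exists_phase_bounds_of_P_indep {α κ b p₁ p₂ q₁ q₂ : ℝ} (hα : 0 < α) (hα1 : α ≠ 1)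
    (hκ : κ ≠ 0) (hp : 0 < p₁) (hq : 0 < q₁) :
    ∃ e₀ c C : ℝ, 0 < e₀ ∧ e₀ ≤ 1 ∧ 0 < c ∧ 0 < C ∧ ∀ e : ℝ, |e| ≤ e₀ →
      ∀ P ∈ Icc p₁ p₂, ∀ Q ∈ Icc q₁ q₂,
      |critPhase₂ α (dirXi κ b e) (dirEta κ 0 e) P Q| ≤ C * |e| ∧
      c * |e| ≤ |critPhase₃ α (dirXi κ b e) (dirEta κ 0 e) (dirXi κ b e) P Q| ∧
      |critPhase₃ α (dirXi κ b e) (dirEta κ 0 e) (dirXi κ b e) P Q| ≤ C * |e| := by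
  have hα1' : α - 1 ≠ 0 := sub_ne_zero.2 hα1
  set K := Icc p₁ p₂ ×ˢ Icc q₁ q₂
  have hK : IsCompact K := isCompact_Icc.prod isCompact_Icc
  have hy2 : ∀ e, dirEta κ 0 e = e • ((0, 1) : ℝ × ℝ) := by intro e; simp [dirEta]
  have hsp := continuousOn_statPoint_box (p₂ := p₂) (q₂ := q₂) hα hp hq (Icc (-1) 1)
  have hdet : ∀ z ∈ Icc (-1 : ℝ) 1 ×ˢ K, z.2.1 ≠ 0 ∧ z.2.2 ≠ 0 := by
    rintro ⟨e, P, Q⟩ ⟨_, hP, hQ⟩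
    exact ⟨by have := hP.1; simp only; linarith, by have := hQ.1; simp only; linarith⟩
  have c2 : ContinuousOn (fun z : ℝ × ℝ × ℝ =>
      critPhase₂ α (dirXi κ b z.1) (0, 1) z.2.1 z.2.2) (Icc (-1) 1 ×ˢ K) := by
    unfold critPhase₂ radDet dirXi
    refine ContinuousOn.div ?_ (by fun_prop) fun z hz => ?_
    · refine (continuousOn_const.mul hsp).mul (Continuous.continuousOn ?_)
      fun_prop
    · have := hdet z hz
      exact mul_ne_zero this.1 (pow_ne_zero _ this.2)
  have c3 : ContinuousOn (fun z : ℝ × ℝ × ℝ =>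
      critPhase₃ α (dirXi κ b z.1) (0, 1) (dirXi κ b z.1) z.2.1 z.2.2) (Icc (-1) 1 ×ˢ K) := by
    unfold critPhase₃ critPoly₃ radDet dirDet dirXi
    refine ContinuousOn.div ?_ (by fun_prop) fun z hz => ?_
    · refine (continuousOn_const.mul hsp).mul (Continuous.continuousOn ?_)
      fun_prop
    · have := hdet z hz
      exact mul_ne_zero (pow_ne_zero _ this.1) (pow_ne_zero _ this.2)
  have hne : ∀ z ∈ K, critPhase₃ α (dirXi κ b 0) (0, 1) (dirXi κ b 0) z.1 z.2 ≠ 0 := by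
    rintro ⟨P, Q⟩ ⟨hP, hQ⟩
    have hP0 : 0 < P := by have := hP.1; simp only at this; linarith
    have hQ0 : 0 < Q := by have := hQ.1; simp only at this; linarith
    have hs := statPoint_pos hα hP0 hQ0
    have hpoly : critPoly₃ α (dirXi κ b 0) (0, 1) (dirXi κ b 0) P Q ≠ 0 := by
      unfold critPoly₃ radDet dirDet dirXi
      have e : (κ * Q - -(0 * b) * P) * ((0 : ℝ) * Q - 1 * P) *
            ((1 / (α - 1) - 1) * κ * Q - (1 / (α - 1) + 2) * -(0 * b) * P) +
            P * Q * ((κ * -(0 * b) - -(0 * b) * κ) * (0 * Q - 1 * P) +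
            (κ * Q - -(0 * b) * P) * (0 * -(0 * b) - 1 * κ)) =
            -(κ ^ 2 * P * Q ^ 2 * (1 / (α - 1))) := by ring
      simp only
      rw [e]
      have : 1 / (α - 1) ≠ 0 := one_div_ne_zero hα1'
      exact neg_ne_zero.2 (by positivity)
    unfold critPhase₃
    refine div_ne_zero (mul_ne_zero (mul_ne_zero ?_ hs.ne') hpoly) (by positivity)
    exact neg_ne_zero.2 (one_div_ne_zero hα1')
  obtain ⟨e₀, c, he₀, he1, hc, hlow⟩ := exists_lower_bound_near_zero hK c3 hne
  obtain ⟨C, hC⟩ := (isCompact_Icc.prod hK).exists_bound_of_continuousOn c2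
  obtain ⟨C', hC'⟩ := (isCompact_Icc.prod hK).exists_bound_of_continuousOn c3
  refine ⟨e₀, c, |C| + |C'| + 1, he₀, he1, hc, by positivity, fun e he P hP Q hQ => ?_⟩
  have hz : (P, Q) ∈ K := ⟨hP, hQ⟩
  have hz' : (e, P, Q) ∈ Icc (-1 : ℝ) 1 ×ˢ K := ⟨abs_le.1 (he.trans he1), hz⟩
  rw [hy2, critPhase₃_smul, critPhase₂_smul, abs_mul, abs_mul]
  have h2 := hC _ hz'
  have h3 := hC' _ hz'
  rw [norm_eq_abs] at h2 h3
  refine ⟨?_, ?_, ?_⟩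
  · rw [mul_comm]; gcongr
    linarith [le_abs_self C, abs_nonneg C']
  · rw [mul_comm]; gcongr
    exact hlow e he _ hz
  · rw [mul_comm]; gcongr
    linarith [le_abs_self C', abs_nonneg C]

/-! ### The amplitude left after removal of the critical phase -/

/-- Smooth functions supported in `[lo, hi]`. -/
structure IsBoxBump (lo hi : ℝ) (χ : ℝ → ℂ) : Prop where
  contDiff : Smooth χ
  tsupport_subset : tsupport χ ⊆ Icc lo hi

theorem IsBoxBump.compact {lo hi : ℝ} {χ : ℝ → ℂ} (h : IsBoxBump lo hi χ) :
    HasCompactSupport χ :=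
  HasCompactSupport.of_support_subset_isCompact isCompact_Icc
    ((subset_tsupport _).trans h.tsupport_subset)

theorem IsBoxBump.eq_zero {lo hi : ℝ} {χ : ℝ → ℂ} (h : IsBoxBump lo hi χ) {x : ℝ}
    (hx : x ∉ Icc lo hi) : χ x = 0 :=
  image_eq_zero_of_notMem_tsupport fun hm => hx (h.tsupport_subset hm)

theorem IsBoxBump.deriv {lo hi : ℝ} {χ : ℝ → ℂ} (h : IsBoxBump lo hi χ) :
    IsBoxBump lo hi (deriv χ) := by
  refine ⟨?_, (tsupport_deriv_subset (f := χ)).trans h.tsupport_subset⟩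
  exact (contDiff_infty_iff_deriv.1 h.contDiff).2

theorem IsBoxBump.hasDerivAt_line {lo hi : ℝ} {χ : ℝ → ℂ} (h : IsBoxBump lo hi χ) (A B u : ℝ) :
    HasDerivAt (fun u => χ (A + B * u)) (_root_.deriv χ (A + B * u) * B) u :=
  ((((contDiff_infty_iff_deriv.1 h.contDiff).1 _).hasDerivAt.scomp u
    (hasDerivAt_affine A B u))).congr_deriv (by rw [real_smul, mul_comm])

theorem IsBoxBump.exists_bound {lo hi : ℝ} {χ : ℝ → ℂ} (h : IsBoxBump lo hi χ) :
    ∃ C : ℝ, 0 ≤ C ∧ ∀ x, ‖χ x‖ ≤ C := by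
  obtain ⟨C, hC⟩ := h.compact.exists_bound_of_continuous h.contDiff.continuous
  exact ⟨C, (norm_nonneg _).trans (hC 0), hC⟩

/-- The oscillatory integral, cut off in `P` and `Q`. -/
def oscMul (α s ι : ℝ) (ρ χ₁ χ₂ : ℝ → ℂ) (L P Q : ℝ) : ℂ :=
  oscInt α s ι ρ L P Q * χ₁ P * χ₂ Q

theorem oscMul_eq_zero {α s ι p₁ p₂ q₁ q₂ : ℝ} {ρ χ₁ χ₂ : ℝ → ℂ} (hχ₁ : IsBoxBump p₁ p₂ χ₁)
    (hχ₂ : IsBoxBump q₁ q₂ χ₂) (L : ℝ) {P Q : ℝ}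
    (h : ¬ (P ∈ Icc p₁ p₂ ∧ Q ∈ Icc q₁ q₂)) : oscMul α s ι ρ χ₁ χ₂ L P Q = 0 := by
  rw [oscMul]
  by_cases hP : P ∈ Icc p₁ p₂
  · rw [hχ₂.eq_zero fun hQ => h ⟨hP, hQ⟩, mul_zero]
  · rw [hχ₁.eq_zero hP, mul_zero, zero_mul]

theorem integrable_oscExp {α : ℝ} (hα : 0 < α) {ρ : ℝ → ℂ} (hρ : Continuous ρ)
    (hc : HasCompactSupport ρ) (s ι L P Q : ℝ) :
    Integrable fun t => expI(s * L * oscPhase α ι P Q t) * ρ t := by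
  have h := continuous_oscPhase hα ι P Q
  exact Continuous.integrable_of_hasCompactSupport (by fun_prop) hc.mul_left

theorem hasDerivAt_oscInt_line {α : ℝ} (hα : 0 < α) {ρ : ℝ → ℂ} (hρ : Continuous ρ)
    (hc : HasCompactSupport ρ) (s ι L P₀ Q₀ : ℝ) (v : ℝ × ℝ) (u : ℝ) :
    HasDerivAt (fun u => oscInt α s ι ρ L (P₀ + v.1 * u) (Q₀ + v.2 * u))
      (oscInt α s ι (fun t => I * ((s * L * (-v.1 * t + ι * v.2 * t ^ α) : ℝ) : ℂ) * ρ t) L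
        (P₀ + v.1 * u) (Q₀ + v.2 * u)) u := by
  have hr : Continuous fun t : ℝ => t ^ α := continuous_rpow_const hα.le
  have hρ' : Continuous fun t : ℝ =>
      I * ((s * L * (-v.1 * t + ι * v.2 * t ^ α) : ℝ) : ℂ) * ρ t := by fun_prop
  unfold oscInt
  refine (hasDerivAt_integral_of_dominated_loc_of_deriv_le (s := univ)
    (F := fun u t => expI(s * L * oscPhase α ι (P₀ + v.1 * u) (Q₀ + v.2 * u) t) * ρ t)
    (F' := fun u t => expI(s * L * oscPhase α ι (P₀ + v.1 * u) (Q₀ + v.2 * u) t) *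
      (I * ((s * L * (-v.1 * t + ι * v.2 * t ^ α) : ℝ) : ℂ) * ρ t))
    (bound := fun t => ‖I * ((s * L * (-v.1 * t + ι * v.2 * t ^ α) : ℝ) : ℂ) * ρ t‖)
    univ_mem ?_ ?_ ?_ ?_ ?_ ?_).2
  · filter_upwards with x
    exact (integrable_oscExp hα hρ hc s ι L _ _).aestronglyMeasurable
  · exact integrable_oscExp hα hρ hc s ι L _ _
  · exact (integrable_oscExp hα hρ' hc.mul_left s ι L _ _).aestronglyMeasurable
  · filter_upwards with t x _
    rw [norm_mul, norm_expI, one_mul]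
  · exact (Continuous.integrable_of_hasCompactSupport hρ' hc.mul_left).norm
  · filter_upwards with t x _
    have h1 : HasDerivAt (fun u => s * L * oscPhase α ι (P₀ + v.1 * u) (Q₀ + v.2 * u) t)
        (s * L * (-v.1 * t + ι * v.2 * t ^ α)) x := by
      unfold oscPhase
      exact (((hasDerivAt_affine P₀ v.1 x).neg.mul_const t).add
        (((hasDerivAt_affine Q₀ v.2 x).const_mul ι).mul_const (t ^ α))).const_mul (s * L)
    exact ((hasDerivAt_exp_I_mul h1).mul_const (ρ t)).congr_deriv (by ring)

/-- The kernel with its critical phase removed. -/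
def oscAmp (α s : ℝ) (ρ χ₁ χ₂ : ℝ → ℂ) (L P Q : ℝ) : ℂ :=
  exp (-(I * ((s * L * critPhase α P Q : ℝ) : ℂ))) * oscMul α s 1 ρ χ₁ χ₂ L P Q

theorem oscMul_eq_exp_mul_oscAmp (α s : ℝ) (ρ χ₁ χ₂ : ℝ → ℂ) (L P Q : ℝ) :
    oscMul α s 1 ρ χ₁ χ₂ L P Q = expI(s * L * critPhase α P Q) * oscAmp α s ρ χ₁ χ₂ L P Q := by
  rw [oscAmp, ← mul_assoc, ← exp_add, add_neg_cancel, exp_zero, one_mul]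

theorem norm_oscAmp (α s : ℝ) (ρ χ₁ χ₂ : ℝ → ℂ) (L P Q : ℝ) :
    ‖oscAmp α s ρ χ₁ χ₂ L P Q‖ = ‖oscMul α s 1 ρ χ₁ χ₂ L P Q‖ := by
  rw [oscMul_eq_exp_mul_oscAmp α s ρ, norm_mul, norm_expI, one_mul]

/-- The amplitude and its derivatives along lines are `O(L ^ (-1/2))`. -/
theorem exists_oscAmp_bounds {α : ℝ} (hα : 0 < α) (hα1 : α ≠ 1) {p₁ p₂ q₁ q₂ : ℝ}
    (hp : 0 < p₁) (hq : 0 < q₁) {ρ χ₁ χ₂ : ℝ → ℂ} (hρ : IsPosBump ρ) (hχ₁ : IsBoxBump p₁ p₂ χ₁)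
    (hχ₂ : IsBoxBump q₁ q₂ χ₂) :
    ∃ C : ℝ, 0 < C ∧ ∀ (L s : ℝ), 1 ≤ L → |s| = 1 → (∀ P Q, ‖oscMul α s 1 ρ χ₁ χ₂ L P Q‖ ≤ C / √L) ∧
      ∀ (P₀ Q₀ : ℝ) (v : ℝ × ℝ) (u : ℝ), P₀ + v.1 * u ∈ Icc p₁ p₂ →
        Q₀ + v.2 * u ∈ Icc q₁ q₂ → ∃ B' : ℂ,
        HasDerivAt (fun u => oscAmp α s ρ χ₁ χ₂ L (P₀ + v.1 * u) (Q₀ + v.2 * u)) B' u ∧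
        ‖B'‖ ≤ C * (|v.1| + |v.2|) / √L := by
  obtain ⟨C, hC0, hC⟩ := exists_oscInt_stationary_bounds (p₂ := p₂) (q₂ := q₂) hα hα1 hp hq hρ
  obtain ⟨X, hX0, hX⟩ := hχ₁.exists_bound
  obtain ⟨Y, hY0, hY⟩ := hχ₂.exists_bound
  obtain ⟨X', hX0', hX'⟩ := hχ₁.deriv.exists_bound
  obtain ⟨Y', hY0', hY'⟩ := hχ₂.deriv.exists_bound
  set K := C * X * Y + C * X' * Y + C * X * Y' + 1
  refine ⟨K, by positivity, fun L s hL hs => ?_⟩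
  have hL0 : 0 < L := by linarith
  have hsL : 0 < √L := sqrt_pos.2 hL0
  have n1 : 0 ≤ C * X * Y := by positivity
  have n2 : 0 ≤ C * X' * Y := by positivity
  have n3 : 0 ≤ C * X * Y' := by positivity
  refine ⟨fun P Q => ?_, fun P₀ Q₀ v u hP hQ => ?_⟩
  · by_cases h : P ∈ Icc p₁ p₂ ∧ Q ∈ Icc q₁ q₂
    · have := (hC L s P Q hL hs h.1 h.2).1
      rw [oscMul, norm_mul, norm_mul]
      calc _ ≤ C / √L * X * Y := by gcongr; exacts [hX P, hY Q]
        _ = (C * X * Y) / √L := by ring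
        _ ≤ _ := by gcongr; linarith
    · rw [oscMul_eq_zero hχ₁ hχ₂ L h, norm_zero]; positivity
  · set P := P₀ + v.1 * u with hPdef
    set Q := Q₀ + v.2 * u with hQdef
    have hP0 : 0 < P := by linarith [hP.1]
    have hQ0 : 0 < Q := by linarith [hQ.1]
    have d1 := hasDerivAt_oscInt_line hα hρ.contDiff.continuous hρ.compact s 1 L P₀ Q₀ v u
    have d4 := hasDerivAt_critPhase (P := fun u => P₀ + v.1 * u) (Q := fun u => Q₀ + v.2 * u)
      (v := v) hα hα1 hP0 hQ0 (hasDerivAt_affine P₀ v.1 u) (hasDerivAt_affine Q₀ v.2 u)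
    have d5 : HasDerivAt (fun u => exp (-(I *
        ((s * L * critPhase α (P₀ + v.1 * u) (Q₀ + v.2 * u) : ℝ) : ℂ))))
        (exp (-(I * ((s * L * critPhase α P Q : ℝ) : ℂ))) *
          -(I * ((s * L * critPhase₁ α v P Q : ℝ) : ℂ))) u :=
      ((((d4.const_mul (s * L)).ofReal_comp).const_mul I).neg).cexp
    have d6 := d5.mul ((d1.mul (hχ₁.hasDerivAt_line P₀ v.1 u)).mul (hχ₂.hasDerivAt_line Q₀ v.2 u))
    refine ⟨_, d6, ?_⟩
    simp only [Pi.mul_apply, ← hPdef, ← hQdef]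
    set c := statPoint α P Q with hc
    obtain ⟨b1, b2, b3⟩ := hC L s P Q hL hs hP hQ
    -- differentiating the critical phase recentres the amplitude at the stationary point
    have lin : oscInt α s 1
        (fun t => I * ((s * L * (-v.1 * t + 1 * v.2 * t ^ α) : ℝ) : ℂ) * ρ t) L P Q =
        I * ((s * L * critPhase₁ α v P Q : ℝ) : ℂ) * oscInt α s 1 ρ L P Q +
        (I * ((s * L : ℝ) : ℂ) * (-(v.1 : ℂ)) *
          oscInt α s 1 (fun t => ((t - c : ℝ) : ℂ) * ρ t) L P Q +
        I * ((s * L : ℝ) : ℂ) * (v.2 : ℂ) *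
          oscInt α s 1 (fun t => ((t ^ α - c ^ α : ℝ) : ℂ) * ρ t) L P Q) := by
      have hr : Continuous fun t : ℝ => t ^ α := continuous_rpow_const hα.le
      have hρc := hρ.contDiff.continuous
      have i0 := integrable_oscExp hα hρc hρ.compact s 1 L P Q
      have i1 := integrable_oscExp (ρ := fun t => ((t - c : ℝ) : ℂ) * ρ t) hα
        (by fun_prop) hρ.compact.mul_left s 1 L P Q
      have i2 := integrable_oscExp (ρ := fun t => ((t ^ α - c ^ α : ℝ) : ℂ) * ρ t) hα
        (by fun_prop) hρ.compact.mul_left s 1 L P Q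
      have i12 : Integrable fun t => I * ((s * L : ℝ) : ℂ) * (-(v.1 : ℂ)) *
          (expI(s * L * oscPhase α 1 P Q t) *
            (((t - c : ℝ) : ℂ) * ρ t)) + I * ((s * L : ℝ) : ℂ) * (v.2 : ℂ) *
          (expI(s * L * oscPhase α 1 P Q t) *
            (((t ^ α - c ^ α : ℝ) : ℂ) * ρ t)) := (i1.const_mul _).add (i2.const_mul _)
      unfold oscInt
      rw [← integral_const_mul, ← integral_const_mul, ← integral_const_mul,
        ← integral_add (i1.const_mul _) (i2.const_mul _), ← integral_add (i0.const_mul _) i12]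
      congr 1; ext t
      simp only [critPhase₁, ← hc]
      push_cast
      ring
    rw [lin]
    set E := exp (-(I * ((s * L * critPhase α P Q : ℝ) : ℂ))) with hE
    have hEn : ‖E‖ = 1 := by
      have : E = expI(-(s * L * critPhase α P Q)) := by rw [hE]; push_cast; ring_nf
      rw [this, norm_expI]
    generalize oscInt α s 1 (fun t => ((t - c : ℝ) : ℂ) * ρ t) L P Q = I1 at *
    generalize oscInt α s 1 (fun t => ((t ^ α - c ^ α : ℝ) : ℂ) * ρ t) L P Q = I2 at *
    generalize oscInt α s 1 ρ L P Q = I0 at *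
    have e : E * -(I * ((s * L * critPhase₁ α v P Q : ℝ) : ℂ)) * (I0 * χ₁ P * χ₂ Q) +
        E * (((I * ((s * L * critPhase₁ α v P Q : ℝ) : ℂ) * I0 +
        (I * ((s * L : ℝ) : ℂ) * (-(v.1 : ℂ)) * I1 +
        I * ((s * L : ℝ) : ℂ) * (v.2 : ℂ) * I2)) * χ₁ P +
        I0 * (deriv χ₁ P * v.1)) * χ₂ Q + I0 * χ₁ P * (deriv χ₂ Q * v.2)) =
        E * ((I * ((s * L : ℝ) : ℂ) * (-(v.1 : ℂ)) * I1 +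
        I * ((s * L : ℝ) : ℂ) * (v.2 : ℂ) * I2) * χ₁ P * χ₂ Q +
        (I0 * (deriv χ₁ P * v.1) * χ₂ Q + I0 * χ₁ P * (deriv χ₂ Q * v.2))) := by ring
    rw [e, norm_mul, hEn, one_mul]
    have m1 : ∀ (w : ℝ) (J : ℂ), ‖J‖ ≤ C / (L * √L) →
        ‖I * ((s * L : ℝ) : ℂ) * (w : ℂ) * J‖ ≤ |w| * (C / √L) := by
      intro w J hJ
      rw [norm_mul, norm_mul, norm_mul, norm_I, norm_real, norm_real, norm_mul, norm_eq_abs, hs,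
        norm_of_nonneg hL0.le, norm_eq_abs]
      calc 1 * (1 * L) * |w| * ‖J‖ ≤ 1 * (1 * L) * |w| * (C / (L * √L)) := by gcongr
        _ = _ := by field_simp
    have m3 : ‖I0 * (deriv χ₁ P * v.1) * χ₂ Q‖ ≤ C / √L * (X' * |v.1|) * Y := by
      rw [norm_mul, norm_mul, norm_mul, norm_real, norm_eq_abs]
      gcongr
      exacts [hX' P, hY Q]
    have m4 : ‖I0 * χ₁ P * (deriv χ₂ Q * v.2)‖ ≤ C / √L * X * (Y' * |v.2|) := by
      rw [norm_mul, norm_mul, norm_mul, norm_real, norm_eq_abs]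
      gcongr
      exacts [hX P, hY' Q]
    have m5 : ‖(I * ((s * L : ℝ) : ℂ) * (-(v.1 : ℂ)) * I1 +
        I * ((s * L : ℝ) : ℂ) * (v.2 : ℂ) * I2) * χ₁ P * χ₂ Q‖ ≤
        (|v.1| * (C / √L) + |v.2| * (C / √L)) * X * Y := by
      rw [norm_mul, norm_mul]
      gcongr
      · exact (norm_add_le _ _).trans (add_le_add
          (by simpa only [ofReal_neg, abs_neg] using m1 (-v.1) I1 b2) (m1 _ _ b3))
      · exact hX P
      · exact hY Q
    refine (norm_add_le _ _).trans ((add_le_add m5 ((norm_add_le _ _).trans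
      (add_le_add m3 m4))).trans ?_)
    have k1 : 0 ≤ |v.1| / √L := by positivity
    have k2 : 0 ≤ |v.2| / √L := by positivity
    have : K * (|v.1| + |v.2|) / √L = K * (|v.1| / √L) + K * (|v.2| / √L) := by ring
    rw [this]
    have e1 : (|v.1| * (C / √L) + |v.2| * (C / √L)) * X * Y + (C / √L * (X' * |v.1|) * Y +
        C / √L * X * (Y' * |v.2|)) = (C * X * Y + C * X' * Y) * (|v.1| / √L) +
        (C * X * Y + C * X * Y') * (|v.2| / √L) := by ring
    rw [e1]
    gcongr <;> linarith

/-! ### Four-fold correlations of the kernel -/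

/-- The linear form `P = κ (ξ - a η)`. -/
def formP (κ a ξ η : ℝ) : ℝ := κ * (ξ - a * η)

/-- The linear form `Q = e (η - b ξ)`. -/
def formQ (e b ξ η : ℝ) : ℝ := e * (η - b * ξ)

/-- The kernel in `(ξ, η)` obtained from a function of `(P, Q)`. -/
def formKernel (κ a b e : ℝ) (M : ℝ → ℝ → ℂ) (ξ η : ℝ) : ℂ := M (formP κ a ξ η) (formQ e b ξ η)

/-- The correlation of four translates of a kernel that appears when the bilinear operator is
squared twice. -/
def quadCorr (K : ℝ → ℝ → ℂ) (τ η σ : ℝ) : ℂ :=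
  ∫ ξ, K ξ η * conj (K (ξ - τ) (η + τ)) * conj (K ξ (η + σ)) * K (ξ - τ) (η + σ + τ)

theorem hasDerivAt_formP (κ a b e r η' ξ : ℝ) :
    HasDerivAt (fun ξ => formP κ a (ξ - r) η') (dirXi κ b e).1 ξ :=
  ((((hasDerivAt_id ξ).sub_const r).sub_const (a * η')).const_mul κ).congr_deriv (by simp [dirXi])

theorem hasDerivAt_formQ (κ b e r η' ξ : ℝ) :
    HasDerivAt (fun ξ => formQ e b (ξ - r) η') (dirXi κ b e).2 ξ :=
  (((((hasDerivAt_id ξ).sub_const r).const_mul b).const_sub η').const_mul e).congr_deriv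
    (by simp [dirXi])

/-- The amplitude of the kernel along the lines on which the correlations integrate. -/
theorem exists_oscAmp_line_bounds {α κ p₁ p₂ q₁ q₂ : ℝ} (hα : 0 < α) (hα1 : α ≠ 1) (hκ : |κ| = 1)
    (hp : 0 < p₁) (hq : 0 < q₁) {ρ χ₁ χ₂ : ℝ → ℂ} (hρ : IsPosBump ρ) (hχ₁ : IsBoxBump p₁ p₂ χ₁)
    (hχ₂ : IsBoxBump q₁ q₂ χ₂) :
    ∃ C : ℝ, 0 < C ∧ ∀ L s : ℝ, 1 ≤ L → |s| = 1 → (∀ P Q, ‖oscMul α s 1 ρ χ₁ χ₂ L P Q‖ ≤ C / √L) ∧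
      (∀ P Q, ‖oscAmp α s ρ χ₁ χ₂ L P Q‖ ≤ C / √L) ∧ ∀ a b e r z ξ : ℝ, |e| ≤ 1 →
      formP κ a (ξ - r) z ∈ Icc p₁ p₂ → formQ e b (ξ - r) z ∈ Icc q₁ q₂ → ∃ B' : ℂ,
        HasDerivAt (fun ξ => oscAmp α s ρ χ₁ χ₂ L (formP κ a (ξ - r) z) (formQ e b (ξ - r) z))
          B' ξ ∧
        ‖B'‖ ≤ (1 + |b|) * (C / √L) := by
  obtain ⟨C, hC, h⟩ := exists_oscAmp_bounds hα hα1 hp hq hρ hχ₁ hχ₂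
  refine ⟨C, hC, fun L s hL hs => ⟨(h L s hL hs).1, fun P Q => ?_, fun a b e r z ξ he h1 h2 => ?_⟩⟩
  · rw [norm_oscAmp]; exact (h L s hL hs).1 _ _
  have eP : ∀ ξ, formP κ a (ξ - r) z = -(κ * r) - κ * a * z + (dirXi κ b e).1 * ξ := fun ξ => by
    unfold formP dirXi; ring
  have eQ : ∀ ξ, formQ e b (ξ - r) z = e * (z + b * r) + (dirXi κ b e).2 * ξ := fun ξ => by
    unfold formQ dirXi; ring
  rw [eP] at h1
  rw [eQ] at h2
  obtain ⟨B', hB, hB'⟩ := (h L s hL hs).2 _ _ (dirXi κ b e) ξ h1 h2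
  refine ⟨B', by simpa only [eP, eQ] using hB, hB'.trans ?_⟩
  rw [mul_comm C, mul_div_assoc]
  have i2 : |(dirXi κ b e).2| ≤ |b| := by
    simp only [dirXi, abs_neg, abs_mul]
    exact mul_le_of_le_one_left (abs_nonneg _) he
  exact mul_le_mul_of_nonneg_right (add_le_add hκ.le i2) (by positivity)

/-- The `ξ` for which finitely many translates lie in the box form an interval of bounded
length. -/
theorem exists_Icc_of_forms {κ a b e p₁ p₂ q₁ q₂ : ℝ} (hκ : |κ| = 1) {pts : Set (ℝ × ℝ)}
    (hne : pts.Nonempty) {S : Set ℝ}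
    (hS : S = {ξ | ∀ z ∈ pts, formP κ a (ξ - z.1) z.2 ∈ Icc p₁ p₂ ∧
      formQ e b (ξ - z.1) z.2 ∈ Icc q₁ q₂}) :
    S = ∅ ∨ ∃ c d, c ≤ d ∧ S = Icc c d ∧ d - c ≤ p₂ - p₁ := by
  rcases S.eq_empty_or_nonempty with h | hSne
  · exact Or.inl h
  right
  obtain ⟨z₀, hz₀⟩ := hne
  have hlen : ∀ x ∈ S, ∀ y ∈ S, y - x ≤ p₂ - p₁ := by
    intro x hx y hy
    rw [hS] at hx hy
    have h1 := (hx z₀ hz₀).1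
    have h2 := (hy z₀ hz₀).1
    have e1 : formP κ a (y - z₀.1) z₀.2 - formP κ a (x - z₀.1) z₀.2 = κ * (y - x) := by
      unfold formP; ring
    have h3 : |κ * (y - x)| ≤ p₂ - p₁ := by
      rw [← e1, abs_le]; constructor <;> linarith [h1.1, h1.2, h2.1, h2.2]
    rw [abs_mul, hκ, one_mul] at h3
    exact (le_abs_self _).trans h3
  have hconv : Convex ℝ S := by
    intro x hx y hy s t hs ht hst
    rw [hS] at hx hy ⊢
    intro z hz
    obtain ⟨hx1, hx2⟩ := hx z hz
    obtain ⟨hy1, hy2⟩ := hy z hz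
    have e1 : formP κ a (s • x + t • y - z.1) z.2 =
        s • formP κ a (x - z.1) z.2 + t • formP κ a (y - z.1) z.2 := by
      unfold formP; simp only [smul_eq_mul]
      linear_combination (-(κ * (z.1 + a * z.2))) * (-hst)
    have e2 : formQ e b (s • x + t • y - z.1) z.2 =
        s • formQ e b (x - z.1) z.2 + t • formQ e b (y - z.1) z.2 := by
      unfold formQ; simp only [smul_eq_mul]
      linear_combination (e * (z.2 + b * z.1)) * (-hst)
    rw [e1, e2]
    exact ⟨convex_Icc _ _ hx1 hy1 hs ht hst, convex_Icc _ _ hx2 hy2 hs ht hst⟩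
  have hclosed : IsClosed S := by
    have : S = ⋂ z ∈ pts, ((fun ξ => formP κ a (ξ - z.1) z.2) ⁻¹' Icc p₁ p₂ ∩
        (fun ξ => formQ e b (ξ - z.1) z.2) ⁻¹' Icc q₁ q₂) := by
      rw [hS]; ext ξ; simp
    rw [this]
    refine isClosed_biInter fun z _ => IsClosed.inter ?_ ?_
    · exact isClosed_Icc.preimage (by unfold formP; fun_prop)
    · exact isClosed_Icc.preimage (by unfold formQ; fun_prop)
  have hbdd : Bornology.IsBounded S := by
    obtain ⟨x, hx⟩ := hSne
    refine (Metric.isBounded_Icc (x - (p₂ - p₁)) (x + (p₂ - p₁))).subset fun y hy => ?_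
    have := hlen x hx y hy
    have := hlen y hy x hx
    exact ⟨by linarith, by linarith⟩
  have hcomp : IsCompact S := Metric.isCompact_of_isClosed_isBounded hclosed hbdd
  have hS' := eq_Icc_of_connected_compact ⟨hSne, hconv.isPreconnected⟩ hcomp
  have hle : sInf S ≤ sSup S := csInf_le_csSup hSne hcomp.bddBelow hcomp.bddAbove
  refine ⟨sInf S, sSup S, hle, hS', hlen _ ?_ _ ?_⟩
  · exact hcomp.sInf_mem hSne
  · exact hcomp.sSup_mem hSne

/-- A mixed second difference is a mixed second derivative at an intermediate point. -/
theorem exists_eq_mixed_deriv {g g₁ g₂ : ℝ → ℝ → ℝ}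
    (h1 : ∀ u ∈ Icc (0 : ℝ) 1, ∀ v ∈ Icc (0 : ℝ) 1, HasDerivAt (fun v => g u v) (g₁ u v) v)
    (h2 : ∀ u ∈ Icc (0 : ℝ) 1, ∀ v ∈ Icc (0 : ℝ) 1, HasDerivAt (fun u => g₁ u v) (g₂ u v) u) :
    ∃ u ∈ Icc (0 : ℝ) 1, ∃ v ∈ Icc (0 : ℝ) 1, g 0 0 - g 1 0 - g 0 1 + g 1 1 = g₂ u v := by
  have m0 : (0 : ℝ) ∈ Icc (0 : ℝ) 1 := by simp
  have m1 : (1 : ℝ) ∈ Icc (0 : ℝ) 1 := by simp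
  obtain ⟨v, hv, hv'⟩ := exists_hasDerivAt_eq_slope (fun v => g 1 v - g 0 v)
    (fun v => g₁ 1 v - g₁ 0 v) one_pos
    (fun v hv => ((h1 1 m1 v hv).sub (h1 0 m0 v hv)).continuousAt.continuousWithinAt)
    (fun v hv => (h1 1 m1 v ⟨hv.1.le, hv.2.le⟩).sub (h1 0 m0 v ⟨hv.1.le, hv.2.le⟩))
  have hvI : v ∈ Icc (0 : ℝ) 1 := ⟨hv.1.le, hv.2.le⟩
  obtain ⟨u, hu, hu'⟩ := exists_hasDerivAt_eq_slope (fun u => g₁ u v) (fun u => g₂ u v) one_pos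
    (fun u hu => (h2 u hu v hvI).continuousAt.continuousWithinAt)
    (fun u hu => h2 u ⟨hu.1.le, hu.2.le⟩ v hvI)
  refine ⟨u, ⟨hu.1.le, hu.2.le⟩, v, hvI, ?_⟩
  rw [hu']
  simp only [sub_zero, div_one] at hv' ⊢
  rw [hv']; ring

theorem parallelogram_mem_Icc {f : ℝ → ℝ → ℝ} {A B C lo hi : ℝ}
    (hf : ∀ u v, f u v = A + B * u + C * v) (h00 : f 0 0 ∈ Icc lo hi)
    (h10 : f 1 0 ∈ Icc lo hi) (h01 : f 0 1 ∈ Icc lo hi) (h11 : f 1 1 ∈ Icc lo hi)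
    {u v : ℝ} (hu : u ∈ Icc (0 : ℝ) 1) (hv : v ∈ Icc (0 : ℝ) 1) :
    f u v ∈ Icc lo hi := by
  have e1 : ∀ w, f u w = (1 - u) • f 0 w + u • f 1 w := by
    intro w; simp only [hf, smul_eq_mul]; ring
  have e2 : f u v = (1 - v) • f u 0 + v • f u 1 := by simp only [hf, smul_eq_mul]; ring
  have c := convex_Icc (𝕜 := ℝ) lo hi
  have k0 : f u 0 ∈ Icc lo hi := by rw [e1]; exact c h00 h10 (by linarith [hu.2]) hu.1 (by ring)
  have k1 : f u 1 ∈ Icc lo hi := by rw [e1]; exact c h01 h11 (by linarith [hu.2]) hu.1 (by ring)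
  rw [e2]; exact c k0 k1 (by linarith [hv.2]) hv.1 (by ring)

theorem critPhase₃_smul_right (α c : ℝ) (x y z : ℝ × ℝ) (P Q : ℝ) :
    critPhase₃ α x y (c • z) P Q = c * critPhase₃ α x y z P Q := by
  simp only [critPhase₃, critPoly₃, dirDet, radDet, Prod.smul_fst, Prod.smul_snd, smul_eq_mul]; ring

theorem critPhase₄_smul_right (α c : ℝ) (x y z w : ℝ × ℝ) (P Q : ℝ) :
    critPhase₄ α x y z (c • w) P Q = c * critPhase₄ α x y z w P Q := by
  simp only [critPhase₄, critPoly₃, critPoly₃', dirDet, radDet, Prod.smul_fst, Prod.smul_snd,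
    smul_eq_mul]; ring

theorem critPhase₃_swap (α : ℝ) (x y z : ℝ × ℝ) (P Q : ℝ) :
    critPhase₃ α x y z P Q = critPhase₃ α x z y P Q := by
  have : critPoly₃ α x y z P Q = critPoly₃ α x z y P Q := by
    simp only [critPoly₃, dirDet, radDet]
    generalize 1 / (α - 1) = g
    ring
  rw [critPhase₃, this, critPhase₃]

theorem critPhase₄_swap (α : ℝ) (x y z w : ℝ × ℝ) (P Q : ℝ) :
    critPhase₄ α x y z w P Q = critPhase₄ α x y w z P Q := by
  simp only [critPhase₄]
  congr 2
  simp only [critPoly₃, critPoly₃', dirDet, radDet]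
  generalize 1 / (α - 1) = g
  ring

theorem critPhase₄_swap' (α : ℝ) (x y z w : ℝ × ℝ) (P Q : ℝ) :
    critPhase₄ α x y z w P Q = critPhase₄ α x z y w P Q := by
  have : critPoly₃ α x y z P Q = critPoly₃ α x z y P Q := by
    simp only [critPoly₃, dirDet, radDet]
    generalize 1 / (α - 1) = g
    ring
  have h' : critPoly₃' α x y z w P Q = critPoly₃' α x z y w P Q := by
    simp only [critPoly₃', dirDet, radDet]
    generalize 1 / (α - 1) = g
    ring
  rw [critPhase₄, critPhase₄, this, h']

section Parallelogram

variable {α κ a b e p₁ p₂ q₁ q₂ ξ η τ σ : ℝ}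

/-- The four corners `(ξ, η)`, `(ξ - τ, η + τ)`, `(ξ, η + σ)`, `(ξ - τ, η + σ + τ)`. -/
def quadPts (τ η σ : ℝ) : Set (ℝ × ℝ) := {(0, η), (τ, η + τ), (0, η + σ), (τ, η + σ + τ)}

/-- The alternating sum over the four corners of a function of `(P, Q)`. -/
def quadDiff (κ a b e τ η σ ξ : ℝ) (g : ℝ → ℝ → ℝ) : ℝ :=
  g (formP κ a (ξ - 0) η) (formQ e b (ξ - 0) η)
    - g (formP κ a (ξ - τ) (η + τ)) (formQ e b (ξ - τ) (η + τ))
    - g (formP κ a (ξ - 0) (η + σ)) (formQ e b (ξ - 0) (η + σ))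
    + g (formP κ a (ξ - τ) (η + σ + τ)) (formQ e b (ξ - τ) (η + σ + τ))

theorem exists_quadDiff_eq {g g₁ g₂ : ℝ → ℝ → ℝ} (hp : 0 < p₁) (hq : 0 < q₁)
    (hS : ∀ z ∈ quadPts τ η σ, formP κ a (ξ - z.1) z.2 ∈ Icc p₁ p₂ ∧
      formQ e b (ξ - z.1) z.2 ∈ Icc q₁ q₂) (h₁ : IsDirDeriv (σ • dirEta κ a e) g g₁)
    (h₂ : IsDirDeriv ((-τ) • dirDiff κ a b e) g₁ g₂) :
    ∃ P ∈ Icc p₁ p₂, ∃ Q ∈ Icc q₁ q₂, quadDiff κ a b e τ η σ ξ g = g₂ P Q := by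
  set Pf : ℝ → ℝ → ℝ := fun u v => formP κ a (ξ - τ * u) (η + σ * v + τ * u) with hPf
  set Qf : ℝ → ℝ → ℝ := fun u v => formQ e b (ξ - τ * u) (η + σ * v + τ * u) with hQf
  have c1 := hS (0, η) (by simp [quadPts])
  have c2 := hS (τ, η + τ) (by simp [quadPts])
  have c3 := hS (0, η + σ) (by simp [quadPts])
  have c4 := hS (τ, η + σ + τ) (by simp [quadPts])
  have eP : ∀ u v, Pf u v = κ * (ξ - a * η) + -(κ * (1 + a) * τ) * u + -(κ * a * σ) * v :=
    fun u v => by simp only [hPf, formP]; ring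
  have eQ : ∀ u v, Qf u v = e * (η - b * ξ) + e * (1 + b) * τ * u + e * σ * v :=
    fun u v => by simp only [hQf, formQ]; ring
  have hPm : ∀ u ∈ Icc (0 : ℝ) 1, ∀ v ∈ Icc (0 : ℝ) 1, Pf u v ∈ Icc p₁ p₂ := fun u hu v hv =>
    parallelogram_mem_Icc eP (by simpa [hPf] using c1.1) (by simpa [hPf] using c2.1)
      (by simpa [hPf] using c3.1) (by simpa [hPf] using c4.1) hu hv
  have hQm : ∀ u ∈ Icc (0 : ℝ) 1, ∀ v ∈ Icc (0 : ℝ) 1, Qf u v ∈ Icc q₁ q₂ := fun u hu v hv =>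
    parallelogram_mem_Icc eQ (by simpa [hQf] using c1.2) (by simpa [hQf] using c2.2)
      (by simpa [hQf] using c3.2) (by simpa [hQf] using c4.2) hu hv
  obtain ⟨u, hu, v, hv, h⟩ := exists_eq_mixed_deriv (g := fun u v => g (Pf u v) (Qf u v))
    (fun u hu v hv => h₁ (P := Pf u) (Q := Qf u) (hp.trans_le (hPm u hu v hv).1)
      (hq.trans_le (hQm u hu v hv).1) (by
        simp only [funext (eP u)]
        exact (hasDerivAt_affine _ _ v).congr_deriv (by simp [dirEta]; ring)) (by
        simp only [funext (eQ u)]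
        exact (hasDerivAt_affine _ _ v).congr_deriv (by simp [dirEta]; ring)))
    (fun u hu v hv => h₂ (P := (Pf · v)) (Q := (Qf · v)) (hp.trans_le (hPm u hu v hv).1)
      (hq.trans_le (hQm u hu v hv).1) (by
        simp only [eP]
        exact ((hasDerivAt_affine _ _ u).add_const _).congr_deriv (by simp [dirDiff]; ring)) (by
        simp only [eQ]
        exact ((hasDerivAt_affine _ _ u).add_const _).congr_deriv (by simp [dirDiff]; ring)))
  refine ⟨Pf u v, hPm u hu v hv, Qf u v, hQm u hu v hv, ?_⟩
  rw [← h]; simp [hPf, hQf, quadDiff]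

/-- First and second `ξ`-derivative of the alternating sum of the phase over the four corners. -/
theorem exists_quad_phase_derivs (hα : 0 < α) (hα1 : α ≠ 1) (hp : 0 < p₁) (hq : 0 < q₁)
    (hS : ∀ z ∈ quadPts τ η σ, formP κ a (ξ - z.1) z.2 ∈ Icc p₁ p₂ ∧
      formQ e b (ξ - z.1) z.2 ∈ Icc q₁ q₂) :
    (∃ P ∈ Icc p₁ p₂, ∃ Q ∈ Icc q₁ q₂,
      quadDiff κ a b e τ η σ ξ (critPhase₁ α (dirXi κ b e)) =
        -(τ * σ) * critPhase₃ α (dirXi κ b e) (dirEta κ a e) (dirDiff κ a b e) P Q) ∧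
    ∃ P ∈ Icc p₁ p₂, ∃ Q ∈ Icc q₁ q₂,
      quadDiff κ a b e τ η σ ξ (critPhase₂ α (dirXi κ b e) (dirXi κ b e)) = -(τ * σ) *
        critPhase₄ α (dirXi κ b e) (dirEta κ a e) (dirDiff κ a b e) (dirXi κ b e) P Q := by
  constructor
  · obtain ⟨P, hP, Q, hQ, h⟩ := exists_quadDiff_eq hp hq hS
      (hasDerivAt_critPhase₁ hα hα1 (dirXi κ b e)) (hasDerivAt_critPhase₂ hα hα1 _ _)
    refine ⟨P, hP, Q, hQ, ?_⟩
    rw [h, critPhase₃_smul_right, critPhase₃_smul]; ring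
  · obtain ⟨P, hP, Q, hQ, h⟩ := exists_quadDiff_eq hp hq hS
      (hasDerivAt_critPhase₂ hα hα1 (dirXi κ b e) (dirXi κ b e))
      (hasDerivAt_critPhase₃ hα hα1 _ _ _)
    refine ⟨P, hP, Q, hQ, ?_⟩
    rw [h, critPhase₄_smul_right, critPhase₄_swap', critPhase₄_smul, critPhase₄_swap]; ring

end Parallelogram

theorem mixSize_pos {a e : ℝ} (he : e ≠ 0) : 0 < mixSize a e := by
  unfold mixSize; split_ifs
  · exact abs_pos.2 he
  · exact one_pos

theorem norm_mul_four {A B C D : ℂ} : ‖A * conj B * conj C * D‖ = ‖A‖ * ‖B‖ * ‖C‖ * ‖D‖ := by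
  simp only [norm_mul, RCLike.norm_conj]

/-- Bounds for the four-fold correlation of a stationary kernel: trivial, oscillatory, and
support. -/
theorem exists_quadCorr_bounds {α κ a b p₁ p₂ q₁ q₂ : ℝ} (hα : 0 < α) (hα1 : α ≠ 1)
    (hab : AdmissibleForms α a b) (hκ : |κ| = 1) (hp : 0 < p₁) (hpp : p₁ ≤ p₂) (hq : 0 < q₁)
    (hqq : q₁ ≤ q₂) :
    ∃ e₀ : ℝ, 0 < e₀ ∧ e₀ ≤ 1 ∧ ∀ ρ χ₁ χ₂ : ℝ → ℂ, IsPosBump ρ → IsBoxBump p₁ p₂ χ₁ →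
      IsBoxBump q₁ q₂ χ₂ → ∃ C : ℝ, 0 < C ∧ ∀ L s e τ η σ : ℝ, 1 ≤ L → |s| = 1 → e ≠ 0 →
      |e| ≤ e₀ →
      ‖quadCorr (formKernel κ a b e (oscMul α s 1 ρ χ₁ χ₂ L)) τ η σ‖ ≤ C / L ^ 2 ∧
      L * mixSize a e * |τ * σ| *
        ‖quadCorr (formKernel κ a b e (oscMul α s 1 ρ χ₁ χ₂ L)) τ η σ‖ ≤ C / L ^ 2 ∧
      (C < mixSize a e * |σ| →
        quadCorr (formKernel κ a b e (oscMul α s 1 ρ χ₁ χ₂ L)) τ η σ = 0) := by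
  have hκ0 : κ ≠ 0 := by rintro rfl; simp at hκ
  obtain ⟨e₀, c, C, he₀, he₀1, hc, hC, hbd⟩ :=
    exists_phase_bounds (p₂ := p₂) (q₂ := q₂) hα hα1 hab hκ0 hp hq
  refine ⟨e₀, he₀, he₀1, fun ρ χ₁ χ₂ hρ hχ₁ hχ₂ => ?_⟩
  obtain ⟨C₁, hC₁, hamp⟩ := exists_oscAmp_line_bounds hα hα1 hκ hp hq hρ hχ₁ hχ₂
  set ℓ := p₂ - p₁
  have hℓ0 : 0 ≤ ℓ := sub_nonneg.2 hpp
  have hm0 : 0 ≤ q₂ - q₁ := sub_nonneg.2 hqq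
  set C' := ℓ * C₁ ^ 4 + (2 * C₁ ^ 4 + ℓ * (4 * (1 + |b|) * C₁ ^ 4 + C₁ ^ 4 * C / c)) / c
    + ℓ / |a| + (q₂ - q₁) + 1 with hC'
  have n1 : 0 ≤ ℓ * C₁ ^ 4 := by positivity
  have n2 : 0 ≤ (2 * C₁ ^ 4 + ℓ * (4 * (1 + |b|) * C₁ ^ 4 + C₁ ^ 4 * C / c)) / c := by positivity
  have n3 : 0 ≤ ℓ / |a| := by positivity
  have hC'0 : 0 < C' := by rw [hC']; linarith
  refine ⟨C', hC'0, fun L s e τ η σ hL hs he0 he => ?_⟩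
  have hL0 : 0 < L := by linarith
  have hmix := mixSize_pos (a := a) he0
  obtain ⟨hM, hAb, hamp'⟩ := hamp L s hL hs
  set M := oscMul α s 1 ρ χ₁ χ₂ L
  set K := formKernel κ a b e M
  set Inn : ℝ → ℂ := fun ξ =>
    K ξ η * conj (K (ξ - τ) (η + τ)) * conj (K ξ (η + σ)) * K (ξ - τ) (η + σ + τ) with hInn
  set S : Set ℝ := {ξ | ∀ z ∈ quadPts τ η σ, formP κ a (ξ - z.1) z.2 ∈ Icc p₁ p₂ ∧
      formQ e b (ξ - z.1) z.2 ∈ Icc q₁ q₂} with hS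
  have hoff : ∀ ξ, ξ ∉ S → Inn ξ = 0 := by
    intro ξ hξ
    simp only [hS, Set.mem_ofPred_eq, quadPts, Set.mem_insert_iff, Set.mem_singleton_iff,
      forall_eq_or_imp, forall_eq, not_and_or, sub_zero] at hξ
    have h0 : ∀ x y, (formP κ a x y ∉ Icc p₁ p₂ ∨ formQ e b x y ∉ Icc q₁ q₂) →
        K x y = 0 := fun x y h => oscMul_eq_zero hχ₁ hχ₂ L (by rw [not_and_or]; exact h)
    simp only [hInn]
    rcases hξ with h | h | h | h <;> rw [h0 _ _ h] <;> simp
  have hquad : quadCorr K τ η σ = ∫ ξ, Inn ξ := rfl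
  rcases exists_Icc_of_forms hκ (pts := quadPts τ η σ) ⟨_, Or.inl rfl⟩ hS with hemp | hne
  · have : quadCorr K τ η σ = 0 := by
      rw [hquad]
      have : Inn = fun _ => 0 := by ext ξ; exact hoff ξ (by rw [hemp]; simp)
      rw [this]; simp
    rw [this]; simp only [norm_zero, mul_zero, implies_true, and_true, and_self]; positivity
  obtain ⟨c₀, d₀, hcd, hSI, hlen⟩ := hne
  have hint : quadCorr K τ η σ = ∫ ξ in c₀..d₀, Inn ξ := by
    rw [hquad, integral_of_le hcd, ← integral_Icc_eq_integral_Ioc, ← hSI,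
      setIntegral_eq_integral_of_forall_compl_eq_zero hoff]
  have hsq : (C₁ / √L) ^ 4 = C₁ ^ 4 / L ^ 2 := by
    rw [div_pow, show √L ^ 4 = (√L ^ 2) ^ 2 by ring, sq_sqrt hL0.le]
  have hs0 : 0 < √L := sqrt_pos.2 hL0
  have hM' : ∀ x y, ‖K x y‖ ≤ C₁ / √L := fun x y => hM _ _
  have hx0 : 0 ≤ C₁ / √L := by positivity
  have hInb : ∀ ξ, ‖Inn ξ‖ ≤ C₁ ^ 4 / L ^ 2 := by
    intro ξ
    rw [← hsq]; simp only [hInn]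
    rw [norm_mul_four, show (C₁ / √L) ^ 4 = (C₁ / √L) * (C₁ / √L) * (C₁ / √L) * (C₁ / √L) by ring]
    gcongr <;> exact hM' _ _
  have htriv : ‖quadCorr K τ η σ‖ ≤ ℓ * C₁ ^ 4 / L ^ 2 := by
    rw [hint]
    refine (norm_intervalIntegral_le hcd fun x _ => hInb x).trans ?_
    rw [mul_comm, mul_div_assoc]
    gcongr
  refine ⟨htriv.trans ?_, ?_, ?_⟩
  · gcongr; rw [hC']; linarith
  · rcases eq_or_ne (τ * σ) 0 with h0 | h0
    · rw [h0]; simp; positivity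
    have hτσ : 0 < |τ * σ| := abs_pos.2 h0
    set A : ℝ × ℝ → ℝ → ℂ := fun z ξ =>
      oscAmp α s ρ χ₁ χ₂ L (formP κ a (ξ - z.1) z.2) (formQ e b (ξ - z.1) z.2) with hA
    set Ψ : ℝ × ℝ → ℝ → ℝ := fun z ξ =>
      critPhase α (formP κ a (ξ - z.1) z.2) (formQ e b (ξ - z.1) z.2)
    set Ψ₁ : ℝ × ℝ → ℝ → ℝ := fun z ξ =>
      critPhase₁ α (dirXi κ b e) (formP κ a (ξ - z.1) z.2) (formQ e b (ξ - z.1) z.2)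
    set Ψ₂ : ℝ × ℝ → ℝ → ℝ := fun z ξ =>
      critPhase₂ α (dirXi κ b e) (dirXi κ b e) (formP κ a (ξ - z.1) z.2) (formQ e b (ξ - z.1) z.2)
    have hpos : ∀ z ∈ quadPts τ η σ, ∀ ξ ∈ Icc c₀ d₀,
        (0 < formP κ a (ξ - z.1) z.2 ∧ 0 < formQ e b (ξ - z.1) z.2) := by
      intro z hz ξ hξ
      rw [← hSI] at hξ
      exact ⟨hp.trans_le (hξ z hz).1.1, hq.trans_le (hξ z hz).2.1⟩
    have dΨ : ∀ z ∈ quadPts τ η σ, ∀ ξ ∈ Icc c₀ d₀, HasDerivAt (Ψ z) (Ψ₁ z ξ) ξ := by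
      intro z hz ξ hξ
      exact hasDerivAt_critPhase hα hα1 (hpos z hz ξ hξ).1 (hpos z hz ξ hξ).2 (hasDerivAt_formP ..)
        (hasDerivAt_formQ ..)
    have dΨ₁ : ∀ z ∈ quadPts τ η σ, ∀ ξ ∈ Icc c₀ d₀, HasDerivAt (Ψ₁ z) (Ψ₂ z ξ) ξ := by
      intro z hz ξ hξ
      exact hasDerivAt_critPhase₁ hα hα1 _ (hpos z hz ξ hξ).1 (hpos z hz ξ hξ).2
        (hasDerivAt_formP ..) (hasDerivAt_formQ ..)
    have dA : ∀ z ∈ quadPts τ η σ, ∀ ξ ∈ Icc c₀ d₀, ∃ B' : ℂ, HasDerivAt (A z) B' ξ ∧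
        ‖B'‖ ≤ (1 + |b|) * (C₁ / √L) := by
      intro z hz ξ hξ
      rw [← hSI] at hξ
      exact hamp' a b e z.1 z.2 ξ (he.trans he₀1) (hξ z hz).1 (hξ z hz).2
    choose! A' hA' hA'b using dA
    set z1 : ℝ × ℝ := (0, η)
    set z2 : ℝ × ℝ := (τ, η + τ)
    set z3 : ℝ × ℝ := (0, η + σ)
    set z4 : ℝ × ℝ := (τ, η + σ + τ)
    have m1 : z1 ∈ quadPts τ η σ := by simp [quadPts, z1]
    have m2 : z2 ∈ quadPts τ η σ := by simp [quadPts, z2]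
    have m3 : z3 ∈ quadPts τ η σ := by simp [quadPts, z3]
    have m4 : z4 ∈ quadPts τ η σ := by simp [quadPts, z4]
    set D : ℝ → ℝ := fun ξ => s * L * (Ψ z1 ξ - Ψ z2 ξ - Ψ z3 ξ + Ψ z4 ξ) with hD
    set D₁ : ℝ → ℝ := fun ξ => s * L * (Ψ₁ z1 ξ - Ψ₁ z2 ξ - Ψ₁ z3 ξ + Ψ₁ z4 ξ)
    set D₂ : ℝ → ℝ := fun ξ => s * L * (Ψ₂ z1 ξ - Ψ₂ z2 ξ - Ψ₂ z3 ξ + Ψ₂ z4 ξ)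
    set a₀ : ℝ → ℂ := fun ξ => A z1 ξ * conj (A z2 ξ) * conj (A z3 ξ) * A z4 ξ with ha₀
    set a₁ : ℝ → ℂ := fun ξ => ((A' z1 ξ * conj (A z2 ξ) + A z1 ξ * conj (A' z2 ξ)) *
      conj (A z3 ξ) + A z1 ξ * conj (A z2 ξ) * conj (A' z3 ξ)) * A z4 ξ
        + A z1 ξ * conj (A z2 ξ) * conj (A z3 ξ) * A' z4 ξ with ha₁
    have hIn : ∀ ξ, Inn ξ = expI(D ξ) * a₀ ξ := by
      intro ξ
      have key : ∀ r η', K (ξ - r) η' = expI(s * L * Ψ (r, η') ξ)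
          * A (r, η') ξ := fun r η' => oscMul_eq_exp_mul_oscAmp _ _ _ _ _ _ _ _
      have k1 := key 0 η
      have k3 := key 0 (η + σ)
      rw [sub_zero] at k1 k3
      simp only [hInn]
      rw [k1, k3, key τ (η + τ), key τ (η + σ + τ)]
      have hDe : (D ξ : ℂ) = ((s * L * Ψ z1 ξ : ℝ) : ℂ) + ((-(s * L * Ψ z2 ξ) : ℝ) : ℂ)
        + ((-(s * L * Ψ z3 ξ) : ℝ) : ℂ) + ((s * L * Ψ z4 ξ : ℝ) : ℂ) := by
        simp only [hD]; push_cast; ring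
      rw [hDe, mul_add, mul_add, mul_add, exp_add, exp_add, exp_add]
      simp only [map_mul, conj_expI, ha₀, z1, z2, z3, z4]
      ring
    have hD1 : ∀ ξ ∈ Icc c₀ d₀, HasDerivAt D (D₁ ξ) ξ := fun ξ hξ =>
      ((((dΨ z1 m1 ξ hξ).sub (dΨ z2 m2 ξ hξ)).sub (dΨ z3 m3 ξ hξ)).add
        (dΨ z4 m4 ξ hξ)).const_mul (s * L)
    have hD2 : ∀ ξ ∈ Icc c₀ d₀, HasDerivAt D₁ (D₂ ξ) ξ := fun ξ hξ =>
      ((((dΨ₁ z1 m1 ξ hξ).sub (dΨ₁ z2 m2 ξ hξ)).sub (dΨ₁ z3 m3 ξ hξ)).add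
        (dΨ₁ z4 m4 ξ hξ)).const_mul (s * L)
    have ha1 : ∀ ξ ∈ Icc c₀ d₀, HasDerivAt a₀ (a₁ ξ) ξ := fun ξ hξ =>
      (((hA' z1 m1 ξ hξ).mul (hA' z2 m2 ξ hξ).star).mul (hA' z3 m3 ξ hξ).star).mul (hA' z4 m4 ξ hξ)
    have habs : ∀ x : ℝ, |s * L * (-(τ * σ) * x)| = L * |τ * σ| * |x| := by
      intro x
      rw [abs_mul, abs_mul s, hs, one_mul, abs_of_pos hL0, abs_mul _ x, abs_neg, mul_assoc]
    have hder : ∀ ξ ∈ Icc c₀ d₀, (L * (c * mixSize a e) * |τ * σ| ≤ |D₁ ξ| ∧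
        |D₂ ξ| ≤ L * (C * mixSize a e) * |τ * σ|) := by
      intro ξ hξ
      rw [← hSI] at hξ
      obtain ⟨⟨P, hP, Q, hQ, h1⟩, ⟨P', hP', Q', hQ', h2⟩⟩ :=
        exists_quad_phase_derivs hα hα1 hp hq hξ
      constructor
      · have : D₁ ξ = s * L * (-(τ * σ) *
            critPhase₃ α (dirXi κ b e) (dirEta κ a e) (dirDiff κ a b e) P Q) := by
          rw [← h1]; rfl
        rw [this, habs, mul_right_comm L]
        gcongr
        exact (hbd e he P hP Q hQ).1
      · have : D₂ ξ = s * L * (-(τ * σ) * critPhase₄ α (dirXi κ b e) (dirEta κ a e)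
            (dirDiff κ a b e) (dirXi κ b e) P' Q') := by
          rw [← h2]; rfl
        rw [this, habs, mul_right_comm L]
        gcongr
        exact (hbd e he P' hP' Q' hQ').2
    have ha0b : ∀ ξ ∈ Icc c₀ d₀, ‖a₀ ξ‖ ≤ C₁ ^ 4 / L ^ 2 := by
      intro ξ _
      have : ‖a₀ ξ‖ = ‖Inn ξ‖ := by rw [hIn, norm_mul (exp _), norm_expI, one_mul]
      rw [this]; exact hInb ξ
    have ha1b : ∀ ξ ∈ Icc c₀ d₀, ‖a₁ ξ‖ ≤ 4 * (1 + |b|) * C₁ ^ 4 / L ^ 2 := by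
      intro ξ hξ
      have e1 : a₁ ξ = A' z1 ξ * conj (A z2 ξ) * conj (A z3 ξ) * A z4 ξ
        + A z1 ξ * conj (A' z2 ξ) * conj (A z3 ξ) * A z4 ξ
        + A z1 ξ * conj (A z2 ξ) * conj (A' z3 ξ) * A z4 ξ
        + A z1 ξ * conj (A z2 ξ) * conj (A z3 ξ) * A' z4 ξ := by simp only [ha₁]; ring
      rw [e1, mul_div_assoc, ← hsq]
      refine (norm_add₄_le ..).trans ?_
      simp only [norm_mul_four]
      set r := C₁ / √L
      set r' := (1 + |b|) * r with hr'
      calc _ ≤ r' * r * r * r + r * r' * r * r + r * r * r' * r + r * r * r * r' := by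
            gcongr <;> first | exact hA'b _ ‹_› _ hξ | exact hAb _ _
        _ = _ := by rw [hr']; ring
    have hμ : 0 < L * (c * mixSize a e) * |τ * σ| := by positivity
    have key := norm_integral_exp_le_of_first_deriv hcd hμ hD1 hD2 ha1
      (fun ξ hξ => (hder ξ hξ).1) (fun ξ hξ => (hder ξ hξ).2) ha0b ha1b
    simp only [← hIn] at key
    rw [← hint] at key
    have hr : C₁ ^ 4 / L ^ 2 * (L * (C * mixSize a e) * |τ * σ|) / (L * (c * mixSize a e) * |τ * σ|)
        = (C₁ ^ 4 * C / c) / L ^ 2 := by field_simp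
    rw [hr] at key
    have key2 : (2 * (C₁ ^ 4 / L ^ 2) + (d₀ - c₀) *
        (4 * (1 + |b|) * C₁ ^ 4 / L ^ 2 + C₁ ^ 4 * C / c / L ^ 2)) ≤
        (2 * C₁ ^ 4 + ℓ * (4 * (1 + |b|) * C₁ ^ 4 + C₁ ^ 4 * C / c)) / L ^ 2 := by
      rw [← add_div, ← mul_div_assoc, ← mul_div_assoc, ← add_div]
      gcongr
    calc L * mixSize a e * |τ * σ| * ‖quadCorr K τ η σ‖
        ≤ L * mixSize a e * |τ * σ| * ((2 * C₁ ^ 4 + ℓ * (4 * (1 + |b|) * C₁ ^ 4 + C₁ ^ 4 * C / c))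
          / L ^ 2 / (L * (c * mixSize a e) * |τ * σ|)) := by
          gcongr
          refine key.trans ?_
          gcongr
      _ = (2 * C₁ ^ 4 + ℓ * (4 * (1 + |b|) * C₁ ^ 4 + C₁ ^ 4 * C / c)) / c / L ^ 2 := by field_simp
      _ ≤ C' / L ^ 2 := by gcongr; rw [hC']; linarith
  · intro hσ
    exfalso
    have hc₀ : c₀ ∈ S := by rw [hSI]; exact ⟨le_rfl, hcd⟩
    have k1 := hc₀ (0, η) (by simp [quadPts])
    have k2 := hc₀ (0, η + σ) (by simp [quadPts])
    simp only [formP, formQ, sub_zero] at k1 k2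
    by_cases ha : a = 0
    · rw [mixSize, if_pos ha] at hσ
      have : |e * σ| ≤ q₂ - q₁ := by
        have : e * σ = e * (η + σ - b * c₀) - e * (η - b * c₀) := by ring
        rw [this, abs_le]; constructor <;> linarith [k1.2.1, k1.2.2, k2.2.1, k2.2.2]
      rw [abs_mul] at this
      rw [hC'] at hσ; linarith
    · rw [mixSize, if_neg ha] at hσ
      have ha' : 0 < |a| := abs_pos.2 ha
      have : |κ * (a * σ)| ≤ ℓ := by
        have : κ * (a * σ) = κ * (c₀ - a * η) - κ * (c₀ - a * (η + σ)) := by ring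
        rw [this, abs_le]; constructor <;> linarith [k1.1.1, k1.1.2, k2.1.1, k2.1.2]
      rw [abs_mul, hκ, one_mul, abs_mul, ← le_div_iff₀' ha'] at this
      rw [hC'] at hσ; linarith

/-! ### Squaring bilinear operators -/

/-- Continuous kernels of compact support. -/
structure IsCcKernel (K : ℝ → ℝ → ℂ) : Prop where
  cont : Continuous fun p : ℝ × ℝ => K p.1 p.2
  bdd : ∃ R : ℝ, 0 ≤ R ∧ ∀ x y, R < |x| ∨ R < |y| → K x y = 0

theorem integrable_of_zero_off_closedBall {X : Type*} [NormedAddCommGroup X] [ProperSpace X]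
    [MeasurableSpace X] [BorelSpace X] {μ : Measure X} [IsFiniteMeasureOnCompacts μ]
    {f : X → ℂ} (hf : Continuous f) {R : ℝ} (h : ∀ x, R < ‖x‖ → f x = 0) : Integrable f μ := by
  refine hf.integrable_of_hasCompactSupport
    (HasCompactSupport.of_support_subset_isCompact (isCompact_closedBall (0 : X) R) ?_)
  intro x hx
  by_contra hc
  exact hx (h x (by simpa using hc))

theorem lintegral_mul_sq_le {X : Type*} [MeasurableSpace X] {μ : Measure X} {f g : X → ℝ≥0∞}
    (hf : AEMeasurable f μ) (hg : AEMeasurable g μ) :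
    (∫⁻ x, f x * g x ∂μ) ^ 2 ≤ (∫⁻ x, f x ^ 2 ∂μ) * ∫⁻ x, g x ^ 2 ∂μ := by
  have h := ENNReal.lintegral_mul_le_Lp_mul_Lq μ Real.HolderConjugate.two_two hf hg
  simp only [Pi.mul_apply, rpow_two] at h
  calc (∫⁻ x, f x * g x ∂μ) ^ 2 ≤ _ := pow_le_pow_left₀ zero_le h 2
    _ = _ := by
      rw [mul_pow, ← rpow_two, ← rpow_two, ← rpow_mul, ← rpow_mul]
      norm_num

theorem ENNReal_le_of_sq_le {a b : ℝ≥0∞} (h : a ^ 2 ≤ b ^ 2) : a ≤ b :=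
  (ENNReal.pow_le_pow_left_iff two_ne_zero).1 h

theorem sq_rpow_half (x : ℝ≥0∞) : (x ^ (1 / 2 : ℝ)) ^ 2 = x := by
  rw [← rpow_two, ← rpow_mul]; norm_num

namespace IsCcKernel

variable {k : ℝ → ℝ → ℂ}

theorem exists_bound (hk : IsCcKernel k) : ∃ M : ℝ, ∀ x y, ‖k x y‖ ≤ M := by
  obtain ⟨R, _, hR⟩ := hk.bdd
  have hc : HasCompactSupport fun p : ℝ × ℝ => k p.1 p.2 := by
    refine HasCompactSupport.of_support_subset_isCompact (isCompact_closedBall (0 : ℝ × ℝ) R) ?_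
    intro x hx
    by_contra hc
    refine hx (hR _ _ ?_)
    simpa [Prod.norm_def, -not_or, or_iff_not_imp_left] using hc
  obtain ⟨M, hM⟩ := hc.exists_bound_of_continuous hk.cont
  exact ⟨M, fun x y => hM (x, y)⟩

theorem swap (hk : IsCcKernel k) : IsCcKernel fun x y => k y x := by
  obtain ⟨R, hR0, hR⟩ := hk.bdd
  exact ⟨hk.cont.comp continuous_swap, R, hR0, fun x y h => hR _ _ h.symm⟩

theorem mul_left (hk : IsCcKernel k) {f : ℝ → ℝ → ℂ} (hf : Continuous fun p : ℝ × ℝ => f p.1 p.2) :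
    IsCcKernel fun x y => f x y * k x y := by
  obtain ⟨R, hR0, hR⟩ := hk.bdd
  exact ⟨hf.mul hk.cont, R, hR0, fun x y h => by rw [hR x y h, mul_zero]⟩

theorem shear (hk : IsCcKernel k) : IsCcKernel fun s η => k (s - η) η := by
  obtain ⟨R, hR0, hR⟩ := hk.bdd
  refine ⟨hk.cont.comp (f := fun p : ℝ × ℝ => (p.1 - p.2, p.2)) (by fun_prop), 2 * R,
    by positivity, fun x y h => hR _ _ ?_⟩
  by_contra hc
  push Not at hc
  have := abs_add_le (x - y) y
  rw [sub_add_cancel] at this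
  rcases h with h | h <;> linarith [hc.1, hc.2]

theorem integrable (hk : IsCcKernel k) : Integrable fun p : ℝ × ℝ => k p.1 p.2 := by
  obtain ⟨R, _, hR⟩ := hk.bdd
  refine integrable_of_zero_off_closedBall (R := R) hk.cont fun p hp => hR _ _ ?_
  simpa [Prod.norm_def] using hp

theorem integrable_right (hk : IsCcKernel k) (x : ℝ) : Integrable (k x) := by
  obtain ⟨R, _, hR⟩ := hk.bdd
  exact integrable_of_zero_off_closedBall (R := R)
    (hk.cont.comp (f := fun y : ℝ => (x, y)) (by fun_prop)) fun y hy => hR _ _ (Or.inr hy)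

theorem integral_swap (hk : IsCcKernel k) : ∫ x, ∫ y, k x y = ∫ y, ∫ x, k x y :=
  integral_integral_swap hk.integrable

theorem continuous_integral (hk : IsCcKernel k) : Continuous fun x => ∫ y, k x y := by
  obtain ⟨R, _, hR⟩ := hk.bdd
  exact (continuous_parametric_integral_of_continuous (μ := volume) (f := k) hk.cont
    (isCompact_Icc (a := -R) (b := R))).congr fun x =>
      setIntegral_eq_integral_of_forall_compl_eq_zero fun y hy => hR _ _ (Or.inr (by
        by_contra hc; exact hy (abs_le.1 (not_lt.1 hc))))

theorem hasCompactSupport_integral (hk : IsCcKernel k) :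
    HasCompactSupport fun x => ∫ y, k x y := by
  obtain ⟨R, _, hR⟩ := hk.bdd
  refine HasCompactSupport.of_support_subset_isCompact (isCompact_Icc (a := -R) (b := R)) ?_
  intro x hx
  by_contra hc
  refine hx ?_
  have : ∀ y, k x y = 0 := fun y => hR _ _ (Or.inl (by
      by_contra hc'; exact hc (abs_le.1 (not_lt.1 hc'))))
  simp [this]

theorem integrable_integral (hk : IsCcKernel k) : Integrable fun x => ∫ y, k x y :=
  hk.continuous_integral.integrable_of_hasCompactSupport hk.hasCompactSupport_integral

/-- The square of a marginal as an integral of correlations. -/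
theorem integral_sq_norm_integral (hk : IsCcKernel k) :
    ((∫ x, ‖∫ y, k x y‖ ^ 2 : ℝ) : ℂ) = ∫ τ, ∫ y, ∫ x, k x y * conj (k x (y + τ)) := by
  obtain ⟨R, hR0, hR⟩ := hk.bdd
  set g : ℝ × ℝ × ℝ → ℂ := fun p => k p.1 p.2.1 * conj (k p.1 (p.2.1 + p.2.2)) with hg
  have c1 : Continuous fun p : ℝ × ℝ × ℝ => k p.1 p.2.1 :=
    hk.cont.comp (f := fun p : ℝ × ℝ × ℝ => (p.1, p.2.1)) (by fun_prop)
  have c2 : Continuous fun p : ℝ × ℝ × ℝ => k p.1 (p.2.1 + p.2.2) :=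
    hk.cont.comp (f := fun p : ℝ × ℝ × ℝ => (p.1, p.2.1 + p.2.2)) (by fun_prop)
  have gc : Continuous g := c1.mul (continuous_conj.comp c2)
  have gz : ∀ p : ℝ × ℝ × ℝ, 2 * R < ‖p‖ → g p = 0 := by
    rintro ⟨x, y, τ⟩ hp
    by_contra hne
    have h1 : k x y ≠ 0 := fun h => hne (by simp [hg, h])
    have h2 : k x (y + τ) ≠ 0 := fun h => hne (by simp [hg, h])
    have a1 : |x| ≤ R := by by_contra h; exact h1 (hR _ _ (Or.inl (not_le.1 h)))
    have a2 : |y| ≤ R := by by_contra h; exact h1 (hR _ _ (Or.inr (not_le.1 h)))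
    have a3 : |y + τ| ≤ R := by by_contra h; exact h2 (hR _ _ (Or.inr (not_le.1 h)))
    have a4 : |τ| ≤ 2 * R := by
      have := abs_sub (y + τ) y; rw [add_sub_cancel_left] at this; linarith
    simp only [Prod.norm_def, norm_eq_abs, lt_sup_iff] at hp
    rcases hp with h | h | h <;> linarith
  have gi : Integrable g := integrable_of_zero_off_closedBall gc gz
  have gs : ∀ x, Integrable fun q : ℝ × ℝ => g (x, q) := fun x =>
    integrable_of_zero_off_closedBall (R := 2 * R)
      (gc.comp (f := fun q : ℝ × ℝ => (x, q)) (by fun_prop)) fun q hq => gz _ (by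
        rw [Prod.norm_def]; exact lt_sup_of_lt_right hq)
  have e1 : ∀ x, ((‖∫ y, k x y‖ ^ 2 : ℝ) : ℂ) = ∫ y, ∫ τ, g (x, y, τ) := by
    intro x
    rw [Complex.ofReal_pow, ← Complex.mul_conj', ← integral_conj, ← integral_mul_const]
    congr 1; ext y
    simp only [hg]
    rw [integral_const_mul, integral_add_left_eq_self (fun z => conj (k x z)) y]
  calc ((∫ x, ‖∫ y, k x y‖ ^ 2 : ℝ) : ℂ) = ∫ x, ∫ y, ∫ τ, g (x, y, τ) := by
        rw [← integral_complex_ofReal]; simp only [e1]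
    _ = ∫ x, ∫ q : ℝ × ℝ, g (x, q) := by congr 1; ext x; exact (integral_prod _ (gs x)).symm
    _ = ∫ q : ℝ × ℝ, ∫ x, g (x, q) := integral_integral_swap gi
    _ = ∫ τ, ∫ y, ∫ x, g (x, y, τ) := integral_prod_symm _ gi.integral_prod_right

theorem ofReal_integral_sq_le (hk : IsCcKernel k) :
    ∫⁻ x, ‖∫ y, k x y‖ₑ ^ 2 ≤ ∫⁻ τ, ‖∫ y, ∫ x, k x y * conj (k x (y + τ))‖ₑ := by
  have h := hk.integral_sq_norm_integral
  have hi : Integrable fun x => ‖∫ y, k x y‖ ^ 2 := by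
    refine Continuous.integrable_of_hasCompactSupport (hk.continuous_integral.norm.pow 2) ?_
    have := hk.hasCompactSupport_integral.norm
    exact this.comp_left (g := fun t : ℝ => t ^ 2) (by simp)
  have e : ∫⁻ x, ‖∫ y, k x y‖ₑ ^ 2 = ofReal (∫ x, ‖∫ y, k x y‖ ^ 2) := by
    rw [ofReal_integral_eq_lintegral_ofReal hi (ae_of_all _ fun x => by positivity)]
    congr 1; ext x
    rw [ofReal_pow (norm_nonneg _), ofReal_norm]
  have h0 : 0 ≤ ∫ x, ‖∫ y, k x y‖ ^ 2 := integral_nonneg fun x => by positivity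
  rw [e]
  calc ofReal (∫ x, ‖∫ y, k x y‖ ^ 2)
      = ‖((∫ x, ‖∫ y, k x y‖ ^ 2 : ℝ) : ℂ)‖ₑ := by rw [← ofReal_norm, norm_real, norm_of_nonneg h0]
    _ ≤ _ := by rw [h]; exact enorm_integral_le_lintegral_enorm _

end IsCcKernel

theorem lintegral_translate_mul_le {g : ℝ → ℂ} (hg : Continuous g) (σ : ℝ) :
    ∫⁻ η, ‖g η‖ₑ * ‖g (η + σ)‖ₑ ≤ ∫⁻ η, ‖g η‖ₑ ^ 2 := by
  refine ENNReal_le_of_sq_le ((lintegral_mul_sq_le (by fun_prop) (by fun_prop)).trans ?_)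
  rw [lintegral_add_right_eq_self (fun η => ‖g η‖ₑ ^ 2) σ, sq]

theorem lintegral_lintegral_translate_sq {F : ℝ → ℂ} (hF : Continuous F) :
    ∫⁻ τ, ∫⁻ ξ, ‖F ξ * conj (F (ξ + τ))‖ₑ ^ 2 = (∫⁻ ξ, ‖F ξ‖ₑ ^ 2) ^ 2 := by
  have hc : Continuous fun p : ℝ × ℝ => F p.2 * conj (F (p.2 + p.1)) := by fun_prop
  rw [lintegral_lintegral_swap (hc.enorm.measurable.pow_const 2).aemeasurable]
  have : ∀ ξ, ∫⁻ τ, ‖F ξ * conj (F (ξ + τ))‖ₑ ^ 2 = ‖F ξ‖ₑ ^ 2 * ∫⁻ τ, ‖F τ‖ₑ ^ 2 := by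
    intro ξ
    simp only [enorm_mul, mul_pow, RCLike.enorm_conj]
    rw [lintegral_const_mul' _ _ (by simp), lintegral_add_left_eq_self (fun τ => ‖F τ‖ₑ ^ 2)]
  simp only [this]
  rw [lintegral_mul_const _ (by fun_prop), sq]

/-- The bilinear operator on the frequency side. -/
def freqOp (K : ℝ → ℝ → ℂ) (F G : ℝ → ℂ) (s : ℝ) : ℂ :=
  ∫ η, F (s - η) * G η * K (s - η) η

/-- `TT*` twice: decay of the four-fold correlations bounds the bilinear operator in `L²`. -/
theorem lintegral_freqOp_sq_le {K : ℝ → ℝ → ℂ} (hK : IsCcKernel K) {F G : ℝ → ℂ}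
    (hF : Continuous F) (hG : Continuous G) {k₀ B : ℝ≥0∞} {θ : ℝ}
    (hk : ∀ x y, ‖K x y‖ₑ ≤ k₀) {q : ℝ → ℝ → ℝ≥0∞} (hqm : ∀ τ, Measurable (q τ))
    (hq : ∀ τ σ η, θ < |τ| → σ ≠ 0 → ‖quadCorr K τ η σ‖ₑ ≤ q τ σ)
    (hB : ∀ τ, θ < |τ| → ∫⁻ σ, q τ σ ≤ B ^ 2) :
    ∫⁻ s, ‖freqOp K F G s‖ₑ ^ 2 ≤
      (k₀ ^ 2 * ofReal (2 * θ) + B) * ((∫⁻ ξ, ‖F ξ‖ₑ ^ 2) * ∫⁻ η, ‖G η‖ₑ ^ 2) := by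
  set A := ∫⁻ ξ, ‖F ξ‖ₑ ^ 2 with hA
  set A' := ∫⁻ η, ‖G η‖ₑ ^ 2
  -- the first square
  have hk1 : IsCcKernel fun s η => F (s - η) * G η * K (s - η) η :=
    hK.shear.mul_left (f := fun s η => F (s - η) * G η) (by fun_prop)
  refine hk1.ofReal_integral_sq_le.trans ?_
  set W : ℝ → ℂ := fun τ => ∫ η, ∫ ξ, (F ξ * conj (F (ξ - τ))) * (G η * conj (G (η + τ))) *
    (K ξ η * conj (K (ξ - τ) (η + τ))) with hW
  have e1 : ∀ τ, (∫ η, ∫ s, F (s - η) * G η * K (s - η) η *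
      conj (F (s - (η + τ)) * G (η + τ) * K (s - (η + τ)) (η + τ))) = W τ := by
    intro τ
    simp only [hW]
    congr 1; ext η
    rw [← integral_sub_right_eq_self (fun ξ => (F ξ * conj (F (ξ - τ))) * (G η * conj (G (η + τ))) *
      (K ξ η * conj (K (ξ - τ) (η + τ)))) η]
    congr 1; ext s
    rw [sub_sub]; simp only [map_mul]; ring
  simp only [e1]
  -- small `τ`
  have small : ∀ τ, ‖W τ‖ₑ ≤ k₀ ^ 2 * (A * A') := by
    intro τ
    refine (enorm_integral_le_lintegral_enorm _).trans ?_
    have i1 : ∀ η, ‖∫ ξ, (F ξ * conj (F (ξ - τ))) * (G η * conj (G (η + τ))) *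
        (K ξ η * conj (K (ξ - τ) (η + τ)))‖ₑ ≤ (k₀ ^ 2 * A) * (‖G η‖ₑ * ‖G (η + τ)‖ₑ) := by
      intro η
      refine (enorm_integral_le_lintegral_enorm _).trans ?_
      calc ∫⁻ ξ, ‖(F ξ * conj (F (ξ - τ))) * (G η * conj (G (η + τ))) *
            (K ξ η * conj (K (ξ - τ) (η + τ)))‖ₑ
          ≤ ∫⁻ ξ, (k₀ ^ 2 * (‖G η‖ₑ * ‖G (η + τ)‖ₑ)) * (‖F ξ‖ₑ * ‖F (ξ + -τ)‖ₑ) := by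
            refine lintegral_mono fun ξ => ?_
            simp only [enorm_mul, RCLike.enorm_conj, ← sub_eq_add_neg]
            calc _ ≤ ‖F ξ‖ₑ * ‖F (ξ - τ)‖ₑ * (‖G η‖ₑ * ‖G (η + τ)‖ₑ) * (k₀ * k₀) := by
                  gcongr <;> exact hk _ _
              _ = _ := by ring
        _ = (k₀ ^ 2 * (‖G η‖ₑ * ‖G (η + τ)‖ₑ)) * ∫⁻ ξ, (‖F ξ‖ₑ * ‖F (ξ + -τ)‖ₑ) :=
            lintegral_const_mul _ (by fun_prop)
        _ ≤ (k₀ ^ 2 * (‖G η‖ₑ * ‖G (η + τ)‖ₑ)) * A := by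
            gcongr; exact lintegral_translate_mul_le hF _
        _ = _ := by ring
    refine (lintegral_mono i1).trans ?_
    rw [lintegral_const_mul _ (by fun_prop), mul_assoc]
    gcongr
    exact lintegral_translate_mul_le hG _
  -- large `τ`: the second square
  set nF : ℝ → ℝ≥0∞ := fun τ => ∫⁻ ξ, ‖F ξ * conj (F (ξ - τ))‖ₑ ^ 2 with hnF
  set nG : ℝ → ℝ≥0∞ := fun τ => ∫⁻ η, ‖G η * conj (G (η + τ))‖ₑ ^ 2
  have large : ∀ τ, θ < |τ| → ‖W τ‖ₑ ^ 2 ≤ nF τ * (nG τ * B ^ 2) := by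
    intro τ hτ
    set g : ℝ → ℂ := fun η => G η * conj (G (η + τ)) with hg
    have hgc : Continuous g := by fun_prop
    set Kτ : ℝ → ℝ → ℂ := fun ξ η => K ξ η * conj (K (ξ - τ) (η + τ)) with hKτ
    have hKc : IsCcKernel Kτ := by
      have := hK.mul_left (f := fun ξ η => conj (K (ξ - τ) (η + τ))) (continuous_conj.comp
          (hK.cont.comp (f := fun p : ℝ × ℝ => (p.1 - τ, p.2 + τ)) (by fun_prop)))
      simpa only [hKτ, mul_comm] using this
    have hgK : IsCcKernel fun ξ η => g η * Kτ ξ η :=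
      hKc.mul_left (f := fun ξ η => g η) (by fun_prop)
    have hFgK : IsCcKernel fun ξ η => (F ξ * conj (F (ξ - τ))) * (g η * Kτ ξ η) :=
      hgK.mul_left (f := fun ξ η => F ξ * conj (F (ξ - τ))) (by fun_prop)
    have e2 : W τ = ∫ ξ, (F ξ * conj (F (ξ - τ))) * ∫ η, g η * Kτ ξ η := by
      have := hFgK.integral_swap
      simp only [integral_const_mul] at this
      rw [this]
      simp only [hW, hg, hKτ, mul_assoc]
    have hmeas : Measurable fun ξ => ‖∫ η, g η * Kτ ξ η‖ₑ :=
      (hgK.continuous_integral).enorm.measurable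
    have i2 : ‖W τ‖ₑ ^ 2 ≤ nF τ * ∫⁻ ξ, ‖∫ η, g η * Kτ ξ η‖ₑ ^ 2 := by
      have : ‖W τ‖ₑ ≤ ∫⁻ ξ, ‖F ξ * conj (F (ξ - τ))‖ₑ * ‖∫ η, g η * Kτ ξ η‖ₑ := by
        rw [e2]; refine (enorm_integral_le_lintegral_enorm _).trans_eq ?_
        simp only [enorm_mul]
      exact (pow_le_pow_left₀ zero_le this 2).trans
        (lintegral_mul_sq_le (by fun_prop) hmeas.aemeasurable)
    refine i2.trans ?_
    gcongr
    refine hgK.ofReal_integral_sq_le.trans ?_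
    have i3 : ∀ᵐ σ, ‖∫ η, ∫ ξ, g η * Kτ ξ η * conj (g (η + σ) * Kτ ξ (η + σ))‖ₑ ≤ nG τ * q τ σ := by
      filter_upwards [Measure.ae_ne volume (0 : ℝ)] with σ hσ
      have : ∀ η, (∫ ξ, g η * Kτ ξ η * conj (g (η + σ) * Kτ ξ (η + σ))) =
          (g η * conj (g (η + σ))) * quadCorr K τ η σ := by
        intro η
        rw [quadCorr, ← integral_const_mul]
        congr 1; ext ξ
        simp only [hKτ, map_mul, conj_conj]; ring
      simp only [this]
      refine (enorm_integral_le_lintegral_enorm _).trans ?_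
      calc ∫⁻ η, ‖g η * conj (g (η + σ)) * quadCorr K τ η σ‖ₑ
          ≤ ∫⁻ η, (‖g η‖ₑ * ‖g (η + σ)‖ₑ) * q τ σ := by
            refine lintegral_mono fun η => ?_
            simp only [enorm_mul, RCLike.enorm_conj]
            gcongr; exact hq τ σ η hτ hσ
        _ = (∫⁻ η, ‖g η‖ₑ * ‖g (η + σ)‖ₑ) * q τ σ := lintegral_mul_const _ (by fun_prop)
        _ ≤ _ := by gcongr; exact lintegral_translate_mul_le hgc σ
    calc _ ≤ ∫⁻ σ, nG τ * q τ σ := lintegral_mono_ae i3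
      _ ≤ nG τ * B ^ 2 := by rw [lintegral_const_mul _ (hqm τ)]; gcongr; exact hB τ hτ
  have hnFm : Measurable nF := by
    have : Measurable fun p : ℝ × ℝ => ‖F p.2 * conj (F (p.2 - p.1))‖ₑ ^ 2 := by
      have : Continuous fun p : ℝ × ℝ => F p.2 * conj (F (p.2 - p.1)) := by fun_prop
      exact this.enorm.measurable.pow_const 2
    exact this.lintegral_prod_right'
  have hnGm : Measurable nG := by
    have : Measurable fun p : ℝ × ℝ => ‖G p.2 * conj (G (p.2 + p.1))‖ₑ ^ 2 := by
      have : Continuous fun p : ℝ × ℝ => G p.2 * conj (G (p.2 + p.1)) := by fun_prop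
      exact this.enorm.measurable.pow_const 2
    exact this.lintegral_prod_right'
  have large' : ∀ τ, θ < |τ| → ‖W τ‖ₑ ≤ nF τ ^ (1 / 2 : ℝ) * nG τ ^ (1 / 2 : ℝ) * B := by
    intro τ hτ
    refine ENNReal_le_of_sq_le ((large τ hτ).trans_eq ?_)
    rw [mul_pow, mul_pow, sq_rpow_half, sq_rpow_half, mul_assoc]
  have hsum : ∀ τ, ‖W τ‖ₑ ≤ (Icc (-θ) θ).indicator (fun _ => k₀ ^ 2 * (A * A')) τ +
      nF τ ^ (1 / 2 : ℝ) * nG τ ^ (1 / 2 : ℝ) * B := by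
    intro τ
    by_cases h : τ ∈ Icc (-θ) θ
    · rw [indicator_of_mem h]; exact (small τ).trans le_self_add
    · rw [indicator_of_notMem h, zero_add]
      refine large' τ ?_
      by_contra hc
      exact h (abs_le.1 (not_lt.1 hc))
  have hFG : ∫⁻ τ, nF τ ^ (1 / 2 : ℝ) * nG τ ^ (1 / 2 : ℝ) ≤ A * A' := by
    refine ENNReal_le_of_sq_le ((lintegral_mul_sq_le (hnFm.pow_const _).aemeasurable
      (hnGm.pow_const _).aemeasurable).trans ?_)
    simp only [sq_rpow_half]
    have e3 : ∫⁻ τ, nF τ = A ^ 2 := by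
      rw [hA, ← lintegral_lintegral_translate_sq hF, ← lintegral_neg_eq_self]
      simp only [hnF, sub_neg_eq_add]
    rw [e3, show ∫⁻ τ, nG τ = A' ^ 2 from lintegral_lintegral_translate_sq hG, mul_pow]
  have hm : Measurable fun τ => nF τ ^ (1 / 2 : ℝ) * nG τ ^ (1 / 2 : ℝ) :=
    (hnFm.pow_const _).mul (hnGm.pow_const _)
  calc ∫⁻ τ, ‖W τ‖ₑ ≤ ∫⁻ τ, ((Icc (-θ) θ).indicator (fun _ => k₀ ^ 2 * (A * A')) τ +
      nF τ ^ (1 / 2 : ℝ) * nG τ ^ (1 / 2 : ℝ) * B) := lintegral_mono hsum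
    _ = k₀ ^ 2 * (A * A') * ofReal (2 * θ) +
        (∫⁻ τ, nF τ ^ (1 / 2 : ℝ) * nG τ ^ (1 / 2 : ℝ)) * B := by
        rw [lintegral_add_left (measurable_const.indicator measurableSet_Icc),
          lintegral_indicator_const measurableSet_Icc, Real.volume_Icc,
          lintegral_mul_const B hm, sub_neg_eq_add, ← two_mul]
    _ ≤ k₀ ^ 2 * (A * A') * ofReal (2 * θ) + A * A' * B := by gcongr
    _ = _ := by ring

/-! ### Plancherel's theorem -/

/-- On `L¹ ∩ L²` the `L²` Fourier transform is given by the integral. -/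
theorem coeFn_fourier_toLp_ae_eq {V : ℝ → ℂ} (h1 : Integrable V) (h2 : MemLp V 2) :
    (𝓕 (h2.toLp V) : L²) =ᵐ[volume] 𝓕 V := by
  have hcont : Continuous (𝓕 V) :=
    VectorFourier.fourierIntegral_continuous Real.continuous_fourierChar continuous_inner h1
  refine ae_eq_of_integral_contDiff_smul_eq
    ((Lp.memLp _).locallyIntegrable (by norm_num)) hcont.locallyIntegrable fun g hg hgc => ?_
  have hgc' : HasCompactSupport fun x => (g x : ℂ) := hgc.comp_left (g := fun t : ℝ => (t : ℂ)) rfl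
  set φ : SchwartzMap ℝ ℂ := hgc'.toSchwartzMap (ofRealCLM.contDiff.comp hg)
  have hφa : ∀ x, φ x = (g x : ℂ) := fun x => rfl
  have e := congrArg (fun T => T φ) (Lp.fourier_toTemperedDistribution_eq (h2.toLp V))
  simp only [TemperedDistribution.fourier_apply, Lp.toTemperedDistribution_apply] at e
  have e2 : ∫ x, (𝓕 φ) x • (h2.toLp V) x = ∫ x, (𝓕 φ) x • V x :=
    integral_congr_ae (by filter_upwards [h2.coeFn_toLp] with x hx; rw [hx])
  have e3 : ∫ ξ, 𝓕 V ξ • φ ξ = ∫ x, V x • (𝓕 φ) x := by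
    have := VectorFourier.integral_fourierIntegral_smul_eq_flip (L := innerₗ ℝ)
      (μ := volume) (ν := volume) Real.continuous_fourierChar continuous_inner h1
      (φ.integrable (μ := volume))
    simpa [SchwartzMap.fourier_coe] using! this
  have e4 : ∀ x, g x • 𝓕 V x = 𝓕 V x • φ x := by intro x; rw [hφa, real_smul, smul_eq_mul, mul_comm]
  simp only [e4]
  rw [e3]
  have e5 : ∀ x, g x • (𝓕 (h2.toLp V) : L²) x = φ x • (𝓕 (h2.toLp V) : L²) x := by
    intro x; rw [hφa, real_smul, smul_eq_mul]
  simp only [e5]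
  rw [← e, e2]
  simp only [smul_eq_mul, mul_comm]

theorem lintegral_enorm_sq_eq_of_toLp {f : ℝ → ℂ} (h : MemLp f 2) :
    ∫⁻ x, ‖f x‖ₑ ^ 2 = ‖h.toLp f‖ₑ ^ 2 := by
  rw [Lp.enorm_def, eLpNorm_congr_ae h.coeFn_toLp,
    eLpNorm_eq_lintegral_rpow_enorm_toReal (by norm_num) (by norm_num), ← rpow_two, ← rpow_mul]
  norm_num

theorem lintegral_enorm_sq_Lp (f : L²) :
    ∫⁻ x, ‖f x‖ₑ ^ 2 = ‖f‖ₑ ^ 2 := by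
  rw [Lp.enorm_def, eLpNorm_eq_lintegral_rpow_enorm_toReal (by norm_num) (by norm_num),
    ← rpow_two, ← rpow_mul]
  norm_num

theorem lintegral_fourier_sq {V : ℝ → ℂ} (h1 : Integrable V) (h2 : MemLp V 2) :
    ∫⁻ w, ‖𝓕 V w‖ₑ ^ 2 = ∫⁻ s, ‖V s‖ₑ ^ 2 := by
  have e : ∫⁻ w, ‖𝓕 V w‖ₑ ^ 2 = ∫⁻ w, ‖(𝓕 (h2.toLp V) : L²) w‖ₑ ^ 2 := by
    refine lintegral_congr_ae ?_
    filter_upwards [coeFn_fourier_toLp_ae_eq h1 h2] with x hx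
    rw [hx]
  rw [e, lintegral_enorm_sq_Lp, lintegral_enorm_sq_eq_of_toLp h2]
  congr 1
  rw [← ofReal_norm, ← ofReal_norm, Lp.norm_fourier_eq]

theorem lintegral_comp_mul_left {c : ℝ} (hc : c ≠ 0) (f : ℝ → ℝ≥0∞) :
    ∫⁻ x, f x = ofReal |c| * ∫⁻ x, f (c * x) := by
  have h := Real.smul_map_volume_mul_left hc
  have hm : MeasurableEmbedding fun x : ℝ => c * x := (Homeomorph.mulLeft₀ c hc).measurableEmbedding
  calc ∫⁻ x, f x = ∫⁻ x, f x ∂(ofReal |c| • Measure.map (c * ·) volume) := by rw [h]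
    _ = _ := by rw [lintegral_smul_measure, hm.lintegral_map]; rfl

/-- The bilinear operator with kernel `K` in the space variable. -/
def spaceOp (K : ℝ → ℝ → ℂ) (F G : ℝ → ℂ) (x : ℝ) : ℂ :=
  ∫ ξ, ∫ η, F ξ * G η * K ξ η * expI((ξ + η) * x)

section

variable {K : ℝ → ℝ → ℂ} {F G : ℝ → ℂ}

theorem IsCcKernel.spaceOp_kernel (hK : IsCcKernel K) (hF : Continuous F)
    (hG : Continuous G) (x : ℝ) : IsCcKernel fun ξ η =>
    F ξ * G η * K ξ η * expI((ξ + η) * x) := by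
  have := hK.mul_left (f := fun ξ η => F ξ * G η * expI((ξ + η) * x)) (by fun_prop)
  convert this using 3
  ring

theorem IsCcKernel.freqOp_kernel (hK : IsCcKernel K) (hF : Continuous F)
    (hG : Continuous G) : IsCcKernel fun s η => F (s - η) * G η * K (s - η) η :=
  hK.shear.mul_left (f := fun s η => F (s - η) * G η) (by fun_prop)

theorem IsCcKernel.continuous_freqOp (hK : IsCcKernel K) (hF : Continuous F)
    (hG : Continuous G) : Continuous (freqOp K F G) :=
  (hK.freqOp_kernel hF hG).continuous_integral

theorem IsCcKernel.hasCompactSupport_freqOp (hK : IsCcKernel K) (hF : Continuous F)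
    (hG : Continuous G) : HasCompactSupport (freqOp K F G) :=
  (hK.freqOp_kernel hF hG).hasCompactSupport_integral

theorem IsCcKernel.spaceOp_eq_integral_freqOp (hK : IsCcKernel K) (hF : Continuous F)
    (hG : Continuous G) (x : ℝ) :
    spaceOp K F G x = ∫ s, freqOp K F G s * expI(s * x) := by
  have h1 := hK.spaceOp_kernel hF hG x
  rw [spaceOp, h1.integral_swap]
  have e : ∀ η, (∫ ξ, F ξ * G η * K ξ η * expI((ξ + η) * x)) =
      ∫ s, F (s - η) * G η * K (s - η) η * expI(s * x) := by
    intro η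
    rw [← integral_sub_right_eq_self (fun ξ => F ξ * G η * K ξ η * expI((ξ + η) * x)) η]
    simp only [sub_add_cancel]
  simp only [e]
  have h2 := h1.shear
  simp only [sub_add_cancel] at h2
  rw [← h2.integral_swap]
  simp only [integral_mul_const, freqOp]

theorem IsCcKernel.spaceOp_eq_fourier (hK : IsCcKernel K) (hF : Continuous F)
    (hG : Continuous G) (x : ℝ) :
    spaceOp K F G x = 𝓕 (freqOp K F G) (-(1 / (2 * pi)) * x) := by
  rw [hK.spaceOp_eq_integral_freqOp hF hG, Real.fourier_real_eq_integral_exp_smul]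
  congr 1; ext s
  rw [smul_eq_mul, mul_comm]
  congr 2
  have : pi ≠ 0 := pi_ne_zero
  rw [mul_comm I]
  congr 2
  field_simp

theorem IsCcKernel.continuous_spaceOp (hK : IsCcKernel K) (hF : Continuous F)
    (hG : Continuous G) : Continuous (spaceOp K F G) := by
  have h1 : Integrable (freqOp K F G) :=
    (hK.continuous_freqOp hF hG).integrable_of_hasCompactSupport
    (hK.hasCompactSupport_freqOp hF hG)
  have hcont : Continuous (𝓕 (freqOp K F G)) :=
    VectorFourier.fourierIntegral_continuous Real.continuous_fourierChar continuous_inner h1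
  rw [funext (hK.spaceOp_eq_fourier hF hG)]
  fun_prop

theorem IsCcKernel.lintegral_spaceOp_sq (hK : IsCcKernel K) (hF : Continuous F)
    (hG : Continuous G) :
    ∫⁻ x, ‖spaceOp K F G x‖ₑ ^ 2 = ofReal (2 * pi) * ∫⁻ s, ‖freqOp K F G s‖ₑ ^ 2 := by
  have hc := hK.continuous_freqOp hF hG
  have hs := hK.hasCompactSupport_freqOp hF hG
  rw [← lintegral_fourier_sq (hc.integrable_of_hasCompactSupport hs)
    (hc.memLp_of_hasCompactSupport hs)]
  have hne : -(1 / (2 * pi)) ≠ 0 := by have := pi_ne_zero; simp [this]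
  rw [lintegral_comp_mul_left hne (fun w => ‖𝓕 (freqOp K F G) w‖ₑ ^ 2), ← mul_assoc,
    ← ofReal_mul (by positivity), abs_neg, abs_of_pos (by positivity),
    mul_one_div_cancel (by positivity), ofReal_one, one_mul]
  simp only [hK.spaceOp_eq_fourier hF hG]

end

/-! ### The class of kernels -/

/-- The families of kernels in `(P, Q)`, depending on the large parameter `L` and the small
parameter `e`, that are spanned by the oscillatory integrals over bounded coefficients. The class is
closed under the derivatives that integrations by parts produce. -/
inductive OscFam (α s ι p₁ p₂ q₁ q₂ : ℝ) : (ℝ → ℝ → ℝ → ℝ → ℂ) → Prop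
  | base {ρ χ₁ χ₂ : ℝ → ℂ} : IsPosBump ρ → IsBoxBump p₁ p₂ χ₁ → IsBoxBump q₁ q₂ χ₂ →
      OscFam α s ι p₁ p₂ q₁ q₂ fun L _ => oscMul α s ι ρ χ₁ χ₂ L
  | add {M N : ℝ → ℝ → ℝ → ℝ → ℂ} : OscFam α s ι p₁ p₂ q₁ q₂ M → OscFam α s ι p₁ p₂ q₁ q₂ N →
      OscFam α s ι p₁ p₂ q₁ q₂ fun L e P Q => M L e P Q + N L e P Q
  | smul {M : ℝ → ℝ → ℝ → ℝ → ℂ} (c : ℝ → ℝ → ℂ) (B : ℝ)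
      (hc : ∀ L e, 1 ≤ L → |e| ≤ 1 → ‖c L e‖ ≤ B) : OscFam α s ι p₁ p₂ q₁ q₂ M →
      OscFam α s ι p₁ p₂ q₁ q₂ fun L e P Q => c L e * M L e P Q

theorem continuous_oscInt {α : ℝ} (hα : 0 < α) {ρ : ℝ → ℂ} (hρ : IsPosBump ρ) (s ι L : ℝ) :
    Continuous fun p : ℝ × ℝ => oscInt α s ι ρ L p.1 p.2 := by
  have hr : Continuous fun t : ℝ => t ^ α := continuous_rpow_const hα.le
  have hρc := hρ.contDiff.continuous
  have h := continuous_parametric_integral_of_continuous (μ := volume)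
    (f := fun (p : ℝ × ℝ) t => expI(s * L * oscPhase α ι p.1 p.2 t) * ρ t)
    (by unfold Function.uncurry oscPhase; fun_prop) hρ.compact
  refine h.congr fun p => ?_
  exact setIntegral_eq_integral_of_forall_compl_eq_zero fun t ht => by
    rw [image_eq_zero_of_notMem_tsupport ht, mul_zero]

theorem contDiffOn_rpow_ofReal (α : ℝ) :
    SmoothOn (fun t : ℝ => ((t ^ α : ℝ) : ℂ)) (Ioi 0) :=
  ofRealCLM.contDiff.comp_contDiffOn
    fun _ ht => (Real.contDiffAt_rpow_const_of_ne (ne_of_gt ht)).contDiffWithinAt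

/-- The derivative of the cut off oscillatory integral along a line. -/
theorem hasDerivAt_oscMul_line {α : ℝ} (hα : 0 < α) {p₁ p₂ q₁ q₂ : ℝ} {ρ χ₁ χ₂ : ℝ → ℂ}
    (hρ : IsPosBump ρ) (hχ₁ : IsBoxBump p₁ p₂ χ₁) (hχ₂ : IsBoxBump q₁ q₂ χ₂)
    (s ι L P₀ Q₀ : ℝ) (v : ℝ × ℝ) (u : ℝ) :
    HasDerivAt (fun u => oscMul α s ι ρ χ₁ χ₂ L (P₀ + v.1 * u) (Q₀ + v.2 * u))
      ((-I * s * L * v.1) * oscMul α s ι (fun t => ((t : ℝ) : ℂ) * ρ t) χ₁ χ₂ L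
          (P₀ + v.1 * u) (Q₀ + v.2 * u)
        + (I * s * L * ι * v.2) * oscMul α s ι (fun t => ((t ^ α : ℝ) : ℂ) * ρ t) χ₁ χ₂ L
          (P₀ + v.1 * u) (Q₀ + v.2 * u)
        + v.1 * oscMul α s ι ρ (deriv χ₁) χ₂ L (P₀ + v.1 * u) (Q₀ + v.2 * u)
        + v.2 * oscMul α s ι ρ χ₁ (deriv χ₂) L (P₀ + v.1 * u) (Q₀ + v.2 * u)) u := by
  have hr : Continuous fun t : ℝ => t ^ α := continuous_rpow_const hα.le
  have hρc := hρ.contDiff.continuous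
  have h0 := hasDerivAt_oscInt_line hα hρc hρ.compact s ι L P₀ Q₀ v u
  have e : oscInt α s ι (fun t => I * ((s * L * (-v.1 * t + ι * v.2 * t ^ α) : ℝ) : ℂ) * ρ t)
      L (P₀ + v.1 * u) (Q₀ + v.2 * u) =
      (-I * s * L * v.1) * oscInt α s ι (fun t => ((t : ℝ) : ℂ) * ρ t) L
          (P₀ + v.1 * u) (Q₀ + v.2 * u)
        + (I * s * L * ι * v.2) * oscInt α s ι (fun t => ((t ^ α : ℝ) : ℂ) * ρ t) L
          (P₀ + v.1 * u) (Q₀ + v.2 * u) := by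
    unfold oscInt
    rw [← integral_const_mul, ← integral_const_mul, ← integral_add]
    · congr 1; ext t; push_cast; ring
    · exact (integrable_oscExp hα (by fun_prop) hρ.compact.mul_left s ι L _ _).const_mul _
    · exact (integrable_oscExp hα (by fun_prop) hρ.compact.mul_left s ι L _ _).const_mul _
  refine ((h0.mul (hχ₁.hasDerivAt_line P₀ v.1 u)).mul (hχ₂.hasDerivAt_line Q₀ v.2 u)).congr_deriv ?_
  rw [e]
  simp only [Pi.mul_apply, oscMul]
  ring

section

variable {α s ι p₁ p₂ q₁ q₂ : ℝ} {M : ℝ → ℝ → ℝ → ℝ → ℂ}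

theorem OscFam.continuous (hα : 0 < α) (hM : OscFam α s ι p₁ p₂ q₁ q₂ M) (L e : ℝ) :
    Continuous fun p : ℝ × ℝ => M L e p.1 p.2 := by
  induction hM with
  | base hρ h1 h2 =>
    unfold oscMul
    have := continuous_oscInt hα hρ s ι L
    have := h1.contDiff.continuous
    have := h2.contDiff.continuous
    fun_prop
  | add _ _ h1 h2 => exact h1.add h2
  | smul c B hc _ h => exact h.const_mul _

theorem OscFam.eq_zero (hM : OscFam α s ι p₁ p₂ q₁ q₂ M) (L e : ℝ) {P Q : ℝ}
    (h : ¬ (P ∈ Icc p₁ p₂ ∧ Q ∈ Icc q₁ q₂)) : M L e P Q = 0 := by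
  induction hM with
  | base hρ h1 h2 => exact oscMul_eq_zero h1 h2 L h
  | add _ _ h1 h2 => simp [h1, h2]
  | smul c B hc _ h => simp [h]

/-- Derivatives along lines in directions of size `O(r / L)` are `r` times a member of the class. -/
theorem OscFam.exists_deriv (hα : 0 < α) (hM : OscFam α s ι p₁ p₂ q₁ q₂ M)
    {v : ℝ → ℝ → ℝ × ℝ} {r : ℝ → ℝ → ℝ} {B : ℝ}
    (hr : ∀ L e, 1 ≤ L → |e| ≤ 1 → 0 < r L e)
    (hv : ∀ L e, 1 ≤ L → |e| ≤ 1 → L * |(v L e).1| ≤ B * r L e ∧ L * |(v L e).2| ≤ B * r L e) :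
    ∃ M' : ℝ → ℝ → ℝ → ℝ → ℂ, OscFam α s ι p₁ p₂ q₁ q₂ M' ∧ ∀ L e, 1 ≤ L → |e| ≤ 1 →
      ∀ P₀ Q₀ u : ℝ, HasDerivAt (fun u => M L e (P₀ + (v L e).1 * u) (Q₀ + (v L e).2 * u))
        (r L e * M' L e (P₀ + (v L e).1 * u) (Q₀ + (v L e).2 * u)) u := by
  induction hM with
  | @base ρ χ₁ χ₂ hρ h1 h2 =>
    have b1 := OscFam.base (α := α) (s := s) (ι := ι)
      (hρ.mul (g := fun t => (t : ℂ)) (ofRealCLM.contDiff.contDiffOn)) h1 h2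
    have b2 := OscFam.base (α := α) (s := s) (ι := ι) (hρ.mul (contDiffOn_rpow_ofReal α)) h1 h2
    have b3 := OscFam.base (α := α) (s := s) (ι := ι) hρ h1.deriv h2
    have b4 := OscFam.base (α := α) (s := s) (ι := ι) hρ h1 h2.deriv
    have hq : ∀ (x L e : ℝ), 1 ≤ L → |e| ≤ 1 → L * |x| ≤ B * r L e →
        L * |x| / r L e ≤ B ∧ |x| / r L e ≤ B := by
      intro x L e hL he hx
      have hr0 := hr L e hL he
      have : L * |x| / r L e ≤ B := by rwa [div_le_iff₀ hr0]
      refine ⟨this, le_trans ?_ this⟩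
      gcongr
      exact le_mul_of_one_le_left (abs_nonneg _) hL
    have k1 := OscFam.smul (fun L e => (-I * s * L * (v L e).1) / r L e) (|s| * B)
      (fun L e hL he => by
        have hr0 := hr L e hL he
        have := (hq _ L e hL he (hv L e hL he).1).1
        simp only [norm_div, norm_mul, norm_neg, norm_I, one_mul, norm_real,
          norm_eq_abs, abs_of_pos hr0, abs_of_pos (show 0 < L by linarith)]
        rw [mul_assoc, mul_div_assoc]
        gcongr) b1
    have k2 := OscFam.smul (fun L e => (I * s * L * ι * (v L e).2) / r L e) (|s| * |ι| * B)
      (fun L e hL he => by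
        have hr0 := hr L e hL he
        have := (hq _ L e hL he (hv L e hL he).2).1
        simp only [norm_div, norm_mul, norm_I, one_mul, norm_real,
          norm_eq_abs, abs_of_pos hr0, abs_of_pos (show 0 < L by linarith)]
        calc |s| * L * |ι| * |(v L e).2| / r L e = |s| * |ι| * (L * |(v L e).2| / r L e) := by ring
          _ ≤ _ := by gcongr) b2
    have k3 := OscFam.smul (fun L e => ((v L e).1 : ℂ) / r L e) B (fun L e hL he => by
        simpa only [norm_div, norm_real, norm_eq_abs, abs_of_pos (hr L e hL he)] using
          (hq _ L e hL he (hv L e hL he).1).2) b3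
    have k4 := OscFam.smul (fun L e => ((v L e).2 : ℂ) / r L e) B (fun L e hL he => by
        simpa only [norm_div, norm_real, norm_eq_abs, abs_of_pos (hr L e hL he)] using
          (hq _ L e hL he (hv L e hL he).2).2) b4
    refine ⟨_, ((k1.add k2).add k3).add k4, fun L e hL he P₀ Q₀ u => ?_⟩
    refine (hasDerivAt_oscMul_line hα hρ h1 h2 s ι L P₀ Q₀ (v L e) u).congr_deriv ?_
    have hr0 : ((r L e : ℝ) : ℂ) ≠ 0 := by exact_mod_cast (hr L e hL he).ne'
    field_simp
  | add _ _ h1 h2 =>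
    obtain ⟨M₁, hM₁, d1⟩ := h1
    obtain ⟨M₂, hM₂, d2⟩ := h2
    refine ⟨_, hM₁.add hM₂, fun L e hL he P₀ Q₀ u => ?_⟩
    exact ((d1 L e hL he P₀ Q₀ u).add (d2 L e hL he P₀ Q₀ u)).congr_deriv (by ring)
  | smul c B hc _ h =>
    obtain ⟨M₁, hM₁, d1⟩ := h
    refine ⟨_, hM₁.smul c B hc, fun L e hL he P₀ Q₀ u => ?_⟩
    exact ((d1 L e hL he P₀ Q₀ u).const_mul (c L e)).congr_deriv (by ring)

theorem OscFam.isCcKernel (hα : 0 < α) (hM : OscFam α s ι p₁ p₂ q₁ q₂ M) {κ a b e : ℝ}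
    (hκ : |κ| = 1) (hab : 1 - a * b ≠ 0) (he : e ≠ 0) (L : ℝ) :
    IsCcKernel (formKernel κ a b e (M L e)) := by
  have hκ0 : κ ≠ 0 := by rintro rfl; simp at hκ
  set X := max |p₁| |p₂|
  set Y := max |q₁| |q₂| / |e| with hY
  have hX0 : 0 ≤ X := le_max_of_le_left (abs_nonneg _)
  have hY0 : 0 ≤ Y := div_nonneg (le_max_of_le_left (abs_nonneg _)) (abs_nonneg _)
  refine ⟨(hM.continuous hα L e).comp (f := fun p : ℝ × ℝ => (formP κ a p.1 p.2, formQ e b p.1 p.2))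
    (by unfold formP formQ; fun_prop),
    max ((X + |a| * Y) / |1 - a * b|) ((Y + |b| * X) / |1 - a * b|),
    le_max_of_le_left (by positivity), fun ξ η h => hM.eq_zero L e fun ⟨hP, hQ⟩ => ?_⟩
  have h1 : |ξ - a * η| ≤ X := by
    have : |formP κ a ξ η| ≤ X := abs_le_max_abs_abs hP.1 hP.2
    rwa [formP, abs_mul, hκ, one_mul] at this
  have h2 : |η - b * ξ| ≤ Y := by
    have : |formQ e b ξ η| ≤ max |q₁| |q₂| := abs_le_max_abs_abs hQ.1 hQ.2
    rw [formQ, abs_mul] at this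
    rw [hY, le_div_iff₀' (abs_pos.2 he)]; exact this
  have k1 : |ξ| ≤ (X + |a| * Y) / |1 - a * b| := by
    rw [le_div_iff₀ (abs_pos.2 hab), ← abs_mul,
      show ξ * (1 - a * b) = (ξ - a * η) + a * (η - b * ξ) by ring]
    refine (abs_add_le _ _).trans ?_
    rw [abs_mul]; gcongr
  have k2 : |η| ≤ (Y + |b| * X) / |1 - a * b| := by
    rw [le_div_iff₀ (abs_pos.2 hab), ← abs_mul,
      show η * (1 - a * b) = (η - b * ξ) + b * (ξ - a * η) by ring]
    refine (abs_add_le _ _).trans ?_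
    rw [abs_mul]; gcongr
  rcases h with h | h
  · exact absurd (h.trans_le k1) (not_lt.2 (le_max_left _ _))
  · exact absurd (h.trans_le k2) (not_lt.2 (le_max_right _ _))

end

/-! ### The bilinear operator in `L²` -/

theorem lintegral_abs_rpow_indicator_le {R D : ℝ} (hR : 0 ≤ R) (hD : 0 ≤ D) :
    ∫⁻ σ, (Icc (-R) R).indicator (fun σ => ofReal (D * |σ| ^ (-(7 / 8) : ℝ))) σ
      ≤ ofReal (16 * D * R ^ (1 / 8 : ℝ)) := by
  set f : ℝ → ℝ≥0∞ := fun σ => ofReal (D * |σ| ^ (-(7 / 8) : ℝ)) with hf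
  have hfm : Measurable f := by fun_prop
  have hhalf : ∫⁻ σ in Ioc 0 R, f σ = ofReal (8 * D * R ^ (1 / 8 : ℝ)) := by
    have h1 : IntegrableOn (fun σ : ℝ => D * σ ^ (-(7 / 8) : ℝ)) (Ioc 0 R) := by
      rw [← intervalIntegrable_iff_integrableOn_Ioc_of_le hR]
      exact (intervalIntegral.intervalIntegrable_rpow' (by norm_num)).const_mul D
    have h2 : ∫⁻ σ in Ioc 0 R, f σ = ∫⁻ σ in Ioc 0 R, ofReal (D * σ ^ (-(7 / 8) : ℝ)) :=
      setLIntegral_congr_fun measurableSet_Ioc fun σ hσ => by simp only [hf, abs_of_pos hσ.1]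
    rw [h2, ← ofReal_integral_eq_lintegral_ofReal h1
      ((ae_restrict_iff' measurableSet_Ioc).2 (ae_of_all _ fun σ hσ =>
        mul_nonneg hD (Real.rpow_nonneg hσ.1.le _))),
      ← integral_of_le hR, intervalIntegral.integral_const_mul,
      integral_rpow (Or.inl (by norm_num))]
    congr 1
    norm_num
    ring
  have hneg : ∫⁻ σ in Ico (-R) 0, f σ = ∫⁻ σ in Ioc 0 R, f σ := by
    rw [← lintegral_indicator measurableSet_Ico, ← lintegral_indicator measurableSet_Ioc,
      ← lintegral_neg_eq_self]
    congr 1; ext σ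
    simp only [Set.indicator, Set.mem_Ico, Set.mem_Ioc, hf, abs_neg, neg_le_neg_iff,
      Left.neg_neg_iff, and_comm]
  rw [lintegral_indicator measurableSet_Icc]
  calc ∫⁻ σ in Icc (-R) R, f σ ≤ ∫⁻ σ in Ico (-R) 0 ∪ {0} ∪ Ioc 0 R, f σ := by
        refine lintegral_mono_set fun σ hσ => ?_
        rcases lt_trichotomy σ 0 with h | h | h
        · exact Or.inl (Or.inl ⟨hσ.1, h⟩)
        · exact Or.inl (Or.inr h)
        · exact Or.inr ⟨h, hσ.2⟩
    _ ≤ (∫⁻ σ in Ico (-R) 0 ∪ {0}, f σ) + ∫⁻ σ in Ioc 0 R, f σ := lintegral_union_le _ _ _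
    _ ≤ ((∫⁻ σ in Ico (-R) 0, f σ) + ∫⁻ σ in {0}, f σ) + ∫⁻ σ in Ioc 0 R, f σ := by
        gcongr; exact lintegral_union_le _ _ _
    _ = ofReal (16 * D * R ^ (1 / 8 : ℝ)) := by
        rw [hneg, hhalf, Measure.restrict_singleton]
        simp only [Real.volume_singleton, zero_smul, lintegral_zero_measure, add_zero]
        rw [← ofReal_add (by positivity) (by positivity)]
        congr 1; ring

/-- The square of the `L²` norm. -/
def sqNorm (F : ℝ → ℂ) : ℝ≥0∞ := ∫⁻ ξ, ‖F ξ‖ₑ ^ 2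

/-- The operator with kernel `K` on the frequency side maps `L² × L²` to `L²`, the square of the
norm being at most `B`; only continuous functions are tested. -/
def FreqBound (B : ℝ≥0∞) (K : ℝ → ℝ → ℂ) : Prop := ∀ F G : ℝ → ℂ, Continuous F → Continuous G →
  ∫⁻ x, ‖freqOp K F G x‖ₑ ^ 2 ≤ B * (sqNorm F * sqNorm G)

theorem le_mul_rpow_of_le_of_mul_le {n X x : ℝ} (hn : 0 ≤ n) (hx : 0 < x) (h1 : n ≤ X)
    (h2 : x * n ≤ X) : n ≤ X * x ^ (-(7 / 8) : ℝ) := by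
  have hX : 0 ≤ X := hn.trans h1
  have h3 : n ≤ X / x := by rw [le_div_iff₀ hx, mul_comm]; exact h2
  calc n = n ^ (1 / 8 : ℝ) * n ^ (7 / 8 : ℝ) := by
        rw [← Real.rpow_add_of_nonneg hn (by norm_num) (by norm_num)]; norm_num
    _ ≤ X ^ (1 / 8 : ℝ) * (X / x) ^ (7 / 8 : ℝ) := by gcongr
    _ = X * x ^ (-(7 / 8) : ℝ) := by
        rw [div_rpow hX hx.le, div_eq_mul_inv (X ^ _), ← rpow_neg hx.le, ← mul_assoc,
          ← Real.rpow_add_of_nonneg hX (by norm_num) (by norm_num)]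
        norm_num

section

variable {α κ a b p₁ p₂ q₁ q₂ : ℝ}

/-- The exponent bookkeeping behind the choice `θ = L ^ (-1/40)`. -/
theorem rpow_bookkeeping {L m : ℝ} (hL : 1 ≤ L) (hm : L ^ (-(4 / 5) : ℝ) ≤ m) :
    (L * m * L ^ (-(1 / 40) : ℝ)) ^ (-(7 / 8) : ℝ) * (1 / m) ^ (1 / 8 : ℝ)
      ≤ L ^ (-(1 / 20) : ℝ) := by
  have hL0 : 0 < L := by linarith
  have hm0 : 0 < m := (rpow_pos_of_pos hL0 _).trans_le hm
  have e1 : L * m * L ^ (-(1 / 40) : ℝ) = L ^ (39 / 40 : ℝ) * m := by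
    have : L ^ (39 / 40 : ℝ) = L * L ^ (-(1 / 40) : ℝ) := by
      rw [← Real.rpow_one_add' hL0.le (by norm_num)]; norm_num
    rw [this]; ring
  rw [e1, Real.mul_rpow (by positivity) hm0.le, ← Real.rpow_mul hL0.le, one_div,
    Real.inv_rpow hm0.le, ← rpow_neg hm0.le, mul_assoc, ← rpow_add hm0]
  have e2 : m ^ (-(7 / 8) + -(1 / 8) : ℝ) ≤ L ^ (4 / 5 : ℝ) := by
    norm_num
    rw [Real.rpow_neg_one]
    rw [inv_le_comm₀ hm0 (by positivity), ← rpow_neg hL0.le]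
    exact hm
  calc _ ≤ L ^ (39 / 40 * (-(7 / 8)) : ℝ) * L ^ (4 / 5 : ℝ) := by gcongr
    _ = L ^ (39 / 40 * (-(7 / 8)) + 4 / 5 : ℝ) := by rw [rpow_add hL0]
    _ ≤ _ := Real.rpow_le_rpow_of_exponent_le hL (by norm_num)

/-- The stationary kernels in `L²`. -/
theorem exists_freqBound_stationary (hα : 0 < α) (hα1 : α ≠ 1)
    (hab : AdmissibleForms α a b) (hκ : |κ| = 1) (hp : 0 < p₁) (hpp : p₁ ≤ p₂) (hq : 0 < q₁)
    (hqq : q₁ ≤ q₂) {s : ℝ} (hs : |s| = 1) :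
    ∃ e₀ : ℝ, 0 < e₀ ∧ e₀ ≤ 1 ∧ ∀ ρ χ₁ χ₂ : ℝ → ℂ, IsPosBump ρ → IsBoxBump p₁ p₂ χ₁ →
      IsBoxBump q₁ q₂ χ₂ → ∃ C : ℝ, 0 < C ∧ ∀ L e : ℝ, 1 ≤ L → e ≠ 0 → |e| ≤ e₀ →
      L ^ (-(4 / 5) : ℝ) ≤ mixSize a e → FreqBound (ofReal (C * L ^ (-(41 / 40) : ℝ)))
        (formKernel κ a b e (oscMul α s 1 ρ χ₁ χ₂ L)) := by
  obtain ⟨e₀, he₀, he₀1, hquad⟩ := exists_quadCorr_bounds hα hα1 hab hκ hp hpp hq hqq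
  refine ⟨e₀, he₀, he₀1, fun ρ χ₁ χ₂ hρ hχ₁ hχ₂ => ?_⟩
  obtain ⟨C₁, hC₁, hamp⟩ := exists_oscAmp_bounds hα hα1 hp hq hρ hχ₁ hχ₂
  obtain ⟨C₂, hC₂, hq2⟩ := hquad ρ χ₁ χ₂ hρ hχ₁ hχ₂
  refine ⟨2 * C₁ ^ 2 + √(16 * C₂ * C₂ ^ (1 / 8 : ℝ)), by positivity,
    fun L e hL he0 he hmix F G hF hG => ?_⟩
  have hL0 : 0 < L := by linarith
  have hm0 := mixSize_pos (a := a) he0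
  set m := mixSize a e
  have hfam : OscFam α s 1 p₁ p₂ q₁ q₂ fun L _ => oscMul α s 1 ρ χ₁ χ₂ L := .base hρ hχ₁ hχ₂
  set K := formKernel κ a b e (oscMul α s 1 ρ χ₁ χ₂ L)
  have hKc : IsCcKernel K := hfam.isCcKernel hα hκ hab.one_sub_mul_ne_zero he0 L
  -- shifts below `θ` are estimated trivially, larger ones by the decay of the correlations
  set θ := L ^ (-(1 / 40) : ℝ) with hθ
  have hθ0 : 0 < θ := rpow_pos_of_pos hL0 _
  set D := C₂ / L ^ 2 * (L * m * θ) ^ (-(7 / 8) : ℝ) with hD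
  have hD0 : 0 ≤ D := by positivity
  set R := C₂ / m with hR
  have hR0 : 0 ≤ R := by positivity
  set B := √(16 * D * R ^ (1 / 8 : ℝ)) with hB
  have hBsq : ofReal B ^ 2 = ofReal (16 * D * R ^ (1 / 8 : ℝ)) := by
    rw [← ofReal_pow (sqrt_nonneg _), sq_sqrt (by positivity)]
  have main := lintegral_freqOp_sq_le (B := ofReal B) (k₀ := ofReal (C₁ / √L)) (θ := θ) hKc hF hG
    (fun x y => by
      rw [← ofReal_norm]
      exact ofReal_le_ofReal ((hamp L s hL hs).1 _ _))
    (q := fun _ => (Icc (-R) R).indicator fun σ => ofReal (D * |σ| ^ (-(7 / 8) : ℝ)))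
    (fun _ => Measurable.indicator (by fun_prop) measurableSet_Icc)
    (fun τ σ η hτ hσ => by
      obtain ⟨i1, i2, i3⟩ := hq2 L s e τ η σ hL hs he0 he
      by_cases hσR : σ ∈ Icc (-R) R
      · rw [indicator_of_mem hσR, ← ofReal_norm]
        refine ofReal_le_ofReal ?_
        have hx : 0 < L * m * |τ * σ| := by
          have : τ ≠ 0 := by rintro rfl; rw [abs_zero] at hτ; linarith
          positivity
        refine (le_mul_rpow_of_le_of_mul_le (norm_nonneg _) hx i1 i2).trans ?_
        have h1 : (L * m * |τ * σ|) ^ (-(7 / 8) : ℝ) ≤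
            (L * m * θ) ^ (-(7 / 8) : ℝ) * |σ| ^ (-(7 / 8) : ℝ) := by
          rw [abs_mul, ← mul_assoc, Real.mul_rpow (by positivity) (abs_nonneg _)]
          have : (L * m * |τ|) ^ (-(7 / 8) : ℝ) ≤ (L * m * θ) ^ (-(7 / 8) : ℝ) :=
            Real.rpow_le_rpow_of_nonpos (by positivity) (by gcongr) (by norm_num)
          gcongr
        calc _ ≤ C₂ / L ^ 2 * ((L * m * θ) ^ (-(7 / 8) : ℝ) * |σ| ^ (-(7 / 8) : ℝ)) := by gcongr
          _ = _ := by rw [hD]; ring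
      · have h1 : R < |σ| := by
          by_contra h
          exact hσR (abs_le.1 (not_lt.1 h))
        rw [hR, div_lt_iff₀' hm0] at h1
        have h2 : quadCorr K τ η σ = 0 := i3 h1
        rw [h2]; simp)
    (fun τ _ => by
      rw [hBsq]
      exact lintegral_abs_rpow_indicator_le hR0 hD0)
  refine main.trans (mul_le_mul_left ?_ _)
  rw [← ofReal_pow (by positivity), ← ofReal_mul (by positivity),
    ← ofReal_add (by positivity) (by positivity)]
  refine ofReal_le_ofReal ?_
  rw [add_mul]
  refine add_le_add ?_ ?_
  · rw [div_pow, sq_sqrt hL0.le]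
    have : L ^ (-(41 / 40) : ℝ) = L⁻¹ * θ := by
      rw [hθ, ← Real.rpow_neg_one, ← rpow_add hL0]; norm_num
    rw [this]
    apply le_of_eq; ring
  · have e1 : L ^ (-(41 / 40) : ℝ) = √(L ^ (-2 : ℝ) * L ^ (-(1 / 20) : ℝ)) := by
      rw [← rpow_add hL0, Real.sqrt_eq_rpow, ← Real.rpow_mul hL0.le]; norm_num
    rw [hB, e1, ← sqrt_mul (by positivity)]
    refine sqrt_le_sqrt ?_
    have e2 : 16 * D * R ^ (1 / 8 : ℝ) = 16 * C₂ * C₂ ^ (1 / 8 : ℝ) * (L ^ (-2 : ℝ) *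
        ((L * m * θ) ^ (-(7 / 8) : ℝ) * (1 / m) ^ (1 / 8 : ℝ))) := by
      rw [hD, hR, div_rpow hC₂.le hm0.le, div_rpow zero_le_one hm0.le, one_rpow,
        rpow_neg hL0.le, Real.rpow_two]
      ring
    rw [e2]
    gcongr
    exact rpow_bookkeeping hL hmix

/-- A kernel bounded by `k₀` whose slices `ξ + η = const` are supported on sets of bounded
measure. -/
theorem IsCcKernel.freqBound {K : ℝ → ℝ → ℂ} (hK : IsCcKernel K) {k₀ w : ℝ≥0∞}
    (hk : ∀ x y, ‖K x y‖ₑ ≤ k₀) (hw : ∀ x, volume {η | K (x - η) η ≠ 0} ≤ w) :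
    FreqBound (k₀ ^ 2 * w) K := by
  intro F G hF hG
  have hptw : ∀ s, ‖freqOp K F G s‖ₑ ^ 2 ≤ (k₀ ^ 2 * w) * ∫⁻ η, (‖F (s - η)‖ₑ * ‖G η‖ₑ) ^ 2 := by
    intro s
    set S : Set ℝ := {η | K (s - η) η ≠ 0} with hS
    have hSm : MeasurableSet S := by
      have : Continuous fun η : ℝ => K (s - η) η :=
        hK.cont.comp (f := fun η : ℝ => (s - η, η)) (by fun_prop)
      exact (isOpen_ne_fun this continuous_const).measurableSet
    have h1 : ‖freqOp K F G s‖ₑ ≤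
        ∫⁻ η, (S.indicator (fun _ => k₀) η) * (‖F (s - η)‖ₑ * ‖G η‖ₑ) := by
      refine (enorm_integral_le_lintegral_enorm _).trans (lintegral_mono fun η => ?_)
      simp only [enorm_mul]
      by_cases h : η ∈ S
      · rw [indicator_of_mem h, mul_comm k₀]; gcongr; exact hk _ _
      · have : K (s - η) η = 0 := by simpa [hS] using h
        rw [this]; simp
    refine (pow_le_pow_left₀ zero_le h1 2).trans ((lintegral_mul_sq_le
      (measurable_const.indicator hSm).aemeasurable (by fun_prop)).trans ?_)
    gcongr
    have : ∀ η, (S.indicator (fun _ => k₀) η) ^ 2 = S.indicator (fun _ => k₀ ^ 2) η := by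
      intro η; by_cases h : η ∈ S <;> simp [h]
    simp only [this]
    rw [lintegral_indicator_const hSm]
    gcongr
    exact hw s
  refine (lintegral_mono hptw).trans ?_
  have hm : Measurable fun p : ℝ × ℝ => (‖F (p.1 - p.2)‖ₑ * ‖G p.2‖ₑ) ^ 2 := by
    have h1 : Continuous fun p : ℝ × ℝ => F (p.1 - p.2) := by fun_prop
    have h2 : Continuous fun p : ℝ × ℝ => G p.2 := by fun_prop
    exact (h1.enorm.measurable.mul h2.enorm.measurable).pow_const 2
  rw [lintegral_const_mul _ hm.lintegral_prod_right', lintegral_lintegral_swap hm.aemeasurable]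
  refine le_of_eq ?_
  congr 1
  have : ∀ η, ∫⁻ s, (‖F (s - η)‖ₑ * ‖G η‖ₑ) ^ 2 = sqNorm F * ‖G η‖ₑ ^ 2 := by
    intro η
    simp only [mul_pow, sqNorm]
    rw [lintegral_mul_const' _ _ (by simp), lintegral_sub_right_eq_self (fun s => ‖F s‖ₑ ^ 2)]
  simp only [this, sqNorm]
  rw [lintegral_const_mul _ (by fun_prop)]

/-- The kernels without critical point in `L²`. -/
theorem exists_freqBound_nonstationary (hα : 0 < α) (ha : a ≠ -1)
    (hD1 : 1 - a * b ≠ 0) (hκ : |κ| = 1) (hp : 0 < p₁) (hq : 0 < q₁) {s : ℝ} (hs : |s| = 1)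
    {ρ χ₁ χ₂ : ℝ → ℂ} (hρ : IsPosBump ρ) (hχ₁ : IsBoxBump p₁ p₂ χ₁) (hχ₂ : IsBoxBump q₁ q₂ χ₂) :
    ∃ C : ℝ, 0 < C ∧ ∀ L e : ℝ, 1 ≤ L → e ≠ 0 → FreqBound (ofReal (C * L ^ (-(41 / 40) : ℝ)))
      (formKernel κ a b e (oscMul α s (-1) ρ χ₁ χ₂ L)) := by
  obtain ⟨C, hC0, hC⟩ := exists_oscInt_nonstationary_bound (q₂ := q₂) hα hp hρ
  obtain ⟨X, hX0, hX⟩ := hχ₁.exists_bound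
  obtain ⟨Y, hY0, hY⟩ := hχ₂.exists_bound
  have ha1 : 0 < |1 + a| := abs_pos.2 fun h => ha (by linarith)
  set w := |p₂ - p₁| / |1 + a|
  have hw0 : 0 ≤ w := by positivity
  refine ⟨(C * X * Y) ^ 2 * (2 * w) + 1, by positivity, fun L e hL he0 F G hF hG => ?_⟩
  have hL0 : 0 < L := by linarith
  have hfam : OscFam α s (-1) p₁ p₂ q₁ q₂ fun L _ => oscMul α s (-1) ρ χ₁ χ₂ L := .base hρ hχ₁ hχ₂
  have hKc : IsCcKernel (formKernel κ a b e (oscMul α s (-1) ρ χ₁ χ₂ L)) :=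
    hfam.isCcKernel hα hκ hD1 he0 L
  refine (hKc.freqBound (k₀ := ofReal (C * X * Y / L)) (w := ofReal (2 * w)) ?_ ?_
    F G hF hG).trans ?_
  · intro x y
    rw [← ofReal_norm]
    refine ofReal_le_ofReal ?_
    rw [formKernel]
    by_cases h : formP κ a x y ∈ Icc p₁ p₂ ∧ formQ e b x y ∈ Icc q₁ q₂
    · rw [oscMul, norm_mul, norm_mul]
      calc _ ≤ C / L * X * Y := by
            gcongr
            · exact hC L s _ _ hL hs h.1.1 (hq.le.trans h.2.1) h.2.2
            · exact hX _
            · exact hY _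
        _ = _ := by ring
    · rw [oscMul_eq_zero hχ₁ hχ₂ L h, norm_zero]; positivity
  · intro x
    rcases Set.eq_empty_or_nonempty
      {η | formKernel κ a b e (oscMul α s (-1) ρ χ₁ χ₂ L) (x - η) η ≠ 0} with h0 | ⟨η₀, hη₀⟩
    · rw [h0, measure_empty]; exact zero_le
    have hP : ∀ η, formKernel κ a b e (oscMul α s (-1) ρ χ₁ χ₂ L) (x - η) η ≠ 0 →
        formP κ a (x - η) η ∈ Icc p₁ p₂ := by
      intro η hη
      by_contra h
      exact hη (oscMul_eq_zero hχ₁ hχ₂ L fun h' => h h'.1)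
    refine (measure_mono (t := Icc (η₀ - w) (η₀ + w)) fun η hη => ?_).trans ?_
    · have k1 := hP η hη
      have k2 := hP η₀ hη₀
      have k3 : |κ * (1 + a) * (η - η₀)| ≤ |p₂ - p₁| := by
        have : κ * (1 + a) * (η - η₀) = formP κ a (x - η₀) η₀ - formP κ a (x - η) η := by
          unfold formP; ring
        rw [this, abs_of_nonneg (by linarith [k1.1, k1.2] : 0 ≤ p₂ - p₁), abs_le]
        constructor <;> linarith [k1.1, k1.2, k2.1, k2.2]
      rw [abs_mul, abs_mul, hκ, one_mul, ← le_div_iff₀' ha1] at k3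
      have := abs_le.1 k3
      exact ⟨by linarith [this.1], by linarith [this.2]⟩
    · rw [Real.volume_Icc]
      exact ofReal_le_ofReal (by linarith)
  · gcongr
    rw [← ofReal_pow (by positivity), ← ofReal_mul (by positivity)]
    refine ofReal_le_ofReal ?_
    have : L ^ (-2 : ℝ) ≤ L ^ (-(41 / 40) : ℝ) := Real.rpow_le_rpow_of_exponent_le hL (by norm_num)
    rw [rpow_neg hL0.le, Real.rpow_two] at this
    calc (C * X * Y / L) ^ 2 * (2 * w) = (C * X * Y) ^ 2 * (2 * w) * (L ^ 2)⁻¹ := by ring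
      _ ≤ ((C * X * Y) ^ 2 * (2 * w) + 1) * L ^ (-(41 / 40) : ℝ) := by gcongr; linarith

end

/-! ### Almost orthogonality and localisation in space -/

/-- Almost orthogonality: Bessel's inequality for a family whose Gram matrix has bounded row
sums. -/
theorem sum_sq_inner_le_of_gram {E ι : Type*} [NormedAddCommGroup E] [InnerProductSpace ℂ E]
    (s : Finset ι) (v : ι → E) {R : ℝ} (hR0 : 0 ≤ R)
    (hR : ∀ i ∈ s, ∑ j ∈ s, ‖inner ℂ (v i) (v j)‖ ≤ R) (x : E) :
    ∑ i ∈ s, ‖inner ℂ (v i) x‖ ^ 2 ≤ R * ‖x‖ ^ 2 := by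
  set c : ι → ℂ := fun i => inner ℂ (v i) x
  set S := ∑ i ∈ s, ‖c i‖ ^ 2 with hS
  set w := ∑ i ∈ s, c i • v i with hw
  have hS0 : 0 ≤ S := sum_nonneg fun i _ => by positivity
  have h1 : inner ℂ w x = (S : ℂ) := by
    rw [hw, sum_inner, hS, Complex.ofReal_sum]
    refine sum_congr rfl fun i _ => ?_
    rw [inner_smul_left, Complex.ofReal_pow, ← Complex.conj_mul']
  have h2 : S ≤ ‖w‖ * ‖x‖ := by
    have := norm_inner_le_norm (𝕜 := ℂ) w x
    rwa [h1, norm_real, norm_of_nonneg hS0] at this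
  have h3 : ‖w‖ ^ 2 ≤ R * S := by
    have e : ((‖w‖ ^ 2 : ℝ) : ℂ) = ∑ i ∈ s, ∑ j ∈ s, conj (c i) * (c j * inner ℂ (v i) (v j)) := by
      rw [Complex.ofReal_pow]
      refine (inner_self_eq_norm_sq_to_K (𝕜 := ℂ) w).symm.trans ?_
      rw [hw, sum_inner]
      refine sum_congr rfl fun i _ => ?_
      rw [inner_smul_left, inner_sum, mul_sum]
      simp only [inner_smul_right]
    have e2 : ‖w‖ ^ 2 ≤ ∑ i ∈ s, ∑ j ∈ s,
        (‖c i‖ ^ 2 * ‖inner ℂ (v i) (v j)‖ / 2 + ‖c j‖ ^ 2 * ‖inner ℂ (v j) (v i)‖ / 2) := by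
      rw [← norm_of_nonneg (sq_nonneg ‖w‖), ← norm_real, e]
      refine (norm_sum_le _ _).trans (sum_le_sum fun i _ => ?_)
      refine (norm_sum_le _ _).trans (sum_le_sum fun j _ => ?_)
      rw [norm_mul, norm_mul, RCLike.norm_conj, norm_inner_symm (v j) (v i)]
      nlinarith [mul_nonneg (norm_nonneg (inner ℂ (v i) (v j))) (sq_nonneg (‖c i‖ - ‖c j‖))]
    refine e2.trans ?_
    have e3 : ∑ i ∈ s, ∑ j ∈ s, ‖c i‖ ^ 2 * ‖inner ℂ (v i) (v j)‖ / 2 ≤ R * S / 2 := by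
      rw [hS, mul_sum, sum_div]
      refine sum_le_sum fun i hi => ?_
      rw [← sum_div, ← mul_sum, mul_comm R]
      gcongr
      exact hR i hi
    simp only [sum_add_distrib]
    rw [sum_comm (f := fun i j => ‖c j‖ ^ 2 * ‖inner ℂ (v j) (v i)‖ / 2)]
    linarith
  rcases hS0.eq_or_lt with h0 | h0
  · rw [← h0]
    positivity
  · have h4 : S ^ 2 ≤ (R * S) * ‖x‖ ^ 2 := by
      calc S ^ 2 ≤ (‖w‖ * ‖x‖) ^ 2 := by gcongr
        _ = ‖w‖ ^ 2 * ‖x‖ ^ 2 := by ring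
        _ ≤ _ := by gcongr
    have : S * S ≤ S * (R * ‖x‖ ^ 2) := by linarith
    exact le_of_mul_le_mul_left this h0

theorem inner_toLp {f g : ℝ → ℂ} (hf : MemLp f 2) (hg : MemLp g 2) :
    inner ℂ (hf.toLp f) (hg.toLp g) = ∫ t, conj (f t) * g t := by
  rw [L2.inner_def]
  refine integral_congr_ae ?_
  filter_upwards [hf.coeFn_toLp, hg.coeFn_toLp] with t h1 h2
  rw [h1, h2, RCLike.inner_apply, mul_comm]

theorem sum_enorm_sq_integral_le_of_gram {ι : Type*} (s : Finset ι) {v : ι → ℝ → ℂ} {x : ℝ → ℂ}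
    (hv : ∀ i, MemLp (v i) 2) (hx : MemLp x 2) {R : ℝ} (hR0 : 0 ≤ R)
    (hR : ∀ i ∈ s, ∑ j ∈ s, ‖∫ t, conj (v i t) * v j t‖ ≤ R) :
    ∑ i ∈ s, ‖∫ t, conj (v i t) * x t‖ₑ ^ 2 ≤ ofReal R * ∫⁻ t, ‖x t‖ₑ ^ 2 := by
  have h := sum_sq_inner_le_of_gram s (fun i => (hv i).toLp (v i)) hR0
    (by simpa only [inner_toLp] using hR) (hx.toLp x)
  simp only [inner_toLp] at h
  have h' := ofReal_le_ofReal h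
  rw [ENNReal.ofReal_sum_of_nonneg fun i _ => by positivity, ofReal_mul hR0,
    ofReal_pow (norm_nonneg _), ofReal_norm, ← lintegral_enorm_sq_eq_of_toLp] at h'
  simpa only [ofReal_pow (norm_nonneg _), ofReal_norm] using h'

theorem integrable_exp_neg_abs : Integrable fun t : ℝ => Real.exp (-|t|) := by
  rw [← integrableOn_univ, ← Set.Iic_union_Ioi (a := (0 : ℝ))]
  refine IntegrableOn.union ?_ ?_
  · refine (integrableOn_exp_Iic 0).congr_fun (fun t ht => ?_) measurableSet_Iic
    simp only [abs_of_nonpos (show t ≤ 0 from ht), neg_neg]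
  · refine (exp_neg_integrableOn_Ioi 0 one_pos).congr_fun (fun t ht => ?_) measurableSet_Ioi
    simp only [abs_of_pos (show 0 < t from ht), neg_one_mul]

theorem integral_exp_neg_abs : ∫ t : ℝ, Real.exp (-|t|) = 2 := by
  rw [integral_comp_abs (f := fun t => Real.exp (-t)), integral_exp_neg_Ioi_zero, mul_one]

theorem norm_integral_exp_neg_abs_le (k : ℝ) :
    ‖∫ u : ℝ, exp (-(|u| : ℝ) + I * (k * u : ℝ))‖ ≤ 2 / (1 + k ^ 2) := by
  have hp : (-1 + I * k : ℂ).re < 0 := by simp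
  have hm : 0 < (1 + I * k : ℂ).re := by simp
  have e1 : ∀ u ∈ Ioi (0 : ℝ), exp (-(|u| : ℝ) + I * (k * u : ℝ)) = exp ((-1 + I * k) * u) := by
    intro u hu; rw [abs_of_pos hu]; congr 1; push_cast; ring
  have e2 : ∀ u ∈ Set.Iic (0 : ℝ), exp (-(|u| : ℝ) + I * (k * u : ℝ)) = exp ((1 + I * k) * u) := by
    intro u hu; rw [abs_of_nonpos hu]; congr 1; push_cast; ring
  have i1 := (integrableOn_exp_mul_complex_Ioi hp 0).congr_fun
    (fun u hu => (e1 u hu).symm) measurableSet_Ioi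
  have i2 := (integrableOn_exp_mul_complex_Iic hm 0).congr_fun
    (fun u hu => (e2 u hu).symm) measurableSet_Iic
  rw [← intervalIntegral.integral_Iic_add_Ioi i2 i1, setIntegral_congr_fun measurableSet_Iic e2,
    setIntegral_congr_fun measurableSet_Ioi e1, integral_exp_mul_complex_Iic hm,
    integral_exp_mul_complex_Ioi hp]
  have n1 : (1 + I * k : ℂ) ≠ 0 := fun h => by rw [h] at hm; simp at hm
  have n2 : (-1 + I * k : ℂ) ≠ 0 := fun h => by rw [h] at hp; simp at hp
  have n3 : ((1 : ℂ) + k ^ 2) ≠ 0 := by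
    have : (0 : ℝ) < 1 + k ^ 2 := by positivity
    exact_mod_cast this.ne'
  have e3 : exp ((1 + I * k) * (0 : ℝ)) / (1 + I * k) +
      -exp ((-1 + I * k) * (0 : ℝ)) / (-1 + I * k) = ((2 / (1 + k ^ 2) : ℝ) : ℂ) := by
    push_cast
    rw [mul_zero, mul_zero, exp_zero]
    rw [div_add_div _ _ n1 n2, div_eq_div_iff (mul_ne_zero n1 n2) n3]
    linear_combination (-2 * (k : ℂ) ^ 2) * I_sq
  rw [e3, norm_real, norm_of_nonneg (by positivity)]

/-- Averages of `F` over translates, weighted so that the bilinear operator applied to the result is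
localised near `y` at scale `ℓ`. In the space variable this divides by `1 + i (x - y) / ℓ`. -/
def resolventSmooth (ℓ y : ℝ) (F : ℝ → ℂ) (ξ : ℝ) : ℂ :=
  ∫ t in Ioi ξ, ℓ * exp ((ℓ - I * y) * (ξ - t : ℝ)) * F t

section

variable {F : ℝ → ℂ}

theorem hasDerivAt_resolventSmooth (hF : Continuous F) (hFc : HasCompactSupport F) (ℓ y ξ : ℝ) :
    HasDerivAt (resolventSmooth ℓ y F) ((ℓ - I * y) * resolventSmooth ℓ y F ξ - ℓ * F ξ) ξ := by
  set h : ℝ → ℂ := fun t => exp (-(ℓ - I * y) * t) * F t with hh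
  have hc : Continuous h := by fun_prop
  have hi : Integrable h := hc.integrable_of_hasCompactSupport hFc.mul_left
  have e : resolventSmooth ℓ y F = fun ξ : ℝ => (ℓ * exp ((ℓ - I * y) * ξ)) *
      ((∫ t in Ioi 0, h t) - ∫ t in (0 : ℝ)..ξ, h t) := by
    ext ξ
    rw [← intervalIntegral.integral_interval_add_Ioi (b := ξ) hi.integrableOn hi.integrableOn,
      add_sub_cancel_left, ← integral_const_mul]
    refine setIntegral_congr_fun measurableSet_Ioi fun t _ => ?_
    simp only [hh]
    rw [← mul_assoc, mul_assoc (ℓ : ℂ) _ (exp _), ← exp_add]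
    congr 3; push_cast; ring
  have d1 : HasDerivAt (fun ξ : ℝ => (ℓ : ℂ) * exp ((ℓ - I * y) * ξ))
      (ℓ * (exp ((ℓ - I * y) * ξ) * (ℓ - I * y))) ξ := by
    have : HasDerivAt (fun ξ : ℝ => ((ℓ : ℂ) - I * y) * ξ) (ℓ - I * y) ξ := by
      simpa using (ofRealCLM.hasDerivAt (x := ξ)).const_mul ((ℓ : ℂ) - I * y)
    exact this.cexp.const_mul _
  have d2 : HasDerivAt (fun ξ : ℝ => (∫ t in Ioi 0, h t) - ∫ t in (0 : ℝ)..ξ, h t) (-h ξ) ξ :=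
    (intervalIntegral.integral_hasDerivAt_right (hc.intervalIntegrable _ _)
      (hc.stronglyMeasurableAtFilter _ _) hc.continuousAt).const_sub _
  rw [e]
  refine (d1.mul d2).congr_deriv ?_
  simp only [hh]
  have : exp ((ℓ - I * y) * ξ) * exp (-(ℓ - I * y) * ξ) = 1 := by
    rw [← exp_add, neg_mul, add_neg_cancel, exp_zero]
  linear_combination (-(ℓ : ℂ) * F ξ) * this

theorem continuous_resolventSmooth (hF : Continuous F) (hFc : HasCompactSupport F) (ℓ y : ℝ) :
    Continuous (resolventSmooth ℓ y F) :=
  continuous_iff_continuousAt.2 fun ξ => (hasDerivAt_resolventSmooth hF hFc ℓ y ξ).continuousAt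

/-- The row sums of the Gram matrix of the localisations. -/
def gramSum : ℝ := ∑' k : ℤ, 2 / (1 + (k : ℝ) ^ 2)

theorem summable_gramSum : Summable fun k : ℤ => 2 / (1 + (k : ℝ) ^ 2) := by
  have h := (Real.summable_one_div_int_pow.2 (one_lt_two)).mul_left 2
  refine h.of_norm_bounded_eventually ?_
  rw [Filter.eventually_cofinite]
  refine (Set.finite_singleton (0 : ℤ)).subset fun k hk => ?_
  by_contra hk0
  refine hk ?_
  have : (0 : ℝ) < (k : ℝ) ^ 2 := by
    have : (k : ℝ) ≠ 0 := by exact_mod_cast hk0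
    positivity
  rw [norm_of_nonneg (by positivity), mul_one_div]
  gcongr
  linarith

theorem gramSum_nonneg : 0 ≤ gramSum := tsum_nonneg fun _ => by positivity

theorem sum_gram_le (s : Finset ℤ) (i : ℤ) :
    ∑ j ∈ s, 2 / (1 + ((i : ℝ) - j) ^ 2) ≤ gramSum := by
  have h := (summable_gramSum.comp_injective (sub_right_injective (b := i)))
  have e : gramSum = ∑' j : ℤ, 2 / (1 + ((i - j : ℤ) : ℝ) ^ 2) :=
    ((Equiv.subLeft i).tsum_eq (fun k : ℤ => 2 / (1 + (k : ℝ) ^ 2))).symm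
  rw [e]
  refine le_trans (le_of_eq ?_) (h.sum_le_tsum s fun j _ => by positivity)
  simp

/-- The localisations at the points `y + n ℓ` are almost orthogonal. -/
theorem sum_lintegral_resolventSmooth_sq_le (hF : Continuous F) (hFc : HasCompactSupport F)
    {ℓ : ℝ} (hℓ : 0 < ℓ) (y : ℝ) (s : Finset ℤ) :
    ∑ n ∈ s, ∫⁻ ξ, ‖resolventSmooth ℓ (y + n * ℓ) F ξ‖ₑ ^ 2 ≤
      ofReal (2 * gramSum) * ∫⁻ ξ, ‖F ξ‖ₑ ^ 2 := by
  have hptw : ∀ ξ, ∑ n ∈ s, ‖resolventSmooth ℓ (y + n * ℓ) F ξ‖ₑ ^ 2 ≤ ofReal gramSum *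
      ∫⁻ t, ofReal (ℓ * Real.exp (-(ℓ * |t - ξ|))) * ‖F t‖ₑ ^ 2 := by
    intro ξ
    set v : ℤ → ℝ → ℂ := fun n t => (√ℓ : ℂ) *
      exp ((-(ℓ * |t - ξ| / 2) : ℝ) + I * ((y + n * ℓ) * (ξ - t) : ℝ)) with hv
    set x : ℝ → ℂ := (Ioi ξ).indicator fun t => (√ℓ : ℂ) *
      exp ((-(ℓ * |t - ξ| / 2) : ℝ)) * F t with hx
    have hsq : (√ℓ : ℂ) * (√ℓ : ℂ) = ℓ := by rw [← Complex.ofReal_mul, Real.mul_self_sqrt hℓ.le]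
    have hvc : ∀ n, Continuous (v n) := fun n => by fun_prop
    have hvn : ∀ n t, ‖v n t‖ = √ℓ * Real.exp (-(ℓ * |t - ξ| / 2)) := by
      intro n t
      simp only [hv]
      rw [exp_add, norm_mul, norm_mul, norm_expI, mul_one, norm_real,
        norm_of_nonneg (sqrt_nonneg _), norm_exp, ofReal_re]
    have hprod : ∀ i j t, conj (v i t) * v j t =
        ℓ * exp (-(|ℓ * (t - ξ)| : ℝ) + I * (((i : ℝ) - j) * (ℓ * (t - ξ)) : ℝ)) := by
      intro i j t
      simp only [hv, map_mul, conj_ofReal, ← exp_conj]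
      rw [mul_mul_mul_comm, hsq, ← exp_add]
      congr 2
      simp only [map_add, map_mul, conj_ofReal, conj_I, abs_mul, abs_of_pos hℓ]
      push_cast; ring
    have hvm : ∀ n, MemLp (v n) 2 := by
      intro n
      rw [memLp_two_iff_integrable_sq_norm (hvc n).aestronglyMeasurable]
      have h1 := ((integrable_exp_neg_abs.comp_mul_left' hℓ.ne').comp_sub_right ξ).const_mul ℓ
      refine h1.congr (ae_of_all _ fun t => ?_)
      simp only [hvn]
      rw [mul_pow, sq_sqrt hℓ.le, ← Real.exp_nat_mul, abs_mul, abs_of_pos hℓ]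
      congr 2; push_cast; ring
    have hxm : MemLp x 2 := by
      refine MemLp.indicator measurableSet_Ioi ?_
      exact Continuous.memLp_of_hasCompactSupport (by fun_prop) hFc.mul_left
    have hres : ∀ n : ℤ, resolventSmooth ℓ (y + n * ℓ) F ξ = ∫ t, conj (v n t) * x t := by
      intro n
      rw [resolventSmooth, ← integral_indicator measurableSet_Ioi]
      congr 1; ext t
      by_cases ht : t ∈ Ioi ξ
      · simp only [hx, indicator_of_mem ht]
        simp only [hv, map_mul, conj_ofReal, ← exp_conj]
        rw [show ∀ a b c d : ℂ, a * b * (a * c * d) = (a * a) * (b * c) * d from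
          fun a b c d => by ring, hsq, ← exp_add]
        congr 3
        have : |t - ξ| = t - ξ := abs_of_pos (sub_pos.2 ht)
        rw [this]
        simp only [map_add, map_mul, conj_ofReal, conj_I]
        push_cast; ring
      · simp [hx, indicator_of_notMem ht]
    have hgram : ∀ i ∈ s, ∑ j ∈ s, ‖∫ t, conj (v i t) * v j t‖ ≤ gramSum := by
      intro i _
      refine le_trans (sum_le_sum fun j _ => ?_) (sum_gram_le s i)
      simp only [hprod]
      rw [integral_const_mul, integral_sub_right_eq_self (fun t : ℝ => exp
        (-(|ℓ * t| : ℝ) + I * (((i : ℝ) - j) * (ℓ * t) : ℝ))) ξ,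
        Measure.integral_comp_mul_left (fun t : ℝ => exp
        (-(|t| : ℝ) + I * (((i : ℝ) - j) * t : ℝ))) ℓ, norm_mul, norm_smul,
        norm_real, norm_of_nonneg hℓ.le, norm_of_nonneg (abs_nonneg _),
        abs_inv, abs_of_pos hℓ, mul_inv_cancel_left₀ hℓ.ne']
      exact norm_integral_exp_neg_abs_le _
    have hB := sum_enorm_sq_integral_le_of_gram s hvm hxm gramSum_nonneg hgram
    simp only [hres]
    refine hB.trans ?_
    gcongr with t
    by_cases ht : t ∈ Ioi ξ
    · simp only [hx, indicator_of_mem ht]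
      rw [enorm_mul, mul_pow]
      gcongr
      rw [← ofReal_norm, ← ofReal_pow (norm_nonneg _)]
      refine ofReal_le_ofReal (le_of_eq ?_)
      rw [norm_mul, norm_real, norm_of_nonneg (sqrt_nonneg _), norm_exp,
        ofReal_re, mul_pow, sq_sqrt hℓ.le, ← Real.exp_nat_mul]
      congr 2; push_cast; ring
    · simp [hx, indicator_of_notMem ht]
  have hm : ∀ n : ℤ, Measurable fun ξ => ‖resolventSmooth ℓ (y + n * ℓ) F ξ‖ₑ ^ 2 := fun n =>
    (continuous_resolventSmooth hF hFc ℓ _).enorm.measurable.pow_const 2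
  rw [← lintegral_finsetSum _ fun n _ => hm n]
  refine (lintegral_mono hptw).trans ?_
  have hm2 : Measurable fun p : ℝ × ℝ =>
      ofReal (ℓ * Real.exp (-(ℓ * |p.2 - p.1|))) * ‖F p.2‖ₑ ^ 2 := by
    have h1 : Continuous fun p : ℝ × ℝ => F p.2 := by fun_prop
    exact (Measurable.ennreal_ofReal (by fun_prop)).mul (h1.enorm.measurable.pow_const 2)
  rw [lintegral_const_mul _ hm2.lintegral_prod_right', lintegral_lintegral_swap hm2.aemeasurable]
  have e1 : ∀ t, ∫⁻ ξ, ofReal (ℓ * Real.exp (-(ℓ * |t - ξ|))) * ‖F t‖ₑ ^ 2 = 2 * ‖F t‖ₑ ^ 2 := by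
    intro t
    rw [lintegral_mul_const' _ _ (by simp), lintegral_sub_left_eq_self
      (fun u => ofReal (ℓ * Real.exp (-(ℓ * |u|)))) t]
    have h1 := (integrable_exp_neg_abs.comp_mul_left' hℓ.ne').const_mul ℓ
    have h2 : ∀ u : ℝ, ℓ * Real.exp (-(ℓ * |u|)) = ℓ * Real.exp (-|ℓ * u|) := by
      intro u; rw [abs_mul, abs_of_pos hℓ]
    simp only [h2]
    rw [← ofReal_integral_eq_lintegral_ofReal h1 (ae_of_all _ fun u => by positivity),
      integral_const_mul, Measure.integral_comp_mul_left (fun u : ℝ => Real.exp (-|u|)),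
      integral_exp_neg_abs, abs_inv, abs_of_pos hℓ, smul_eq_mul, mul_inv_cancel_left₀ hℓ.ne']
    simp
  simp only [e1]
  rw [lintegral_const_mul' _ _ (by simp), mul_comm 2 gramSum, ofReal_mul gramSum_nonneg, mul_assoc]
  simp

end

/-! ### From local to global estimates -/

/-- The bilinear operator with the continuous kernel `K` maps `L² × L²` to `L¹` with norm at most
`B`; only continuous functions of compact support are tested. -/
structure SpaceBound (B : ℝ≥0∞) (K : ℝ → ℝ → ℂ) : Prop where
  isCc : IsCcKernel K
  le : ∀ F G : ℝ → ℂ, Continuous F → HasCompactSupport F → Continuous G → HasCompactSupport G →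
    ∫⁻ x, ‖spaceOp K F G x‖ₑ ≤ B * (sqNorm F * sqNorm G) ^ (1 / 2 : ℝ)

theorem SpaceBound.mono {B B' : ℝ≥0∞} {K : ℝ → ℝ → ℂ} (hK : SpaceBound B K)
    (h : B ≤ B') : SpaceBound B' K :=
  ⟨hK.isCc, fun F G hF hFc hG hGc => (hK.le F G hF hFc hG hGc).trans (by gcongr)⟩

theorem tsum_sqrt_mul_le {ι : Type*} (a b : ι → ℝ≥0∞) :
    ∑' i, (a i * b i) ^ (1 / 2 : ℝ) ≤ ((∑' i, a i) * ∑' i, b i) ^ (1 / 2 : ℝ) := by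
  let : MeasurableSpace ι := ⊤
  refine ENNReal_le_of_sq_le ?_
  have h := lintegral_mul_sq_le (μ := Measure.count) (f := fun i => a i ^ (1 / 2 : ℝ))
    (g := fun i => b i ^ (1 / 2 : ℝ)) measurable_from_top.aemeasurable
    measurable_from_top.aemeasurable
  simp only [lintegral_count, sq_rpow_half] at h
  rw [sq_rpow_half]
  refine le_trans (le_of_eq ?_) h
  congr 2; ext i
  exact mul_rpow_of_nonneg _ _ (by norm_num)

theorem spaceOp_swap {K : ℝ → ℝ → ℂ} (hK : IsCcKernel K) {F G : ℝ → ℂ} (hF : Continuous F)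
    (hG : Continuous G) (x : ℝ) : spaceOp K F G x = spaceOp (fun ξ η => K η ξ) G F x := by
  rw [spaceOp, (hK.spaceOp_kernel hF hG x).integral_swap, spaceOp]
  congr 1; ext η; congr 1; ext ξ
  rw [add_comm ξ η]; ring

/-- Integration by parts in `ξ`: localising `F` at `y`. -/
theorem spaceOp_eq_localized_left {K K₁ : ℝ → ℝ → ℂ} (hK : IsCcKernel K) (hK₁ : IsCcKernel K₁)
    {ℓ : ℝ} (hℓ : 0 < ℓ) (hd : ∀ ξ η, HasDerivAt (fun ξ => K ξ η) (ℓ * K₁ ξ η) ξ) {F G : ℝ → ℂ}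
    (hF : Continuous F) (hFc : HasCompactSupport F) (hG : Continuous G) (x y : ℝ) :
    spaceOp K F G x = (1 + I * ((x - y) / ℓ : ℝ)) * spaceOp K (resolventSmooth ℓ y F) G x
      + spaceOp K₁ (resolventSmooth ℓ y F) G x := by
  set S := resolventSmooth ℓ y F
  have hSc : Continuous S := continuous_resolventSmooth hF hFc ℓ y
  have k0 := (hK.spaceOp_kernel hF hG x).swap
  have k1 := (hK.spaceOp_kernel hSc hG x).swap
  have k2 := (hK₁.spaceOp_kernel hSc hG x).swap
  rw [spaceOp, (hK.spaceOp_kernel hF hG x).integral_swap, spaceOp,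
    (hK.spaceOp_kernel hSc hG x).integral_swap, spaceOp,
    (hK₁.spaceOp_kernel hSc hG x).integral_swap, ← integral_const_mul, ← integral_add]
  · congr 1; ext η
    have hℓ' : (ℓ : ℂ) ≠ 0 := by exact_mod_cast hℓ.ne'
    set E : ℝ → ℂ := fun ξ => expI((ξ + η) * x)
    have dE : ∀ ξ, HasDerivAt E (I * x * E ξ) ξ := by
      intro ξ
      have : HasDerivAt (fun ξ : ℝ => (ξ + η) * x) x ξ := by
        simpa using ((hasDerivAt_id ξ).add_const η).mul_const x
      exact hasDerivAt_exp_I_mul this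
    have du : ∀ ξ, HasDerivAt (fun ξ => S ξ * G η * K ξ η * E ξ)
        ((ℓ - I * y + I * x) * (S ξ * G η * K ξ η * E ξ)
          - ℓ * (F ξ * G η * K ξ η * E ξ) + ℓ * (S ξ * G η * K₁ ξ η * E ξ)) ξ := by
      intro ξ
      refine ((((hasDerivAt_resolventSmooth hF hFc ℓ y ξ).mul_const (G η)).mul (hd ξ η)).mul
        (dE ξ)).congr_deriv ?_
      simp only [Pi.mul_apply]
      ring
    have i0 := k0.integrable_right η
    have i1 := k1.integrable_right η
    have i2 := k2.integrable_right η
    have hz := integral_eq_zero_of_hasDerivAt_of_integrable du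
      (((i1.const_mul _).sub (i0.const_mul _)).add (i2.const_mul _)) i1
    have j0 : Integrable fun ξ => (ℓ : ℂ) * (F ξ * G η * K ξ η * E ξ) := i0.const_mul _
    have j1 : Integrable fun ξ => (ℓ - I * y + I * x) * (S ξ * G η * K ξ η * E ξ) := i1.const_mul _
    have j2 : Integrable fun ξ => (ℓ : ℂ) * (S ξ * G η * K₁ ξ η * E ξ) := i2.const_mul _
    have t1 : ∫ ξ, ((ℓ - I * y + I * x) * (S ξ * G η * K ξ η * E ξ)
        - ℓ * (F ξ * G η * K ξ η * E ξ) + ℓ * (S ξ * G η * K₁ ξ η * E ξ)) =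
        (∫ ξ, ((ℓ - I * y + I * x) * (S ξ * G η * K ξ η * E ξ)
        - ℓ * (F ξ * G η * K ξ η * E ξ))) + ∫ ξ, ℓ * (S ξ * G η * K₁ ξ η * E ξ) :=
      integral_add (j1.sub j0) j2
    rw [t1, integral_sub j1 j0, integral_const_mul, integral_const_mul, integral_const_mul] at hz
    have e : (1 + I * ((x - y) / ℓ : ℝ) : ℂ) * ℓ = ℓ - I * y + I * x := by
      push_cast; field_simp; ring
    refine mul_left_cancel₀ hℓ' ?_
    linear_combination -hz - (∫ ξ, S ξ * G η * K ξ η * E ξ) * e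
  · exact k1.integrable_integral.const_mul _
  · exact k2.integrable_integral

theorem enorm_spaceOp_le_localized_left {K K₁ : ℝ → ℝ → ℂ} (hK : IsCcKernel K)
    (hK₁ : IsCcKernel K₁) {ℓ : ℝ} (hℓ : 0 < ℓ)
    (hd : ∀ ξ η, HasDerivAt (fun ξ => K ξ η) (ℓ * K₁ ξ η) ξ) {F G : ℝ → ℂ}
    (hF : Continuous F) (hFc : HasCompactSupport F) (hG : Continuous G) {x y : ℝ}
    (hxy : |x - y| ≤ ℓ) :
    ‖spaceOp K F G x‖ₑ ≤ 2 * (‖spaceOp K (resolventSmooth ℓ y F) G x‖ₑ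
      + ‖spaceOp K₁ (resolventSmooth ℓ y F) G x‖ₑ) := by
  rw [spaceOp_eq_localized_left hK hK₁ hℓ hd hF hFc hG x y]
  refine (enorm_add_le _ _).trans ?_
  rw [mul_add, enorm_mul]
  have h1 : ‖(1 + I * ((x - y) / ℓ : ℝ) : ℂ)‖ₑ ≤ 2 := by
    rw [← ofReal_norm, ← ENNReal.ofReal_ofNat]
    refine ofReal_le_ofReal ((norm_add_le _ _).trans ?_)
    rw [norm_one, norm_mul, norm_I, one_mul, norm_real, norm_eq_abs, abs_div, abs_of_pos hℓ]
    have := (div_le_one hℓ).2 hxy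
    linarith
  gcongr
  exact le_mul_of_one_le_left zero_le (by norm_num)

/-- The kernel `K 0 0` and its normalised derivatives up to order one in each variable: the first
index counts derivatives in `ξ`, the second, taken afterwards, derivatives in `η`. -/
structure IsSmoothKernel (ℓ₁ ℓ₂ : ℝ) (K : Fin 2 → Fin 2 → ℝ → ℝ → ℂ) : Prop where
  isCc : ∀ i j, IsCcKernel (K i j)
  deriv_left : ∀ ξ η, HasDerivAt (fun ξ => K 0 0 ξ η) (ℓ₁ * K 1 0 ξ η) ξ
  deriv_right : ∀ i ξ η, HasDerivAt (fun η => K i 0 ξ η) (ℓ₂ * K i 1 ξ η) η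

theorem IsSmoothKernel.enorm_spaceOp_le {ℓ₁ ℓ₂ : ℝ} {K : Fin 2 → Fin 2 → ℝ → ℝ → ℂ}
    (hK : IsSmoothKernel ℓ₁ ℓ₂ K) (h1 : 0 < ℓ₁) (h2 : 0 < ℓ₂) {F G : ℝ → ℂ}
    (hF : Continuous F) (hFc : HasCompactSupport F) (hG : Continuous G) (hGc : HasCompactSupport G)
    {x y₁ y₂ : ℝ} (hx1 : |x - y₁| ≤ ℓ₁) (hx2 : |x - y₂| ≤ ℓ₂) :
    ‖spaceOp (K 0 0) F G x‖ₑ ≤ 4 * ∑ i, ∑ j,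
      ‖spaceOp (K i j) (resolventSmooth ℓ₁ y₁ F) (resolventSmooth ℓ₂ y₂ G) x‖ₑ := by
  have hFs := continuous_resolventSmooth hF hFc ℓ₁ y₁
  have hGs := continuous_resolventSmooth hG hGc ℓ₂ y₂
  have right : ∀ i, ‖spaceOp (K i 0) (resolventSmooth ℓ₁ y₁ F) G x‖ₑ ≤
      2 * (‖spaceOp (K i 0) (resolventSmooth ℓ₁ y₁ F) (resolventSmooth ℓ₂ y₂ G) x‖ₑ
      + ‖spaceOp (K i 1) (resolventSmooth ℓ₁ y₁ F) (resolventSmooth ℓ₂ y₂ G) x‖ₑ) := by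
    intro i
    rw [spaceOp_swap (hK.isCc i 0) hFs hG, spaceOp_swap (hK.isCc i 0) hFs hGs,
      spaceOp_swap (hK.isCc i 1) hFs hGs]
    exact enorm_spaceOp_le_localized_left (hK.isCc i 0).swap (hK.isCc i 1).swap h2
      (fun η ξ => hK.deriv_right i ξ η) hG hGc hFs hx2
  refine (enorm_spaceOp_le_localized_left (hK.isCc 0 0) (hK.isCc 1 0) h1 hK.deriv_left
    hF hFc hG hx1).trans ?_
  simp only [Fin.sum_univ_two]
  calc _ ≤ _ := mul_le_mul_right (add_le_add (right 0) (right 1)) 2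
    _ = _ := by ring

/-- The local estimate: on an interval cut into `N` cells of length `ℓ`, with one function `G` for
each cell. -/
def LocalBound (ℓ : ℝ) (N : ℕ) (B : ℝ≥0∞) (K : ℝ → ℝ → ℂ) : Prop :=
  ∀ (F : ℝ → ℂ) (G : Fin N → ℝ → ℂ), Continuous F → (∀ n, Continuous (G n)) → ∀ y : ℝ,
    ∑ n : Fin N, ∫⁻ x in Ico (y + (n : ℕ) * ℓ) (y + ((n : ℕ) + 1) * ℓ), ‖spaceOp K F (G n) x‖ₑ ≤
      B * (sqNorm F * ∑ n, sqNorm (G n)) ^ (1 / 2 : ℝ)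

theorem tsum_sqNorm_resolventSmooth_le {F : ℝ → ℂ} (hF : Continuous F) (hFc : HasCompactSupport F)
    {ℓ : ℝ} (hℓ : 0 < ℓ) :
    ∑' n : ℤ, sqNorm (resolventSmooth ℓ (n * ℓ) F) ≤ ofReal (2 * gramSum) * sqNorm F := by
  rw [ENNReal.tsum_eq_iSup_sum]
  refine iSup_le fun s => ?_
  have := sum_lintegral_resolventSmooth_sq_le hF hFc hℓ 0 s
  simp only [zero_add] at this
  exact this

/-- Local estimates for a kernel and its normalised derivatives give a global one. -/
theorem IsSmoothKernel.spaceBound {ℓ : ℝ} {N : ℕ} (hN : N ≠ 0) (hℓ : 0 < ℓ)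
    {K : Fin 2 → Fin 2 → ℝ → ℝ → ℂ} (hK : IsSmoothKernel (N * ℓ) ℓ K) {B : ℝ≥0∞}
    (hB : ∀ i j, LocalBound ℓ N B (K i j)) :
    SpaceBound (16 * B * ofReal (2 * gramSum)) (K 0 0) := by
  refine ⟨hK.isCc 0 0, fun F G hF hFc hG hGc => ?_⟩
  have : NeZero N := ⟨hN⟩
  have hN0 : (0 : ℝ) < N := by exact_mod_cast Nat.pos_of_ne_zero hN
  set Fp : ℤ → ℝ → ℂ := fun p => resolventSmooth (N * ℓ) (p * (N * ℓ)) F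
  set Gk : ℤ → ℝ → ℂ := fun k => resolventSmooth ℓ (k * ℓ) G
  have hFpc : ∀ p, Continuous (Fp p) := fun p => continuous_resolventSmooth hF hFc _ _
  have hGkc : ∀ k, Continuous (Gk k) := fun k => continuous_resolventSmooth hG hGc _ _
  have hcell : ∀ p : ℤ, ∑ n : Fin N, ∫⁻ x in Ico (((p * N + (n : ℕ) : ℤ) : ℝ) * ℓ)
      (((p * N + (n : ℕ) : ℤ) + 1 : ℝ) * ℓ), ‖spaceOp (K 0 0) F G x‖ₑ ≤
      16 * B * (sqNorm (Fp p) * ∑ n : Fin N, sqNorm (Gk (p * N + (n : ℕ)))) ^ (1 / 2 : ℝ) := by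
    intro p
    set J : Fin N → Set ℝ := fun n =>
      Ico (p * (N * ℓ) + (n : ℕ) * ℓ) (p * (N * ℓ) + ((n : ℕ) + 1) * ℓ) with hJ
    have hJe : ∀ n : Fin N, Ico (((p * N + (n : ℕ) : ℤ) : ℝ) * ℓ)
      (((p * N + (n : ℕ) : ℤ) + 1 : ℝ) * ℓ) = J n := by
      intro n; simp only [hJ]; congr 1 <;> push_cast <;> ring
    simp only [hJe]
    have hle : ∀ n : Fin N, ∫⁻ x in J n, ‖spaceOp (K 0 0) F G x‖ₑ ≤ 4 * ∑ i, ∑ j,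
        ∫⁻ x in J n, ‖spaceOp (K i j) (Fp p) (Gk (p * N + (n : ℕ))) x‖ₑ := by
      intro n
      have hmeas : ∀ i j, Measurable
          fun x => ‖spaceOp (K i j) (Fp p) (Gk (p * N + (n : ℕ))) x‖ₑ := fun i j =>
        ((hK.isCc i j).continuous_spaceOp (hFpc p) (hGkc _)).enorm.measurable
      calc ∫⁻ x in J n, ‖spaceOp (K 0 0) F G x‖ₑ ≤ ∫⁻ x in J n, 4 * ∑ i, ∑ j,
            ‖spaceOp (K i j) (Fp p) (Gk (p * N + (n : ℕ))) x‖ₑ := by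
            refine setLIntegral_mono' measurableSet_Ico fun x hx => ?_
            have hn : ((n : ℕ) : ℝ) + 1 ≤ N := by exact_mod_cast n.2
            have hn0 : (0 : ℝ) ≤ (n : ℕ) := Nat.cast_nonneg _
            obtain ⟨a1, a2⟩ := hx
            refine hK.enorm_spaceOp_le (by positivity) hℓ hF hFc hG hGc ?_ ?_
            · have b1 : 0 ≤ (n : ℕ) * ℓ := by positivity
              have b2 : ((n : ℕ) + 1) * ℓ ≤ N * ℓ := by gcongr
              rw [abs_of_nonneg (by linarith)]; linarith
            · have e : ((p * N + (n : ℕ) : ℤ) : ℝ) * ℓ = p * (N * ℓ) + (n : ℕ) * ℓ := by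
                push_cast; ring
              rw [e, abs_of_nonneg (by linarith)]; linarith
        _ = _ := by
            rw [lintegral_const_mul _ (measurable_sum _ fun i _ =>
              measurable_sum _ fun j _ => hmeas i j),
              lintegral_finsetSum _ fun i _ => measurable_sum _ fun j _ => hmeas i j]
            congr 2; ext i
            rw [lintegral_finsetSum _ fun j _ => hmeas i j]
    calc ∑ n, ∫⁻ x in J n, ‖spaceOp (K 0 0) F G x‖ₑ
        ≤ ∑ n, 4 * ∑ i, ∑ j, ∫⁻ x in J n, ‖spaceOp (K i j) (Fp p) (Gk (p * N + (n : ℕ))) x‖ₑ :=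
          sum_le_sum fun n _ => hle n
      _ = 4 * ∑ i, ∑ j, ∑ n, ∫⁻ x in J n, ‖spaceOp (K i j) (Fp p) (Gk (p * N + (n : ℕ))) x‖ₑ := by
          rw [← mul_sum, sum_comm]
          congr 2; ext i; rw [sum_comm]
      _ ≤ 4 * ∑ i : Fin 2, ∑ j : Fin 2, B *
            (sqNorm (Fp p) * ∑ n : Fin N, sqNorm (Gk (p * N + (n : ℕ)))) ^ (1 / 2 : ℝ) := by
          gcongr with i _ j _
          exact hB i j (Fp p) (fun n => Gk (p * N + (n : ℕ))) (hFpc p) (fun n => hGkc _) _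
      _ = _ := by simp only [Fin.sum_univ_two]; ring
  have hpart : ∫⁻ x, ‖spaceOp (K 0 0) F G x‖ₑ = ∑' p : ℤ, ∑ n : Fin N,
      ∫⁻ x in Ico (((p * N + (n : ℕ) : ℤ) : ℝ) * ℓ)
        (((p * N + (n : ℕ) : ℤ) + 1 : ℝ) * ℓ), ‖spaceOp (K 0 0) F G x‖ₑ := by
    have h1 := iUnion_Ico_zsmul hℓ
    have h2 := Set.pairwise_disjoint_Ico_zsmul ℓ
    simp only [zsmul_eq_mul, Int.cast_add, Int.cast_one] at h1 h2
    rw [← setLIntegral_univ, ← h1, lintegral_iUnion (fun _ => measurableSet_Ico) h2,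
      ← (Int.divModEquiv N).symm.tsum_eq, tsum_prod']
    congr 1; ext p
    rw [tsum_fintype]
    rfl
  have hGsum : ∑' p : ℤ, ∑ n : Fin N, sqNorm (Gk (p * N + (n : ℕ))) = ∑' k, sqNorm (Gk k) := by
    rw [← (Int.divModEquiv N).symm.tsum_eq (fun k => sqNorm (Gk k)), tsum_prod']
    congr 1; ext p
    rw [tsum_fintype]
    rfl
  rw [hpart]
  calc _ ≤ ∑' p : ℤ, 16 * B *
        (sqNorm (Fp p) * ∑ n : Fin N, sqNorm (Gk (p * N + (n : ℕ)))) ^ (1 / 2 : ℝ) :=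
        tsum_le_tsum hcell
    _ ≤ 16 * B * ((∑' p, sqNorm (Fp p)) *
        ∑' p : ℤ, ∑ n : Fin N, sqNorm (Gk (p * N + (n : ℕ)))) ^ (1 / 2 : ℝ) := by
        rw [ENNReal.tsum_mul_left]; gcongr; exact tsum_sqrt_mul_le _ _
    _ ≤ 16 * B * ((ofReal (2 * gramSum) * sqNorm F) *
        (ofReal (2 * gramSum) * sqNorm G)) ^ (1 / 2 : ℝ) := by
        rw [hGsum]
        gcongr
        · exact tsum_sqNorm_resolventSmooth_le hF hFc (by positivity)
        · exact tsum_sqNorm_resolventSmooth_le hG hGc hℓ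
    _ = _ := by
        rw [mul_mul_mul_comm, mul_rpow_of_nonneg _ _ (by norm_num : (0 : ℝ) ≤ 1 / 2),
          ← sq, ← rpow_two, ← rpow_mul]
        norm_num
        ring

section

variable {α s ι κ a b p₁ p₂ q₁ q₂ : ℝ} {M : ℝ → ℝ → ℝ → ℝ → ℂ}

theorem OscFam.exists_isSmoothKernel (hα : 0 < α) (hM : OscFam α s ι p₁ p₂ q₁ q₂ M)
    (hκ : |κ| = 1) (hab : 1 - a * b ≠ 0) {r₁ r₂ : ℝ → ℝ → ℝ} {B : ℝ}
    (h1 : ∀ L e, 1 ≤ L → |e| ≤ 1 → L ≤ r₁ L e)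
    (h2 : ∀ L e, 1 ≤ L → |e| ≤ 1 → 0 < r₂ L e ∧ L * |a| ≤ B * r₂ L e ∧ L * |e| ≤ B * r₂ L e) :
    ∃ M' : Fin 2 → Fin 2 → ℝ → ℝ → ℝ → ℝ → ℂ, M' 0 0 = M ∧
      (∀ i j, OscFam α s ι p₁ p₂ q₁ q₂ (M' i j)) ∧ ∀ L e, 1 ≤ L → |e| ≤ 1 → e ≠ 0 →
      IsSmoothKernel (r₁ L e) (r₂ L e) fun i j => formKernel κ a b e (M' i j L e) := by
  have r1pos : ∀ L e, 1 ≤ L → |e| ≤ 1 → 0 < r₁ L e := fun L e hL he => by linarith [h1 L e hL he]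
  have hξ : ∀ L e, 1 ≤ L → |e| ≤ 1 → L * |(dirXi κ b e).1| ≤ (1 + |b|) * r₁ L e ∧
      L * |(dirXi κ b e).2| ≤ (1 + |b|) * r₁ L e := by
    intro L e hL he
    have h := h1 L e hL he
    have hL0 : 0 ≤ L := by linarith
    simp only [dirXi, hκ, abs_neg, abs_mul]
    have hb := abs_nonneg b
    have he0 := abs_nonneg e
    have h3 : L * |b| ≤ r₁ L e * |b| := by gcongr
    constructor
    · nlinarith
    · nlinarith [mul_le_mul_of_nonneg_left (mul_le_of_le_one_left hb he) hL0]
  have hη : ∀ L e, 1 ≤ L → |e| ≤ 1 → L * |(dirEta κ a e).1| ≤ B * r₂ L e ∧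
      L * |(dirEta κ a e).2| ≤ B * r₂ L e := by
    intro L e hL he
    simp only [dirEta, abs_neg, abs_mul, hκ, one_mul]
    exact (h2 L e hL he).2
  have r2pos : ∀ L e, 1 ≤ L → |e| ≤ 1 → 0 < r₂ L e := fun L e hL he => (h2 L e hL he).1
  obtain ⟨M₁, hM₁, d₁⟩ := hM.exists_deriv (v := fun _ e => dirXi κ b e) hα r1pos hξ
  obtain ⟨M₂, hM₂, d₂⟩ := hM.exists_deriv (v := fun _ e => dirEta κ a e) hα r2pos hη
  obtain ⟨M₃, hM₃, d₃⟩ := hM₁.exists_deriv (v := fun _ e => dirEta κ a e) hα r2pos hη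
  refine ⟨![![M, M₂], ![M₁, M₃]], rfl, ?_, fun L e hL he he0 => ⟨?_, ?_, ?_⟩⟩
  · intro i j
    fin_cases i <;> fin_cases j
    exacts [hM, hM₂, hM₁, hM₃]
  · intro i j
    fin_cases i <;> fin_cases j
    exacts [hM.isCcKernel hα hκ hab he0 L, hM₂.isCcKernel hα hκ hab he0 L,
      hM₁.isCcKernel hα hκ hab he0 L, hM₃.isCcKernel hα hκ hab he0 L]
  · intro ξ η
    have e1 : ∀ ξ, formP κ a ξ η = -(κ * a * η) + (dirXi κ b e).1 * ξ := by
      intro ξ; simp only [formP, dirXi]; ring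
    have e2 : ∀ ξ, formQ e b ξ η = e * η + (dirXi κ b e).2 * ξ := by
      intro ξ; simp only [formQ, dirXi]; ring
    simp only [formKernel, e1, e2]
    exact d₁ L e hL he _ _ ξ
  · intro i ξ η
    have e1 : ∀ η, formP κ a ξ η = κ * ξ + (dirEta κ a e).1 * η := by
      intro ξ; simp only [formP, dirEta]; ring
    have e2 : ∀ η, formQ e b ξ η = -(e * b * ξ) + (dirEta κ a e).2 * η := by
      intro ξ; simp only [formQ, dirEta]; ring
    simp only [formKernel, e1, e2]
    fin_cases i
    exacts [d₂ L e hL he _ _ η, d₃ L e hL he _ _ η]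

theorem spaceOp_add {K K' : ℝ → ℝ → ℂ} (hK : IsCcKernel K) (hK' : IsCcKernel K') {F G : ℝ → ℂ}
    (hF : Continuous F) (hG : Continuous G) (x : ℝ) :
    spaceOp (fun ξ η => K ξ η + K' ξ η) F G x = spaceOp K F G x + spaceOp K' F G x := by
  have k1 := hK.spaceOp_kernel hF hG x
  have k2 := hK'.spaceOp_kernel hF hG x
  unfold spaceOp
  rw [← integral_add k1.integrable_integral k2.integrable_integral]
  congr 1; ext ξ
  rw [← integral_add (k1.integrable_right ξ) (k2.integrable_right ξ)]
  congr 1; ext η; ring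

theorem spaceOp_const_mul (K : ℝ → ℝ → ℂ) (F G : ℝ → ℂ) (c : ℂ) (x : ℝ) :
    spaceOp (fun ξ η => c * K ξ η) F G x = c * spaceOp K F G x := by
  unfold spaceOp
  rw [← integral_const_mul]
  congr 1; ext ξ
  rw [← integral_const_mul]
  congr 1; ext η; ring

theorem LocalBound.add {ℓ : ℝ} {N : ℕ} {B B' : ℝ≥0∞} {K K' : ℝ → ℝ → ℂ} (hK : IsCcKernel K)
    (hK' : IsCcKernel K') (h : LocalBound ℓ N B K) (h' : LocalBound ℓ N B' K') :
    LocalBound ℓ N (B + B') fun ξ η => K ξ η + K' ξ η := by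
  intro F G hF hG y
  rw [add_mul]
  refine le_trans ?_ (add_le_add (h F G hF hG y) (h' F G hF hG y))
  rw [← sum_add_distrib]
  refine sum_le_sum fun n _ => ?_
  rw [← lintegral_add_left (hK.continuous_spaceOp hF (hG n)).enorm.measurable]
  refine lintegral_mono fun x => ?_
  rw [spaceOp_add hK hK' hF (hG n)]
  exact enorm_add_le _ _

theorem LocalBound.const_mul {ℓ : ℝ} {N : ℕ} {B : ℝ≥0∞} {K : ℝ → ℝ → ℂ} (h : LocalBound ℓ N B K)
    (c : ℂ) : LocalBound ℓ N (‖c‖ₑ * B) fun ξ η => c * K ξ η := by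
  intro F G hF hG y
  rw [mul_assoc]
  refine le_trans (le_of_eq ?_) (mul_le_mul_right (h F G hF hG y) ‖c‖ₑ)
  rw [mul_sum]
  refine sum_congr rfl fun n _ => ?_
  rw [← lintegral_const_mul' _ _ (by simp)]
  refine lintegral_congr fun x => ?_
  rw [spaceOp_const_mul, enorm_mul]

theorem LocalBound.mono {ℓ : ℝ} {N : ℕ} {B B' : ℝ≥0∞} {K : ℝ → ℝ → ℂ} (h : LocalBound ℓ N B K)
    (hB : B ≤ B') : LocalBound ℓ N B' K := fun F G hF hG y =>
  (h F G hF hG y).trans (by gcongr)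

/-- Local estimates for the oscillatory integrals give global estimates for the whole class. -/
theorem OscFam.exists_spaceBound (hα : 0 < α) (hM : OscFam α s ι p₁ p₂ q₁ q₂ M)
    (hκ : |κ| = 1) (hab : 1 - a * b ≠ 0) {reg : ℝ → ℝ → Prop}
    (hreg : ∀ L e, reg L e → 1 ≤ L ∧ |e| ≤ 1 ∧ e ≠ 0) {N : ℝ → ℝ → ℕ} {ℓ : ℝ → ℝ → ℝ} {A : ℝ}
    (h1 : ∀ L e, 1 ≤ L → |e| ≤ 1 → L ≤ N L e * ℓ L e)
    (h2 : ∀ L e, 1 ≤ L → |e| ≤ 1 → 0 < ℓ L e ∧ L * |a| ≤ A * ℓ L e ∧ L * |e| ≤ A * ℓ L e)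
    {β : ℝ → ℝ} (hβ : ∀ L, 1 ≤ L → 0 ≤ β L)
    (hbase : ∀ ρ χ₁ χ₂ : ℝ → ℂ, IsPosBump ρ → IsBoxBump p₁ p₂ χ₁ → IsBoxBump q₁ q₂ χ₂ →
      ∃ C : ℝ, 0 ≤ C ∧ ∀ L e, reg L e → LocalBound (ℓ L e) (N L e) (ofReal (C * β L))
        (formKernel κ a b e (oscMul α s ι ρ χ₁ χ₂ L))) :
    ∃ C : ℝ, 0 ≤ C ∧ ∀ L e, reg L e →
      SpaceBound (ofReal (C * β L)) (formKernel κ a b e (M L e)) := by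
  have hlocal : ∀ M, OscFam α s ι p₁ p₂ q₁ q₂ M → ∃ C : ℝ, 0 ≤ C ∧ ∀ L e, reg L e →
      LocalBound (ℓ L e) (N L e) (ofReal (C * β L)) (formKernel κ a b e (M L e)) := by
    intro M hM
    induction hM with
    | base hρ hχ₁ hχ₂ => exact hbase _ _ _ hρ hχ₁ hχ₂
    | add hM hM' h h' =>
      obtain ⟨C, hC0, hC⟩ := h
      obtain ⟨C', hC0', hC'⟩ := h'
      refine ⟨C + C', by positivity, fun L e hr => ?_⟩
      obtain ⟨hL, he, he0⟩ := hreg L e hr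
      have hb := hβ L hL
      rw [add_mul, ofReal_add (by positivity) (by positivity)]
      exact (hC L e hr).add (hM.isCcKernel hα hκ hab he0 L) (hM'.isCcKernel hα hκ hab he0 L)
        (hC' L e hr)
    | smul c B hc hM h =>
      obtain ⟨C, hC0, hC⟩ := h
      refine ⟨|B| * C, by positivity, fun L e hr => ?_⟩
      obtain ⟨hL, he, he0⟩ := hreg L e hr
      refine ((hC L e hr).const_mul (c L e)).mono ?_
      rw [mul_assoc, ofReal_mul (abs_nonneg B), ← ofReal_norm]
      gcongr
      exact (hc L e hL he).trans (le_abs_self B)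
  obtain ⟨M', hM0, hM', hsm⟩ := hM.exists_isSmoothKernel hα hκ hab h1 h2
  choose C hC0 hC using fun i j => hlocal (M' i j) (hM' i j)
  refine ⟨16 * (∑ i, ∑ j, C i j) * (2 * gramSum), ?_, fun L e hr => ?_⟩
  · have := gramSum_nonneg
    have : 0 ≤ ∑ i, ∑ j, C i j := sum_nonneg fun i _ => sum_nonneg fun j _ => hC0 i j
    positivity
  obtain ⟨hL, he, he0⟩ := hreg L e hr
  have hsmk := hsm L e hL he he0
  have hb := hβ L hL
  have hN : N L e ≠ 0 := by
    intro h0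
    have := h1 L e hL he
    rw [h0, Nat.cast_zero, zero_mul] at this
    linarith
  have hle : ∀ i j, C i j ≤ ∑ i, ∑ j, C i j := fun i j =>
    (Finset.single_le_sum (f := fun j => C i j) (fun j _ => hC0 i j) (mem_univ j)).trans
      (Finset.single_le_sum (f := fun i => ∑ j, C i j)
        (fun i _ => sum_nonneg fun j _ => hC0 i j) (mem_univ i))
  have := hsmk.spaceBound hN (h2 L e hL he).1 (B := ofReal ((∑ i, ∑ j, C i j) * β L))
    (fun i j => (hC i j L e hr).mono (ofReal_le_ofReal (by gcongr; exact hle i j)))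
  rw [hM0] at this
  refine this.mono (le_of_eq ?_)
  have g0 := gramSum_nonneg
  have s0 : 0 ≤ ∑ i, ∑ j, C i j := sum_nonneg fun i _ => sum_nonneg fun j _ => hC0 i j
  rw [← ENNReal.ofReal_ofNat, ← ofReal_mul (by positivity), ← ofReal_mul (by positivity)]
  congr 1; ring

/-- An `L²` bound localises by the Cauchy–Schwarz inequality. -/
theorem localBound_of_freqBound {ℓ B : ℝ} (hℓ : 0 ≤ ℓ) (hB : 0 ≤ B) {K : ℝ → ℝ → ℂ}
    (hK : IsCcKernel K) (h : FreqBound (ofReal B) K) :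
    LocalBound ℓ 1 (ofReal √(ℓ * (2 * pi * B))) K := by
  intro F G hF hG y
  simp only [Finset.univ_unique, Finset.sum_singleton]
  refine ENNReal_le_of_sq_le ?_
  have hm : Measurable fun x => ‖spaceOp K F (G 0) x‖ₑ :=
    (hK.continuous_spaceOp hF (hG 0)).enorm.measurable
  have h1 := lintegral_mul_sq_le (μ := volume.restrict
    (Ico (y + ((0 : Fin 1) : ℕ) * ℓ) (y + (((0 : Fin 1) : ℕ) + 1) * ℓ))) (f := fun _ => 1)
    (g := fun x => ‖spaceOp K F (G 0) x‖ₑ) aemeasurable_const hm.aemeasurable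
  simp only [one_mul, one_pow, lintegral_const, Measure.restrict_apply MeasurableSet.univ,
    Set.univ_inter, Real.volume_Ico] at h1
  refine h1.trans ?_
  rw [mul_pow, sq_rpow_half, ← ofReal_pow (sqrt_nonneg _),
    sq_sqrt (by positivity), ofReal_mul hℓ, ofReal_mul (by positivity), mul_assoc, mul_assoc]
  have e : y + (((0 : Fin 1) : ℕ) + 1) * ℓ - (y + ((0 : Fin 1) : ℕ) * ℓ) = ℓ := by ring
  rw [e]
  gcongr
  refine (setLIntegral_le_lintegral _ _).trans ?_
  rw [hK.lintegral_spaceOp_sq hF (hG 0)]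
  gcongr
  exact h F (G 0) hF (hG 0)

theorem sqrt_bookkeeping {L C : ℝ} (hL : 1 ≤ L) (hC : 0 ≤ C) :
    √(L * (2 * pi * (C * L ^ (-(41 / 40) : ℝ)))) = √(2 * pi * C) * L ^ (-(1 / 80) : ℝ) := by
  have hL0 : 0 < L := by linarith
  have e : L * (2 * pi * (C * L ^ (-(41 / 40) : ℝ))) =
      (2 * pi * C) * (L ^ (-(1 / 80) : ℝ)) ^ 2 := by
    have : (L ^ (-(1 / 80) : ℝ)) ^ 2 = L * L ^ (-(41 / 40) : ℝ) := by
      rw [← rpow_natCast, ← Real.rpow_mul hL0.le]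
      nth_rewrite 2 [← rpow_one L]
      rw [← rpow_add hL0]; norm_num
    rw [this]; ring
  rw [e, sqrt_mul (by positivity), Real.sqrt_sq (by positivity)]

/-- A bound on the frequency side is localised to cells of length `L`. -/
theorem OscFam.exists_spaceBound_of_freqBound (hα : 0 < α) (hM : OscFam α s ι p₁ p₂ q₁ q₂ M)
    (hκ : |κ| = 1) (hab : 1 - a * b ≠ 0) {reg : ℝ → ℝ → Prop}
    (hreg : ∀ L e, reg L e → 1 ≤ L ∧ |e| ≤ 1 ∧ e ≠ 0)
    (hbase : ∀ ρ χ₁ χ₂ : ℝ → ℂ, IsPosBump ρ → IsBoxBump p₁ p₂ χ₁ → IsBoxBump q₁ q₂ χ₂ →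
      ∃ C : ℝ, 0 < C ∧ ∀ L e, reg L e → FreqBound (ofReal (C * L ^ (-(41 / 40) : ℝ)))
        (formKernel κ a b e (oscMul α s ι ρ χ₁ χ₂ L))) :
    ∃ C : ℝ, 0 ≤ C ∧ ∀ L e, reg L e →
      SpaceBound (ofReal (C * L ^ (-(1 / 80) : ℝ))) (formKernel κ a b e (M L e)) := by
  refine hM.exists_spaceBound hα hκ hab (N := fun _ _ => 1) (ℓ := fun L _ => L) (A := |a| + 1)
    hreg (fun L e _ _ => by simp) (fun L e hL he => ⟨by linarith, ?_, ?_⟩)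
    (fun L hL => by positivity) fun ρ χ₁ χ₂ hρ hχ₁ hχ₂ => ?_
  · nlinarith [abs_nonneg a]
  · nlinarith [abs_nonneg a, mul_nonneg (abs_nonneg a) (by linarith : (0 : ℝ) ≤ L)]
  · obtain ⟨C, hC0, hC⟩ := hbase ρ χ₁ χ₂ hρ hχ₁ hχ₂
    refine ⟨√(2 * pi * C), sqrt_nonneg _, fun L e hr => ?_⟩
    obtain ⟨hL, -, he0⟩ := hreg L e hr
    rw [← sqrt_bookkeeping hL hC0.le]
    exact localBound_of_freqBound (by linarith) (by positivity)
      ((OscFam.base hρ hχ₁ hχ₂).isCcKernel hα hκ hab he0 L) (hC L e hr)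

/-- The single scale estimate for kernels with a nondegenerate mixed derivative. -/
theorem exists_spaceBound_of_mixSize (hα : 0 < α) (hα1 : α ≠ 1)
    (hab : AdmissibleForms α a b) (hκ : |κ| = 1) (hp : 0 < p₁) (hpp : p₁ ≤ p₂) (hq : 0 < q₁)
    (hqq : q₁ ≤ q₂) (hs : |s| = 1) :
    ∃ e₀ : ℝ, 0 < e₀ ∧ e₀ ≤ 1 ∧ ∀ M, OscFam α s 1 p₁ p₂ q₁ q₂ M → ∃ C : ℝ, 0 ≤ C ∧
      ∀ L e, (1 ≤ L ∧ e ≠ 0 ∧ |e| ≤ e₀ ∧ L ^ (-(4 / 5) : ℝ) ≤ mixSize a e) →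
      SpaceBound (ofReal (C * L ^ (-(1 / 80) : ℝ))) (formKernel κ a b e (M L e)) := by
  obtain ⟨e₀, he₀, he₀1, hE⟩ := exists_freqBound_stationary hα hα1 hab hκ hp hpp hq hqq hs
  refine ⟨e₀, he₀, he₀1, fun M hM => hM.exists_spaceBound_of_freqBound hα hκ
    hab.one_sub_mul_ne_zero (fun L e h => ⟨h.1, h.2.2.1.trans he₀1, h.2.1⟩)
    fun ρ χ₁ χ₂ hρ hχ₁ hχ₂ => ?_⟩
  obtain ⟨C, hC0, hC⟩ := hE ρ χ₁ χ₂ hρ hχ₁ hχ₂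
  exact ⟨C, hC0, fun L e ⟨hL, he0, he, hm⟩ => hC L e hL he0 he hm⟩

/-- The single scale estimate for kernels without critical point. -/
theorem exists_spaceBound_nonstationary (hα : 0 < α) (ha : a ≠ -1)
    (hD1 : 1 - a * b ≠ 0) (hκ : |κ| = 1) (hp : 0 < p₁) (hq : 0 < q₁) (hs : |s| = 1)
    (hM : OscFam α s (-1) p₁ p₂ q₁ q₂ M) : ∃ C : ℝ, 0 ≤ C ∧
      ∀ L e, (1 ≤ L ∧ e ≠ 0 ∧ |e| ≤ 1) →
      SpaceBound (ofReal (C * L ^ (-(1 / 80) : ℝ))) (formKernel κ a b e (M L e)) := by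
  refine hM.exists_spaceBound_of_freqBound hα hκ hD1 (fun L e h => ⟨h.1, h.2.2, h.2.1⟩)
    fun ρ χ₁ χ₂ hρ hχ₁ hχ₂ => ?_
  obtain ⟨C, hC0, hC⟩ := exists_freqBound_nonstationary hα ha hD1 hκ hp hq hs hρ hχ₁ hχ₂
  exact ⟨C, hC0, fun L e ⟨hL, he0, _⟩ => hC L e hL he0⟩

end

/-! ### Freezing one space variable -/

/-- The `ξ`-integral of the bilinear operator. -/
def partialOp (K : ℝ → ℝ → ℂ) (F : ℝ → ℂ) (z η : ℝ) : ℂ :=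
  ∫ ξ, F ξ * K ξ η * expI(ξ * z)

/-- The bilinear operator with separate space variables for the two functions. -/
def mixOp (K : ℝ → ℝ → ℂ) (F G : ℝ → ℂ) (z x : ℝ) : ℂ :=
  ∫ p : ℝ × ℝ, F p.1 * G p.2 * K p.1 p.2 * expI(p.1 * z + p.2 * x)

/-- Samples of `partialOp` at the points `y + n ℓ` are almost orthogonal. -/
def SampleBound (p ℓ : ℝ) (N : ℕ) (R : ℝ≥0∞) (K : ℝ → ℝ → ℂ) : Prop :=
  ∀ F : ℝ → ℂ, Continuous F → ∀ (y : ℝ) (η : Fin N → ℝ),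
    ∑ n : Fin N, ‖partialOp K F (y + (n : ℕ) * ℓ) (η n)‖ₑ ^ 2 ≤ R * ∫⁻ ξ in Icc (-p) p, ‖F ξ‖ₑ ^ 2

section

variable {K : ℝ → ℝ → ℂ} {F G : ℝ → ℂ}

theorem IsCcKernel.mixOp_kernel (hK : IsCcKernel K) (hF : Continuous F) (hG : Continuous G)
    (z x : ℝ) : IsCcKernel fun ξ η => F ξ * G η * K ξ η * expI(ξ * z + η * x) := by
  have := hK.mul_left (f := fun ξ η => F ξ * G η * expI(ξ * z + η * x)) (by fun_prop)
  convert this using 3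
  ring

theorem IsCcKernel.spaceOp_eq_mixOp (hK : IsCcKernel K) (hF : Continuous F) (hG : Continuous G)
    (x : ℝ) : spaceOp K F G x = mixOp K F G x x := by
  rw [mixOp, Measure.volume_eq_prod, integral_prod _ (hK.mixOp_kernel hF hG x x).integrable,
    spaceOp]
  simp only [add_mul]

theorem IsCcKernel.mixOp_eq (hK : IsCcKernel K) (hF : Continuous F) (hG : Continuous G)
    (z x : ℝ) : mixOp K F G z x = ∫ η, G η * partialOp K F z η * expI(η * x) := by
  rw [mixOp, Measure.volume_eq_prod, integral_prod_symm _ (hK.mixOp_kernel hF hG z x).integrable]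
  congr 1; ext η
  rw [partialOp, ← integral_const_mul, ← integral_mul_const]
  congr 1; ext ξ
  simp only [Complex.ofReal_add, mul_add, exp_add]
  ring

theorem IsCcKernel.partialOp_kernel (hK : IsCcKernel K) (hF : Continuous F) (z : ℝ) :
    IsCcKernel fun η ξ => F ξ * K ξ η * expI(ξ * z) := by
  have := hK.swap.mul_left (f := fun _ ξ => F ξ * expI(ξ * z)) (by fun_prop)
  convert this using 3
  ring

theorem IsCcKernel.continuous_partialOp (hK : IsCcKernel K) (hF : Continuous F) (z : ℝ) :
    Continuous (partialOp K F z) := (hK.partialOp_kernel hF z).continuous_integral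

theorem IsCcKernel.hasCompactSupport_partialOp (hK : IsCcKernel K) (hF : Continuous F) (z : ℝ) :
    HasCompactSupport (partialOp K F z) := (hK.partialOp_kernel hF z).hasCompactSupport_integral

theorem IsCcKernel.continuous_mixOp (hK : IsCcKernel K) (hF : Continuous F) (hG : Continuous G) :
    Continuous fun q : ℝ × ℝ => mixOp K F G q.1 q.2 := by
  obtain ⟨R, hR0, hR⟩ := hK.bdd
  have hc := hK.cont
  have h := continuous_parametric_integral_of_continuous (μ := volume)
    (f := fun (q : ℝ × ℝ) (p : ℝ × ℝ) => F p.1 * G p.2 * K p.1 p.2 * expI(p.1 * q.1 + p.2 * q.2))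
    (by
      have : Continuous fun r : (ℝ × ℝ) × ℝ × ℝ => K r.2.1 r.2.2 := hc.comp continuous_snd
      unfold Function.uncurry
      fun_prop)
    (isCompact_closedBall (0 : ℝ × ℝ) R)
  refine h.congr fun q => ?_
  refine setIntegral_eq_integral_of_forall_compl_eq_zero fun p hp => ?_
  rw [hR p.1 p.2, mul_zero, zero_mul]
  simpa [Prod.norm_def, -not_or, or_iff_not_imp_left] using hp

theorem lintegral_fourierExp_sq_le {H : ℝ → ℂ} (hH : Continuous H) (hc : HasCompactSupport H) :
    ∫⁻ x, ‖∫ η, H η * expI(η * x)‖ₑ ^ 2 = ofReal (2 * pi) * ∫⁻ η, ‖H η‖ₑ ^ 2 := by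
  rw [← lintegral_fourier_sq (hH.integrable_of_hasCompactSupport hc)
    (hH.memLp_of_hasCompactSupport hc)]
  have hne : -(1 / (2 * pi)) ≠ 0 := by have := pi_ne_zero; simp [this]
  rw [lintegral_comp_mul_left hne (fun w => ‖𝓕 H w‖ₑ ^ 2), ← mul_assoc,
    ← ofReal_mul (by positivity), abs_neg, abs_of_pos (by positivity),
    mul_one_div_cancel (by positivity), ofReal_one, one_mul]
  congr 1; ext x
  rw [Real.fourier_real_eq_integral_exp_smul]
  congr 2
  congr 1; ext s
  rw [smul_eq_mul, mul_comm]
  congr 2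
  have : pi ≠ 0 := pi_ne_zero
  rw [mul_comm I]
  congr 2
  field_simp

theorem IsCcKernel.hasDerivAt_mixOp (hK : IsCcKernel K) (hF : Continuous F) (hG : Continuous G)
    (z x : ℝ) : HasDerivAt (fun z => mixOp K F G z x) (mixOp K (fun ξ => I * ξ * F ξ) G z x) z := by
  have hF' : Continuous fun ξ : ℝ => I * ξ * F ξ := by fun_prop
  refine (hasDerivAt_integral_of_dominated_loc_of_deriv_le (s := univ)
    (F := fun z (p : ℝ × ℝ) => F p.1 * G p.2 * K p.1 p.2 * expI(p.1 * z + p.2 * x))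
    (F' := fun z (p : ℝ × ℝ) => (I * p.1 * F p.1) * G p.2 * K p.1 p.2 * expI(p.1 * z + p.2 * x))
    (bound := fun p => ‖(I * p.1 * F p.1) * G p.2 * K p.1 p.2 * expI(p.1 * 0 + p.2 * 0)‖)
    univ_mem ?_ ?_ ?_ ?_ ?_ ?_).2
  · filter_upwards with z'
    exact (hK.mixOp_kernel hF hG z' x).integrable.aestronglyMeasurable
  · exact (hK.mixOp_kernel hF hG z x).integrable
  · exact (hK.mixOp_kernel hF' hG z x).integrable.aestronglyMeasurable
  · filter_upwards with p z' _
    simp only [norm_mul (_ * _ * _) (exp _), norm_expI]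
    exact le_rfl
  · exact (hK.mixOp_kernel hF' hG 0 0).integrable.norm
  · filter_upwards with p z' _
    have : HasDerivAt (fun z => p.1 * z + p.2 * x) p.1 z' := by
      simpa using ((hasDerivAt_id z').const_mul p.1).add_const (p.2 * x)
    exact ((hasDerivAt_exp_I_mul this).const_mul _).congr_deriv (by ring)

theorem IsCcKernel.enorm_spaceOp_le_mixOp (hK : IsCcKernel K) (hF : Continuous F)
    (hG : Continuous G) {x z ℓ : ℝ} (hx : x ∈ Ico z (z + ℓ)) :
    ‖spaceOp K F G x‖ₑ ≤ ‖mixOp K F G z x‖ₑ +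
      ∫⁻ t in Ioc 0 ℓ, ‖mixOp K (fun ξ => I * ξ * F ξ) G (z + t) x‖ₑ := by
  have hF' : Continuous fun ξ : ℝ => I * ξ * F ξ := by fun_prop
  set D : ℝ → ℂ := fun t => mixOp K (fun ξ => I * ξ * F ξ) G (z + t) x
  have hDc : Continuous D :=
    (hK.continuous_mixOp hF' hG).comp (f := fun t : ℝ => (z + t, x)) (by fun_prop)
  have h := integral_eq_sub_of_hasDerivAt (a := 0) (b := x - z)
    (f := fun t => mixOp K F G (z + t) x) (f' := D)
    (fun t _ => (hK.hasDerivAt_mixOp hF hG (z + t) x).comp_const_add z t)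
    (hDc.intervalIntegrable _ _)
  simp only [add_sub_cancel, add_zero] at h
  have hx0 : 0 ≤ x - z := by linarith [hx.1]
  rw [hK.spaceOp_eq_mixOp hF hG, ← sub_add_cancel (mixOp K F G x x) (mixOp K F G z x), ← h,
    integral_of_le hx0, add_comm]
  refine (enorm_add_le _ _).trans ?_
  gcongr
  refine (enorm_integral_le_lintegral_enorm _).trans (lintegral_mono_set ?_)
  exact Set.Ioc_subset_Ioc_right (by linarith [hx.2])

/-- The bilinear operator with the first space variable frozen at the sample points. -/
theorem sum_lintegral_mixOp_le (hK : IsCcKernel K) {p ℓ : ℝ} {N : ℕ} {R : ℝ≥0∞}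
    (hS : SampleBound p ℓ N R K) (hF : Continuous F) {G : Fin N → ℝ → ℂ}
    (hG : ∀ n, Continuous (G n)) (y y' : ℝ) :
    ∑ n : Fin N, ∫⁻ x in Ico (y' + (n : ℕ) * ℓ) (y' + ((n : ℕ) + 1) * ℓ),
      ‖mixOp K F (G n) (y + (n : ℕ) * ℓ) x‖ₑ ≤
      (ofReal ℓ * ofReal (2 * pi) * R) ^ (1 / 2 : ℝ) *
        ((∫⁻ ξ in Icc (-p) p, ‖F ξ‖ₑ ^ 2) * ∑ n, sqNorm (G n)) ^ (1 / 2 : ℝ) := by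
  have hmax : ∀ n : Fin N, ∃ η₀, ∀ η, ‖partialOp K F (y + (n : ℕ) * ℓ) η‖ ≤
      ‖partialOp K F (y + (n : ℕ) * ℓ) η₀‖ := fun n =>
    (hK.continuous_partialOp hF _).norm.exists_forall_ge_of_hasCompactSupport
      (hK.hasCompactSupport_partialOp hF _).norm
  choose η₀ hη₀ using hmax
  set S : Fin N → ℝ≥0∞ := fun n => ‖partialOp K F (y + (n : ℕ) * ℓ) (η₀ n)‖ₑ ^ 2 with hSdef
  have hone : ∀ n : Fin N, ∫⁻ x in Ico (y' + (n : ℕ) * ℓ) (y' + ((n : ℕ) + 1) * ℓ),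
      ‖mixOp K F (G n) (y + (n : ℕ) * ℓ) x‖ₑ ≤
      (ofReal ℓ * ofReal (2 * pi)) ^ (1 / 2 : ℝ) * (S n * sqNorm (G n)) ^ (1 / 2 : ℝ) := by
    intro n
    refine ENNReal_le_of_sq_le ?_
    have hm : Measurable fun x => ‖mixOp K F (G n) (y + (n : ℕ) * ℓ) x‖ₑ :=
      ((hK.continuous_mixOp hF (hG n)).comp
        (f := fun x : ℝ => (y + (n : ℕ) * ℓ, x)) (by fun_prop)).enorm.measurable
    have h1 := lintegral_mul_sq_le (μ := volume.restrict
      (Ico (y' + (n : ℕ) * ℓ) (y' + ((n : ℕ) + 1) * ℓ))) (f := fun _ => 1)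
      (g := fun x => ‖mixOp K F (G n) (y + (n : ℕ) * ℓ) x‖ₑ) aemeasurable_const hm.aemeasurable
    simp only [one_mul, one_pow, lintegral_const, Measure.restrict_apply MeasurableSet.univ,
      Set.univ_inter, Real.volume_Ico] at h1
    refine h1.trans ?_
    rw [mul_pow, sq_rpow_half, sq_rpow_half, mul_assoc,
      show y' + ((n : ℕ) + 1) * ℓ - (y' + (n : ℕ) * ℓ) = ℓ by ring]
    gcongr
    refine (setLIntegral_le_lintegral _ _).trans ?_
    simp only [hK.mixOp_eq hF (hG n)]
    rw [lintegral_fourierExp_sq_le (H := fun η => G n η * partialOp K F (y + (n : ℕ) * ℓ) η)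
      ((hG n).mul (hK.continuous_partialOp hF _)) (hK.hasCompactSupport_partialOp hF _).mul_left]
    gcongr
    calc ∫⁻ η, ‖G n η * partialOp K F (y + (n : ℕ) * ℓ) η‖ₑ ^ 2
        ≤ ∫⁻ η, S n * ‖G n η‖ₑ ^ 2 := by
          refine lintegral_mono fun η => ?_
          rw [enorm_mul, mul_pow, mul_comm]
          gcongr
          simp only [hSdef]
          rw [← ofReal_norm, ← ofReal_norm]
          gcongr
          exact hη₀ n η
      _ = S n * sqNorm (G n) := lintegral_const_mul _ ((hG n).enorm.measurable.pow_const 2)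
  calc _ ≤ ∑ n, (ofReal ℓ * ofReal (2 * pi)) ^ (1 / 2 : ℝ) *
        (S n * sqNorm (G n)) ^ (1 / 2 : ℝ) := sum_le_sum fun n _ => hone n
    _ ≤ (ofReal ℓ * ofReal (2 * pi)) ^ (1 / 2 : ℝ) *
        ((∑ n, S n) * ∑ n, sqNorm (G n)) ^ (1 / 2 : ℝ) := by
        rw [← mul_sum]
        gcongr
        simpa only [tsum_fintype] using tsum_sqrt_mul_le S (fun n => sqNorm (G n))
    _ ≤ (ofReal ℓ * ofReal (2 * pi)) ^ (1 / 2 : ℝ) *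
        ((R * ∫⁻ ξ in Icc (-p) p, ‖F ξ‖ₑ ^ 2) * ∑ n, sqNorm (G n)) ^ (1 / 2 : ℝ) := by
        gcongr
        exact hS F hF y η₀
    _ = _ := by
        rw [← mul_rpow_of_nonneg _ _ (by norm_num : (0 : ℝ) ≤ 1 / 2),
          ← mul_rpow_of_nonneg _ _ (by norm_num : (0 : ℝ) ≤ 1 / 2)]
        congr 1; ring

/-- Almost orthogonality of the samples implies the local estimate. -/
theorem SampleBound.localBound (hK : IsCcKernel K) {p ℓ : ℝ} (hℓ : 0 ≤ ℓ) {N : ℕ}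
    {R : ℝ≥0∞} (hS : SampleBound p ℓ N R K) :
    LocalBound ℓ N ((1 + ofReal (ℓ * p)) * (ofReal ℓ * ofReal (2 * pi) * R) ^ (1 / 2 : ℝ)) K := by
  intro F G hF hG y
  have hF' : Continuous fun ξ : ℝ => I * ξ * F ξ := by fun_prop
  set X := (ofReal ℓ * ofReal (2 * pi) * R) ^ (1 / 2 : ℝ)
  set J : Fin N → Set ℝ := fun n => Ico (y + (n : ℕ) * ℓ) (y + ((n : ℕ) + 1) * ℓ)
  have hFb : ∫⁻ ξ in Icc (-p) p, ‖F ξ‖ₑ ^ 2 ≤ sqNorm F := setLIntegral_le_lintegral _ _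
  have hFb' : ∫⁻ ξ in Icc (-p) p, ‖I * ξ * F ξ‖ₑ ^ 2 ≤ ofReal p ^ 2 * sqNorm F := by
    calc _ ≤ ∫⁻ ξ in Icc (-p) p, ofReal p ^ 2 * ‖F ξ‖ₑ ^ 2 := by
          refine setLIntegral_mono' measurableSet_Icc fun ξ hξ => ?_
          rw [enorm_mul, mul_pow]
          gcongr
          rw [← ofReal_norm, norm_mul, norm_I, one_mul, norm_real]
          exact ofReal_le_ofReal (abs_le.2 hξ)
      _ = ofReal p ^ 2 * ∫⁻ ξ in Icc (-p) p, ‖F ξ‖ₑ ^ 2 :=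
          lintegral_const_mul _ (hF.enorm.measurable.pow_const 2)
      _ ≤ _ := by gcongr
  have hm : ∀ n, Measurable fun q : ℝ × ℝ =>
      ‖mixOp K (fun ξ => I * ξ * F ξ) (G n) (y + (n : ℕ) * ℓ + q.2) q.1‖ₑ := fun n =>
    ((hK.continuous_mixOp hF' (hG n)).comp
      (f := fun q : ℝ × ℝ => (y + (n : ℕ) * ℓ + q.2, q.1)) (by fun_prop)).enorm.measurable
  have h1 : ∀ n, ∫⁻ x in J n, ‖spaceOp K F (G n) x‖ₑ ≤
      (∫⁻ x in J n, ‖mixOp K F (G n) (y + (n : ℕ) * ℓ) x‖ₑ) + ∫⁻ t in Ioc 0 ℓ, ∫⁻ x in J n,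
        ‖mixOp K (fun ξ => I * ξ * F ξ) (G n) (y + t + (n : ℕ) * ℓ) x‖ₑ := by
    intro n
    have hm0 : Measurable fun x => ‖mixOp K F (G n) (y + (n : ℕ) * ℓ) x‖ₑ :=
      ((hK.continuous_mixOp hF (hG n)).comp
        (f := fun x : ℝ => (y + (n : ℕ) * ℓ, x)) (by fun_prop)).enorm.measurable
    have e : ∀ t, y + t + (n : ℕ) * ℓ = y + (n : ℕ) * ℓ + t := fun t => by ring
    simp only [e]
    rw [← lintegral_lintegral_swap (hm n).aemeasurable, ← lintegral_add_left hm0]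
    refine setLIntegral_mono' measurableSet_Ico fun x hx => ?_
    refine hK.enorm_spaceOp_le_mixOp hF (hG n) ⟨hx.1, ?_⟩
    have := hx.2
    linarith
  have hpow : ∀ c S : ℝ≥0∞, (c ^ 2 * sqNorm F * S) ^ (1 / 2 : ℝ) =
      c * (sqNorm F * S) ^ (1 / 2 : ℝ) := by
    intro c S
    rw [mul_assoc, mul_rpow_of_nonneg _ _ (by norm_num : (0 : ℝ) ≤ 1 / 2), ← rpow_two, ← rpow_mul]
    norm_num
  calc ∑ n, ∫⁻ x in J n, ‖spaceOp K F (G n) x‖ₑ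
      ≤ ∑ n, ((∫⁻ x in J n, ‖mixOp K F (G n) (y + (n : ℕ) * ℓ) x‖ₑ) + ∫⁻ t in Ioc 0 ℓ, ∫⁻ x in J n,
        ‖mixOp K (fun ξ => I * ξ * F ξ) (G n) (y + t + (n : ℕ) * ℓ) x‖ₑ) :=
        sum_le_sum fun n _ => h1 n
    _ = (∑ n, ∫⁻ x in J n, ‖mixOp K F (G n) (y + (n : ℕ) * ℓ) x‖ₑ) +
        ∫⁻ t in Ioc 0 ℓ, ∑ n, ∫⁻ x in J n,
        ‖mixOp K (fun ξ => I * ξ * F ξ) (G n) (y + t + (n : ℕ) * ℓ) x‖ₑ := by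
        rw [sum_add_distrib, lintegral_finsetSum]
        intro n _
        have e : ∀ t, y + t + (n : ℕ) * ℓ = y + (n : ℕ) * ℓ + t := fun t => by ring
        simp only [e]
        exact (hm n).comp measurable_swap |>.lintegral_prod_right'
    _ ≤ X * (sqNorm F * ∑ n, sqNorm (G n)) ^ (1 / 2 : ℝ) + ∫⁻ _ in Ioc 0 ℓ,
        X * (ofReal p ^ 2 * sqNorm F * ∑ n, sqNorm (G n)) ^ (1 / 2 : ℝ) := by
        refine add_le_add ((sum_lintegral_mixOp_le hK hS hF hG y y).trans ?_)
          (lintegral_mono fun t => (sum_lintegral_mixOp_le hK hS hF' hG (y + t) y).trans ?_)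
        · gcongr
        · gcongr
    _ = _ := by
        rw [hpow, lintegral_const, Measure.restrict_apply MeasurableSet.univ, Set.univ_inter,
          Real.volume_Ioc, sub_zero, ofReal_mul hℓ]
        ring

end

/-! ### Almost orthogonality of the frozen kernels -/

theorem sum_le_of_sqrt_decay {N i : ℕ} (hi : i < N) {g : ℕ → ℝ} (h1 : ∀ j, g j ≤ 1)
    (h2 : ∀ j : ℕ, √|(i : ℝ) - j| * g j ≤ 1) : ∑ j ∈ range N, g j ≤ 8 * √N := by
  -- `√(x - i) - √(i - x)` is the odd extension of the square root: one of the terms is zero.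
  set h : ℝ → ℝ := fun x => √(x - i) - √(i - x) with hh
  have key : ∀ j : ℕ, g j ≤ 2 * (h (j + 1) - h (j - 1)) := by
    have aux : ∀ d x : ℝ, 1 ≤ d → √d * x ≤ 1 → x ≤ 2 * (√(d + 1) - √(d - 1)) := by
      intro d x hd hx
      have hp : 0 < √d := sqrt_pos.2 (by linarith)
      have hq : 0 ≤ √(d - 1) := sqrt_nonneg _
      have hqp : √(d - 1) ≤ √d := sqrt_le_sqrt (by linarith)
      have hpr : √d ≤ √(d + 1) := sqrt_le_sqrt (by linarith)
      have e1 : √d ^ 2 = d := sq_sqrt (by linarith)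
      have e2 : √(d - 1) ^ 2 = d - 1 := sq_sqrt (by linarith)
      have : x ≤ 2 * (√d - √(d - 1)) := by
        refine le_of_mul_le_mul_left (?_ : √d * x ≤ √d * (2 * (√d - √(d - 1)))) hp
        nlinarith
      linarith
    intro j
    simp only [hh]
    rcases lt_trichotomy i j with hij | rfl | hij
    · have hd : (1 : ℝ) ≤ j - i := by
        have : (i : ℝ) + 1 ≤ j := by exact_mod_cast hij
        linarith
      have h3 := h2 j
      rw [abs_sub_comm, abs_of_nonneg (by linarith)] at h3
      have := aux _ _ hd h3
      rw [sqrt_eq_zero_of_nonpos (by linarith : (i : ℝ) - (j + 1) ≤ 0),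
        sqrt_eq_zero_of_nonpos (by linarith : (i : ℝ) - (j - 1) ≤ 0)]
      convert this using 3 <;> ring_nf
    · have := h1 i
      have e1 : √((i : ℝ) + 1 - i) = 1 := by simp
      have e2 : √((i : ℝ) - (i - 1)) = 1 := by simp
      rw [e1, e2, sqrt_eq_zero_of_nonpos (by linarith : (i : ℝ) - (i + 1) ≤ 0),
        sqrt_eq_zero_of_nonpos (by linarith : (i : ℝ) - 1 - i ≤ 0)]
      linarith
    · have hd : (1 : ℝ) ≤ i - j := by
        have : (j : ℝ) + 1 ≤ i := by exact_mod_cast hij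
        linarith
      have h3 := h2 j
      rw [abs_of_nonneg (by linarith)] at h3
      have := aux _ _ hd h3
      rw [sqrt_eq_zero_of_nonpos (by linarith : (j : ℝ) + 1 - i ≤ 0),
        sqrt_eq_zero_of_nonpos (by linarith : (j : ℝ) - 1 - i ≤ 0)]
      have e1 : (i : ℝ) - (j + 1) = i - j - 1 := by ring
      have e2 : (i : ℝ) - (j - 1) = i - j + 1 := by ring
      rw [e1, e2]; linarith
  have hsum : ∀ n : ℕ, ∑ j ∈ range n, (h (j + 1) - h (j - 1)) = h n + h (n - 1) - h 0 - h (-1) := by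
    intro n
    induction n with
    | zero => simp
    | succ n ih => rw [Finset.sum_range_succ, ih]; push_cast; rw [add_sub_cancel_right]; ring
  have hiN : (i : ℝ) + 1 ≤ N := by exact_mod_cast hi
  have hb : ∀ x : ℝ, -1 ≤ x → x ≤ N → |h x| ≤ √N := by
    intro x h3 h4
    have i0 : (0 : ℝ) ≤ i := Nat.cast_nonneg i
    have k1 : √(x - i) ≤ √N := sqrt_le_sqrt (by linarith)
    have k2 : √(i - x) ≤ √N := sqrt_le_sqrt (by linarith)
    have k3 := sqrt_nonneg (x - i)
    have k4 := sqrt_nonneg (i - x)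
    simp only [hh]
    rw [abs_le]; constructor <;> linarith
  have hN0 : (0 : ℝ) ≤ N := Nat.cast_nonneg N
  have hN1 : (1 : ℝ) ≤ N := by linarith [(Nat.cast_nonneg i : (0 : ℝ) ≤ i)]
  calc ∑ j ∈ range N, g j ≤ ∑ j ∈ range N, 2 * (h (j + 1) - h (j - 1)) :=
        sum_le_sum fun j _ => key j
    _ = 2 * (h N + h (N - 1) - h 0 - h (-1)) := by rw [← mul_sum, hsum]
    _ ≤ 8 * √N := by
        have k1 := abs_le.1 (hb N (by linarith) le_rfl)
        have k2 := abs_le.1 (hb (N - 1) (by linarith) (by linarith))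
        have k3 := abs_le.1 (hb 0 (by linarith) hN0)
        have k4 := abs_le.1 (hb (-1) le_rfl (by linarith))
        linarith [k1.2, k2.2, k3.1, k4.1]

theorem exists_eq_mul_deriv {f f' : ℝ → ℝ} {x y : ℝ}
    (hf : ∀ u ∈ Icc (0 : ℝ) 1, HasDerivAt (fun u => f (x + (y - x) * u)) (f' u) u) :
    ∃ u ∈ Icc (0 : ℝ) 1, f y - f x = f' u := by
  obtain ⟨u, hu, hu'⟩ := exists_hasDerivAt_eq_slope (fun u => f (x + (y - x) * u)) f' one_pos
    (fun u hu => (hf u hu).continuousAt.continuousWithinAt) (fun u hu => hf u ⟨hu.1.le, hu.2.le⟩)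
  refine ⟨u, ⟨hu.1.le, hu.2.le⟩, ?_⟩
  rw [hu']; simp

set_option maxHeartbeats 600000 in
/-- Gram matrix of the frozen kernels. The frequency difference `d` and the phase difference, of
size `L |e (η - η')|`, decide between the first and the second derivative test. -/
theorem exists_sampleGram_bound {α κ b p₁ p₂ q₁ q₂ : ℝ} (hα : 0 < α) (hα1 : α ≠ 1)
    (hκ : |κ| = 1) (hp : 0 < p₁) (hpp : p₁ ≤ p₂) (hq : 0 < q₁) :
    ∃ e₀ : ℝ, 0 < e₀ ∧ e₀ ≤ 1 ∧ ∀ ρ χ₁ χ₂ : ℝ → ℂ, IsPosBump ρ → IsBoxBump p₁ p₂ χ₁ →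
      IsBoxBump q₁ q₂ χ₂ → ∃ C : ℝ, 0 < C ∧ ∀ L s e η η' d : ℝ, 1 ≤ L → |s| = 1 → |e| ≤ e₀ →
      ‖∫ ξ, expI(ξ * d) *
        (formKernel κ 0 b e (oscMul α s 1 ρ χ₁ χ₂ L) ξ η *
          conj (formKernel κ 0 b e (oscMul α s 1 ρ χ₁ χ₂ L) ξ η'))‖ ≤ C / L ∧
      √|d| * ‖∫ ξ, expI(ξ * d) *
        (formKernel κ 0 b e (oscMul α s 1 ρ χ₁ χ₂ L) ξ η *
          conj (formKernel κ 0 b e (oscMul α s 1 ρ χ₁ χ₂ L) ξ η'))‖ ≤ C / L := by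
  have hκ0 : κ ≠ 0 := by rintro rfl; simp at hκ
  obtain ⟨e₀, c, C, he₀, he₀1, hc, hC, hbd⟩ :=
    exists_phase_bounds_of_P_indep (b := b) (p₂ := p₂) (q₂ := q₂) hα hα1 hκ0 hp hq
  refine ⟨e₀, he₀, he₀1, fun ρ χ₁ χ₂ hρ hχ₁ hχ₂ => ?_⟩
  obtain ⟨C₁, hC₁, hamp⟩ := exists_oscAmp_line_bounds hα hα1 hκ hp hq hρ hχ₁ hχ₂
  set ℓ := p₂ - p₁
  have hℓ0 : 0 ≤ ℓ := sub_nonneg.2 hpp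
  set A₀ := C₁ ^ 2 with hA₀
  set A₁ := 2 * (1 + |b|) * C₁ ^ 2 with hA₁
  have hA0 : 0 ≤ A₀ := by positivity
  have hA1 : 0 ≤ A₁ := by positivity
  set T₁ := 2 * (2 * A₀ + ℓ * (A₁ + A₀)) with hT₁
  set T₂ := 10 * √(2 * C / c) * (A₀ + ℓ * A₁) with hT₂
  have hT1 : 0 ≤ T₁ := by positivity
  have hT2 : 0 ≤ T₂ := by positivity
  refine ⟨ℓ * A₀ + T₁ + T₂ + 1, by positivity, fun L s e η η' d hL hs he => ?_⟩
  have hL0 : 0 < L := by linarith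
  have hs0 : 0 < √L := sqrt_pos.2 hL0
  obtain ⟨hM, hAb, hamp'⟩ := hamp L s hL hs
  set M := oscMul α s 1 ρ χ₁ χ₂ L
  set K := formKernel κ 0 b e M
  set Inn : ℝ → ℂ := fun ξ => expI(ξ * d) * (K ξ η * conj (K ξ η')) with hInn
  set pts : Set (ℝ × ℝ) := {(0, η), (0, η')} with hpts
  set S : Set ℝ := {ξ | ∀ z ∈ pts, formP κ 0 (ξ - z.1) z.2 ∈ Icc p₁ p₂ ∧
      formQ e b (ξ - z.1) z.2 ∈ Icc q₁ q₂} with hS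
  have hSiff : ∀ ξ, ξ ∈ S ↔ (formP κ 0 ξ η ∈ Icc p₁ p₂ ∧ formQ e b ξ η ∈ Icc q₁ q₂) ∧
      (formP κ 0 ξ η' ∈ Icc p₁ p₂ ∧ formQ e b ξ η' ∈ Icc q₁ q₂) := by
    intro ξ
    simp only [hS, hpts, Set.mem_ofPred_eq, Set.mem_insert_iff, Set.mem_singleton_iff,
      forall_eq_or_imp, forall_eq, sub_zero]
  have hoff : ∀ ξ, ξ ∉ S → Inn ξ = 0 := by
    intro ξ hξ
    rw [hSiff, not_and_or] at hξ
    simp only [hInn]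
    rcases hξ with h | h
    · rw [show K ξ η = 0 from oscMul_eq_zero hχ₁ hχ₂ L h]; simp
    · rw [show K ξ η' = 0 from oscMul_eq_zero hχ₁ hχ₂ L h]; simp
  rcases exists_Icc_of_forms hκ (pts := pts) ⟨_, Or.inl rfl⟩ hS with hemp | hne
  · have : Inn = fun _ => 0 := by ext ξ; exact hoff ξ (by rw [hemp]; simp)
    rw [this]; simp only [integral_zero, norm_zero, mul_zero, and_self]; positivity
  obtain ⟨c₀, d₀, hcd, hSI, hlen⟩ := hne
  have hint : ∫ ξ, Inn ξ = ∫ ξ in c₀..d₀, Inn ξ := by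
    rw [integral_of_le hcd, ← integral_Icc_eq_integral_Ioc, ← hSI,
      setIntegral_eq_integral_of_forall_compl_eq_zero hoff]
  have hx0 : 0 ≤ C₁ / √L := by positivity
  have hsq : (C₁ / √L) * (C₁ / √L) = C₁ ^ 2 / L := by
    rw [div_mul_div_comm, Real.mul_self_sqrt hL0.le, sq]
  have hKb : ∀ x y, ‖K x y‖ ≤ C₁ / √L := fun x y => hM _ _
  have htriv : ‖∫ ξ, Inn ξ‖ ≤ ℓ * A₀ / L := by
    rw [hint]
    refine (norm_intervalIntegral_le (A := A₀ / L) hcd fun ξ _ => ?_).trans ?_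
    · simp only [hInn]
      rw [norm_mul, norm_expI, one_mul, norm_mul, RCLike.norm_conj, hA₀, ← hsq]
      gcongr <;> exact hKb _ _
    · rw [mul_comm, mul_div_assoc]
      gcongr
  refine ⟨htriv.trans (by gcongr; linarith), ?_⟩
  rcases eq_or_ne d 0 with rfl | hd0
  · simp only [abs_zero, Real.sqrt_zero, zero_mul]; positivity
  have hd : 0 < |d| := abs_pos.2 hd0
  set Φ : ℝ → ℝ → ℝ := fun z ξ => critPhase α (formP κ 0 ξ z) (formQ e b ξ z)
  set Φ₁ : ℝ → ℝ → ℝ := fun z ξ => critPhase₁ α (dirXi κ b e) (formP κ 0 ξ z) (formQ e b ξ z)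
  set Φ₂ : ℝ → ℝ → ℝ := fun z ξ =>
    critPhase₂ α (dirXi κ b e) (dirXi κ b e) (formP κ 0 ξ z) (formQ e b ξ z)
  set A : ℝ → ℝ → ℂ := fun z ξ => oscAmp α s ρ χ₁ χ₂ L (formP κ 0 ξ z) (formQ e b ξ z) with hA
  have dP : ∀ z ξ : ℝ, HasDerivAt (fun ξ => formP κ 0 ξ z) (dirXi κ b e).1 ξ := fun z ξ => by
    simpa only [sub_zero] using hasDerivAt_formP κ 0 b e 0 z ξ
  have dQ : ∀ z ξ : ℝ, HasDerivAt (fun ξ => formQ e b ξ z) (dirXi κ b e).2 ξ := fun z ξ => by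
    simpa only [sub_zero] using hasDerivAt_formQ κ b e 0 z ξ
  -- The box condition for all points between `η` and `η'`.
  have hbox : ∀ ξ ∈ Icc c₀ d₀, ∀ u ∈ Icc (0 : ℝ) 1, formP κ 0 ξ (η' + (η - η') * u) ∈ Icc p₁ p₂ ∧
      formQ e b ξ (η' + (η - η') * u) ∈ Icc q₁ q₂ := by
    intro ξ hξ u hu
    rw [← hSI, hSiff] at hξ
    obtain ⟨⟨h1, h2⟩, h3, h4⟩ := hξ
    refine ⟨by simpa [formP] using h1, ?_⟩
    have : formQ e b ξ (η' + (η - η') * u) = (1 - u) • formQ e b ξ η' + u • formQ e b ξ η := by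
      simp only [formQ, smul_eq_mul]; ring
    rw [this]
    exact convex_Icc (𝕜 := ℝ) q₁ q₂ h4 h2 (by linarith [hu.2]) hu.1 (by ring)
  have hpos : ∀ ξ ∈ Icc c₀ d₀, ∀ u ∈ Icc (0 : ℝ) 1,
      0 < formP κ 0 ξ (η' + (η - η') * u) ∧ 0 < formQ e b ξ (η' + (η - η') * u) :=
    fun ξ hξ u hu => ⟨hp.trans_le (hbox ξ hξ u hu).1.1, hq.trans_le (hbox ξ hξ u hu).2.1⟩
  have hends : ∀ z ∈ ({η, η'} : Set ℝ), ∃ u ∈ Icc (0 : ℝ) 1, z = η' + (η - η') * u := by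
    rintro z (rfl | rfl)
    · exact ⟨1, by simp, by ring⟩
    · exact ⟨0, by simp, by ring⟩
  have hpos' : ∀ z ∈ ({η, η'} : Set ℝ), ∀ ξ ∈ Icc c₀ d₀,
      (formP κ 0 ξ z ∈ Icc p₁ p₂ ∧ formQ e b ξ z ∈ Icc q₁ q₂) ∧
        0 < formP κ 0 ξ z ∧ 0 < formQ e b ξ z := by
    intro z hz ξ hξ
    obtain ⟨u, hu, rfl⟩ := hends z hz
    exact ⟨hbox ξ hξ u hu, hpos ξ hξ u hu⟩
  have dΦ : ∀ z ∈ ({η, η'} : Set ℝ), ∀ ξ ∈ Icc c₀ d₀, HasDerivAt (Φ z) (Φ₁ z ξ) ξ :=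
    fun z hz ξ hξ => hasDerivAt_critPhase hα hα1 (hpos' z hz ξ hξ).2.1 (hpos' z hz ξ hξ).2.2
      (dP z ξ) (dQ z ξ)
  have dΦ₁ : ∀ z ∈ ({η, η'} : Set ℝ), ∀ ξ ∈ Icc c₀ d₀, HasDerivAt (Φ₁ z) (Φ₂ z ξ) ξ :=
    fun z hz ξ hξ => hasDerivAt_critPhase₁ hα hα1 _ (hpos' z hz ξ hξ).2.1 (hpos' z hz ξ hξ).2.2
      (dP z ξ) (dQ z ξ)
  have dA : ∀ z ∈ ({η, η'} : Set ℝ), ∀ ξ ∈ Icc c₀ d₀, ∃ B' : ℂ, HasDerivAt (A z) B' ξ ∧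
      ‖B'‖ ≤ (1 + |b|) * (C₁ / √L) := by
    intro z hz ξ hξ
    have h := hamp' 0 b e 0 z ξ (he.trans he₀1)
    simp only [sub_zero] at h
    exact h (hpos' z hz ξ hξ).1.1 (hpos' z hz ξ hξ).1.2
  choose! A' hA' hA'b using dA
  have m1 : η ∈ ({η, η'} : Set ℝ) := by simp
  have m2 : η' ∈ ({η, η'} : Set ℝ) := by simp
  set D : ℝ → ℝ := fun ξ => ξ * d + s * L * (Φ η ξ - Φ η' ξ) with hD
  set D₁ : ℝ → ℝ := fun ξ => d + s * L * (Φ₁ η ξ - Φ₁ η' ξ) with hD₁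
  set D₂ : ℝ → ℝ := fun ξ => s * L * (Φ₂ η ξ - Φ₂ η' ξ) with hD₂
  set a₀ : ℝ → ℂ := fun ξ => A η ξ * conj (A η' ξ) with ha₀
  set a₁ : ℝ → ℂ := fun ξ => A' η ξ * conj (A η' ξ) + A η ξ * conj (A' η' ξ)
  have hIn : ∀ ξ, Inn ξ = expI(D ξ) * a₀ ξ := by
    intro ξ
    have key : ∀ z, K ξ z = expI(s * L * Φ z ξ) * A z ξ :=
      fun z => oscMul_eq_exp_mul_oscAmp _ _ _ _ _ _ _ _
    have hDe : (D ξ : ℂ) = ((ξ * d : ℝ) : ℂ) + ((s * L * Φ η ξ : ℝ) : ℂ) +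
        ((-(s * L * Φ η' ξ) : ℝ) : ℂ) := by
      simp only [hD]; push_cast; ring
    simp only [hInn]
    rw [key, key, hDe, mul_add, mul_add, exp_add, exp_add, map_mul, conj_expI]
    ring
  have hD1 : ∀ ξ ∈ Icc c₀ d₀, HasDerivAt D (D₁ ξ) ξ := fun ξ hξ =>
    (((hasDerivAt_id ξ).mul_const d).add (((dΦ η m1 ξ hξ).sub (dΦ η' m2 ξ hξ)).const_mul
      (s * L))).congr_deriv (by simp [hD₁])
  have hD2 : ∀ ξ ∈ Icc c₀ d₀, HasDerivAt D₁ (D₂ ξ) ξ := fun ξ hξ =>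
    (((dΦ₁ η m1 ξ hξ).sub (dΦ₁ η' m2 ξ hξ)).const_mul (s * L)).const_add d
  have ha1 : ∀ ξ ∈ Icc c₀ d₀, HasDerivAt a₀ (a₁ ξ) ξ := fun ξ hξ =>
    (hA' η m1 ξ hξ).mul (hA' η' m2 ξ hξ).star
  have ha0b : ∀ ξ ∈ Icc c₀ d₀, ‖a₀ ξ‖ ≤ A₀ / L := by
    intro ξ _
    simp only [ha₀]
    rw [norm_mul, RCLike.norm_conj, hA₀, ← hsq]
    gcongr <;> exact hAb _ _
  have ha1b : ∀ ξ ∈ Icc c₀ d₀, ‖a₁ ξ‖ ≤ A₁ / L := by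
    intro ξ hξ
    refine (norm_add_le _ _).trans ?_
    rw [norm_mul, norm_mul, RCLike.norm_conj, RCLike.norm_conj]
    have b1 : ‖A' η ξ‖ * ‖A η' ξ‖ ≤ ((1 + |b|) * (C₁ / √L)) * (C₁ / √L) := by
      gcongr
      exacts [hA'b _ m1 _ hξ, hAb _ _]
    have b2 : ‖A η ξ‖ * ‖A' η' ξ‖ ≤ (C₁ / √L) * ((1 + |b|) * (C₁ / √L)) := by
      gcongr
      exacts [hAb _ _, hA'b _ m2 _ hξ]
    have e2 : A₁ / L = 2 * (1 + |b|) * ((C₁ / √L) * (C₁ / √L)) := by rw [hsq, hA₁]; ring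
    rw [e2]; linarith
  set w := L * (|e| * |η - η'|) with hw
  have hw0 : 0 ≤ w := by positivity
  have dPe : ∀ (ξ u : ℝ), HasDerivAt (fun u => formP κ 0 ξ (η' + (η - η') * u))
      ((η - η') • dirEta κ 0 e).1 u := by
    intro ξ u
    simp only [formP, dirEta, zero_mul, Prod.smul_fst, mul_zero, neg_zero, smul_eq_mul]
    exact hasDerivAt_const _ _
  have dQe : ∀ (ξ u : ℝ), HasDerivAt (fun u => formQ e b ξ (η' + (η - η') * u))
      ((η - η') • dirEta κ 0 e).2 u := by
    intro ξ u
    unfold formQ dirEta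
    exact (((((hasDerivAt_id u).const_mul (η - η')).const_add η').sub_const (b * ξ)).const_mul
      e).congr_deriv (by simp; ring)
  have habs : ∀ x : ℝ, |s * L * ((η - η') * x)| = L * |η - η'| * |x| := by
    intro x
    rw [abs_mul, abs_mul s, hs, one_mul, abs_of_pos hL0, abs_mul, mul_assoc]
  have hd1 : ∀ ξ ∈ Icc c₀ d₀, |D₁ ξ - d| ≤ C * w := by
    intro ξ hξ
    obtain ⟨u, hu, h⟩ := exists_eq_mul_deriv (f := fun z => Φ₁ z ξ) (x := η') (y := η)
      fun u hu => hasDerivAt_critPhase₁ hα hα1 (dirXi κ b e) (hpos ξ hξ u hu).1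
        (hpos ξ hξ u hu).2 (dPe ξ u) (dQe ξ u)
    have e1 : D₁ ξ - d = s * L * ((η - η') * critPhase₂ α (dirXi κ b e) (dirEta κ 0 e)
        (formP κ 0 ξ (η' + (η - η') * u)) (formQ e b ξ (η' + (η - η') * u))) := by
      simp only [hD₁, add_sub_cancel_left]
      rw [h, critPhase₂_smul]
    rw [e1, habs, hw]
    have := (hbd e he _ (hbox ξ hξ u hu).1 _ (hbox ξ hξ u hu).2).1
    calc _ ≤ L * |η - η'| * (C * |e|) := by gcongr
      _ = _ := by ring
  have hd2 : ∀ ξ ∈ Icc c₀ d₀, c * w ≤ |D₂ ξ| ∧ |D₂ ξ| ≤ C * w := by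
    intro ξ hξ
    obtain ⟨u, hu, h⟩ := exists_eq_mul_deriv (f := fun z => Φ₂ z ξ) (x := η') (y := η)
      fun u hu => hasDerivAt_critPhase₂ hα hα1 (dirXi κ b e) (dirXi κ b e) (hpos ξ hξ u hu).1
        (hpos ξ hξ u hu).2 (dPe ξ u) (dQe ξ u)
    have e1 : D₂ ξ = s * L * ((η - η') * critPhase₃ α (dirXi κ b e) (dirEta κ 0 e)
        (dirXi κ b e) (formP κ 0 ξ (η' + (η - η') * u)) (formQ e b ξ (η' + (η - η') * u))) := by
      simp only [hD₂]
      rw [h, critPhase₃_smul_right, critPhase₃_swap]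
    rw [e1, habs, hw]
    obtain ⟨-, h1, h2⟩ := hbd e he _ (hbox ξ hξ u hu).1 _ (hbox ξ hξ u hu).2
    constructor
    · calc _ = L * |η - η'| * (c * |e|) := by ring
        _ ≤ _ := by gcongr
    · calc _ ≤ L * |η - η'| * (C * |e|) := by gcongr
        _ = _ := by ring
  rcases le_or_gt (2 * (C * w)) |d| with hbig | hsmall
  · have hfst : ‖∫ ξ, Inn ξ‖ ≤ T₁ / L / |d| := by
      have key := norm_integral_exp_le_of_first_deriv hcd (half_pos hd) hD1 hD2 ha1 (fun ξ hξ => by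
          have h1 := hd1 ξ hξ
          have h2 := abs_sub_abs_le_abs_sub d (D₁ ξ)
          rw [abs_sub_comm d] at h2
          linarith)
        (fun ξ hξ => ((hd2 ξ hξ).2.trans (by linarith) : |D₂ ξ| ≤ |d| / 2)) ha0b ha1b
      simp only [← hIn] at key
      rw [← hint, mul_div_assoc (A₀ / L), div_self (half_pos hd).ne', mul_one, ← mul_div_assoc,
        ← add_div] at key
      refine key.trans ?_
      rw [div_div_eq_mul_div, hT₁]
      gcongr ?_ / _
      calc (2 * A₀ / L + (d₀ - c₀) * ((A₁ + A₀) / L)) * 2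
          ≤ (2 * A₀ / L + ℓ * ((A₁ + A₀) / L)) * 2 := by gcongr
        _ = 2 * (2 * A₀ + ℓ * (A₁ + A₀)) / L := by ring
    rcases le_or_gt |d| 1 with hd1 | hd1
    · calc √|d| * ‖∫ ξ, Inn ξ‖ ≤ 1 * (ℓ * A₀ / L) := by
            gcongr
            exact Real.sqrt_le_one.2 hd1
        _ ≤ _ := by rw [one_mul]; gcongr; linarith
    · calc √|d| * ‖∫ ξ, Inn ξ‖ ≤ |d| * (T₁ / L / |d|) := by
            gcongr
            exact sqrt_le_iff.2 ⟨hd.le, by nlinarith⟩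
        _ = T₁ / L := by field_simp
        _ ≤ _ := by gcongr; linarith [mul_nonneg hℓ0 hA0]
  · have hwpos : 0 < w := by
      rcases hw0.eq_or_lt with h | h
      · rw [← h] at hsmall; simp only [mul_zero] at hsmall; linarith
      · exact h
    have hcont : ContinuousOn D₂ (Icc c₀ d₀) := by
      intro ξ hξ
      have h : ∀ z ∈ ({η, η'} : Set ℝ), HasDerivAt (Φ₂ z) _ ξ := fun z hz =>
        hasDerivAt_critPhase₂ (P := fun ξ => formP κ 0 ξ z) (Q := fun ξ => formQ e b ξ z) hα hα1
          (dirXi κ b e) (dirXi κ b e) (hpos' z hz ξ hξ).2.1 (hpos' z hz ξ hξ).2.2 (dP z ξ) (dQ z ξ)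
      have h := ((h η m1).sub (h η' m2)).const_mul (s * L)
      exact h.continuousAt.continuousWithinAt
    have key := norm_integral_exp_mul_le_of_second_deriv hcd (by positivity : 0 < c * w) hD1 hD2
      hcont (fun ξ hξ => (hd2 ξ hξ).1) ha1 ha0b ha1b
    simp only [← hIn] at key
    rw [← hint] at key
    have hsd : √|d| ≤ √(2 * C / c) * √(c * w) := by
      rw [← sqrt_mul (by positivity)]
      refine sqrt_le_sqrt ?_
      have : 2 * C / c * (c * w) = 2 * (C * w) := by field_simp
      rw [this]; exact hsmall.le
    have hscw : 0 < √(c * w) := sqrt_pos.2 (by positivity)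
    calc √|d| * ‖∫ ξ, Inn ξ‖
        ≤ (√(2 * C / c) * √(c * w)) * (10 / √(c * w) * (A₀ / L + ℓ * (A₁ / L))) := by
          gcongr
          refine key.trans ?_
          gcongr
      _ = T₂ / L := by rw [hT₂]; field_simp
      _ ≤ _ := by gcongr; linarith [mul_nonneg hℓ0 hA0]

/-! ### The single scale estimate -/

theorem IsCcKernel.sampleBound {K : ℝ → ℝ → ℂ} (hK : IsCcKernel K) {p ℓ C : ℝ} {N : ℕ}
    (hp : ∀ ξ η, ξ ∉ Icc (-p) p → K ξ η = 0) (hℓ : 1 ≤ ℓ) (hC : 0 ≤ C)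
    (hG : ∀ d η η', ‖∫ ξ, expI(ξ * d) * (K ξ η * conj (K ξ η'))‖ ≤ C ∧ √|d| * ‖∫ ξ, expI(ξ * d) *
      (K ξ η * conj (K ξ η'))‖ ≤ C) :
    SampleBound p ℓ N (ofReal (C * (1 + 8 * (√N / √ℓ)))) K := by
  intro F hF y η
  have hℓ0 : 0 < ℓ := by linarith
  have hsℓ : 0 < √ℓ := sqrt_pos.2 hℓ0
  set v : Fin N → ℝ → ℂ := fun n ξ => conj (K ξ (η n)) * expI(-(ξ * (y + (n : ℕ) * ℓ))) with hv
  set x : ℝ → ℂ := (Icc (-p) p).indicator F with hx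
  have hK1 : ∀ n, Continuous fun ξ => K ξ (η n) := fun n =>
    hK.cont.comp (f := fun ξ : ℝ => (ξ, η n)) (by fun_prop)
  have hvm : ∀ n, MemLp (v n) 2 := by
    intro n
    have h1 : Continuous (v n) := (continuous_conj.comp (hK1 n)).mul (by fun_prop)
    refine h1.memLp_of_hasCompactSupport (HasCompactSupport.of_support_subset_isCompact
      (isCompact_Icc (a := -p) (b := p)) fun ξ hξ => ?_)
    by_contra h
    exact hξ (by simp [hv, hp ξ (η n) h])
  have hxm : MemLp x 2 := by
    rw [memLp_indicator_iff_restrict measurableSet_Icc]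
    rw [memLp_two_iff_integrable_sq_norm hF.aestronglyMeasurable]
    exact (hF.norm.pow 2).continuousOn.integrableOn_compact isCompact_Icc
  have hpart : ∀ n : Fin N, partialOp K F (y + (n : ℕ) * ℓ) (η n) = ∫ ξ, conj (v n ξ) * x ξ := by
    intro n
    rw [partialOp]
    congr 1; ext ξ
    by_cases hξ : ξ ∈ Icc (-p) p
    · simp only [hv, hx, map_mul, conj_expI, neg_neg, conj_conj, indicator_of_mem hξ]; ring
    · simp [hv, hp ξ (η n) hξ]
  have hgram : ∀ i j : Fin N, ∫ ξ, conj (v i ξ) * v j ξ =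
      ∫ ξ, expI(ξ * ((((i : ℕ) : ℝ) - (j : ℕ)) * ℓ)) * (K ξ (η i) * conj (K ξ (η j))) := by
    intro i j
    congr 1; ext ξ
    simp only [hv, map_mul, conj_expI, neg_neg, conj_conj]
    rw [show ∀ a b c d : ℂ, a * b * (c * d) = (b * d) * (a * c) from fun a b c d => by ring,
      ← exp_add, ← mul_add, ← Complex.ofReal_add]
    congr 4; ring
  have hR : ∀ i ∈ Finset.univ, ∑ j, ‖∫ ξ, conj (v i ξ) * v j ξ‖ ≤ C * (1 + 8 * (√N / √ℓ)) := by
    intro i _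
    rcases hC.eq_or_lt with h0 | hC
    · rw [← h0, zero_mul]
      refine Finset.sum_nonpos fun j _ => ?_
      rw [hgram, h0]
      exact (hG _ _ _).1
    simp only [hgram]
    set B : ℕ → ℝ := fun j => if h : j < N then ‖∫ ξ, expI(ξ * ((((i : ℕ) : ℝ) - j) * ℓ)) *
        (K ξ (η i) * conj (K ξ (η ⟨j, h⟩)))‖ else 0 with hB
    have hB0 : ∀ j, 0 ≤ B j := by intro j; simp only [hB]; split_ifs <;> positivity
    have hB1 : ∀ j, B j ≤ C := by
      intro j
      simp only [hB]
      split_ifs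
      · exact (hG _ _ _).1
      · exact hC.le
    have hB2 : ∀ j : ℕ, √|(i : ℕ) - (j : ℝ)| * √ℓ * B j ≤ C := by
      intro j
      rw [← sqrt_mul (abs_nonneg _), show |(i : ℕ) - (j : ℝ)| * ℓ = |((i : ℕ) - (j : ℝ)) * ℓ| by
        rw [abs_mul, abs_of_pos hℓ0]]
      simp only [hB]
      split_ifs
      · exact (hG _ _ _).2
      · simpa using hC.le
    have hrow := sum_le_of_sqrt_decay i.2
      (g := fun j => if j = i then 0 else √ℓ / C * B j) (fun j => ?_) (fun j => ?_)
    · have hsum : ∑ j : Fin N, ‖∫ ξ, expI(ξ * ((((i : ℕ) : ℝ) - (j : ℕ)) * ℓ)) *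
            (K ξ (η i) * conj (K ξ (η j)))‖ = ∑ j ∈ range N, B j := by
        rw [← Fin.sum_univ_eq_sum_range]
        refine sum_congr rfl fun j _ => ?_
        simp only [hB, j.2, dif_pos]
      rw [hsum]
      have hsplit : ∀ j, B j = (if j = i then B j else 0) +
          C / √ℓ * (if j = i then 0 else √ℓ / C * B j) := by
        intro j
        split_ifs
        · simp
        · field_simp; ring
      rw [sum_congr rfl fun j _ => hsplit j, sum_add_distrib, ← mul_sum,
        Finset.sum_ite_eq' , if_pos (Finset.mem_range.2 i.2)]
      calc _ ≤ C + C / √ℓ * (8 * √N) := add_le_add (hB1 _) (by gcongr)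
        _ = _ := by ring
    · split_ifs with h
      · exact zero_le_one
      have h1 : (1 : ℝ) ≤ √|(i : ℕ) - (j : ℝ)| := by
        rw [Real.one_le_sqrt]
        have : (1 : ℤ) ≤ |((i : ℕ) : ℤ) - j| := Int.one_le_abs (by omega)
        exact_mod_cast this
      rw [div_mul_eq_mul_div, div_le_one hC]
      refine le_trans ?_ (hB2 j)
      rw [mul_assoc]
      exact le_mul_of_one_le_left (mul_nonneg hsℓ.le (hB0 j)) h1
    · split_ifs with h
      · simp
      · calc _ = √|(i : ℕ) - (j : ℝ)| * √ℓ * B j / C := by ring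
          _ ≤ 1 := (div_le_one hC).2 (hB2 j)
  have h := sum_enorm_sq_integral_le_of_gram Finset.univ hvm hxm (by positivity) hR
  simp only [hpart]
  refine h.trans (le_of_eq ?_)
  congr 1
  rw [← lintegral_indicator measurableSet_Icc]
  refine lintegral_congr fun ξ => ?_
  by_cases hξ : ξ ∈ Icc (-p) p
  · simp [hx, indicator_of_mem hξ]
  · simp [hx, indicator_of_notMem hξ]

section

variable {α s κ a b p₁ p₂ q₁ q₂ : ℝ} {M : ℝ → ℝ → ℝ → ℝ → ℂ}

/-- The length of the cells on which one function is frozen. -/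
def cellLength (L e : ℝ) : ℝ := max (L ^ (1 / 5 : ℝ)) (L * |e|)

theorem exists_spaceBound_of_small (hα : 0 < α) (hα1 : α ≠ 1) (hκ : |κ| = 1)
    (hp : 0 < p₁) (hpp : p₁ ≤ p₂) (hq : 0 < q₁) (hs : |s| = 1) :
    ∃ e₀ : ℝ, 0 < e₀ ∧ e₀ ≤ 1 ∧ ∀ M, OscFam α s 1 p₁ p₂ q₁ q₂ M → ∃ C : ℝ, 0 ≤ C ∧
      ∀ L e, (1 ≤ L ∧ e ≠ 0 ∧ |e| ≤ e₀ ∧ |e| ≤ L ^ (-(4 / 5) : ℝ)) →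
      SpaceBound (ofReal (C * L ^ (-(1 / 80) : ℝ))) (formKernel κ 0 b e (M L e)) := by
  obtain ⟨e₀, he₀, he₀1, hE⟩ := exists_sampleGram_bound (b := b) (q₂ := q₂) hα hα1 hκ hp hpp hq
  have hD1 : 1 - 0 * b ≠ 0 := by simp
  have hcell : ∀ L e : ℝ, 1 ≤ L → 1 ≤ cellLength L e := fun L e hL =>
    (Real.one_le_rpow hL (by norm_num)).trans (le_max_left _ _)
  refine ⟨e₀, he₀, he₀1, fun M hM => ?_⟩
  refine hM.exists_spaceBound hα hκ hD1 (N := fun L e => ⌈L / cellLength L e⌉₊)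
    (ℓ := cellLength) (A := 1) (fun L e h => ⟨h.1, h.2.2.1.trans he₀1, h.2.1⟩)
    (fun L e hL he => ?_) (fun L e hL he => ⟨by linarith [hcell L e hL], ?_, ?_⟩)
    (fun L hL => by positivity) fun ρ χ₁ χ₂ hρ hχ₁ hχ₂ => ?_
  · rw [← div_le_iff₀ (by linarith [hcell L e hL])]
    exact Nat.le_ceil _
  · simp only [abs_zero, mul_zero, one_mul]; linarith [hcell L e hL]
  · rw [one_mul]; exact le_max_right _ _
  · obtain ⟨C, hC0, hC⟩ := hE ρ χ₁ χ₂ hρ hχ₁ hχ₂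
    have hp2 : 0 ≤ p₂ := hp.le.trans hpp
    refine ⟨(1 + p₂) * √(2 * pi * (17 * C)), by positivity, fun L e ⟨hL, he0, he, hm⟩ => ?_⟩
    have hL0 : 0 < L := by linarith
    set ℓ := cellLength L e
    have hℓe : ℓ = L ^ (1 / 5 : ℝ) := by
      refine max_eq_left ?_
      calc L * |e| ≤ L * L ^ (-(4 / 5) : ℝ) := by gcongr
        _ = L ^ (1 / 5 : ℝ) := by
          nth_rewrite 1 [← rpow_one L]
          rw [← rpow_add hL0]; norm_num
    have hℓ1 : 1 ≤ ℓ := hcell L e hL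
    have hℓ0 : 0 < ℓ := by linarith
    set N := ⌈L / ℓ⌉₊
    have hℓL : ℓ ≤ L := by
      rw [hℓe]
      exact (Real.rpow_le_rpow_of_exponent_le hL (by norm_num)).trans (rpow_one L).le
    have hK := (OscFam.base hρ hχ₁ hχ₂).isCcKernel (s := s) (ι := 1) hα hκ hD1 he0 L
    have hS : SampleBound p₂ ℓ N (ofReal (C / L * (1 + 8 * (√N / √ℓ))))
        (formKernel κ 0 b e (oscMul α s 1 ρ χ₁ χ₂ L)) := by
      refine IsCcKernel.sampleBound hK (fun ξ η hξ => ?_) hℓ1 (by positivity)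
        fun d η η' => hC L s e η η' d hL hs he
      refine oscMul_eq_zero hχ₁ hχ₂ L fun h => hξ ?_
      have h1 := h.1
      simp only [formP, zero_mul, sub_zero] at h1
      refine abs_le.1 ?_
      calc |ξ| = |κ * ξ| := by rw [abs_mul, hκ, one_mul]
        _ ≤ p₂ := abs_le.2 ⟨by linarith [h1.1], h1.2⟩
    refine (hS.localBound hK hℓ0.le).mono ?_
    have hNr : √N / √ℓ ≤ 2 * L ^ (3 / 10 : ℝ) := by
      rw [← Real.sqrt_div (Nat.cast_nonneg N)]
      refine sqrt_le_iff.2 ⟨by positivity, ?_⟩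
      have h1 : (N : ℝ) ≤ 2 * (L / ℓ) := by
        have h2 := (Nat.ceil_lt_add_one (by positivity : 0 ≤ L / ℓ)).le
        have h3 : 1 ≤ L / ℓ := (one_le_div hℓ0).2 hℓL
        linarith
      have h4 : L / ℓ / ℓ = (L ^ (3 / 10 : ℝ)) ^ 2 := by
        rw [hℓe, ← rpow_natCast, ← Real.rpow_mul hL0.le]
        nth_rewrite 1 [← rpow_one L]
        rw [← rpow_sub hL0, ← rpow_sub hL0]; norm_num
      calc (N : ℝ) / ℓ ≤ 2 * (L / ℓ) / ℓ := by gcongr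
        _ = 2 * (L ^ (3 / 10 : ℝ)) ^ 2 := by rw [mul_div_assoc, h4]
        _ ≤ _ := by nlinarith [sq_nonneg (L ^ (3 / 10 : ℝ))]
    have hR : C / L * (1 + 8 * (√N / √ℓ)) ≤ 17 * C * L ^ (-(7 / 10) : ℝ) := by
      have h1 : 1 ≤ L ^ (3 / 10 : ℝ) := Real.one_le_rpow hL (by norm_num)
      calc _ ≤ C / L * (L ^ (3 / 10 : ℝ) + 8 * (2 * L ^ (3 / 10 : ℝ))) := by gcongr
        _ = 17 * C * (L ^ (3 / 10 : ℝ) / L) := by ring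
        _ = _ := by
          congr 1
          nth_rewrite 2 [← rpow_one L]
          rw [← rpow_sub hL0]; norm_num
    have hY : ℓ * (2 * pi) * (C / L * (1 + 8 * (√N / √ℓ))) ≤
        (√(2 * pi * (17 * C)) * L ^ (-(1 / 4) : ℝ)) ^ 2 := by
      rw [mul_pow, sq_sqrt (by positivity), ← rpow_natCast, ← Real.rpow_mul hL0.le]
      calc _ ≤ ℓ * (2 * pi) * (17 * C * L ^ (-(7 / 10) : ℝ)) := by gcongr
        _ = 2 * pi * (17 * C) * (L ^ (1 / 5 : ℝ) * L ^ (-(7 / 10) : ℝ)) := by rw [hℓe]; ring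
        _ = _ := by rw [← rpow_add hL0]; norm_num
    rw [← ofReal_mul hℓ0.le, ← ofReal_mul (by positivity),
      ENNReal.ofReal_rpow_of_nonneg (by positivity) (by norm_num), ← ofReal_one,
      ← ofReal_add zero_le_one (by positivity), ← ofReal_mul (by positivity), ← Real.sqrt_eq_rpow]
    refine ofReal_le_ofReal ?_
    calc _ ≤ (L ^ (1 / 5 : ℝ) + L ^ (1 / 5 : ℝ) * p₂) *
          (√(2 * pi * (17 * C)) * L ^ (-(1 / 4) : ℝ)) := by
          rw [hℓe] at hY ⊢
          gcongr
          · exact Real.one_le_rpow hL (by norm_num)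
          · exact sqrt_le_iff.2 ⟨by positivity, hY⟩
      _ = (1 + p₂) * √(2 * pi * (17 * C)) * (L ^ (1 / 5 : ℝ) * L ^ (-(1 / 4) : ℝ)) := by ring
      _ ≤ _ := by
          rw [← rpow_add hL0]
          exact mul_le_mul_of_nonneg_left
            (Real.rpow_le_rpow_of_exponent_le hL (by norm_num)) (by positivity)

/-- The single scale estimate. -/
theorem exists_spaceBound_stationary (hα : 0 < α) (hα1 : α ≠ 1)
    (hab : AdmissibleForms α a b) (hκ : |κ| = 1) (hp : 0 < p₁) (hpp : p₁ ≤ p₂) (hq : 0 < q₁)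
    (hqq : q₁ ≤ q₂) (hs : |s| = 1) :
    ∃ e₀ : ℝ, 0 < e₀ ∧ e₀ ≤ 1 ∧ ∀ M, OscFam α s 1 p₁ p₂ q₁ q₂ M → ∃ C : ℝ, 0 ≤ C ∧
      ∀ L e, (1 ≤ L ∧ e ≠ 0 ∧ |e| ≤ e₀) →
      SpaceBound (ofReal (C * L ^ (-(1 / 80) : ℝ))) (formKernel κ a b e (M L e)) := by
  obtain ⟨e₁, he₁, he₁1, h1⟩ := exists_spaceBound_of_mixSize hα hα1 hab hκ hp hpp hq hqq hs
  by_cases ha : a = 0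
  · subst ha
    obtain ⟨e₂, he₂, he₂1, h2⟩ :=
      exists_spaceBound_of_small (b := b) (q₂ := q₂) hα hα1 hκ hp hpp hq hs
    refine ⟨min e₁ e₂, lt_min he₁ he₂, (min_le_left _ _).trans he₁1, fun M hM => ?_⟩
    obtain ⟨C₁, hC₁, h1⟩ := h1 M hM
    obtain ⟨C₂, hC₂, h2⟩ := h2 M hM
    refine ⟨max C₁ C₂, hC₁.trans (le_max_left _ _), fun L e ⟨hL, he0, he⟩ => ?_⟩
    have hL0 : 0 ≤ L := by linarith
    rcases le_total |e| (L ^ (-(4 / 5) : ℝ)) with h | h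
    · refine (h2 L e ⟨hL, he0, he.trans (min_le_right _ _), h⟩).mono ?_
      gcongr; exact le_max_right _ _
    · refine (h1 L e ⟨hL, he0, he.trans (min_le_left _ _), ?_⟩).mono ?_
      · rwa [mixSize, if_pos rfl]
      · gcongr; exact le_max_left _ _
  · refine ⟨e₁, he₁, he₁1, fun M hM => ?_⟩
    obtain ⟨C, hC, h⟩ := h1 M hM
    refine ⟨C, hC, fun L e ⟨hL, he0, he⟩ => h L e ⟨hL, he0, he, ?_⟩⟩
    rw [mixSize, if_neg ha]
    exact Real.rpow_le_one_of_one_le_of_nonpos hL (by norm_num)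

end

/-! ### Square integrable functions -/

theorem eLpNorm_two_eq (F : ℝ → ℂ) : eLpNorm F 2 volume = sqNorm F ^ (1 / 2 : ℝ) := by
  rw [eLpNorm_eq_lintegral_rpow_enorm_toReal (by norm_num) (by norm_num)]
  simp [sqNorm]

section

variable {K : ℝ → ℝ → ℂ} {F G : ℝ → ℂ}

theorem IsCcKernel.integrable_spaceOp (hK : IsCcKernel K) (hF : MemLp F 2)
    (hG : MemLp G 2) (x : ℝ) : Integrable (fun p : ℝ × ℝ => F p.1 * G p.2 * K p.1 p.2 *
      expI((p.1 + p.2) * x)) (volume.prod volume) := by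
  obtain ⟨R, hR0, hR⟩ := hK.bdd
  obtain ⟨M, hM⟩ := hK.exists_bound
  set J := Icc (-R) R with hI
  have hint : ∀ {F : ℝ → ℂ}, MemLp F 2 → Integrable (J.indicator F) := by
    intro F hF
    rw [integrable_indicator_iff measurableSet_Icc]
    have : IsFiniteMeasure (volume.restrict J) := ⟨by simp [hI]⟩
    exact (hF.restrict J).integrable one_le_two
  have hc : Continuous fun p : ℝ × ℝ =>
      K p.1 p.2 * expI((p.1 + p.2) * x) := hK.cont.mul (by fun_prop)
  refine (((hint hF).mul_prod (hint hG)).mul_bdd (c := M) hc.aestronglyMeasurable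
    (ae_of_all _ fun p => ?_)).congr (ae_of_all _ fun p => ?_)
  · rw [norm_mul, norm_expI, mul_one]; exact hM _ _
  · by_cases h1 : p.1 ∈ J
    · by_cases h2 : p.2 ∈ J
      · simp only [indicator_of_mem h1, indicator_of_mem h2]; ring
      · have : K p.1 p.2 = 0 := hR _ _ (Or.inr (by by_contra h; exact h2 (abs_le.1 (not_lt.1 h))))
        simp [this]
    · have : K p.1 p.2 = 0 := hR _ _ (Or.inl (by by_contra h; exact h1 (abs_le.1 (not_lt.1 h))))
      simp [this]

theorem IsCcKernel.spaceOp_eq_integral_prod (hK : IsCcKernel K) (hF : MemLp F 2)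
    (hG : MemLp G 2) (x : ℝ) : spaceOp K F G x = ∫ p : ℝ × ℝ, F p.1 * G p.2 * K p.1 p.2 *
      expI((p.1 + p.2) * x) ∂(volume.prod volume) :=
  (integral_prod _ (hK.integrable_spaceOp hF hG x)).symm

theorem IsCcKernel.spaceOp_sub (hK : IsCcKernel K) (hF : MemLp F 2)
    (hG : MemLp G 2) {F' G' : ℝ → ℂ} (hF' : MemLp F' 2) (hG' : MemLp G' 2)
    (x : ℝ) : spaceOp K F' G' x - spaceOp K F G x =
      spaceOp K (F' - F) G' x + spaceOp K F (G' - G) x := by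
  rw [hK.spaceOp_eq_integral_prod hF hG, hK.spaceOp_eq_integral_prod hF' hG',
    hK.spaceOp_eq_integral_prod (hF'.sub hF) hG', hK.spaceOp_eq_integral_prod hF (hG'.sub hG),
    ← integral_sub (hK.integrable_spaceOp hF' hG' x) (hK.integrable_spaceOp hF hG x),
    ← integral_add (hK.integrable_spaceOp (hF'.sub hF) hG' x)
      (hK.integrable_spaceOp hF (hG'.sub hG) x)]
  congr 1; ext p
  simp only [Pi.sub_apply]; ring

theorem IsCcKernel.exists_enorm_spaceOp_le (hK : IsCcKernel K) : ∃ S : ℝ≥0∞, S ≠ ⊤ ∧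
    ∀ F G : ℝ → ℂ, MemLp F 2 → MemLp G 2 → ∀ x,
      ‖spaceOp K F G x‖ₑ ≤ S * (eLpNorm F 2 volume * eLpNorm G 2 volume) := by
  have hS := (hK.mul_left hK.cont).integrable.2
  rw [hasFiniteIntegral_iff_enorm] at hS
  set S := ∫⁻ p : ℝ × ℝ, ‖K p.1 p.2 * K p.1 p.2‖ₑ with hSdef
  refine ⟨S ^ (1 / 2 : ℝ), (rpow_lt_top_of_nonneg (by norm_num) hS.ne).ne, fun F G hF hG x => ?_⟩
  rw [hK.spaceOp_eq_integral_prod hF hG, eLpNorm_two_eq, eLpNorm_two_eq]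
  refine (enorm_integral_le_lintegral_enorm _).trans ?_
  refine ENNReal_le_of_sq_le ?_
  have h := lintegral_mul_sq_le (μ := (volume : Measure ℝ).prod (volume : Measure ℝ))
    (f := fun p => ‖K p.1 p.2‖ₑ) (g := fun p => ‖F p.1‖ₑ * ‖G p.2‖ₑ) hK.cont.enorm.aemeasurable
    ((hF.1.enorm.comp_quasiMeasurePreserving Measure.quasiMeasurePreserving_fst).mul
      (hG.1.enorm.comp_quasiMeasurePreserving Measure.quasiMeasurePreserving_snd))
  calc _ = (∫⁻ p : ℝ × ℝ, ‖K p.1 p.2‖ₑ * (‖F p.1‖ₑ * ‖G p.2‖ₑ) ∂(volume.prod volume)) ^ 2 := by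
        congr 2; ext p
        rw [enorm_mul, enorm_mul, enorm_mul, ← ofReal_norm (exp _), norm_expI, ofReal_one]
        ring
    _ ≤ _ := h
    _ = S * (sqNorm F * sqNorm G) := by
        simp only [mul_pow]
        rw [lintegral_prod_mul (hF.1.enorm.pow_const 2) (hG.1.enorm.pow_const 2), hSdef]
        simp only [enorm_mul, sq, sqNorm]
        rfl
    _ = _ := by rw [mul_pow, mul_pow, sq_rpow_half, sq_rpow_half, sq_rpow_half]

/-- The estimate extends to square integrable functions by density and Fatou's lemma. -/
theorem SpaceBound.of_memLp {B : ℝ≥0∞} (hB : B ≠ ⊤) (hK : SpaceBound B K) (hF : MemLp F 2)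
    (hG : MemLp G 2) : StronglyMeasurable (spaceOp K F G) ∧
      ∫⁻ x, ‖spaceOp K F G x‖ₑ ≤ B * (sqNorm F * sqNorm G) ^ (1 / 2 : ℝ) := by
  have hpos : ∀ n : ℕ, ((n : ℝ≥0∞) + 1)⁻¹ ≠ 0 := fun n => by simp
  have hδ : Tendsto (fun n : ℕ => ((n : ℝ≥0∞) + 1)⁻¹) atTop (nhds 0) := by
    have := (Filter.tendsto_add_atTop_iff_nat 1).2 ENNReal.tendsto_inv_nat_nhds_zero
    simpa using this
  have hδ1 : ∀ n : ℕ, ((n : ℝ≥0∞) + 1)⁻¹ ≤ 1 := fun n => by simp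
  choose Fn hFc hFe hFn hFm using fun n : ℕ =>
    hF.exists_hasCompactSupport_eLpNorm_sub_le (by norm_num) (hpos n)
  choose Gn hGc hGe hGn hGm using fun n : ℕ =>
    hG.exists_hasCompactSupport_eLpNorm_sub_le (by norm_num) (hpos n)
  have hFe' : ∀ n, eLpNorm (Fn n - F) 2 volume ≤ ((n : ℝ≥0∞) + 1)⁻¹ := fun n => by
    rw [eLpNorm_sub_comm]; exact hFe n
  have hGe' : ∀ n, eLpNorm (Gn n - G) 2 volume ≤ ((n : ℝ≥0∞) + 1)⁻¹ := fun n => by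
    rw [eLpNorm_sub_comm]; exact hGe n
  have hnorm : ∀ {F F' : ℝ → ℂ} {δ : ℝ≥0∞}, MemLp F 2 → MemLp F' 2 →
      eLpNorm (F' - F) 2 volume ≤ δ → eLpNorm F' 2 volume ≤ eLpNorm F 2 volume + δ := by
    intro F F' δ hF hF' h
    have := eLpNorm_add_le hF.1 (hF'.sub hF).1 one_le_two
    rw [add_sub_cancel] at this
    exact this.trans (by gcongr)
  obtain ⟨S, hS, hSb⟩ := hK.isCc.exists_enorm_spaceOp_le
  set f := eLpNorm F 2 volume
  set g := eLpNorm G 2 volume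
  have hf' : f ≠ ⊤ := hF.2.ne
  have hg' : g ≠ ⊤ := hG.2.ne
  have hlim : ∀ x, Tendsto (fun n => spaceOp K (Fn n) (Gn n) x) atTop (nhds (spaceOp K F G x)) := by
    intro x
    rw [tendsto_iff_edist_tendsto_0]
    have hz : Tendsto (fun n : ℕ => S * (g + 1 + f) * ((n : ℝ≥0∞) + 1)⁻¹) atTop (nhds 0) := by
      have := ENNReal.Tendsto.const_mul (a := S * (g + 1 + f)) hδ
        (Or.inr (mul_ne_top hS (by simp [hf', hg'])))
      rwa [mul_zero] at this
    refine tendsto_of_tendsto_of_tendsto_of_le_of_le tendsto_const_nhds hz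
      (fun _ => bot_le) fun n => ?_
    simp only
    rw [edist_eq_enorm_sub, hK.isCc.spaceOp_sub hF hG (hFm n) (hGm n)]
    refine (enorm_add_le _ _).trans ?_
    calc _ ≤ S * (eLpNorm (Fn n - F) 2 volume * eLpNorm (Gn n) 2 volume) +
          S * (f * eLpNorm (Gn n - G) 2 volume) :=
          add_le_add (hSb _ _ ((hFm n).sub hF) (hGm n) x) (hSb _ _ hF ((hGm n).sub hG) x)
      _ ≤ S * (((n : ℝ≥0∞) + 1)⁻¹ * (g + 1)) + S * (f * ((n : ℝ≥0∞) + 1)⁻¹) := by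
          gcongr
          · exact hFe' n
          · exact (hnorm hG (hGm n) (hGe' n)).trans (by gcongr; exact hδ1 n)
          · exact hGe' n
      _ = _ := by ring
  have hcont : ∀ n, Continuous (spaceOp K (Fn n) (Gn n)) := fun n =>
    hK.isCc.continuous_spaceOp (hFn n) (hGn n)
  refine ⟨stronglyMeasurable_of_tendsto atTop (fun n => (hcont n).stronglyMeasurable)
    (tendsto_pi_nhds.2 hlim), ?_⟩
  have hmul : ∀ F G, (sqNorm F * sqNorm G) ^ (1 / 2 : ℝ) =
      eLpNorm F 2 volume * eLpNorm G 2 volume := fun F G => by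
    rw [eLpNorm_two_eq, eLpNorm_two_eq, mul_rpow_of_nonneg _ _ (by norm_num)]
  rw [hmul]
  have hB' : Tendsto (fun n : ℕ => B * ((f + ((n : ℝ≥0∞) + 1)⁻¹) * (g + ((n : ℝ≥0∞) + 1)⁻¹)))
      atTop (nhds (B * (f * g))) := by
    refine ENNReal.Tendsto.const_mul ?_ (Or.inr hB)
    have h1 := (tendsto_const_nhds (x := f)).add hδ
    have h2 := (tendsto_const_nhds (x := g)).add hδ
    rw [add_zero] at h1 h2
    exact ENNReal.Tendsto.mul h1 (Or.inr hg') h2 (Or.inr hf')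
  calc ∫⁻ x, ‖spaceOp K F G x‖ₑ
      = ∫⁻ x, liminf (fun n => ‖spaceOp K (Fn n) (Gn n) x‖ₑ) atTop :=
        lintegral_congr fun x => ((continuous_enorm.tendsto _).comp (hlim x)).liminf_eq.symm
    _ ≤ liminf (fun n => ∫⁻ x, ‖spaceOp K (Fn n) (Gn n) x‖ₑ) atTop :=
        lintegral_liminf_le fun n => (hcont n).enorm.measurable
    _ ≤ liminf (fun n : ℕ => B * ((f + ((n : ℝ≥0∞) + 1)⁻¹) * (g + ((n : ℝ≥0∞) + 1)⁻¹))) atTop := by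
        refine Filter.liminf_le_liminf (Filter.Eventually.of_forall fun n => ?_)
        refine (hK.le _ _ (hFn n) (hFc n) (hGn n) (hGc n)).trans ?_
        rw [hmul]
        gcongr
        · exact hnorm hF (hFm n) (hFe' n)
        · exact hnorm hG (hGm n) (hGe' n)
    _ = _ := hB'.liminf_eq

/-! ### Symmetries of the estimate -/

theorem SpaceBound.swap {B : ℝ≥0∞} (hK : SpaceBound B K) : SpaceBound B fun ξ η => K η ξ := by
  refine ⟨hK.isCc.swap, fun F G hF hFc hG hGc => ?_⟩
  have e : ∀ x, spaceOp (fun ξ η => K η ξ) F G x = spaceOp K G F x :=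
    spaceOp_swap hK.isCc.swap hF hG
  simp only [e]
  rw [mul_comm (sqNorm F)]
  exact hK.le G F hG hGc hF hFc

theorem SpaceBound.add {B B' : ℝ≥0∞} {K' : ℝ → ℝ → ℂ} (hK : SpaceBound B K)
    (hK' : SpaceBound B' K') : SpaceBound (B + B') fun ξ η => K ξ η + K' ξ η := by
  obtain ⟨R, hR0, hR⟩ := hK.isCc.bdd
  obtain ⟨R', hR0', hR'⟩ := hK'.isCc.bdd
  refine ⟨⟨hK.isCc.cont.add hK'.isCc.cont, max R R', le_max_of_le_left hR0, fun x y h => ?_⟩,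
    fun F G hF hFc hG hGc => ?_⟩
  · rw [hR x y (h.imp (le_max_left _ _).trans_lt (le_max_left _ _).trans_lt),
      hR' x y (h.imp (le_max_right _ _).trans_lt (le_max_right _ _).trans_lt), add_zero]
  · have e : ∀ x, spaceOp (fun ξ η => K ξ η + K' ξ η) F G x = spaceOp K F G x + spaceOp K' F G x :=
      spaceOp_add hK.isCc hK'.isCc hF hG
    simp only [e]
    refine (lintegral_mono fun x => enorm_add_le _ _).trans ?_
    rw [lintegral_add_left (hK.isCc.continuous_spaceOp hF hG).enorm.measurable, add_mul]
    exact add_le_add (hK.le F G hF hFc hG hGc) (hK'.le F G hF hFc hG hGc)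

theorem SpaceBound.const_mul {B : ℝ≥0∞} (hK : SpaceBound B K) (c : ℂ) :
    SpaceBound (‖c‖ₑ * B) fun ξ η => c * K ξ η := by
  refine ⟨hK.isCc.mul_left (by fun_prop), fun F G hF hFc hG hGc => ?_⟩
  have e : ∀ x, spaceOp (fun ξ η => c * K ξ η) F G x = c * spaceOp K F G x := fun x =>
    spaceOp_const_mul K F G c x
  simp only [e, enorm_mul]
  rw [lintegral_const_mul' _ _ (by simp), mul_assoc]
  gcongr
  exact hK.le F G hF hFc hG hGc

theorem sqNorm_comp_mul_left {r : ℝ} (hr : 0 < r) (F : ℝ → ℂ) :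
    ofReal r * sqNorm (fun ξ => F (r * ξ)) = sqNorm F := by
  rw [sqNorm, sqNorm, lintegral_comp_mul_left hr.ne' (fun ξ => ‖F ξ‖ₑ ^ 2), abs_of_pos hr]

theorem SpaceBound.dilate {B : ℝ≥0∞} (hK : SpaceBound B K) {r : ℝ} (hr : 0 < r) :
    SpaceBound B fun ξ η => K (ξ / r) (η / r) := by
  obtain ⟨R, hR0, hR⟩ := hK.isCc.bdd
  refine ⟨⟨hK.isCc.cont.comp (f := fun p : ℝ × ℝ => (p.1 / r, p.2 / r)) (by fun_prop), R * r,
    by positivity, fun x y h => hR _ _ ?_⟩, fun F G hF hFc hG hGc => ?_⟩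
  · rwa [abs_div, abs_div, abs_of_pos hr, lt_div_iff₀ hr, lt_div_iff₀ hr]
  have e : ∀ x, spaceOp (fun ξ η => K (ξ / r) (η / r)) F G x =
      (r ^ 2 : ℝ) * spaceOp K (fun ξ => F (r * ξ)) (fun η => G (r * η)) (r * x) := by
    intro x
    have h : ∀ f : ℝ → ℂ, ∫ t, f t = r * ∫ t, f (r * t) := by
      intro f
      rw [Measure.integral_comp_mul_left, abs_of_pos (inv_pos.2 hr), real_smul,
        ← mul_assoc, ← Complex.ofReal_mul, mul_inv_cancel₀ hr.ne', Complex.ofReal_one, one_mul]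
    unfold spaceOp
    rw [h]
    conv_lhs => enter [2, 2, ξ]; rw [h]
    rw [integral_const_mul, ← mul_assoc, sq, Complex.ofReal_mul]
    congr 2; ext ξ; congr 1; ext η
    simp only [mul_div_cancel_left₀ _ hr.ne']
    congr 4; ring
  simp only [e, enorm_mul]
  have hscale := lintegral_comp_mul_left hr.ne'
    (fun x => ‖spaceOp K (fun ξ => F (r * ξ)) (fun η => G (r * η)) x‖ₑ)
  rw [abs_of_pos hr] at hscale
  have hc : ∀ {F : ℝ → ℂ}, HasCompactSupport F → HasCompactSupport fun ξ => F (r * ξ) :=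
    fun h => h.comp_homeomorph (Homeomorph.mulLeft₀ r hr.ne')
  have h := hK.le (fun ξ => F (r * ξ)) (fun η => G (r * η)) (by fun_prop) (hc hFc) (by fun_prop)
    (hc hGc)
  rw [lintegral_const_mul' _ _ (by simp), ← ofReal_norm, norm_real,
    norm_of_nonneg (by positivity), sq, ofReal_mul hr.le, mul_assoc, ← hscale,
    ← sqNorm_comp_mul_left hr F, ← sqNorm_comp_mul_left hr G]
  calc _ ≤ ofReal r * (B * (sqNorm (fun ξ => F (r * ξ)) *
        sqNorm (fun η => G (r * η))) ^ (1 / 2 : ℝ)) := by gcongr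
    _ = B * (ofReal r * (sqNorm (fun ξ => F (r * ξ)) *
        sqNorm (fun η => G (r * η))) ^ (1 / 2 : ℝ)) := by ring
    _ = _ := by
      congr 1
      rw [mul_mul_mul_comm, mul_rpow_of_nonneg (ofReal r * ofReal r) _
        (by norm_num : (0 : ℝ) ≤ 1 / 2), ← sq, ← rpow_two, ← rpow_mul]
      norm_num

end

/-! ### Reduction of the multiplier to model kernels -/

/-- The single scale estimate, with one threshold for all choices of signs. -/
theorem exists_spaceBound {α a b p₁ p₂ q₁ q₂ : ℝ} (hα : 0 < α) (hα1 : α ≠ 1)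
    (hab : AdmissibleForms α a b) (hp : 0 < p₁) (hpp : p₁ ≤ p₂) (hq : 0 < q₁) (hqq : q₁ ≤ q₂) :
    ∃ e₀ : ℝ, 0 < e₀ ∧ e₀ ≤ 1 ∧ ∀ ρ χ₁ χ₂ : ℝ → ℂ, IsPosBump ρ → IsBoxBump p₁ p₂ χ₁ →
      IsBoxBump q₁ q₂ χ₂ → ∀ κ s ι : ℝ, |κ| = 1 → |s| = 1 → |ι| = 1 → ∃ C : ℝ, 0 ≤ C ∧
      ∀ L e, 1 ≤ L → e ≠ 0 → |e| ≤ e₀ → SpaceBound (ofReal (C * L ^ (-(1 / 80) : ℝ)))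
        (formKernel κ a b e (oscMul α s ι ρ χ₁ χ₂ L)) := by
  have ha : a ≠ -1 := by
    rcases hab with h | h
    · exact h.2.2.1
    · rw [h]; norm_num
  have hpm : ∀ x : ℝ, |x| = 1 → x = 1 ∨ x = -1 := fun x => (abs_eq zero_le_one).1
  have h := fun κ s : ℝ => fun (hκ : |κ| = 1) (hs : |s| = 1) =>
    exists_spaceBound_stationary (p₂ := p₂) (q₂ := q₂) hα hα1 hab hκ hp hpp hq hqq hs
  choose! e₀ he₀ he₀1 h using h
  have u1 : |(1 : ℝ)| = 1 := by simp
  have u2 : |(-1 : ℝ)| = 1 := by simp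
  set E := min (min (e₀ 1 1) (e₀ 1 (-1))) (min (e₀ (-1) 1) (e₀ (-1) (-1))) with hE
  have hE0 : 0 < E := lt_min (lt_min (he₀ _ _ u1 u1) (he₀ _ _ u1 u2))
    (lt_min (he₀ _ _ u2 u1) (he₀ _ _ u2 u2))
  have hEle : ∀ κ s : ℝ, |κ| = 1 → |s| = 1 → E ≤ e₀ κ s := by
    intro κ s hκ hs
    rcases hpm κ hκ with rfl | rfl <;> rcases hpm s hs with rfl | rfl <;> simp [hE]
  have hE1 : E ≤ 1 := (hEle 1 1 u1 u1).trans (he₀1 _ _ u1 u1)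
  refine ⟨E, hE0, hE1, fun ρ χ₁ χ₂ hρ hχ₁ hχ₂ κ s ι hκ hs hι => ?_⟩
  have hM := fun ι => OscFam.base (α := α) (s := s) (ι := ι) hρ hχ₁ hχ₂
  rcases hpm ι hι with rfl | rfl
  · obtain ⟨C, hC, hb⟩ := h κ s hκ hs _ (hM 1)
    exact ⟨C, hC, fun L e hL he0 he => hb L e ⟨hL, he0, he.trans (hEle κ s hκ hs)⟩⟩
  · obtain ⟨C, hC, hb⟩ :=
      exists_spaceBound_nonstationary hα ha hab.one_sub_mul_ne_zero hκ hp hq hs (hM (-1))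
    exact ⟨C, hC, fun L e hL he0 he => hb L e ⟨hL, he0, he.trans hE1⟩⟩

/-- The restriction of `ψ` to the positive half-line, extended by zero. -/
def rightHalf (ψ : ℝ → ℝ) (t : ℝ) : ℂ := if 0 < t then (ψ t : ℂ) else 0

theorem contDiff_of_zero_off_Icc {f : ℝ → ℂ} {c d : ℝ} (hc : 0 < c)
    (h0 : ∀ t, t ∉ Icc c d → f t = 0) (h : ∀ t, 0 < t → SmoothAt f t) : Smooth f := by
  rw [contDiff_iff_contDiffAt]
  intro t
  rcases lt_or_ge 0 t with ht | ht
  · exact h t ht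
  · refine contDiffAt_const (c := (0 : ℂ)) |>.congr_of_eventuallyEq ?_
    filter_upwards [Iio_mem_nhds (show t < c by linarith)] with u hu
    exact h0 u fun hh => by linarith [hh.1, Set.mem_Iio.1 hu]

theorem tsupport_subset_Icc {f : ℝ → ℂ} {c d : ℝ} (h0 : ∀ t, t ∉ Icc c d → f t = 0) :
    tsupport f ⊆ Icc c d :=
  closure_minimal (fun t ht => by by_contra h; exact ht (h0 t h)) isClosed_Icc

theorem isPosBump_of_zero_off_Icc {f : ℝ → ℂ} {c d : ℝ} (hc : 0 < c)
    (h0 : ∀ t, t ∉ Icc c d → f t = 0) (h : ∀ t, 0 < t → SmoothAt f t) : IsPosBump f :=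
  ⟨contDiff_of_zero_off_Icc hc h0 h, HasCompactSupport.of_support_subset_isCompact isCompact_Icc
    ((subset_tsupport _).trans (tsupport_subset_Icc h0)),
    (tsupport_subset_Icc h0).trans fun _ ht => hc.trans_le ht.1⟩

section

variable {ψ : ℝ → ℝ} {α : ℝ} {ρ : ℝ → ℂ}

theorem eq_zero_of_tsupport (hs : tsupport ψ ⊆ {t : ℝ | 1 / 4 < |t| ∧ |t| < 4}) {t : ℝ}
    (ht : |t| ∉ Icc (1 / 4 : ℝ) 4) : ψ t = 0 := by
  by_contra h
  have := hs (subset_tsupport _ h)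
  exact ht ⟨this.1.le, this.2.le⟩

theorem rightHalf_eq_zero (hs : tsupport ψ ⊆ {t : ℝ | 1 / 4 < |t| ∧ |t| < 4}) {t : ℝ}
    (ht : t ∉ Icc (1 / 4 : ℝ) 4) : rightHalf ψ t = 0 := by
  unfold rightHalf
  split_ifs with h
  · rw [eq_zero_of_tsupport hs (by rwa [abs_of_pos h]), Complex.ofReal_zero]
  · rfl

theorem contDiffAt_rightHalf (hψ : Smooth ψ) {t : ℝ} (ht : 0 < t) :
    SmoothAt (rightHalf ψ) t := by
  refine (ofRealCLM.contDiff.comp hψ).contDiffAt.congr_of_eventuallyEq ?_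
  filter_upwards [Ioi_mem_nhds ht] with u hu
  exact if_pos hu

theorem isPosBump_rightHalf (hψ : Smooth ψ)
    (hs : tsupport ψ ⊆ {t : ℝ | 1 / 4 < |t| ∧ |t| < 4}) : IsPosBump (rightHalf ψ) :=
  isPosBump_of_zero_off_Icc (by norm_num) (fun _ => rightHalf_eq_zero hs)
    fun _ => contDiffAt_rightHalf hψ

theorem isBoxBump_rightHalf (hψ : Smooth ψ)
    (hs : tsupport ψ ⊆ {t : ℝ | 1 / 4 < |t| ∧ |t| < 4}) (hα : 0 < α) :
    IsBoxBump (1 / (4 * α)) (4 / α) fun t => rightHalf ψ (α * t) := by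
  refine ⟨(isPosBump_rightHalf hψ hs).contDiff.comp (contDiff_const.mul contDiff_id),
    tsupport_subset_Icc fun t ht => rightHalf_eq_zero hs fun h => ht ⟨?_, ?_⟩⟩
  · rw [← div_div, div_le_iff₀' hα]; exact h.1
  · rw [le_div_iff₀' hα]; exact h.2

/-- The amplitude after the substitution `u = t ^ α`. -/
def powSubst (α : ℝ) (ρ : ℝ → ℂ) (u : ℝ) : ℂ :=
  if 0 < u then ((1 / α * u ^ (1 / α - 1) : ℝ) : ℂ) * ρ (u ^ (1 / α)) else 0

theorem isPosBump_powSubst (hα : 0 < α) (hρ : IsPosBump ρ) : IsPosBump (powSubst α ρ) := by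
  obtain ⟨t₁, t₂, ht₁, ht, h0⟩ := hρ.exists_interval
  refine isPosBump_of_zero_off_Icc (c := t₁ ^ α) (d := t₂ ^ α) (by positivity) (fun u hu => ?_)
    fun u hu => ?_
  · unfold powSubst
    split_ifs with h
    · have e : (u ^ (1 / α)) ^ α = u := by
        rw [← Real.rpow_mul h.le, one_div_mul_cancel hα.ne', rpow_one]
      rw [h0, mul_zero]
      refine fun hh => hu (e ▸ ⟨?_, ?_⟩) <;> gcongr
      exacts [hh.1.le, hh.2.le]
    · rfl
  · have h1 : ∀ r : ℝ, SmoothAt (fun u : ℝ => u ^ r) u :=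
      fun r => Real.contDiffAt_rpow_const_of_ne hu.ne'
    have h2 := (ofRealCLM.contDiff.contDiffAt.comp u
      (contDiffAt_const (c := 1 / α) |>.mul (h1 (1 / α - 1)))).mul
        (hρ.contDiff.contDiffAt.comp u (h1 (1 / α)))
    refine h2.congr_of_eventuallyEq ?_
    filter_upwards [Ioi_mem_nhds hu] with v hv
    exact if_pos hv

/-- The substitution `u = t ^ α` interchanges the roles of the two frequencies. -/
theorem oscInt_eq_powSubst (hα : 0 < α) (hρ : IsPosBump ρ) {s ι : ℝ} (hι : |ι| = 1) (L P Q : ℝ) :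
    oscInt α s ι ρ L P Q = oscInt (1 / α) (-(s * ι)) ι (powSubst α ρ) L Q P := by
  have hι2 : ι * ι = 1 := by rw [← abs_mul_abs_self, hι, one_mul]
  have hpos : ∀ {f : ℝ → ℂ}, (∀ t, t ≤ 0 → f t = 0) → ∫ t, f t = ∫ t in Ioi 0, f t := by
    intro f hf
    refine (setIntegral_eq_integral_of_forall_compl_eq_zero fun t ht => hf t ?_).symm
    simpa using ht
  obtain ⟨t₁, t₂, ht₁, ht, h0⟩ := hρ.exists_interval
  rw [oscInt, oscInt, hpos, hpos, ← integral_comp_rpow_Ioi_of_pos (one_div_pos.2 hα)]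
  · refine setIntegral_congr_fun measurableSet_Ioi fun u hu => ?_
    have hu0 : (0 : ℝ) < u := hu
    simp only [powSubst, if_pos hu0, oscPhase, real_smul]
    rw [← Real.rpow_mul hu0.le, one_div_mul_cancel hα.ne', rpow_one, mul_left_comm]
    congr 4
    linear_combination (s * L * P * u ^ (1 / α)) * hι2
  · intro t ht; simp [powSubst, not_lt.2 ht]
  · intro t ht; rw [h0 t fun h => by linarith [h.1], mul_zero]

end

/-- The model kernels at a single scale: both signs of `(α - 1) j` are reduced to kernels for
which one of the linear forms carries a small factor. -/
theorem exists_spaceBound_scale {a α : ℝ} (ha : a ≠ -1) (hα : 0 < α) (hα1 : α ≠ 1) (hα2 : α ≠ 2) :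
    ∃ e₀ : ℝ, 0 < e₀ ∧ e₀ ≤ 1 ∧ ∀ ρ χ₁ χ₂ : ℝ → ℂ, IsPosBump ρ → IsBoxBump (1 / 4) 4 χ₁ →
      IsBoxBump (1 / (4 * α)) (4 / α) χ₂ → ∀ s ι κ₁ κ₂ : ℝ, |s| = 1 → |ι| = 1 → |κ₁| = 1 →
      |κ₂| = 1 → ∃ C : ℝ, 0 ≤ C ∧ ∀ L r₁ r₂ : ℝ, 1 ≤ L → 0 < r₁ → 0 < r₂ →
      (r₁ ≤ e₀ * r₂ ∨ r₂ ≤ e₀ * r₁) →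
      SpaceBound (ofReal (C * L ^ (-(1 / 80) : ℝ))) fun ξ η =>
        oscMul α s ι ρ χ₁ χ₂ L (κ₁ * ((ξ - a * η) / r₁)) (κ₂ * (η / r₂)) := by
  have hadm : AdmissibleForms α a 0 := by
    by_cases h : a = 0
    · exact Or.inr h
    · exact Or.inl ⟨rfl, h, ha, hα2⟩
  have hb1 : 1 / (4 * α) ≤ 4 / α := by rw [div_le_div_iff₀ (by positivity) hα]; nlinarith
  have hα' : 1 / α ≠ 1 := fun h => hα1 (by rwa [one_div, inv_eq_one] at h)
  obtain ⟨e₁, he₁, he₁1, h1⟩ := exists_spaceBound hα hα1 hadm (p₁ := 1 / 4) (p₂ := 4)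
    (q₁ := 1 / (4 * α)) (q₂ := 4 / α) (by norm_num) (by norm_num) (by positivity) hb1
  obtain ⟨e₂, he₂, he₂1, h2⟩ := exists_spaceBound (one_div_pos.2 hα) hα'
    (Or.inr rfl : AdmissibleForms (1 / α) 0 a) (p₁ := 1 / (4 * α)) (p₂ := 4 / α)
    (q₁ := 1 / 4) (q₂ := 4) (by positivity) hb1 (by norm_num) (by norm_num)
  refine ⟨min e₁ e₂, lt_min he₁ he₂, (min_le_left _ _).trans he₁1,
    fun ρ χ₁ χ₂ hρ hχ₁ hχ₂ s ι κ₁ κ₂ hs hι hκ₁ hκ₂ => ?_⟩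
  obtain ⟨C₁, hC₁, h1⟩ := h1 ρ χ₁ χ₂ hρ hχ₁ hχ₂ κ₁ s ι hκ₁ hs hι
  obtain ⟨C₂, hC₂, h2⟩ := h2 (powSubst α ρ) χ₂ χ₁ (isPosBump_powSubst hα hρ) hχ₂ hχ₁ κ₂
    (-(s * ι)) ι hκ₂ (by rw [abs_neg, abs_mul, hs, hι, one_mul]) hι
  refine ⟨max C₁ C₂, hC₁.trans (le_max_left _ _), fun L r₁ r₂ hL hr₁ hr₂ hr => ?_⟩
  have hL0 : 0 < L := by linarith
  have hne : ∀ κ : ℝ, |κ| = 1 → κ ≠ 0 := fun κ h h0 => by simp [h0] at h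
  rcases hr with hr | hr
  · have he : |κ₂ * (r₁ / r₂)| ≤ e₁ := by
      rw [abs_mul, hκ₂, one_mul, abs_of_pos (by positivity), div_le_iff₀ hr₂]
      exact hr.trans (by gcongr; exact min_le_left _ _)
    have h := ((h1 L _ hL (mul_ne_zero (hne _ hκ₂) (by positivity)) he).dilate hr₁).mono
      (ofReal_le_ofReal (mul_le_mul_of_nonneg_right (le_max_left C₁ C₂) (by positivity)))
    convert h using 3 with ξ η
    simp only [formKernel, formP, formQ]
    congr 1
    · field_simp
    · field_simp; ring
  · have he : |κ₁ * (r₂ / r₁)| ≤ e₂ := by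
      rw [abs_mul, hκ₁, one_mul, abs_of_pos (by positivity), div_le_iff₀ hr₁]
      exact hr.trans (by gcongr; exact min_le_right _ _)
    have h := ((h2 L _ hL (mul_ne_zero (hne _ hκ₁) (by positivity)) he).dilate hr₂).swap.mono
      (ofReal_le_ofReal (mul_le_mul_of_nonneg_right (le_max_right C₁ C₂) (by positivity)))
    convert h using 3 with ξ η
    simp only [formKernel, formP, formQ]
    rw [oscMul, oscMul, oscInt_eq_powSubst hα hρ hι, mul_right_comm]
    have e1 : κ₂ * (η / r₂ - 0 * (ξ / r₂)) = κ₂ * (η / r₂) := by ring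
    have e2 : κ₁ * (r₂ / r₁) * (ξ / r₂ - a * (η / r₂)) = κ₁ * ((ξ - a * η) / r₁) := by field_simp
    rw [e1, e2]

theorem two_rpow_le_or_le {α j e : ℝ} (hj : (2 : ℝ) ^ (-(|α - 1| * |j|)) ≤ e) (v : ℝ) :
    (2 : ℝ) ^ (j + v) ≤ e * 2 ^ (α * j + v) ∨ (2 : ℝ) ^ (α * j + v) ≤ e * 2 ^ (j + v) := by
  have h : ∀ x y : ℝ, x - y = -(|α - 1| * |j|) → (2 : ℝ) ^ x ≤ e * 2 ^ y := by
    intro x y hxy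
    calc (2 : ℝ) ^ x = 2 ^ (x - y) * 2 ^ y := by rw [← rpow_add two_pos]; ring_nf
      _ ≤ _ := by rw [hxy]; gcongr
  rw [← abs_mul] at h
  rcases le_total 0 ((α - 1) * j) with h0 | h0
  · exact Or.inl (h _ _ (by rw [abs_of_nonneg h0]; ring))
  · exact Or.inr (h _ _ (by rw [abs_of_nonpos h0]; ring))

/-- The multiplier is the sum of eight model kernels, one for each choice of the signs of `t`, of
`ξ - a η` and of `η`. -/
theorem exists_spaceBound_pieceMultiplier {a α : ℝ} (ha : a ≠ -1) (hα : 0 < α) (hα1 : α ≠ 1)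
    (hα2 : α ≠ 2) : ∃ e₀ : ℝ, 0 < e₀ ∧ e₀ ≤ 1 ∧ ∀ ρ φ : ℝ → ℝ, IsSpatialCutoff ρ →
      IsFrequencyCutoff φ → ∀ σ : ℝ, |σ| = 1 → ∃ C : ℝ, 0 ≤ C ∧ ∀ (j : ℤ) (m : ℕ),
      (2 : ℝ) ^ (-(|α - 1| * |(j : ℝ)|)) ≤ e₀ →
      SpaceBound (ofReal (C * ((2 : ℝ) ^ m) ^ (-(1 / 80) : ℝ)))
        (pieceMultiplier ρ φ σ a α j m m) := by
  obtain ⟨e₀, he₀, he₀1, h⟩ := exists_spaceBound_scale ha hα hα1 hα2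
  refine ⟨e₀, he₀, he₀1, fun ρ φ hρ hφ σ hσ => ?_⟩
  have hρ' := isPosBump_rightHalf hρ.contDiff hρ.tsupport_subset
  have hφ' := isPosBump_rightHalf hφ.contDiff hφ.tsupport_subset
  have hχ₁ : IsBoxBump (1 / 4) 4 (rightHalf φ) :=
    ⟨hφ'.contDiff, tsupport_subset_Icc fun _ => rightHalf_eq_zero hφ.tsupport_subset⟩
  have hχ₂ := isBoxBump_rightHalf hφ.contDiff hφ.tsupport_subset hα
  have h := h _ _ _ hρ' hχ₁ hχ₂
  set χ₂ : ℝ → ℂ := fun t => rightHalf φ (α * t)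
  have u1 : |(1 : ℝ)| = 1 := by simp
  have u2 : |(-1 : ℝ)| = 1 := by simp
  have hterm : ∀ κ₁ κ₂ : ℝ, |κ₁| = 1 → |κ₂| = 1 → ∃ C : ℝ, 0 ≤ C ∧ ∀ L r₁ r₂ : ℝ, 1 ≤ L →
      0 < r₁ → 0 < r₂ → (r₁ ≤ e₀ * r₂ ∨ r₂ ≤ e₀ * r₁) →
      SpaceBound (ofReal (C * L ^ (-(1 / 80) : ℝ))) fun ξ η =>
        oscMul α (1 * κ₁) (1 * κ₂ * (1 * κ₁)) (rightHalf ρ) (rightHalf φ) χ₂ L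
          (κ₁ * ((ξ - a * η) / r₁)) (κ₂ * (η / r₂)) +
        (-1) * oscMul α (-1 * κ₁) (σ * κ₂ * (-1 * κ₁)) (rightHalf ρ) (rightHalf φ) χ₂ L
          (κ₁ * ((ξ - a * η) / r₁)) (κ₂ * (η / r₂)) := by
    intro κ₁ κ₂ hκ₁ hκ₂
    obtain ⟨C, hC, h1⟩ := h (1 * κ₁) (1 * κ₂ * (1 * κ₁)) κ₁ κ₂ (by simpa using hκ₁)
      (by simp [abs_mul, hκ₁, hκ₂]) hκ₁ hκ₂
    obtain ⟨C', hC', h2⟩ := h (-1 * κ₁) (σ * κ₂ * (-1 * κ₁)) κ₁ κ₂ (by simpa using hκ₁)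
      (by simp [abs_mul, hκ₁, hκ₂, hσ]) hκ₁ hκ₂
    refine ⟨C + C', by positivity, fun L r₁ r₂ hL hr₁ hr₂ hr => ?_⟩
    have hL0 : 0 ≤ L := by linarith
    refine ((h1 L r₁ r₂ hL hr₁ hr₂ hr).add ((h2 L r₁ r₂ hL hr₁ hr₂ hr).const_mul (-1))).mono ?_
    rw [enorm_neg, enorm_one, one_mul, add_mul, ofReal_add (by positivity) (by positivity)]
  obtain ⟨C₁, hC₁, t1⟩ := hterm 1 1 u1 u1
  obtain ⟨C₂, hC₂, t2⟩ := hterm 1 (-1) u1 u2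
  obtain ⟨C₃, hC₃, t3⟩ := hterm (-1) 1 u2 u1
  obtain ⟨C₄, hC₄, t4⟩ := hterm (-1) (-1) u2 u2
  refine ⟨C₁ + C₂ + (C₃ + C₄), by positivity, fun j m hj => ?_⟩
  set L : ℝ := 2 ^ m with hL
  have hL1 : 1 ≤ L := one_le_pow₀ (by norm_num)
  have hL0 : 0 < L := by linarith
  set r₁ : ℝ := (2 : ℝ) ^ (j + (m : ℤ)) with hr₁
  set r₂ : ℝ := (2 : ℝ) ^ (α * (j : ℝ) + ((m : ℤ) : ℝ)) with hr₂
  have hr₁0 : 0 < r₁ := by positivity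
  have hr₂0 : 0 < r₂ := by positivity
  have hr₁' : r₁ = 2 ^ ((j : ℝ) + ((m : ℤ) : ℝ)) := by rw [hr₁, ← Real.rpow_intCast]; push_cast; rfl
  have hr : r₁ ≤ e₀ * r₂ ∨ r₂ ≤ e₀ * r₁ := by rw [hr₁']; exact two_rpow_le_or_le hj _
  have hsum := ((t1 L r₁ r₂ hL1 hr₁0 hr₂0 hr).add (t2 L r₁ r₂ hL1 hr₁0 hr₂0 hr)).add
    ((t3 L r₁ r₂ hL1 hr₁0 hr₂0 hr).add (t4 L r₁ r₂ hL1 hr₁0 hr₂0 hr))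
  rw [← ofReal_add (by positivity) (by positivity), ← ofReal_add (by positivity) (by positivity),
    ← ofReal_add (by positivity) (by positivity), ← add_mul, ← add_mul, ← add_mul] at hsum
  convert hsum using 3 with ξ η
  have hsplit : ∀ x : ℝ, (φ x : ℂ) = rightHalf φ x + rightHalf φ (-x) := by
    intro x
    unfold rightHalf
    rcases lt_trichotomy x 0 with hx | rfl | hx
    · rw [if_neg (by linarith), if_pos (by linarith), hφ.even, zero_add]
    · simp [eq_zero_of_tsupport hφ.tsupport_subset (t := 0) (by norm_num)]
    · rw [if_pos hx, if_neg (by linarith), add_zero]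
  set W : ℝ → ℝ → ℂ := fun ε τ => ∫ t, expI(L * (-(ε * ((ξ - a * η) / r₁)) * t +
    τ * (η / r₂) * t ^ α)) * rightHalf ρ t with hW
  have hosc : ∀ ε τ κ₁ κ₂ : ℝ, ε * ε = 1 → κ₁ * κ₁ = 1 → κ₂ * κ₂ = 1 →
      oscInt α (ε * κ₁) (τ * κ₂ * (ε * κ₁)) (rightHalf ρ) L (κ₁ * ((ξ - a * η) / r₁))
        (κ₂ * (η / r₂)) = W ε τ := by
    intro ε τ κ₁ κ₂ h1 h2 h3
    rw [oscInt, hW]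
    congr 1; ext t
    congr 4
    simp only [oscPhase]
    have e1 : ε * κ₁ * L * (-(κ₁ * ((ξ - a * η) / r₁)) * t + τ * κ₂ * (ε * κ₁) * (κ₂ * (η / r₂)) *
        t ^ α) = L * (-(ε * (κ₁ * κ₁) * ((ξ - a * η) / r₁)) * t + τ * (ε * ε) * (κ₁ * κ₁) *
        (κ₂ * κ₂) * (η / r₂) * t ^ α) := by ring
    rw [e1, h1, h2, h3]; ring_nf
  have hpow : (2 : ℝ) ^ (α * (j : ℝ)) * L = r₂ := by
    rw [hr₂, rpow_add two_pos, hL, Int.cast_natCast, rpow_natCast]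
  have hpow' : (2 : ℝ) ^ j * L = r₁ := by rw [hr₁, zpow_add₀ two_ne_zero, zpow_natCast]
  have hphase : ∀ t, phase σ a α j ξ η t = L * (-((ξ - a * η) / r₁) * t +
      (η / r₂) * signedPow σ α t) := by
    intro t
    rw [phase, ← hpow, ← hpow']
    have : (2 : ℝ) ^ (α * (j : ℝ)) ≠ 0 := by positivity
    field_simp
  have hscale : scaleMultiplier ρ σ a α j ξ η = W 1 1 - W (-1) σ := by
    have hpc := continuous_rpow_const hα.le
    have hρc := hρ'.contDiff.continuous
    have hint : ∀ ε τ : ℝ, Integrable fun t =>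
        expI(L * (-(ε * ((ξ - a * η) / r₁)) * t + τ * (η / r₂) * t ^ α)) *
          rightHalf ρ t := fun ε τ =>
      Continuous.integrable_of_hasCompactSupport (by fun_prop) hρ'.compact.mul_left
    simp only [hW]
    rw [← integral_neg_eq_self (fun t =>
        expI(L * (-(-1 * ((ξ - a * η) / r₁)) * t + σ * (η / r₂) * t ^ α)) *
          rightHalf ρ t), ← integral_sub (hint 1 1) (hint (-1) σ).comp_neg, scaleMultiplier]
    congr 1; ext t
    rw [hphase, signedPow, rightHalf, rightHalf]
    rcases lt_trichotomy t 0 with ht | rfl | ht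
    · rw [if_neg (not_le.2 ht), if_neg (by linarith), if_pos (by linarith), hρ.odd, mul_zero,
        zero_sub, ofReal_neg, mul_neg, neg_neg]
      congr 4; ring
    · simp [eq_zero_of_tsupport hρ.tsupport_subset (t := 0) (by norm_num)]
    · rw [if_pos ht.le, if_pos ht, if_neg (by linarith), mul_zero, sub_zero]
      congr 4; ring
  have hR : ∀ x, χ₂ x = rightHalf φ (α * x) := fun x => rfl
  have hm1 : α * (-1 * (η / r₂)) = -(α * η / r₂) := by ring
  have hm2 : α * (1 * (η / r₂)) = α * η / r₂ := by ring
  rw [pieceMultiplier, hscale, hsplit, hsplit]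
  simp only [oscMul]
  rw [hosc 1 1 1 1, hosc 1 1 1 (-1), hosc 1 1 (-1) 1, hosc 1 1 (-1) (-1), hosc (-1) σ 1 1,
    hosc (-1) σ 1 (-1), hosc (-1) σ (-1) 1, hosc (-1) σ (-1) (-1), hR, hR, hm1, hm2]
  · simp only [one_mul, neg_one_mul]; ring
  all_goals norm_num

/-! ### Summation over the scales -/

/-- The frequencies of size about `2 ^ (β j + v)`. -/
def band (c₁ c₂ β v : ℝ) (j : ℤ) : Set ℝ :=
  {ξ | c₁ * 2 ^ (β * (j : ℝ) + v) ≤ |ξ| ∧ |ξ| ≤ c₂ * 2 ^ (β * (j : ℝ) + v)}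

theorem measurableSet_band (c₁ c₂ β v : ℝ) (j : ℤ) : MeasurableSet (band c₁ c₂ β v j) :=
  MeasurableSet.inter (measurableSet_le measurable_const continuous_abs.measurable)
    (measurableSet_le continuous_abs.measurable measurable_const)

theorem card_le_of_sub_le (s : Finset ℤ) {D : ℝ} (h : ∀ i ∈ s, ∀ j ∈ s, (j : ℝ) - i ≤ D) :
    s.card ≤ ⌊D⌋₊ + 1 := by
  rcases s.eq_empty_or_nonempty with rfl | hs
  · simp
  have hsub : s ⊆ Finset.Icc (s.min' hs) (s.min' hs + ⌊D⌋₊) := by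
    intro j hj
    have h1 := h _ (s.min'_mem hs) j hj
    have h2 := s.min'_le j hj
    refine Finset.mem_Icc.2 ⟨h2, ?_⟩
    obtain ⟨n, hn⟩ := Int.eq_ofNat_of_zero_le (sub_nonneg.2 h2)
    have h3 : n ≤ ⌊D⌋₊ := by
      refine Nat.le_floor (le_trans (le_of_eq ?_) h1)
      exact_mod_cast hn.symm
    omega
  refine (Finset.card_le_card hsub).trans ?_
  rw [Int.card_Icc]; omega

/-- The bands have bounded overlap. -/
theorem exists_tsum_band_le {c₁ c₂ β : ℝ} (hc₁ : 0 < c₁) (hβ : 0 < β) :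
    ∃ N : ℕ, ∀ F : ℝ → ℂ, AEStronglyMeasurable F volume → ∀ v : ℝ,
      ∑' j : ℤ, ∫⁻ ξ in band c₁ c₂ β v j, ‖F ξ‖ₑ ^ 2 ≤ N * sqNorm F := by
  set D := logb 2 (c₂ / c₁) / β with hD
  refine ⟨⌊D⌋₊ + 1, fun F hF v => ?_⟩
  simp_rw [← lintegral_indicator (measurableSet_band c₁ c₂ β v _)]
  rw [← lintegral_tsum fun j => (hF.enorm.pow_const 2).indicator (measurableSet_band ..), sqNorm,
    ← lintegral_const_mul' _ _ (by simp)]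
  refine lintegral_mono fun ξ => ?_
  rw [ENNReal.tsum_eq_iSup_sum]
  refine iSup_le fun s => ?_
  classical
  simp_rw [Set.indicator_apply]
  rw [← Finset.sum_filter, Finset.sum_const, nsmul_eq_mul]
  gcongr
  refine card_le_of_sub_le _ fun i hi j hj => ?_
  have h1 := (Finset.mem_filter.1 hi).2
  have h2 := (Finset.mem_filter.1 hj).2
  rw [hD, le_div_iff₀ hβ]
  have h3 : (2 : ℝ) ^ ((j - i : ℝ) * β) ≤ c₂ / c₁ := by
    rw [le_div_iff₀ hc₁, show ((j : ℝ) - i) * β = (β * j + v) - (β * i + v) by ring,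
      rpow_sub two_pos, div_mul_eq_mul_div, div_le_iff₀ (by positivity), mul_comm _ c₁]
    exact h2.1.trans h1.2
  exact (Real.le_logb_iff_rpow_le one_lt_two ((by positivity : (0 : ℝ) < _).trans_le h3)).2 h3

/-- Orthogonality of the frequency supports allows one to sum over the scales. -/
theorem tsum_lintegral_spaceOp_le {K : ℤ → ℝ → ℝ → ℂ} {J : Set ℤ} {B : ℝ≥0∞} (hB : B ≠ ⊤)
    (hK : ∀ j ∈ J, SpaceBound B (K j)) {S T : ℤ → Set ℝ} (hS : ∀ j, MeasurableSet (S j))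
    (hT : ∀ j, MeasurableSet (T j)) (hST : ∀ j ∈ J, ∀ ξ η, K j ξ η ≠ 0 → ξ ∈ S j ∧ η ∈ T j)
    {F G : ℝ → ℂ} (hF : MemLp F 2) (hG : MemLp G 2) :
    ∑' j : J, ∫⁻ x, ‖spaceOp (K j) F G x‖ₑ ≤ B * ((∑' j, ∫⁻ ξ in S j, ‖F ξ‖ₑ ^ 2) *
      ∑' j, ∫⁻ ξ in T j, ‖G ξ‖ₑ ^ 2) ^ (1 / 2 : ℝ) := by
  have hsq : ∀ (F : ℝ → ℂ) {S : Set ℝ}, MeasurableSet S →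
      sqNorm (S.indicator F) = ∫⁻ ξ in S, ‖F ξ‖ₑ ^ 2 := by
    intro F S hS
    rw [← lintegral_indicator hS, sqNorm]
    refine lintegral_congr fun ξ => ?_
    by_cases h : ξ ∈ S <;> simp [h]
  have hone : ∀ j : J, ∫⁻ x, ‖spaceOp (K j) F G x‖ₑ ≤ B * ((∫⁻ ξ in S j, ‖F ξ‖ₑ ^ 2) *
      ∫⁻ ξ in T j, ‖G ξ‖ₑ ^ 2) ^ (1 / 2 : ℝ) := by
    intro j
    have e : spaceOp (K j) F G = spaceOp (K j) ((S j).indicator F) ((T j).indicator G) := by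
      ext x
      unfold spaceOp
      congr 1; ext ξ; congr 1; ext η
      by_cases h : K j ξ η = 0
      · simp [h]
      · obtain ⟨h1, h2⟩ := hST j j.2 ξ η h
        rw [indicator_of_mem h1, indicator_of_mem h2]
    rw [e, ← hsq F (hS j), ← hsq G (hT j)]
    exact ((hK j j.2).of_memLp hB (hF.indicator (hS j)) (hG.indicator (hT j))).2
  refine (tsum_le_tsum hone).trans ?_
  rw [ENNReal.tsum_mul_left]
  gcongr
  refine (tsum_sqrt_mul_le _ _).trans ?_
  gcongr
  all_goals exact ENNReal.tsum_comp_le_tsum_of_injective Subtype.val_injective fun j => ∫⁻ _ in _, _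

theorem sqNorm_angularFourier (f : L²) :
    sqNorm (angularFourier f) = ofReal (2 * pi) * ‖f‖ₑ ^ 2 := by
  have h := sqNorm_comp_mul_left (r := 1 / (2 * pi)) (by positivity) (𝓕 f : L²)
  have e : angularFourier f = fun ξ => (𝓕 f : L²) (1 / (2 * pi) * ξ) := by
    ext ξ; rw [angularFourier]; congr 1; ring
  have h2 : sqNorm (𝓕 f : L²) = ‖f‖ₑ ^ 2 := by
    rw [sqNorm, lintegral_enorm_sq_Lp, ← ofReal_norm, ← ofReal_norm, Lp.norm_fourier_eq]
  rw [e, ← h2, ← h, ← mul_assoc, ← ofReal_mul (by positivity),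
    mul_one_div_cancel (by positivity), ofReal_one, one_mul]

theorem memLp_angularFourier (f : L²) : MemLp (angularFourier f) 2 := by
  refine ⟨((Lp.stronglyMeasurable _).comp_measurable (by fun_prop)).aestronglyMeasurable, ?_⟩
  rw [eLpNorm_two_eq, sqNorm_angularFourier]
  exact rpow_lt_top_of_nonneg (by norm_num) (mul_ne_top ofReal_ne_top (by simp))

theorem pieceMultiplier_ne_zero {ρ φ : ℝ → ℝ} (hφ : IsFrequencyCutoff φ) {σ a α ξ η v : ℝ} {j m : ℤ}
    (hα : 0 < α) (hv : v = m) (h : pieceMultiplier ρ φ σ a α j m m ξ η ≠ 0) :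
    (1 / 4 * 2 ^ ((j : ℝ) + v) ≤ |ξ - a * η| ∧ |ξ - a * η| ≤ 4 * 2 ^ ((j : ℝ) + v)) ∧
      η ∈ band (1 / (4 * α)) (4 / α) α v j := by
  have h0 : ∀ {x r : ℝ}, 0 < r → φ (x / r) ≠ 0 → 1 / 4 * r ≤ |x| ∧ |x| ≤ 4 * r := by
    intro x r hr hx
    by_contra hc
    refine hx (eq_zero_of_tsupport hφ.tsupport_subset fun hm => hc ?_)
    rw [abs_div, abs_of_pos hr] at hm
    exact ⟨(le_div_iff₀ hr).1 hm.1, (div_le_iff₀ hr).1 hm.2⟩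
  rw [pieceMultiplier, mul_ne_zero_iff, mul_ne_zero_iff] at h
  have h1 := h0 (by positivity) (ofReal_ne_zero.1 h.1.2)
  have h2 := h0 (by positivity) (ofReal_ne_zero.1 h.2)
  rw [← Real.rpow_intCast] at h1
  push_cast at h1
  rw [← hv] at h1 h2
  refine ⟨h1, ?_⟩
  rw [abs_mul, abs_of_pos hα] at h2
  constructor
  · rw [← div_div, div_mul_eq_mul_div, div_le_iff₀ hα, mul_comm |η|]; exact h2.1
  · rw [div_mul_eq_mul_div, le_div_iff₀ hα, mul_comm]; exact h2.2

/-- For large `|j|` one of the terms of `ξ = (ξ - a η) + a η` dominates. -/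
theorem exists_band_of_pieceMultiplier_ne_zero (a : ℝ) {α : ℝ} (hα : 0 < α) :
    ∃ e₀ c₁ c₂ : ℝ, 0 < e₀ ∧ 0 < c₁ ∧ ∀ ρ φ : ℝ → ℝ, IsFrequencyCutoff φ → ∀ (σ : ℝ) (j m : ℤ),
      (2 : ℝ) ^ (-(|α - 1| * |(j : ℝ)|)) ≤ e₀ → ∀ ξ η,
      pieceMultiplier ρ φ σ a α j m m ξ η ≠ 0 →
      ξ ∈ band c₁ c₂ 1 m j ∪ band c₁ c₂ α m j := by
  set A := |a| / α with hA
  have hA0 : 0 ≤ A := by positivity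
  set e₀ : ℝ := min (1 / (32 * (A + 1))) (if a = 0 then 1 else A / 32)
  set c₁ : ℝ := min (1 / 8) (if a = 0 then 1 else A / 8)
  have hApos : a ≠ 0 → 0 < A := fun h => div_pos (abs_pos.2 h) hα
  have hite : ∀ x : ℝ, 0 < x → 0 < if a = 0 then 1 else A / x := fun x hx => by
    split_ifs with h
    exacts [one_pos, div_pos (hApos h) hx]
  refine ⟨e₀, c₁, 4 + 4 * A, lt_min (by positivity) (hite _ (by norm_num)),
    lt_min (by norm_num) (hite _ (by norm_num)), fun ρ φ hφ σ j m hj ξ η h => ?_⟩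
  obtain ⟨⟨h1, h2⟩, h3, h4⟩ := pieceMultiplier_ne_zero hφ hα (rfl : (m : ℝ) = m) h
  have hr := two_rpow_le_or_le hj m
  simp only [band, Set.mem_union, Set.mem_ofPred_eq, one_mul]
  set r₁ : ℝ := 2 ^ ((j : ℝ) + m)
  set r₂ : ℝ := 2 ^ (α * (j : ℝ) + m)
  have hr₁ : 0 < r₁ := by positivity
  have hr₂ : 0 < r₂ := by positivity
  have hc8 : c₁ ≤ 1 / 8 := min_le_left _ _
  have he1 : e₀ * (32 * (A + 1)) ≤ 1 := by rw [← le_div_iff₀ (by positivity)]; exact min_le_left _ _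
  have he : e₀ ≤ 1 / 32 := by
    have : e₀ ≤ 1 / (32 * (A + 1)) := min_le_left _ _
    refine this.trans ?_
    rw [div_le_div_iff₀ (by positivity) (by norm_num)]; linarith
  have h3' : A / 4 * r₂ ≤ |a * η| := by
    rw [abs_mul]
    calc A / 4 * r₂ = |a| * (1 / (4 * α) * r₂) := by rw [hA]; field_simp
      _ ≤ _ := by gcongr
  have h4' : |a * η| ≤ 4 * A * r₂ := by
    rw [abs_mul]
    calc _ ≤ |a| * (4 / α * r₂) := by gcongr
      _ = _ := by rw [hA]; field_simp
  have t1 : |ξ| ≤ |ξ - a * η| + |a * η| := by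
    have := abs_add_le (ξ - a * η) (a * η); rwa [sub_add_cancel] at this
  have t2 : |ξ - a * η| ≤ |ξ| + |a * η| := abs_sub _ _
  have t3 : |a * η| ≤ |ξ| + |ξ - a * η| := by
    have := abs_sub ξ (ξ - a * η); rwa [sub_sub_cancel] at this
  rcases hr with hr | hr
  · by_cases ha : a = 0
    · left
      have : |a * η| = 0 := by rw [ha, zero_mul, abs_zero]
      rw [this] at t1 t2
      constructor <;> nlinarith
    · right
      have hA' := hApos ha
      have hc : c₁ ≤ A / 8 := (min_le_right _ _).trans (by rw [if_neg ha])
      have he2 : e₀ ≤ A / 32 := (min_le_right _ _).trans (by rw [if_neg ha])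
      constructor <;> nlinarith
  · left
    have h5 : A * r₂ ≤ A * (e₀ * r₁) := by gcongr
    have h6 : A * e₀ ≤ 1 / 32 := by nlinarith
    have h7 : A * e₀ * r₁ ≤ 1 / 32 * r₁ := by gcongr
    constructor
    · nlinarith
    · nlinarith [mul_nonneg hA0 hr₁.le]

/-- Exponential decay of the stationary forms. -/
theorem exists_stationaryForm_le {a α : ℝ} (ha : a ≠ -1) (hα : 0 < α) (hα1 : α ≠ 1) (hα2 : α ≠ 2) :
    ∃ Cmin : ℝ, 0 < Cmin ∧ ∀ ρ φ : ℝ → ℝ, IsSpatialCutoff ρ → IsFrequencyCutoff φ →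
      ∀ σ : ℝ, (σ = 1 ∨ σ = -1) → ∃ C : ℝ, 0 < C ∧ ∀ C₀ : ℝ, Cmin ≤ C₀ →
      ∀ (m : ℕ) (f g : L²) (h : L^∞),
        (∀ j : ℤ, C₀ ≤ |(j : ℝ)| →
          Integrable (fun x : ℝ => pieceOperator ρ φ σ a α j m m f g x * h x)) ∧
        Summable (fun j : {j : ℤ // C₀ ≤ |(j : ℝ)|} => pieceForm ρ φ σ a α j m m f g h) ∧
        ‖stationaryForm ρ φ σ a α C₀ m f g h‖
          ≤ C * (2 : ℝ) ^ (-(1 / 80 * (m : ℝ))) * ‖f‖ * ‖g‖ * ‖h‖ := by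
  obtain ⟨e₁, he₁, he₁1, hpiece⟩ := exists_spaceBound_pieceMultiplier ha hα hα1 hα2
  obtain ⟨e₂, c₁, c₂, he₂, hc₁, hband⟩ := exists_band_of_pieceMultiplier_ne_zero a hα
  obtain ⟨N₁, hN₁⟩ := exists_tsum_band_le (c₂ := c₂) hc₁ one_pos
  obtain ⟨N₂, hN₂⟩ := exists_tsum_band_le (c₂ := c₂) hc₁ hα
  obtain ⟨N₃, hN₃⟩ := exists_tsum_band_le (c₁ := 1 / (4 * α)) (c₂ := 4 / α) (by positivity) hα
  set E := min e₁ e₂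
  have hE0 : 0 < E := lt_min he₁ he₂
  have hE1 : logb 2 E ≤ 0 := Real.logb_nonpos one_lt_two hE0.le ((min_le_left _ _).trans he₁1)
  have hα' : 0 < |α - 1| := abs_pos.2 (sub_ne_zero.2 hα1)
  -- the threshold is chosen such that `2 ^ (-|α - 1| |j|) ≤ E` for all remaining `j`
  refine ⟨(1 - logb 2 E) / |α - 1|, div_pos (by linarith) hα', fun ρ φ hρ hφ σ hσ => ?_⟩
  have hσ' : |σ| = 1 := by rcases hσ with rfl | rfl <;> simp
  obtain ⟨C, hC, hpiece⟩ := hpiece ρ φ hρ hφ σ hσ'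
  refine ⟨C * (2 * pi * √((N₁ + N₂) * N₃)) + 1, by positivity, fun C₀ hC₀ m f g h => ?_⟩
  set J : Set ℤ := {j | C₀ ≤ |(j : ℝ)|}
  set β : ℝ := 2 ^ (-(1 / 80 * (m : ℝ)))
  have hβe : ((2 : ℝ) ^ m) ^ (-(1 / 80) : ℝ) = β := by
    rw [← rpow_natCast, ← Real.rpow_mul (by norm_num)]; congr 1; ring
  have hsmall : ∀ j ∈ J, (2 : ℝ) ^ (-(|α - 1| * |(j : ℝ)|)) ≤ E := by
    intro j hj
    have h1 : (1 - logb 2 E) / |α - 1| ≤ |(j : ℝ)| := hC₀.trans hj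
    rw [div_le_iff₀ hα'] at h1
    calc (2 : ℝ) ^ (-(|α - 1| * |(j : ℝ)|)) ≤ 2 ^ logb 2 E :=
          Real.rpow_le_rpow_of_exponent_le one_le_two (by linarith)
      _ = E := Real.rpow_logb two_pos (by norm_num) hE0
  have hK : ∀ j ∈ J, SpaceBound (ofReal (C * β)) (pieceMultiplier ρ φ σ a α j m m) :=
    fun j hj => hβe ▸ hpiece j m ((hsmall j hj).trans (min_le_left _ _))
  have hF := memLp_angularFourier f
  have hG := memLp_angularFourier g
  have hop : ∀ j, pieceOperator ρ φ σ a α j m m f g =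
      spaceOp (pieceMultiplier ρ φ σ a α j m m) (angularFourier f) (angularFourier g) :=
    fun j => rfl
  have hsum := tsum_lintegral_spaceOp_le ofReal_ne_top hK
    (S := fun j => band c₁ c₂ 1 m j ∪ band c₁ c₂ α m j)
    (T := fun j => band (1 / (4 * α)) (4 / α) α m j)
    (fun j => (measurableSet_band ..).union (measurableSet_band ..))
    (fun j => measurableSet_band ..)
    (fun j hj ξ η h => ⟨hband ρ φ hφ σ j m ((hsmall j hj).trans (min_le_right _ _)) ξ η h,
      (pieceMultiplier_ne_zero hφ hα (by simp) h).2⟩) hF hG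
  have hS1 : ∑' j, ∫⁻ ξ in band c₁ c₂ 1 m j ∪ band c₁ c₂ α m j, ‖angularFourier f ξ‖ₑ ^ 2 ≤
      ofReal ((N₁ + N₂) * (2 * pi)) * ‖f‖ₑ ^ 2 := by
    calc _ ≤ ∑' j, ((∫⁻ ξ in band c₁ c₂ 1 m j, ‖angularFourier f ξ‖ₑ ^ 2) +
          ∫⁻ ξ in band c₁ c₂ α m j, ‖angularFourier f ξ‖ₑ ^ 2) :=
          tsum_le_tsum fun j => lintegral_union_le _ _ _
      _ ≤ N₁ * sqNorm (angularFourier f) + N₂ * sqNorm (angularFourier f) := by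
          rw [ENNReal.tsum_add]
          exact add_le_add (hN₁ _ hF.1 m) (hN₂ _ hF.1 m)
      _ = _ := by
          rw [sqNorm_angularFourier, ofReal_mul (p := (N₁ + N₂ : ℝ)) (by positivity),
            ofReal_add (by positivity) (by positivity), ofReal_natCast, ofReal_natCast]
          ring
  have hS2 : ∑' j, ∫⁻ ξ in band (1 / (4 * α)) (4 / α) α m j, ‖angularFourier g ξ‖ₑ ^ 2 ≤
      ofReal (N₃ * (2 * pi)) * ‖g‖ₑ ^ 2 := by
    refine (hN₃ _ hG.1 m).trans (le_of_eq ?_)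
    rw [sqNorm_angularFourier, ofReal_mul (p := (N₃ : ℝ)) (by positivity), ofReal_natCast,
      mul_assoc]
  set Tot := C * (2 * pi * √((N₁ + N₂) * N₃)) * β * ‖f‖ * ‖g‖ with hTot
  have hsum' : ∑' j : J, ∫⁻ x, ‖pieceOperator ρ φ σ a α j m m f g x‖ₑ ≤ ofReal Tot := by
    refine hsum.trans ?_
    calc _ ≤ ofReal (C * β) * ((ofReal ((N₁ + N₂) * (2 * pi)) * ‖f‖ₑ ^ 2) *
          (ofReal (N₃ * (2 * pi)) * ‖g‖ₑ ^ 2)) ^ (1 / 2 : ℝ) := by gcongr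
      _ = ofReal (C * β * √(((N₁ + N₂) * (2 * pi) * ‖f‖ ^ 2) * (N₃ * (2 * pi) * ‖g‖ ^ 2))) := by
          rw [← ofReal_norm, ← ofReal_norm, ← ofReal_pow (norm_nonneg _),
            ← ofReal_pow (norm_nonneg _), ← ofReal_mul (by positivity),
            ← ofReal_mul (by positivity), ← ofReal_mul (by positivity),
            ENNReal.ofReal_rpow_of_nonneg (by positivity) (by norm_num),
            ← ofReal_mul (by positivity), Real.sqrt_eq_rpow]
      _ = _ := by
          congr 1
          rw [show ((N₁ + N₂ : ℝ) * (2 * pi) * ‖f‖ ^ 2) * (N₃ * (2 * pi) * ‖g‖ ^ 2) =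
            ((N₁ + N₂) * N₃) * (2 * pi * ‖f‖ * ‖g‖) ^ 2 by ring,
            sqrt_mul (by positivity), Real.sqrt_sq (by positivity), hTot]
          ring
  have hh : ∀ᵐ x, ‖h x‖ₑ ≤ ‖h‖ₑ := by
    rw [Lp.enorm_def, eLpNorm_exponent_top]; exact enorm_ae_le_eLpNormEssSup _ _
  have hform : ∀ j, ∫⁻ x, ‖pieceOperator ρ φ σ a α j m m f g x * h x‖ₑ ≤
      ‖h‖ₑ * ∫⁻ x, ‖pieceOperator ρ φ σ a α j m m f g x‖ₑ := by
    intro j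
    rw [← lintegral_const_mul' _ _ (by simp)]
    refine lintegral_mono_ae ?_
    filter_upwards [hh] with x hx
    rw [enorm_mul, mul_comm]
    gcongr
  have hle : ∀ j : J, ‖pieceForm ρ φ σ a α j m m f g h‖ₑ ≤
      ‖h‖ₑ * ∫⁻ x, ‖pieceOperator ρ φ σ a α j m m f g x‖ₑ := fun j =>
    (enorm_integral_le_lintegral_enorm _).trans (hform j)
  have htot : ∑' j : J, ‖pieceForm ρ φ σ a α j m m f g h‖ₑ ≤ ofReal (Tot * ‖h‖) := by
    refine (tsum_le_tsum hle).trans ?_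
    rw [ENNReal.tsum_mul_left, mul_comm Tot, ofReal_mul (norm_nonneg _), ofReal_norm]
    gcongr
  have htop := (htot.trans_lt ENNReal.ofReal_lt_top).ne
  have hsummable : Summable fun j : J => ‖pieceForm ρ φ σ a α j m m f g h‖ := by
    simpa only [toReal_enorm] using ENNReal.summable_toReal htop
  refine ⟨fun j hj => ⟨?_, ?_⟩, hsummable.of_norm, ?_⟩
  · rw [hop]
    exact (((hK j hj).of_memLp ofReal_ne_top hF hG).1.aestronglyMeasurable).mul
      (Lp.aestronglyMeasurable h)
  · rw [hasFiniteIntegral_iff_enorm]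
    refine (hform j).trans_lt (ENNReal.mul_lt_top (by simp) ?_)
    exact ((ENNReal.le_tsum (⟨j, hj⟩ : J)).trans hsum').trans_lt ENNReal.ofReal_lt_top
  · have h1 : ‖stationaryForm ρ φ σ a α C₀ m f g h‖ ≤ Tot * ‖h‖ := by
      refine (norm_tsum_le_tsum_norm hsummable).trans ?_
      have : ∑' j : J, ‖pieceForm ρ φ σ a α j m m f g h‖ =
          (∑' j : J, ‖pieceForm ρ φ σ a α j m m f g h‖ₑ).toReal := by
        rw [ENNReal.tsum_toReal_eq fun _ => enorm_ne_top]
        simp only [toReal_enorm]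
      exact this.le.trans (ENNReal.toReal_le_of_le_ofReal (by positivity) htot)
    refine h1.trans ?_
    rw [hTot]
    gcongr
    linarith

/-! ### Fresnel integrals -/

theorem norm_integral_fresnel_tail_le {Y Z : ℝ} (hY : 0 < Y) (hYZ : Y ≤ Z) :
    ‖∫ u in Y..Z, expI(u ^ 2 / 2)‖ ≤ 2 / Y := by
  have hpos : ∀ u ∈ uIcc Y Z, 0 < u := fun u hu => by
    rw [uIcc_of_le hYZ] at hu; exact hY.trans_le hu.1
  have hne : ∀ u ∈ uIcc Y Z, (u : ℂ) ≠ 0 := fun u hu => ofReal_ne_zero.2 (hpos u hu).ne'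
  set E : ℝ → ℂ := fun u => expI(u ^ 2 / 2) with hE
  have hEn : ∀ u, ‖E u‖ = 1 := fun u => norm_expI _
  have hEc : Continuous E := by fun_prop
  have hd : ∀ u ∈ uIcc Y Z, HasDerivAt (fun u : ℝ => E u / (I * u))
      (E u + I * (E u / u ^ 2)) u := by
    intro u hu
    have h1 : HasDerivAt E (E u * (I * u)) u := by
      convert! hasDerivAt_exp_I_mul (D := fun u => u ^ 2 / 2) (D' := u) (x := u)
        (by convert! (hasDerivAt_pow 2 u).div_const 2 using 1; simp) using 1
      simp [hE]; ring
    convert! h1.div ((hasDerivAt_id u).ofReal_comp.const_mul I)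
      (mul_ne_zero I_ne_zero (hne u hu)) using 1
    have := hne u hu
    simp only [id, Complex.ofReal_one, mul_pow, I_sq]
    field_simp
    linear_combination (E u * (u : ℂ) ^ 2) * I_sq
  have hc2 : ContinuousOn (fun u : ℝ => E u / (u : ℂ) ^ 2) (uIcc Y Z) :=
    hEc.continuousOn.div (by fun_prop) fun u hu => pow_ne_zero 2 (hne u hu)
  have hc3 : ContinuousOn (fun u : ℝ => I * (E u / (u : ℂ) ^ 2)) (uIcc Y Z) :=
    continuousOn_const.mul hc2
  have hFTC := integral_eq_sub_of_hasDerivAt hd (hEc.continuousOn.add hc3).intervalIntegrable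
  rw [intervalIntegral.integral_add (hEc.intervalIntegrable _ _)
    hc3.intervalIntegrable, intervalIntegral.integral_const_mul] at hFTC
  have hsq : ‖∫ u in Y..Z, E u / (u : ℂ) ^ 2‖ ≤ 1 / Y - 1 / Z := by
    refine (intervalIntegral.norm_integral_le_of_norm_le hYZ (g := fun u => 1 / u ^ 2)
      (ae_of_all _ fun u hu => ?_) ?_).trans_eq ?_
    · rw [norm_div, hEn, norm_pow, norm_real, norm_eq_abs, sq_abs]
    · exact (continuousOn_const.div (by fun_prop)
        fun u hu => pow_ne_zero 2 (hpos u hu).ne').intervalIntegrable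
    · have : ∀ u ∈ uIcc Y Z, HasDerivAt (fun u : ℝ => -u⁻¹) (1 / u ^ 2) u := fun u hu => by
        convert! (hasDerivAt_inv (hpos u hu).ne').neg using 1
        field_simp
      rw [integral_eq_sub_of_hasDerivAt this (continuousOn_const.div (by fun_prop)
          fun u hu => pow_ne_zero 2 (hpos u hu).ne').intervalIntegrable]
      ring
  have hb : ∀ u : ℝ, 0 < u → ‖E u / (I * u)‖ = 1 / u := fun u hu => by
    rw [norm_div, hEn, norm_mul, norm_I, one_mul, norm_real, norm_eq_abs, abs_of_pos hu]
  rw [eq_sub_of_add_eq hFTC]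
  refine (norm_sub_le _ _).trans ((add_le_add (norm_sub_le _ _) le_rfl).trans ?_)
  rw [hb Y hY, hb Z (hY.trans_le hYZ), norm_mul, norm_I, one_mul]
  calc _ ≤ 1 / Z + 1 / Y + (1 / Y - 1 / Z) := by gcongr
    _ = _ := by ring

theorem le_norm_integral_fresnel {L : ℝ} (hL : 1 ≤ L) :
    3 / 10 / √L ≤ ‖∫ u in (-4 : ℝ)..4, expI(L * u ^ 2 / 2)‖ := by
  set E : ℝ → ℂ := fun u => expI(u ^ 2 / 2) with hE
  have hEc : Continuous E := by fun_prop
  have hi : ∀ c d, IntervalIntegrable E volume c d := fun c d => hEc.intervalIntegrable c d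
  set s := √L
  have hs1 : 1 ≤ s := Real.one_le_sqrt.2 hL
  have hs2 : s ^ 2 = L := sq_sqrt (by linarith)
  have h1 : (∫ u in (-4 : ℝ)..4, expI(L * u ^ 2 / 2)) = s⁻¹ • ∫ v in (-(s * 4))..(s * 4), E v := by
    have := intervalIntegral.integral_comp_mul_left (a := -4) (b := 4) E (show s ≠ 0 by positivity)
    rw [mul_neg] at this
    rw [← this]
    congr 1; ext u
    simp only [hE]; rw [mul_pow, hs2]
  have h2 : (∫ v in (-(s * 4))..(s * 4), E v) = 2 * ∫ v in (0 : ℝ)..(s * 4), E v := by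
    rw [← integral_add_adjacent_intervals (hi _ 0) (hi 0 _)]
    have := intervalIntegral.integral_comp_neg (a := -(s * 4)) (b := 0) E
    rw [neg_neg, neg_zero] at this
    rw [← this, two_mul]
    simp [hE]
  have h3 : 1.345 ≤ ‖∫ v in (0 : ℝ)..1.7, E v‖ := by
    refine le_trans ?_ (Complex.re_le_norm _)
    have : (∫ v in (0 : ℝ)..1.7, E v).re = ∫ v in (0 : ℝ)..1.7, cos (v ^ 2 / 2) := by
      have := Complex.reCLM.intervalIntegral_comp_comm (hi 0 1.7)
      simp only [Complex.reCLM_apply] at this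
      rw [← this]
      congr 1; ext v
      rw [hE]; simp only; rw [mul_comm, Complex.exp_ofReal_mul_I_re]
    rw [this]
    have hm : (∫ v in (0 : ℝ)..1.7, (1 - v ^ 4 / 8)) ≤ ∫ v in (0 : ℝ)..1.7, cos (v ^ 2 / 2) := by
      refine integral_mono_on (by norm_num)
        (Continuous.intervalIntegrable (by fun_prop) _ _)
        (Continuous.intervalIntegrable (by fun_prop) _ _) fun v _ => ?_
      have := Real.one_sub_sq_div_two_le_cos (x := v ^ 2 / 2)
      nlinarith
    refine le_trans ?_ hm
    rw [intervalIntegral.integral_sub (by simp) (Continuous.intervalIntegrable (by fun_prop) _ _),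
      intervalIntegral.integral_div, integral_pow]
    norm_num
  have h4 := norm_integral_fresnel_tail_le (Y := 1.7) (Z := s * 4) (by norm_num) (by linarith)
  have h5 := integral_add_adjacent_intervals (hi 0 1.7) (hi 1.7 (s * 4))
  have h6 := norm_sub_le_norm_add (∫ v in (0 : ℝ)..1.7, E v) (∫ v in (1.7 : ℝ)..(s * 4), E v)
  rw [h5] at h6
  rw [h1, h2, norm_smul, norm_mul, Complex.norm_two, norm_eq_abs, abs_of_pos (by positivity),
    div_eq_inv_mul]
  have h7 : (2 / 1.7 : ℝ) ≤ 1.18 := by norm_num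
  gcongr
  change ‖∫ v in (1.7 : ℝ)..(s * 4), E v‖ ≤ _ at h4
  norm_num at *
  linarith

/-- Stationary phase at `u = 0`, to leading order: the constant in front of `f 0` does not depend
on the interval. -/
theorem norm_integral_fresnel_sub_le {f f' : ℝ → ℂ} {A B L M δ : ℝ} (hL : 0 < L) (hδ : 0 < δ)
    (hδ1 : δ ≤ 1) (hA : -4 ≤ A) (hAδ : A ≤ -δ) (hB : B ≤ 4) (hBδ : δ ≤ B)
    (hf : ∀ u, HasDerivAt f (f' u) u) (h0 : ∀ u, ‖f u‖ ≤ M) (h1 : ∀ u, ‖f' u‖ ≤ M) :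
    ‖(∫ u in A..B, expI(L * u ^ 2 / 2) * f u) -
        f 0 * ∫ u in (-4 : ℝ)..4, expI(L * u ^ 2 / 2)‖ ≤
      30 * M * δ / √L + 40 * M / (L * δ ^ 2) := by
  have hM : 0 ≤ M := (norm_nonneg _).trans (h0 0)
  have hD : ∀ x : ℝ, HasDerivAt (fun u : ℝ => L * u ^ 2 / 2) (L * x) x := fun x => by
    convert! ((hasDerivAt_pow 2 x).const_mul L).div_const 2 using 1
    simp; ring
  have hD' : ∀ x : ℝ, HasDerivAt (fun u : ℝ => L * u) L x := fun x => by
    simpa using (hasDerivAt_id x).const_mul L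
  set E : ℝ → ℂ := fun u => expI(L * u ^ 2 / 2)
  have outer : ∀ {g g' : ℝ → ℂ} {c d : ℝ}, (∀ u, HasDerivAt g (g' u) u) → (∀ u, ‖g u‖ ≤ M) →
      (∀ u, ‖g' u‖ ≤ M) → c ≤ d → d - c ≤ 4 → (∀ u ∈ Icc c d, δ ≤ |u|) →
      ‖∫ u in c..d, E u * g u‖ ≤ 10 * M / (L * δ ^ 2) := by
    intro g g' c d hg hg0 hg1 hcd hdc hu
    refine (norm_integral_exp_le_of_first_deriv hcd (mul_pos hL hδ) (fun x _ => hD x)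
      (fun x _ => hD' x) (fun x _ => hg x) (fun x hx => ?_) (fun x _ => (abs_of_pos hL).le)
      (fun x _ => hg0 x) (fun x _ => hg1 x)).trans ?_
    · rw [abs_mul, abs_of_pos hL]; exact mul_le_mul_of_nonneg_left (hu x hx) hL.le
    · have e : M * L / (L * δ) = M / δ := by field_simp
      have e1 : M ≤ M / δ := le_div_self hM hδ hδ1
      rw [e]
      calc _ ≤ (2 * (M / δ) + 4 * (M / δ + M / δ)) / (L * δ) := by gcongr
        _ = _ := by field_simp; ring
  have hEc : Continuous E := by fun_prop
  have hfc : Continuous f := continuous_iff_continuousAt.2 fun u => (hf u).continuousAt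
  have inner : ‖∫ u in (-δ)..δ, E u * (f u - f 0)‖ ≤ 30 * M * δ / √L := by
    refine (norm_integral_exp_mul_le_of_second_deriv (by linarith) hL (fun x _ => hD x)
      (fun x _ => hD' x) continuousOn_const (fun x _ => (abs_of_pos hL).ge)
      (fun x _ => (hf x).sub_const (f 0)) (A₀ := M * δ) (fun x hx => ?_)
      (fun x _ => h1 x)).trans_eq (by ring)
    have := Convex.norm_image_sub_le_of_norm_hasDerivWithin_le (s := univ)
      (fun u _ => (hf u).hasDerivWithinAt) (fun u _ => h1 u) convex_univ
      (Set.mem_univ 0) (Set.mem_univ x)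
    rw [sub_zero, norm_eq_abs] at this
    exact this.trans (mul_le_mul_of_nonneg_left (abs_le.2 hx) hM)
  have hi : ∀ c d, IntervalIntegrable (fun u => E u * f u) volume c d := fun c d =>
    (hEc.mul hfc).intervalIntegrable c d
  have hi0 : ∀ c d, IntervalIntegrable (fun u => E u * f 0) volume c d := fun c d =>
    (hEc.mul continuous_const).intervalIntegrable c d
  have e0 : f 0 * ∫ u in (-4 : ℝ)..4, E u = ∫ u in (-4 : ℝ)..4, E u * f 0 := by
    rw [intervalIntegral.integral_mul_const, mul_comm]
  have hsplit : (∫ u in A..B, E u * f u) - ∫ u in (-4 : ℝ)..4, E u * f 0 =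
      (∫ u in (-δ)..δ, E u * (f u - f 0)) + (∫ u in A..(-δ), E u * f u) + (∫ u in δ..B, E u * f u)
        - (∫ u in (-4 : ℝ)..(-δ), E u * f 0) - ∫ u in δ..4, E u * f 0 := by
    simp_rw [mul_sub]
    rw [intervalIntegral.integral_sub (hi _ _) (hi0 _ _),
      ← integral_add_adjacent_intervals (hi A (-δ)) (hi (-δ) B),
      ← integral_add_adjacent_intervals (hi (-δ) δ) (hi δ B),
      ← integral_add_adjacent_intervals (hi0 (-4) (-δ)) (hi0 (-δ) 4),
      ← integral_add_adjacent_intervals (hi0 (-δ) δ) (hi0 δ 4)]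
    ring
  have hneg : ∀ {c : ℝ}, ∀ u ∈ Icc c (-δ), δ ≤ |u| := fun {c} u hu => by
    rw [← abs_neg]; exact (le_neg.1 hu.2).trans (le_abs_self _)
  have hpos : ∀ {d : ℝ}, ∀ u ∈ Icc δ d, δ ≤ |u| := fun {d} u hu => hu.1.trans (le_abs_self _)
  have hz : ∀ u, HasDerivAt (fun _ : ℝ => f 0) 0 u := fun u => hasDerivAt_const u _
  have b1 := outer hf h0 h1 hAδ (by linarith) hneg
  have b2 := outer hf h0 h1 hBδ (by linarith) hpos
  have b3 := outer hz (fun _ => h0 0) (fun _ => by simpa using hM)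
    (show -4 ≤ -δ by linarith) (by linarith) hneg
  have b4 := outer hz (fun _ => h0 0) (fun _ => by simpa using hM)
    (show δ ≤ 4 by linarith) (by linarith) hpos
  rw [e0, hsplit]
  refine (norm_sub_le _ _).trans <| (add_le_add ((norm_sub_le _ _).trans (add_le_add
    ((norm_add_le _ _).trans (add_le_add ((norm_add_le _ _).trans (add_le_add inner b1)) b2))
    b3)) b4).trans_eq (by ring)

/-! ### The resonance at `α = 2` -/

theorem continuous_signedPow_two (σ : ℝ) : Continuous (signedPow σ 2) := by
  unfold signedPow
  simp only [Real.rpow_two]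
  refine Continuous.if_le (by fun_prop) (by fun_prop) continuous_const continuous_id fun t h => ?_
  simp [← h]

/-- The phase of the form at `α = 2`, after the quadratic phases of the test functions have
completed the square. -/
def chirpPhase (σ a L e z w t : ℝ) : ℝ :=
  L * ((z - a * w) ^ 2 / 2 - (z - a * w) * t + (1 / 2 + e * w) * signedPow σ 2 t)

/-- The part of the multiplier at `α = 2` coming from `t` between `c` and `d`. -/
def chirpInt (ρ : ℝ → ℝ) (σ a L e c d z w : ℝ) : ℂ :=
  ∫ t in c..d, expI(chirpPhase σ a L e z w t) * (ρ t : ℂ)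

/-- The amplitude of the form at `α = 2`. -/
def chirpAmp (φ : ℝ → ℝ) (a e z w : ℝ) : ℝ :=
  Real.exp (-((z + w) ^ 2 / 2)) * φ (z - a * w) * φ (1 + 2 * e * w)

theorem exists_bound_deriv {ψ : ℝ → ℝ} (hψ : Smooth ψ)
    (hs : tsupport ψ ⊆ {t : ℝ | 1 / 4 < |t| ∧ |t| < 4}) :
    ∃ M : ℝ, 0 < M ∧ ∀ t, |ψ t| ≤ M ∧ |deriv ψ t| ≤ M := by
  have hc : HasCompactSupport ψ := HasCompactSupport.intro (isCompact_Icc (a := -4) (b := 4))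
    fun t ht => eq_zero_of_tsupport hs fun h => ht (abs_le.1 h.2)
  obtain ⟨A, hA⟩ := hψ.continuous.bounded_above_of_compact_support hc
  obtain ⟨B, hB⟩ := (hψ.continuous_deriv (by simp)).bounded_above_of_compact_support hc.deriv
  exact ⟨max 1 (max A B), by positivity, fun t => ⟨(hA t).trans (by simp), (hB t).trans (by simp)⟩⟩

section

variable {ρ φ : ℝ → ℝ} {σ a L e M : ℝ}

theorem continuous_chirp (hρ : Continuous ρ) (σ a L e : ℝ) : Continuous fun p : (ℝ × ℝ) × ℝ =>
    expI(chirpPhase σ a L e p.1.1 p.1.2 p.2) * (ρ p.2 : ℂ) := by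
  have := continuous_signedPow_two σ
  unfold chirpPhase
  fun_prop

theorem continuous_chirpInt (hρ : Continuous ρ) (σ a L e c d : ℝ) :
    Continuous fun p : ℝ × ℝ => chirpInt ρ σ a L e c d p.1 p.2 :=
  continuous_parametric_intervalIntegral_of_continuous'
    (f := fun (p : ℝ × ℝ) t => expI(chirpPhase σ a L e p.1 p.2 t) * (ρ t : ℂ))
    (continuous_chirp hρ σ a L e) c d

/-- On the positive half-line the phase is `L (t - P) ^ 2 / 2`, up to a negligible term. -/
theorem norm_chirpInt_pos_sub_le (hρ : Smooth ρ)
    (hM : ∀ t, |ρ t| ≤ M ∧ |deriv ρ t| ≤ M) {δ z w : ℝ} (hL : 1 ≤ L) (he : 0 ≤ e)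
    (heL : e ≤ 1 / L ^ 2) (hδ : 0 < δ) (hδ1 : δ ≤ 1 / 2) (hw : |w| ≤ 1) (hP : 3 / 4 ≤ z - a * w)
    (hP' : z - a * w ≤ 5 / 4) :
    ‖chirpInt ρ σ a L e 0 4 z w - (ρ (z - a * w) : ℂ) *
        ∫ u in (-4 : ℝ)..4, expI(L * u ^ 2 / 2)‖ ≤
      30 * M * δ / √L + 40 * M / (L * δ ^ 2) + 64 * M / L := by
  have hL0 : 0 < L := by linarith
  have hM0 : 0 ≤ M := (abs_nonneg _).trans (hM 0).1
  set P := z - a * w with hPdef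
  have h1 := norm_integral_fresnel_sub_le (f := fun u => (ρ (u + P) : ℂ))
    (f' := fun u => ((deriv ρ (u + P) : ℝ) : ℂ)) (A := 0 - P) (B := 4 - P) (M := M) hL0 hδ
    (by linarith) (by linarith) (by linarith) (by linarith) (by linarith)
    (fun u => (((hρ.differentiable (by simp)) (u + P)).hasDerivAt.comp_add_const u P).ofReal_comp)
    (fun u => by simpa using (hM _).1) (fun u => by simpa using (hM _).2)
  rw [← intervalIntegral.integral_comp_sub_right (fun u => expI(L * u ^ 2 / 2) * (ρ (u + P) : ℂ)) P,
    zero_add] at h1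
  simp only [sub_add_cancel] at h1
  have hc := hρ.continuous
  have h2 : ‖chirpInt ρ σ a L e 0 4 z w - ∫ t in (0 : ℝ)..4,
      expI(L * (t - P) ^ 2 / 2) * (ρ t : ℂ)‖ ≤ 64 * M / L := by
    have i1 : IntervalIntegrable (fun t => expI(chirpPhase σ a L e z w t) * (ρ t : ℂ)) volume 0 4 :=
      ((continuous_chirp hc σ a L e).comp
      (Continuous.prodMk_right (z, w))).intervalIntegrable _ _
    have i2 : Continuous fun t => expI(L * (t - P) ^ 2 / 2) * (ρ t : ℂ) := by fun_prop
    rw [chirpInt, ← intervalIntegral.integral_sub i1 (i2.intervalIntegrable _ _)]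
    refine (norm_intervalIntegral_le (A := 16 * M / L) (by norm_num) fun t ht => ?_).trans_eq
      (by ring)
    have e1 : chirpPhase σ a L e z w t = L * (t - P) ^ 2 / 2 + L * e * w * t ^ 2 := by
      rw [chirpPhase, signedPow, if_pos ht.1, Real.rpow_two, ← hPdef]; ring
    rw [e1, Complex.ofReal_add, mul_add, exp_add, ← sub_mul,
      ← mul_sub_one, norm_mul, norm_mul, norm_expI, one_mul, norm_real]
    have e2 : ‖expI(L * e * w * t ^ 2) - 1‖ ≤ 16 / L := by
      refine Real.norm_exp_I_mul_ofReal_sub_one_le.trans ?_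
      rw [norm_eq_abs, abs_mul, abs_mul, abs_mul, abs_of_pos hL0, abs_of_nonneg he,
        abs_of_nonneg (sq_nonneg t)]
      calc _ ≤ L * (1 / L ^ 2) * 1 * 4 ^ 2 := by gcongr; exacts [ht.1, ht.2]
        _ = _ := by field_simp; norm_num
    calc _ ≤ 16 / L * M := by gcongr; exact (hM t).1
      _ = _ := by ring
  calc _ ≤ _ := norm_sub_le_norm_sub_add_norm_sub _ (∫ t in (0 : ℝ)..4,
        expI(L * (t - P) ^ 2 / 2) * (ρ t : ℂ)) _
    _ ≤ _ := (add_le_add h2 h1).trans_eq (by ring)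

/-- On the negative half-line the phase is not stationary in `w`. -/
theorem norm_integral_chirpInt_neg_le (ha : a ≠ 0) (hρ : Continuous ρ) (hM : ∀ t, |ρ t| ≤ M)
    (hσ : |σ| = 1) {W W' : ℝ → ℂ} {A k z : ℝ} (hL : 0 < L) (he : 0 ≤ e) (hea : e ≤ |a| / 64)
    (hk : 0 < k) (hk1 : k ≤ 1 / 2) (hP : ∀ w ∈ Icc (-k) k, 3 / 4 ≤ z - a * w)
    (hW : ∀ w, HasDerivAt W (W' w) w) (h0 : ∀ w ∈ Icc (-k) k, ‖W w‖ ≤ A)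
    (h1 : ∀ w ∈ Icc (-k) k, ‖W' w‖ ≤ A) :
    ‖∫ w in (-k)..k, W w * chirpInt ρ σ a L e (-4) 0 z w‖ ≤
      8 * M * A * (3 + 2 * |a|) / |a| / L := by
  have hA : 0 ≤ A := (norm_nonneg _).trans (h0 0 (by constructor <;> linarith))
  have ha0 : 0 < |a| := abs_pos.2 ha
  have hWc : Continuous W := continuous_iff_continuousAt.2 fun w => (hW w).continuousAt
  simp only [chirpInt, ← intervalIntegral.integral_const_mul]
  rw [intervalIntegral_intervalIntegral_swap]
  · refine (norm_intervalIntegral_le (A := 2 * M * A * (3 + 2 * |a|) / |a| / L) (by norm_num)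
      fun t ht => ?_).trans_eq (by ring)
    simp only [← mul_assoc]
    rw [intervalIntegral.integral_mul_const, norm_mul, norm_real]
    have hs : |signedPow σ 2 t| ≤ 16 := by
      have : t ^ 2 ≤ 16 := by nlinarith [ht.1, ht.2]
      unfold signedPow
      split_ifs <;> simpa [abs_mul, hσ, Real.rpow_two] using this
    set s := signedPow σ 2 t
    have hp : ∀ w, HasDerivAt (fun w => z - a * w) (-a) w := fun w => by
      simpa only [sub_eq_add_neg, neg_mul] using hasDerivAt_affine z (-a) w
    have hD : ∀ w, HasDerivAt (fun w => chirpPhase σ a L e z w t)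
        (L * ((z - a * w) * (-a) + a * t + e * s)) w := fun w =>
      ((((((hp w).pow 2).div_const 2).sub ((hp w).mul_const t)).add
        ((hasDerivAt_affine _ e w).mul_const s)).const_mul L).congr_deriv (by
          rw [Nat.cast_ofNat]; norm_num only; ring)
    have hD' : ∀ w, HasDerivAt (fun w => L * ((z - a * w) * (-a) + a * t + e * s))
        (L * a ^ 2) w := fun w =>
      (((((hp w).mul_const (-a)).add_const (a * t)).add_const (e * s)).const_mul L).congr_deriv
        (by ring)
    have key := norm_integral_exp_le_of_first_deriv (show -k ≤ k by linarith)
      (show 0 < L * (|a| / 2) by positivity) (fun w _ => hD w) (fun w _ => hD' w)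
      (fun w _ => hW w) (fun w hw => ?_) (ν := L * |a| ^ 2) (fun w _ => ?_) h0 h1
    · simp_rw [mul_comm (W _)]
      have e1 : (2 * A + (k - -k) * (A + A * (L * |a| ^ 2) / (L * (|a| / 2)))) / (L * (|a| / 2)) ≤
          2 * A * (3 + 2 * |a|) / |a| / L := by
        have : A * (L * |a| ^ 2) / (L * (|a| / 2)) = 2 * A * |a| := by field_simp
        rw [this]
        calc _ ≤ (2 * A + 1 * (A + 2 * A * |a|)) / (L * (|a| / 2)) := by gcongr; linarith
          _ = _ := by field_simp; ring
      calc _ ≤ 2 * A * (3 + 2 * |a|) / |a| / L * M := by gcongr; exacts [key.trans e1, hM t]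
        _ = _ := by ring
    · rw [abs_mul, abs_of_pos hL]
      refine mul_le_mul_of_nonneg_left ?_ hL.le
      have e1 : |e * s| ≤ |a| / 4 := by
        rw [abs_mul, abs_of_nonneg he]
        calc _ ≤ |a| / 64 * 16 := by gcongr
          _ = _ := by ring
      have e2 : 3 / 4 * |a| ≤ |a * (t - (z - a * w))| := by
        rw [abs_mul, mul_comm]
        have := hP w hw
        refine mul_le_mul_of_nonneg_left ?_ ha0.le
        rw [abs_sub_comm]
        exact le_trans (by linarith [ht.2]) (le_abs_self _)
      have e3 := abs_sub_abs_le_abs_sub (a * (t - (z - a * w))) (-(e * s))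
      rw [abs_neg, show a * (t - (z - a * w)) - -(e * s) = (z - a * w) * -a + a * t + e * s by
        ring] at e3
      linarith
    · rw [abs_mul, abs_of_pos hL, abs_pow]
  · have hc : Continuous (Function.uncurry fun w t : ℝ => W w *
        (expI(chirpPhase σ a L e z w t) * (ρ t : ℂ))) :=
      (hWc.comp continuous_fst).mul ((continuous_chirp hρ σ a L e).comp
        (f := fun p : ℝ × ℝ => ((z, p.1), p.2)) (by fun_prop))
    exact (hc.continuousOn.integrableOn_compact (isCompact_uIcc.prod isCompact_uIcc)).mono_set
      (Set.prod_mono Set.uIoc_subset_uIcc Set.uIoc_subset_uIcc)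

end

section

variable {ρ φ : ℝ → ℝ} {σ a : ℝ}

theorem exists_hasDerivAt_chirpAmp {M : ℝ} (hφ : Smooth φ)
    (hM : ∀ t, |φ t| ≤ M ∧ |deriv φ t| ≤ M) {e z : ℝ} (he : |e| ≤ 1) (hz : |z| ≤ 2) :
    ∃ W' : ℝ → ℂ, ∀ w, HasDerivAt (fun w => (chirpAmp φ a e z w : ℂ)) (W' w) w ∧
      (|w| ≤ 1 → ‖(chirpAmp φ a e z w : ℂ)‖ ≤ M ^ 2 * (5 + |a|) ∧ ‖W' w‖ ≤ M ^ 2 * (5 + |a|)) := by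
  have hd : ∀ x, HasDerivAt φ (deriv φ x) x := fun x => (hφ.differentiable (by simp) x).hasDerivAt
  have hM0 : 0 ≤ M := (abs_nonneg _).trans (hM 0).1
  have key : ∀ w, HasDerivAt (fun w => chirpAmp φ a e z w)
      ((Real.exp (-((z + w) ^ 2 / 2)) * (-(z + w)) * φ (z - a * w) +
        Real.exp (-((z + w) ^ 2 / 2)) * (deriv φ (z - a * w) * (-a))) * φ (1 + 2 * e * w) +
        Real.exp (-((z + w) ^ 2 / 2)) * φ (z - a * w) * (deriv φ (1 + 2 * e * w) * (2 * e))) w := by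
    intro w
    have h1 : HasDerivAt (fun w => -((z + w) ^ 2 / 2)) (-(z + w)) w :=
      ((((hasDerivAt_id w).const_add z).pow 2).div_const 2).neg.congr_deriv (by simp)
    have h2 : HasDerivAt (fun w => z - a * w) (-a) w := by
      simpa only [sub_eq_add_neg, neg_mul] using hasDerivAt_affine z (-a) w
    exact (h1.exp.mul ((hd _).comp w h2)).mul ((hd _).comp w (hasDerivAt_affine 1 (2 * e) w))
  refine ⟨_, fun w => ⟨(key w).ofReal_comp, fun hw => ?_⟩⟩
  rw [norm_real, norm_real, norm_eq_abs, norm_eq_abs, chirpAmp]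
  have hE : |Real.exp (-((z + w) ^ 2 / 2))| ≤ 1 := by
    rw [abs_of_pos (Real.exp_pos _), Real.exp_le_one_iff, neg_nonpos]; positivity
  have hzw : |z + w| ≤ 3 := (abs_add_le _ _).trans (by linarith)
  constructor
  · rw [abs_mul, abs_mul]
    calc _ ≤ 1 * M * M := by gcongr; exacts [(hM _).1, (hM _).1]
      _ ≤ _ := by nlinarith [abs_nonneg a, sq_nonneg M]
  · rw [add_mul]
    refine (abs_add_three _ _ _).trans ?_
    simp only [abs_mul, abs_neg, abs_two]
    calc _ ≤ 1 * 3 * M * M + 1 * (M * |a|) * M + 1 * M * (M * (2 * 1)) := by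
          gcongr <;> first | exact (hM _).1 | exact (hM _).2
      _ = _ := by ring

theorem mul_le_abs_integral_integral {V : ℝ → ℝ → ℝ} (hV : Continuous (Function.uncurry V))
    {c d c' d' s v : ℝ} (hcd : c ≤ d) (hcd' : c' ≤ d')
    (h : ∀ z ∈ Icc c d, ∀ w ∈ Icc c' d', v ≤ s * V z w) :
    v * ((d' - c') * (d - c)) ≤ |s| * |∫ z in c..d, ∫ w in c'..d', V z w| := by
  have hlow : ∀ {f : ℝ → ℝ} {c d v : ℝ}, Continuous f → c ≤ d → (∀ x ∈ Icc c d, v ≤ f x) →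
      v * (d - c) ≤ ∫ x in c..d, f x := by
    intro f c d v hf hcd h
    have := integral_mono_on (μ := volume) hcd (continuous_const.intervalIntegrable _ _)
      (hf.intervalIntegrable _ _) h
    rwa [intervalIntegral.integral_const, smul_eq_mul, mul_comm] at this
  have hc : Continuous fun z => ∫ w in c'..d', V z w :=
    continuous_parametric_intervalIntegral_of_continuous' hV _ _
  rw [← abs_mul, ← intervalIntegral.integral_const_mul, ← mul_assoc]
  refine (hlow (continuous_const.mul hc) hcd fun z hz => ?_).trans (le_abs_self _)
  rw [Pi.mul_apply, ← intervalIntegral.integral_const_mul]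
  exact hlow (continuous_const.mul (hV.comp (Continuous.prodMk_right z))) hcd' (h z hz)

set_option maxHeartbeats 1000000 in
theorem exists_le_norm_integral_chirp (ha : a ≠ 0) (hρ : IsSpatialCutoff ρ)
    (hφ : IsFrequencyCutoff φ) (hρ1 : ρ 1 ≠ 0) (hφ1 : φ 1 ≠ 0) (hσ : |σ| = 1) :
    ∃ k c L₀ : ℝ, 0 < k ∧ k ≤ 1 / 4 ∧ 0 < c ∧ 1 ≤ L₀ ∧ ∀ L e : ℝ, L₀ ≤ L → 0 ≤ e →
      e ≤ 1 / L ^ 2 → c / √L ≤ ‖∫ z in (1 - k)..(1 + k), ∫ w in (-k)..k,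
        (chirpAmp φ a e z w : ℂ) * chirpInt ρ σ a L e (-4) 4 z w‖ := by
  obtain ⟨M, hM0, hM⟩ := exists_bound_deriv hρ.contDiff hρ.tsupport_subset
  obtain ⟨N, hN0, hN⟩ := exists_bound_deriv hφ.contDiff hφ.tsupport_subset
  have hρc := hρ.contDiff.continuous
  have hφc := hφ.contDiff.continuous
  have hφ1' : 0 < φ 1 := (hφ.nonneg 1).lt_of_ne' hφ1
  have ha0 : 0 < |a| := abs_pos.2 ha
  -- near `1` the two cutoffs keep their sign and half of their size
  obtain ⟨κ, hκ, hκρ⟩ : ∃ κ > 0, ∀ x, |x - 1| ≤ κ → ρ 1 ^ 2 / 2 ≤ ρ 1 * ρ x ∧ φ 1 / 2 ≤ φ x := by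
    have h1 : ∀ᶠ x in nhds 1, ρ 1 ^ 2 / 2 < ρ 1 * ρ x :=
      (continuous_const.mul hρc).continuousAt.eventually (lt_mem_nhds (by
        have := sq_pos_of_ne_zero hρ1; rw [Pi.mul_apply, ← sq]; linarith))
    have h2 : ∀ᶠ x in nhds 1, φ 1 / 2 < φ x :=
      hφc.continuousAt.eventually (lt_mem_nhds (by linarith))
    obtain ⟨κ, hκ, h⟩ := Metric.eventually_nhds_iff.1 (h1.and h2)
    exact ⟨κ / 2, by positivity, fun x hx =>
      ⟨(h (hx.trans_lt (by linarith))).1.le, (h (hx.trans_lt (by linarith))).2.le⟩⟩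
  set k := min (1 / 4) κ / (1 + |a|) with hk
  have hk0 : 0 < k := by positivity
  have hka : k * (1 + |a|) = min (1 / 4) κ := by rw [hk]; field_simp
  have hk1 : k * (1 + |a|) ≤ 1 / 4 := hka.trans_le (min_le_left _ _)
  have hk4 : k ≤ 1 / 4 := by nlinarith
  have hkκ : k * (1 + |a|) ≤ κ := hka.trans_le (min_le_right _ _)
  set A := N ^ 2 * (5 + |a|)
  have hA0 : 0 < A := by positivity
  have hρ1' : 0 < |ρ 1| := abs_pos.2 hρ1
  obtain ⟨w₀, hw₀p, hw₀⟩ : ∃ w₀ > 0, w₀ * |ρ 1| =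
      Real.exp (-2) * (φ 1 / 2) * (φ 1 / 2) * (ρ 1 ^ 2 / 2) :=
    ⟨_, by positivity, div_mul_cancel₀ _ hρ1'.ne'⟩
  set B := 3 / 10 * w₀ * (2 * k) ^ 2 with hB
  have hB0 : 0 < B := by positivity
  set δ := min (1 / 2) (B / (120 * A * M))
  have hδ0 : 0 < δ := by positivity
  set D := 40 * A * M / δ ^ 2 + 64 * A * M + 8 * M * A * (3 + 2 * |a|) / |a| with hD
  have hD0 : 0 < D := by positivity
  refine ⟨k, B / 2, max 2 (max (64 / |a|) ((4 * D / B) ^ 2)), hk0, hk4, by positivity,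
    one_le_two.trans (le_max_left _ _), fun L e hL he heL => ?_⟩
  have hL2 : 2 ≤ L := (le_max_left _ _).trans hL
  have hL1 : 1 ≤ L := by linarith
  have hL0 : 0 < L := by linarith
  have hea : e ≤ |a| / 64 := by
    have h := ((le_max_left _ _).trans (le_max_right _ _)).trans hL
    rw [div_le_iff₀ ha0] at h
    refine heL.trans ((div_le_div_iff₀ (by positivity) (by norm_num)).2 ?_)
    nlinarith
  have he1 : e ≤ 1 / 2 := heL.trans (one_div_le_one_div_of_le two_pos (by nlinarith))
  have hDL : D / L ≤ B / 4 / √L := by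
    have h := Real.le_sqrt_of_sq_le (((le_max_right _ _).trans (le_max_right _ _)).trans hL)
    rw [div_le_iff₀ hB0] at h
    rw [div_le_div_iff₀ hL0 (by positivity)]
    nlinarith [sq_sqrt hL0.le, sqrt_nonneg L]
  set c₀ := ∫ u in (-4 : ℝ)..4, expI(L * u ^ 2 / 2)
  have hc₀L : 3 / 10 / √L ≤ ‖c₀‖ := le_norm_integral_fresnel hL1
  set V : ℝ → ℝ → ℝ := fun z w => chirpAmp φ a e z w * ρ (z - a * w) with hV
  have hWc : Continuous fun p : ℝ × ℝ => (chirpAmp φ a e p.1 p.2 : ℂ) := by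
    unfold chirpAmp; fun_prop
  have hVc : Continuous (Function.uncurry V) := by
    simp only [hV, chirpAmp, Function.uncurry_def]; fun_prop
  have hmc : Continuous fun z => ∫ w in (-k)..k, V z w :=
    continuous_parametric_intervalIntegral_of_continuous' hVc _ _
  have hTc := fun c d => continuous_chirpInt hρc σ a L e c d
  set J : ℝ → ℂ := fun z => ∫ w in (-k)..k, (chirpAmp φ a e z w : ℂ) * chirpInt ρ σ a L e (-4) 4 z w
  have hJc : Continuous J :=
    continuous_parametric_intervalIntegral_of_continuous' (hWc.mul (hTc (-4) 4)) _ _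
  have hz2 : ∀ z ∈ Icc (1 - k) (1 + k), |z| ≤ 2 := fun z hz =>
    abs_le.2 ⟨by linarith [hz.1], by linarith [hz.2]⟩
  have hP : ∀ z ∈ Icc (1 - k) (1 + k), ∀ w ∈ Icc (-k) k,
      |z - a * w - 1| ≤ k * (1 + |a|) := by
    intro z hz w hw
    have h1 : |z - 1| ≤ k := abs_le.2 ⟨by linarith [hz.1], by linarith [hz.2]⟩
    have h2 : |a * w| ≤ |a| * k := by rw [abs_mul]; gcongr; exact abs_le.2 hw
    calc _ = |z - 1 - a * w| := by ring_nf
      _ ≤ _ := (abs_sub _ _).trans (by linarith)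
  have hw1 : ∀ w ∈ Icc (-k) k, |w| ≤ 1 := fun w hw => (abs_le.2 hw).trans (by linarith)
  set E := 30 * A * M * δ / √L + D / L with hE
  have hEp : 0 ≤ E := by positivity
  -- the main term carries the same constant `c₀` for all `z` and `w`
  have hz : ∀ z ∈ Icc (1 - k) (1 + k), ‖J z - c₀ * ((∫ w in (-k)..k, V z w : ℝ) : ℂ)‖ ≤ E := by
    intro z hz
    obtain ⟨W', hW'⟩ := exists_hasDerivAt_chirpAmp (a := a) hφ.contDiff hN
      ((abs_of_nonneg he).trans_le (by linarith)) (hz2 z hz)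
    have hPz := fun w hw => abs_le.1 ((hP z hz w hw).trans hk1)
    have hneg := norm_integral_chirpInt_neg_le (z := z) ha hρc (fun t => (hM t).1) hσ hL0 he hea hk0
      (by linarith) (fun w hw => by linarith [(hPz w hw).1]) (fun w => (hW' w).1)
      (fun w hw => ((hW' w).2 (hw1 w hw)).1) (fun w hw => ((hW' w).2 (hw1 w hw)).2)
    have hiz : ∀ c d, IntervalIntegrable (fun w => (chirpAmp φ a e z w : ℂ) *
        chirpInt ρ σ a L e c d z w) volume (-k) k := fun c d =>
      ((hWc.mul (hTc c d)).comp (Continuous.prodMk_right z)).intervalIntegrable _ _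
    have hVz : IntervalIntegrable (fun w => c₀ * (V z w : ℂ)) volume (-k) k :=
      (continuous_const.mul (continuous_ofReal.comp
        (hVc.comp (Continuous.prodMk_right z)))).intervalIntegrable _ _
    have hpos : ‖∫ w in (-k)..k, ((chirpAmp φ a e z w : ℂ) * chirpInt ρ σ a L e 0 4 z w -
        c₀ * (V z w : ℂ))‖ ≤ A * (30 * M * δ / √L + 40 * M / (L * δ ^ 2) + 64 * M / L) := by
      refine (norm_intervalIntegral_le (by linarith) fun w hw => ?_).trans
        (mul_le_of_le_one_right (by positivity) (by linarith))
      have h := norm_chirpInt_pos_sub_le (σ := σ) (a := a) (z := z)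
        hρ.contDiff hM hL1 he heL hδ0 (min_le_left _ _)
        (hw1 w hw) (by linarith [(hPz w hw).1]) (by linarith [(hPz w hw).2])
      calc _ = ‖(chirpAmp φ a e z w : ℂ) *
            (chirpInt ρ σ a L e 0 4 z w - (ρ (z - a * w) : ℂ) * c₀)‖ := by
            congr 1; simp only [hV]; push_cast; ring
        _ ≤ _ := by
          rw [norm_mul]
          exact mul_le_mul ((hW' w).2 (hw1 w hw)).1 h (norm_nonneg _) hA0.le
    have hsplit : J z - c₀ * ((∫ w in (-k)..k, V z w : ℝ) : ℂ) =
        (∫ w in (-k)..k, (chirpAmp φ a e z w : ℂ) * chirpInt ρ σ a L e (-4) 0 z w) +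
        ∫ w in (-k)..k, ((chirpAmp φ a e z w : ℂ) * chirpInt ρ σ a L e 0 4 z w -
          c₀ * (V z w : ℂ)) := by
      rw [intervalIntegral.integral_sub (hiz 0 4) hVz, ← add_sub_assoc,
        ← intervalIntegral.integral_add (hiz (-4) 0) (hiz 0 4),
        intervalIntegral.integral_const_mul, intervalIntegral.integral_ofReal]
      change intervalIntegral _ _ _ _ - _ = _
      congr 2; ext w
      rw [← mul_add]
      congr 1
      have hi : ∀ c d, IntervalIntegrable
          (fun t => expI(chirpPhase σ a L e z w t) * (ρ t : ℂ)) volume c d := fun c d =>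
        ((continuous_chirp hρc σ a L e).comp
          (Continuous.prodMk_right (z, w))).intervalIntegrable _ _
      exact (integral_add_adjacent_intervals (hi _ _) (hi _ _)).symm
    rw [hsplit]
    refine (norm_add_le _ _).trans ((add_le_add hneg hpos).trans_eq ?_)
    rw [hE, hD]; ring
  have hmain : w₀ * (2 * k) ^ 2 ≤ |∫ z in (1 - k)..(1 + k), ∫ w in (-k)..k, V z w| := by
    have hv : ∀ z ∈ Icc (1 - k) (1 + k), ∀ w ∈ Icc (-k) k, w₀ * |ρ 1| ≤ ρ 1 * V z w := by
      intro z hz w hw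
      have h1 := hκρ _ ((hP z hz w hw).trans hkκ)
      have h2 : φ 1 / 2 ≤ φ (1 + 2 * e * w) := by
        refine (hκρ _ ?_).2
        rw [add_sub_cancel_left, abs_mul, abs_of_nonneg (by positivity)]
        calc _ ≤ 1 * k := by gcongr; exacts [by linarith, abs_le.2 hw]
          _ ≤ κ := by linarith [mul_nonneg hk0.le ha0.le]
      have h3 : Real.exp (-2) ≤ Real.exp (-((z + w) ^ 2 / 2)) := by
        refine Real.exp_le_exp.2 (neg_le_neg ?_)
        have := sq_le_sq' (a := z + w) (b := 2) (by linarith [hz.1, hw.1])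
          (by linarith [hz.2, hw.2])
        linarith
      rw [hw₀]
      calc _ ≤ Real.exp (-((z + w) ^ 2 / 2)) * φ (z - a * w) * φ (1 + 2 * e * w) *
            (ρ 1 * ρ (z - a * w)) := by
            gcongr
            exacts [mul_nonneg (mul_nonneg (Real.exp_nonneg _) (hφ.nonneg _)) (hφ.nonneg _),
              mul_nonneg (Real.exp_nonneg _) (hφ.nonneg _), h1.2, h1.1]
        _ = _ := by simp only [hV, chirpAmp]; ring
    have h1 := mul_le_abs_integral_integral hVc (by linarith) (by linarith) hv
    rw [show (k - -k) * (1 + k - (1 - k)) = (2 * k) ^ 2 by ring, mul_right_comm, mul_comm] at h1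
    exact le_of_mul_le_mul_left h1 hρ1'
  have hmc' : Continuous fun z => c₀ * ((∫ w in (-k)..k, V z w : ℝ) : ℂ) := by fun_prop
  have hdiff := norm_intervalIntegral_le (by linarith) hz
  rw [intervalIntegral.integral_sub (hJc.intervalIntegrable _ _) (hmc'.intervalIntegrable _ _),
    intervalIntegral.integral_const_mul, intervalIntegral.integral_ofReal,
    show 1 + k - (1 - k) = 2 * k by ring] at hdiff
  have h1 : B / √L ≤ ‖c₀ * ((∫ z in (1 - k)..(1 + k), ∫ w in (-k)..k, V z w : ℝ) : ℂ)‖ := by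
    rw [norm_mul, norm_real]
    calc B / √L = 3 / 10 / √L * (w₀ * (2 * k) ^ 2) := by rw [hB]; ring
      _ ≤ _ := by gcongr; exact hmain
  have h2 : E ≤ B / 2 / √L := by
    have : 30 * A * M * δ ≤ B / 4 := by
      calc _ ≤ 30 * A * M * (B / (120 * A * M)) := by gcongr; exact min_le_right _ _
        _ = _ := by field_simp; norm_num
    calc E ≤ B / 4 / √L + B / 4 / √L := by rw [hE]; gcongr
      _ = _ := by ring
  have h3 : E * (2 * k) ≤ E := mul_le_of_le_one_right hEp (by linarith)
  have h4 := norm_sub_norm_le (c₀ * ((∫ z in (1 - k)..(1 + k), ∫ w in (-k)..k, V z w : ℝ) : ℂ))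
    (∫ z in (1 - k)..(1 + k), J z)
  rw [norm_sub_rev] at h4
  have h5 : B / 2 / √L = B / √L - B / 2 / √L := by ring
  linarith

end

theorem exists_angularFourier_ae_eq {F : ℝ → ℂ} (hF : StronglyMeasurable F)
    (hF2 : MemLp F 2) :
    ∃ f : L², angularFourier f =ᵐ[volume] F := by
  have h0 : (0 : ℝ) < 2 * pi := by positivity
  have hG : MemLp (fun x => F (2 * pi * x)) 2 := by
    refine ⟨(hF.comp_measurable (by fun_prop)).aestronglyMeasurable, ?_⟩
    have h1 := sqNorm_comp_mul_left h0 F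
    have h2 := hF2.2
    rw [eLpNorm_two_eq] at h2 ⊢
    refine rpow_lt_top_of_nonneg (by norm_num) fun h => ?_
    rw [h, ENNReal.mul_top (by simpa using h0)] at h1
    rw [← h1] at h2
    simp at h2
  refine ⟨𝓕⁻ (hG.toLp _), ?_⟩
  have h1 := hG.coeFn_toLp
  have h2 : 𝓕 (𝓕⁻ (hG.toLp _) : L²) = hG.toLp _ := fourier_fourierInv_eq _
  rw [← h2] at h1
  have hq : Measure.QuasiMeasurePreserving (fun x : ℝ => (2 * pi)⁻¹ * x) volume volume :=
    ⟨by fun_prop, by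
      rw [Real.map_volume_mul_left (by positivity)]
      exact Measure.smul_absolutelyContinuous⟩
  filter_upwards [hq.ae h1] with x hx
  rw [angularFourier, div_eq_inv_mul, hx, ← mul_assoc, mul_inv_cancel₀ h0.ne', one_mul]

/-- Pairing with a Gaussian in space multiplies the kernel by a Gaussian in `ξ + η`. -/
theorem IsCcKernel.integral_spaceOp_mul_gaussian {K : ℝ → ℝ → ℂ} {F G : ℝ → ℂ}
    (hK : IsCcKernel K) (hF : MemLp F 2) (hG : MemLp G 2) {γ : ℂ} (hγ : 0 < γ.re)
    (ω : ℝ) :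
    ∫ x, spaceOp K F G x * (exp (-(I * (ω * x : ℝ))) * exp (-γ * x ^ 2)) =
      (pi / γ) ^ (1 / 2 : ℂ) * ∫ ξ, ∫ η, F ξ * G η * K ξ η *
        exp (-((ξ + η - ω : ℝ) : ℂ) ^ 2 / (4 * γ)) := by
  have hi := hK.integrable_spaceOp hF hG 0
  simp only [mul_zero, Complex.ofReal_zero, exp_zero, mul_one] at hi
  have hi2 : Integrable (fun q : (ℝ × ℝ) × ℝ => (F q.1.1 * G q.1.2 * K q.1.1 q.1.2 *
      exp (-γ * q.2 ^ 2)) * expI((q.1.1 + q.1.2 - ω) * q.2))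
      ((volume.prod volume).prod volume) := by
    refine (hi.mul_prod (integrable_cexp_neg_mul_sq hγ)).mul_bdd (c := 1) ?_
      (ae_of_all _ fun _ => (norm_expI _).le)
    exact Continuous.aestronglyMeasurable (by fun_prop)
  have hi3 : Integrable (fun p : ℝ × ℝ => F p.1 * G p.2 * K p.1 p.2 *
      exp (-((p.1 + p.2 - ω : ℝ) : ℂ) ^ 2 / (4 * γ))) (volume.prod volume) := by
    refine hi.mul_bdd (c := 1) (Continuous.aestronglyMeasurable (by fun_prop))
      (ae_of_all _ fun p => ?_)
    rw [norm_exp, Real.exp_le_one_iff, show -((p.1 + p.2 - ω : ℝ) : ℂ) ^ 2 / (4 * γ) =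
      ((-(p.1 + p.2 - ω) ^ 2 / 4 : ℝ) : ℂ) * γ⁻¹ by push_cast; ring, Complex.re_ofReal_mul, inv_re]
    have := Complex.normSq_nonneg γ
    exact mul_nonpos_of_nonpos_of_nonneg (by nlinarith [sq_nonneg (p.1 + p.2 - ω)]) (by positivity)
  rw [← integral_prod (fun p : ℝ × ℝ => F p.1 * G p.2 * K p.1 p.2 *
    exp (-((p.1 + p.2 - ω : ℝ) : ℂ) ^ 2 / (4 * γ))) hi3, ← integral_const_mul]
  calc _ = ∫ x : ℝ, ∫ p : ℝ × ℝ, (F p.1 * G p.2 * K p.1 p.2 * exp (-γ * x ^ 2)) *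
          expI((p.1 + p.2 - ω) * x) ∂(volume.prod volume) := by
        congr 1; ext x
        rw [hK.spaceOp_eq_integral_prod hF hG, ← integral_mul_const]
        congr 1; ext p
        rw [show (p.1 + p.2 - ω) * x = (p.1 + p.2) * x + -(ω * x) by ring, Complex.ofReal_add,
          mul_add, exp_add, ofReal_neg, mul_neg]
        ring
    _ = ∫ p : ℝ × ℝ, (∫ x : ℝ, (F p.1 * G p.2 * K p.1 p.2 * exp (-γ * x ^ 2)) *
          expI((p.1 + p.2 - ω) * x)) ∂(volume.prod volume) := (integral_integral_swap hi2).symm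
    _ = _ := by
        congr 1; ext p
        have := fourierIntegral_gaussian hγ ((p.1 + p.2 - ω : ℝ) : ℂ)
        rw [mul_left_comm, ← this, ← integral_const_mul]
        congr 1; ext x
        push_cast
        ring_nf

section

variable {ρ φ : ℝ → ℝ} {σ a : ℝ}

theorem two_rpow_two_mul (j : ℤ) : (2 : ℝ) ^ (2 * (j : ℝ)) = ((2 : ℝ) ^ j) ^ 2 := by
  rw [← Real.rpow_intCast, ← Real.rpow_two, ← Real.rpow_mul two_pos.le, mul_comm]

theorem scaleMultiplier_eq_intervalIntegral (hρ : IsSpatialCutoff ρ) (α : ℝ) (j : ℤ) (ξ η : ℝ) :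
    scaleMultiplier ρ σ a α j ξ η = ∫ t in (-4 : ℝ)..4, expI(phase σ a α j ξ η t) * (ρ t : ℂ) := by
  rw [integral_of_le (by norm_num), setIntegral_eq_integral_of_forall_compl_eq_zero,
    scaleMultiplier]
  intro t ht
  have : ρ t = 0 := by
    by_contra h
    have h1 := (abs_lt.1 (hρ.tsupport_subset (subset_tsupport _ h)).2)
    exact ht ⟨h1.1, h1.2.le⟩
  simp [this]

theorem isCcKernel_pieceMultiplier_two (hρ : IsSpatialCutoff ρ) (hφ : IsFrequencyCutoff φ) (σ a : ℝ)
    (j m : ℤ) : IsCcKernel (pieceMultiplier ρ φ σ a 2 j m m) := by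
  have hρc := hρ.contDiff.continuous
  have hφc := hφ.contDiff.continuous
  have hs := continuous_signedPow_two σ
  constructor
  · simp only [pieceMultiplier, scaleMultiplier_eq_intervalIntegral hρ]
    have : Continuous fun p : ℝ × ℝ => ∫ t in (-4 : ℝ)..4,
        expI(phase σ a 2 j p.1 p.2 t) * (ρ t : ℂ) := by
      refine continuous_parametric_intervalIntegral_of_continuous' ?_ _ _
      unfold phase Function.uncurry
      fun_prop
    fun_prop
  · set R := (4 + 2 * |a|) * 2 ^ ((j : ℝ) + m) + 2 * 2 ^ ((2 : ℝ) * j + m) * (1 + |a|)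
    have h1 : (0 : ℝ) < 2 ^ ((j : ℝ) + m) := by positivity
    have h2 : (0 : ℝ) < 2 ^ ((2 : ℝ) * j + m) := by positivity
    refine ⟨R, by positivity, fun ξ η h => ?_⟩
    by_contra h0
    obtain ⟨⟨-, h3⟩, -, h4⟩ := pieceMultiplier_ne_zero hφ two_pos rfl h0
    have h5 : |ξ| ≤ |ξ - a * η| + |a| * |η| := by
      rw [← abs_mul]; simpa using abs_add_le (ξ - a * η) (a * η)
    have h6 := mul_le_mul_of_nonneg_left h4 (abs_nonneg a)
    have h7 := mul_nonneg (abs_nonneg a) h1.le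
    rcases h with h | h <;> nlinarith

theorem integral_eq_smul_integral_affine {r : ℝ} (hr : 0 < r) (ζ : ℝ) (g : ℝ → ℂ) :
    ∫ x, g x = r * ∫ z, g (r * (ζ + z)) := by
  rw [integral_add_left_eq_self (fun z => g (r * z)), Measure.integral_comp_mul_left,
    abs_of_pos (by positivity), real_smul, ← mul_assoc, ← Complex.ofReal_mul,
    mul_inv_cancel₀ hr.ne', Complex.ofReal_one, one_mul]

end

section

variable {ρ φ : ℝ → ℝ} {σ a : ℝ}

/-- A function in `L²` whose Fourier transform is a modulated and dilated interval. -/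
theorem exists_chirp {r c d : ℝ} (hr : 0 < r) (hcd : c ≤ d) {θ : ℝ → ℝ} (hθ : Continuous θ)
    (ζ : ℝ) : ∃ F : ℝ → ℂ, MemLp F 2 ∧ (∀ z, F (r * (ζ + z)) =
      (Icc c d).indicator (fun z => expI(θ z)) z) ∧
      ∃ f : L², angularFourier f =ᵐ[volume] F ∧ ‖f‖ ^ 2 = r * (d - c) / (2 * pi) := by
  set u := (Icc c d).indicator fun z => expI(θ z) with hu
  have hum : StronglyMeasurable u :=
    (Continuous.stronglyMeasurable (by fun_prop)).indicator measurableSet_Icc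
  have hu2 : ∫⁻ z, ‖u z‖ₑ ^ 2 = ofReal (d - c) := by
    rw [← Real.volume_Icc, ← lintegral_indicator_one measurableSet_Icc]
    congr 1; ext z
    by_cases hz : z ∈ Icc c d
    · rw [hu, indicator_of_mem hz, indicator_of_mem hz, ← ofReal_norm, norm_expI]
      simp
    · simp [hu, indicator_of_notMem hz]
  set F : ℝ → ℂ := fun ξ => u (r⁻¹ * ξ - ζ) with hF
  have hFz : ∀ z, F (r * (ζ + z)) = u z := fun z => by
    simp only [hF]; rw [inv_mul_cancel_left₀ hr.ne', add_sub_cancel_left]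
  have hFm : StronglyMeasurable F := hum.comp_measurable (by fun_prop)
  have hFs : sqNorm F = ofReal (r * (d - c)) := by
    rw [← sqNorm_comp_mul_left hr, ofReal_mul hr.le, ← hu2,
      ← lintegral_sub_right_eq_self (fun z => ‖u z‖ₑ ^ 2) ζ, sqNorm]
    simp only [hF]
    simp_rw [inv_mul_cancel_left₀ hr.ne']
  have hF2 : MemLp F 2 := ⟨hFm.aestronglyMeasurable, by
    rw [eLpNorm_two_eq, hFs]
    exact rpow_lt_top_of_nonneg (by norm_num) ofReal_ne_top⟩
  obtain ⟨f, hf⟩ := exists_angularFourier_ae_eq hFm hF2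
  refine ⟨F, hF2, hFz, f, hf, ?_⟩
  have h1 : sqNorm (angularFourier f) = sqNorm F :=
    lintegral_congr_ae (hf.mono fun x hx => by simp only [hx])
  rw [sqNorm_angularFourier, hFs, ← ofReal_norm, ← ofReal_pow (norm_nonneg _),
    ← ofReal_mul (by positivity), ENNReal.ofReal_eq_ofReal_iff (by positivity)
      (mul_nonneg hr.le (sub_nonneg.2 hcd))] at h1
  rw [← h1]; field_simp

theorem exists_gaussian {γ : ℂ} (hγ : 0 < γ.re) (ω : ℝ) : ∃ h : L^∞,
    ‖h‖ ≤ 1 ∧ h =ᵐ[volume] fun x : ℝ => exp (-(I * (ω * x : ℝ))) * exp (-γ * x ^ 2) := by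
  have hb : ∀ x : ℝ, ‖exp (-(I * (ω * x : ℝ))) * exp (-γ * x ^ 2)‖ ≤ 1 := by
    intro x
    rw [norm_mul, ← mul_neg, ← ofReal_neg, norm_expI, one_mul,
      norm_cexp_neg_mul_sq, Real.exp_le_one_iff]
    nlinarith [sq_nonneg x]
  have hm : MemLp (fun x : ℝ => exp (-(I * (ω * x : ℝ))) * exp (-γ * x ^ 2)) ∞ volume :=
    memLp_top_of_bound (Continuous.aestronglyMeasurable (by fun_prop)) 1 (ae_of_all _ hb)
  refine ⟨hm.toLp _, ?_, hm.coeFn_toLp⟩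
  rw [Lp.norm_toLp, eLpNorm_exponent_top]
  refine ENNReal.toReal_le_of_le_ofReal zero_le_one (eLpNormEssSup_le_of_ae_bound (ae_of_all _ hb))

theorem pieceForm_congr {α : ℝ} {j m n : ℤ} {f g : L²}
    {h : L^∞} {F G H : ℝ → ℂ} (hf : angularFourier f =ᵐ[volume] F)
    (hg : angularFourier g =ᵐ[volume] G) (hh : h =ᵐ[volume] H) :
    pieceForm ρ φ σ a α j m n f g h =
      ∫ x, spaceOp (pieceMultiplier ρ φ σ a α j m n) F G x * H x := by
  refine integral_congr_ae (hh.mono fun x hx => ?_)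
  simp only [hx]
  congr 1
  refine integral_congr_ae (hf.mono fun ξ hξ => integral_congr_ae (hg.mono fun η hη => ?_))
  simp only [hξ, hη]

theorem chirp_mul_pieceMultiplier (hρ : IsSpatialCutoff ρ) (j : ℤ) (m : ℕ) (z w : ℝ) :
    expI(2 ^ m * ((1 + a) * z ^ 2 / 2)) * expI(2 ^ m * ((a ^ 2 + a) * w ^ 2 / 2)) *
      pieceMultiplier ρ φ σ a 2 j m m (2 ^ j * 2 ^ m * (a * 2 ^ j / 2 + z))
        (2 ^ j * 2 ^ m * (2 ^ j / 2 + w)) *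
      exp (-(((z + w) ^ 2 / 2 : ℝ) * (1 + I * (a * 2 ^ m : ℝ)))) =
    chirpAmp φ a (2 ^ j)⁻¹ z w * chirpInt ρ σ a (2 ^ m) (2 ^ j)⁻¹ (-4) 4 z w := by
  have h2 : (2 : ℝ) ^ (2 * (j : ℝ) + ((m : ℤ) : ℝ)) = (2 ^ j) ^ 2 * 2 ^ m := by
    rw [rpow_add two_pos, two_rpow_two_mul]; simp
  rw [pieceMultiplier, scaleMultiplier_eq_intervalIntegral hρ, h2, zpow_add₀ two_ne_zero,
    zpow_natCast]
  have hx : (0 : ℝ) < 2 ^ j := by positivity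
  have hL : (0 : ℝ) < 2 ^ m := by positivity
  simp only [phase, two_rpow_two_mul]
  generalize (2 : ℝ) ^ j = x at *
  generalize (2 : ℝ) ^ m = L at *
  rw [show (x * L * (a * x / 2 + z) - a * (x * L * (x / 2 + w))) / (x * L) = z - a * w by
    field_simp; ring, show 2 * (x * L * (x / 2 + w)) / (x ^ 2 * L) = 1 + 2 * x⁻¹ * w by
    field_simp, chirpAmp, chirpInt]
  have hint : ∀ t, expI(chirpPhase σ a L x⁻¹ z w t) * (ρ t : ℂ) =
      expI(L * (z - a * w) ^ 2 / 2) *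
        (expI(-((x * L * (a * x / 2 + z) - a * (x * L * (x / 2 + w))) / x) * t +
          x * L * (x / 2 + w) / x ^ 2 * signedPow σ 2 t) * (ρ t : ℂ)) := by
    intro t
    rw [← mul_assoc, ← exp_add, ← mul_add, ← Complex.ofReal_add, chirpPhase]
    congr 4
    field_simp
    ring
  simp_rw [hint]
  rw [intervalIntegral.integral_const_mul]
  have he : expI(L * ((1 + a) * z ^ 2 / 2)) * expI(L * ((a ^ 2 + a) * w ^ 2 / 2)) *
      exp (-(((z + w) ^ 2 / 2 : ℝ) * (1 + I * (a * L : ℝ)))) =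
      Real.exp (-((z + w) ^ 2 / 2)) * expI(L * (z - a * w) ^ 2 / 2) := by
    rw [Complex.ofReal_exp, ← exp_add, ← exp_add, ← exp_add]
    congr 1; push_cast; ring
  generalize (intervalIntegral _ (-4) 4 volume : ℂ) = T
  push_cast at he ⊢
  linear_combination (φ (z - a * w) : ℂ) * φ (1 + 2 * x⁻¹ * w) * T * he

end

section

variable {ρ φ : ℝ → ℝ} {σ a : ℝ}

/-- The second cutoff separates the scales: a frequency close to `2 ^ (2 j + m) / 2` is seen by the
scale `j` only. -/
theorem exists_scale_unique (hφ : IsFrequencyCutoff φ) : ∃ ε > 0, ∀ x y b : ℝ, 0 < x → 0 < y →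
    (2 * y ≤ x ∨ 2 * x ≤ y) → |b| ≤ ε → φ ((x / y) ^ 2 * (1 + b)) = 0 := by
  have hcpt : IsCompact (tsupport φ) := (isCompact_Icc (a := -4) (b := 4)).of_isClosed_subset
    (isClosed_tsupport φ) fun t ht => abs_le.1 (hφ.tsupport_subset ht).2.le
  obtain ⟨ε, hε, h⟩ := hcpt.exists_forall_le' (f := fun x => min (|x| - 1 / 4) (4 - |x|))
    (by fun_prop) (a := 0) fun x hx => lt_min (sub_pos.2 (hφ.tsupport_subset hx).1)
      (sub_pos.2 (hφ.tsupport_subset hx).2)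
  refine ⟨min (1 / 2) (ε / 8), by positivity, fun x y b hx hy hxy hb => ?_⟩
  by_contra h0
  obtain ⟨h1, h2⟩ := le_min_iff.1 (h _ (subset_tsupport _ h0))
  obtain ⟨hb1, hb2⟩ := abs_le.1 (hb.trans (min_le_left _ _))
  obtain ⟨hb3, hb4⟩ := abs_le.1 (hb.trans (min_le_right _ _))
  have hq : 0 < x / y := by positivity
  rw [abs_of_nonneg (mul_nonneg (sq_nonneg _) (by linarith))] at h1 h2
  rcases hxy with h3 | h3
  · have : 2 ≤ x / y := by rwa [le_div_iff₀ hy]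
    have h4 : 4 ≤ (x / y) ^ 2 := by nlinarith
    nlinarith [mul_nonneg (sub_nonneg.2 h4) (by linarith : 0 ≤ 1 + b)]
  · have : x / y ≤ 1 / 2 := by rw [div_le_iff₀ hy]; linarith
    have h4 : (x / y) ^ 2 ≤ 1 / 4 := by nlinarith
    nlinarith

/-- A single scale contributes, with a form that does not decay in `m`. -/
theorem exists_pieceForm_ge (ha : a ≠ 0) (hρ : IsSpatialCutoff ρ) (hφ : IsFrequencyCutoff φ)
    {k c ε : ℝ} (hk : 0 < k) (hk1 : k ≤ 1 / 4) (hc : 0 < c) (hε : 0 < ε)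
    (hsep : ∀ x y b : ℝ, 0 < x → 0 < y → (2 * y ≤ x ∨ 2 * x ≤ y) → |b| ≤ ε →
      φ ((x / y) ^ 2 * (1 + b)) = 0) {j : ℤ} {m : ℕ} (hj : ((2 : ℝ) ^ j)⁻¹ ≤ ε)
    (hI : c / √(2 ^ m) ≤ ‖∫ z in (1 - k)..(1 + k), ∫ w in (-k)..k,
      (chirpAmp φ a (2 ^ j)⁻¹ z w : ℂ) * chirpInt ρ σ a (2 ^ m) (2 ^ j)⁻¹ (-4) 4 z w‖) :
    ∃ (f g : L²) (h : L^∞),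
      c * √(2 * pi * |a|) * pi / (2 * k) * ‖f‖ * ‖g‖ * ‖h‖ < ‖pieceForm ρ φ σ a 2 j m m f g h‖ ∧
      ∀ i : ℤ, i ≠ j → pieceForm ρ φ σ a 2 i m m f g h = 0 := by
  set x : ℝ := 2 ^ j with hx
  set L : ℝ := 2 ^ m with hL
  have hx0 : 0 < x := by positivity
  have hL0 : 0 < L := by positivity
  set r := x * L with hr
  have hr0 : 0 < r := by positivity
  set β : ℂ := 1 + I * (a * L : ℝ) with hβ
  have hβre : β.re = 1 := by simp [hβ]
  have hβ0 : β ≠ 0 := fun h => by simp [h] at hβre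
  set γ : ℂ := (r ^ 2 / 2 : ℝ) * β⁻¹ with hγ
  have hγ0 : 0 < γ.re := by
    rw [hγ, Complex.re_ofReal_mul, inv_re, hβre]
    have := Complex.normSq_pos.2 hβ0
    positivity
  set ω := r * (a * x / 2 + x / 2) with hω
  -- with the Gaussian of parameter `γ`, the phases `θ` complete the square in the phase
  obtain ⟨F, hF2, hF, f, hf, hfn⟩ := exists_chirp hr0 (show 1 - k ≤ 1 + k by linarith)
    (θ := fun z => L * ((1 + a) * z ^ 2 / 2)) (by fun_prop) (a * x / 2)
  obtain ⟨G, hG2, hG, g, hg, hgn⟩ := exists_chirp hr0 (show -k ≤ k by linarith)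
    (θ := fun w => L * ((a ^ 2 + a) * w ^ 2 / 2)) (by fun_prop) (x / 2)
  obtain ⟨h, hh1, hh⟩ := exists_gaussian hγ0 ω
  refine ⟨f, g, h, ?_, fun i hi => ?_⟩
  · rw [pieceForm_congr hf hg hh,
      (isCcKernel_pieceMultiplier_two hρ hφ σ a j m).integral_spaceOp_mul_gaussian hF2 hG2 hγ0]
    set X : ℂ := (pi / γ) ^ (1 / 2 : ℂ) with hX
    have hXn : √(2 * pi * |a|) * √L ≤ ‖X‖ * r := by
      rw [← sqrt_mul (by positivity), sqrt_le_iff]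
      refine ⟨by positivity, ?_⟩
      have h1 : X ^ 2 = pi / γ := by rw [hX, one_div]; exact Complex.cpow_ofNat_inv_pow _ 2
      have h2 : |a| * L ≤ ‖β‖ := by
        have := Complex.abs_im_le_norm β
        simpa [hβ, abs_mul, abs_of_pos hL0] using this
      rw [mul_pow, ← norm_pow, h1, norm_div, hγ, norm_mul, norm_inv, norm_real,
        norm_real, norm_eq_abs, norm_eq_abs, abs_of_pos Real.pi_pos,
        abs_of_pos (show 0 < r ^ 2 / 2 by positivity)]
      have := norm_pos_iff.2 hβ0
      calc _ = 2 * pi * (|a| * L) := by ring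
        _ ≤ 2 * pi * ‖β‖ := by gcongr
        _ = _ := by field_simp
    have hint : (∫ ξ, ∫ η, F ξ * G η * pieceMultiplier ρ φ σ a 2 j m m ξ η *
        exp (-((ξ + η - ω : ℝ) : ℂ) ^ 2 / (4 * γ))) = r ^ 2 *
        ∫ z in (1 - k)..(1 + k), ∫ w in (-k)..k,
          (chirpAmp φ a x⁻¹ z w : ℂ) * chirpInt ρ σ a L x⁻¹ (-4) 4 z w := by
      rw [integral_eq_smul_integral_affine hr0 (a * x / 2), integral_congr_ae (ae_of_all _ fun z =>
        integral_eq_smul_integral_affine hr0 (x / 2) _), integral_const_mul, ← mul_assoc, ← sq,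
        integral_of_le (by linarith),
        ← integral_Icc_eq_integral_Ioc, ← integral_indicator measurableSet_Icc]
      congr 2; ext z
      by_cases hz : z ∈ Icc (1 - k) (1 + k)
      · rw [indicator_of_mem hz, integral_of_le (by linarith),
          ← integral_Icc_eq_integral_Ioc, ← integral_indicator measurableSet_Icc]
        congr 1; ext w
        by_cases hw : w ∈ Icc (-k) k
        · rw [hF, hG, indicator_of_mem hz, indicator_of_mem hw, indicator_of_mem hw,
            ← chirp_mul_pieceMultiplier hρ]
          congr 2
          rw [hγ, show r * (a * x / 2 + z) + r * (x / 2 + w) - ω = r * (z + w) by rw [hω]; ring]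
          push_cast
          have : (r : ℂ) ≠ 0 := ofReal_ne_zero.2 hr0.ne'
          field_simp
          rw [hβ, hL]
          push_cast
          ring
        · rw [hG, indicator_of_notMem hw, indicator_of_notMem hw]; simp
      · simp [hF, indicator_of_notMem hz]
    rw [hint, norm_mul, norm_mul, norm_pow, norm_real, norm_eq_abs, abs_of_pos hr0]
    have hfg : ‖f‖ * ‖g‖ = k * r / pi := by
      rw [← sq_eq_sq₀ (by positivity) (by positivity), mul_pow, hfn, hgn]
      field_simp
      ring
    have hm : c * √(2 * pi * |a|) * r ≤ ‖X‖ * (r ^ 2 * (c / √L)) := by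
      have hs : 0 < √L := sqrt_pos.2 hL0
      calc _ = √(2 * pi * |a|) * √L * (r * (c / √L)) := by field_simp
        _ ≤ ‖X‖ * r * (r * (c / √L)) := by gcongr
        _ = _ := by ring
    have hpos : 0 < c * √(2 * pi * |a|) * r := by have := abs_pos.2 ha; positivity
    calc _ = c * √(2 * pi * |a|) * pi / (2 * k) * (‖f‖ * ‖g‖) * ‖h‖ := by ring
      _ ≤ c * √(2 * pi * |a|) * pi / (2 * k) * (‖f‖ * ‖g‖) * 1 := by gcongr
      _ = c * √(2 * pi * |a|) * r / 2 := by rw [hfg]; field_simp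
      _ < c * √(2 * pi * |a|) * r := by linarith
      _ ≤ _ := hm.trans (by gcongr)
  · rw [pieceForm_congr hf hg hh]
    have hz : ∀ ξ η, G η * pieceMultiplier ρ φ σ a 2 i m m ξ η = 0 := by
      intro ξ η
      set w := η / r - x / 2 with hw
      have hη : η = r * (x / 2 + w) := by rw [hw]; field_simp; ring
      by_cases hwk : w ∈ Icc (-k) k
      · have h2 : (2 : ℝ) ^ (2 * (i : ℝ) + ((m : ℤ) : ℝ)) = (2 ^ i) ^ 2 * L := by
          rw [rpow_add two_pos, two_rpow_two_mul]; simp [hL]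
        have h3 : 2 * η / ((2 ^ i) ^ 2 * L) = (x / 2 ^ i) ^ 2 * (1 + 2 * x⁻¹ * w) := by
          rw [hη, hr]; field_simp
        rw [pieceMultiplier, h2, h3, hsep x _ _ hx0 (by positivity) ?_ ?_]
        · simp
        · rcases lt_or_gt_of_ne hi with h | h
          · left
            rw [← zpow_one_add₀ two_ne_zero]
            exact zpow_le_zpow_right₀ one_le_two (by omega)
          · right
            rw [hx, ← zpow_one_add₀ two_ne_zero]
            exact zpow_le_zpow_right₀ one_le_two (by omega)
        · have := abs_le.2 hwk
          rw [abs_mul, abs_mul, abs_two, abs_of_pos (by positivity)]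
          calc _ ≤ 2 * ε * (1 / 4) := by gcongr; linarith
            _ ≤ ε := by linarith
      · rw [hη, hG, indicator_of_notMem hwk, zero_mul]
    simp only [spaceOp, mul_assoc, hz, mul_zero]
    simp

theorem exists_stationaryForm_two_gt (ha : a ≠ 0) (hρ : IsSpatialCutoff ρ)
    (hφ : IsFrequencyCutoff φ) (hρ1 : ρ 1 ≠ 0) (hφ1 : φ 1 ≠ 0) (hσ : σ = 1 ∨ σ = -1) (C₀ : ℝ) :
    ∃ c : ℝ, 0 < c ∧ ∃ m₀ : ℕ, ∀ m : ℕ, m₀ ≤ m →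
      ∃ (f g : L²) (h : L^∞), c * ‖f‖ * ‖g‖ * ‖h‖ < ‖stationaryForm ρ φ σ a 2 C₀ m f g h‖ := by
  obtain ⟨k, c, L₀, hk, hk1, hc, -, hI⟩ := exists_le_norm_integral_chirp (σ := σ) ha hρ hφ hρ1 hφ1
    (by rcases hσ with rfl | rfl <;> simp)
  obtain ⟨ε, hε, hsep⟩ := exists_scale_unique hφ
  obtain ⟨m₀, hm₀⟩ := pow_unbounded_of_one_lt L₀ one_lt_two
  have ha0 := abs_pos.2 ha
  refine ⟨c * √(2 * pi * |a|) * pi / (2 * k), by positivity, m₀, fun m hm => ?_⟩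
  obtain ⟨n, hn⟩ := pow_unbounded_of_one_lt ε⁻¹ one_lt_two
  obtain ⟨N, hN⟩ := exists_nat_ge C₀
  set j := n + N + 2 * m
  have hjn : ((2 : ℝ) ^ (j : ℤ))⁻¹ ≤ ε := by
    rw [zpow_natCast]
    refine inv_le_of_inv_le₀ hε (hn.le.trans (pow_le_pow_right₀ one_le_two (by omega)))
  have hjm : ((2 : ℝ) ^ (j : ℤ))⁻¹ ≤ 1 / (2 ^ m) ^ 2 := by
    rw [zpow_natCast, one_div, ← pow_mul]
    exact inv_anti₀ (by positivity) (pow_le_pow_right₀ one_le_two (by omega))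
  obtain ⟨f, g, h, h1, h2⟩ := exists_pieceForm_ge ha hρ hφ hk hk1 hc hε hsep hjn
    (hI (2 ^ m) _ (hm₀.le.trans (pow_le_pow_right₀ one_le_two hm)) (by positivity) hjm)
  refine ⟨f, g, h, ?_⟩
  have hjC : C₀ ≤ |((j : ℤ) : ℝ)| := by
    refine hN.trans (le_trans ?_ (le_abs_self _))
    rw [Int.cast_natCast]; exact_mod_cast (by omega : N ≤ j)
  rwa [stationaryForm, tsum_eq_single (⟨(j : ℤ), hjC⟩ : {j : ℤ // C₀ ≤ |(j : ℝ)|})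
    fun i hi => h2 i fun he => hi (Subtype.ext he)]

end

/-! ### The theorem -/

theorem mainTheorem7 :
    -- exponential decay for `α ∉ {1, 2}`
    (∃ δ : ℝ, 0 < δ ∧
      ∀ a : ℝ, a ≠ -1 → ∀ α : ℝ, 0 < α → α ≠ 1 → α ≠ 2 →
      ∃ Cmin : ℝ, 0 < Cmin ∧
      ∀ ρ φ : ℝ → ℝ, IsSpatialCutoff ρ → IsFrequencyCutoff φ →
      ∀ σ : ℝ, (σ = 1 ∨ σ = -1) →
      ∃ C : ℝ, 0 < C ∧ ∀ C₀ : ℝ, Cmin ≤ C₀ →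
      ∀ (m : ℕ) (f g : Lp ℂ 2 (volume : Measure ℝ)) (h : Lp ℂ ∞ (volume : Measure ℝ)),
        (∀ j : ℤ, C₀ ≤ |(j : ℝ)| →
          Integrable (fun x : ℝ => pieceOperator ρ φ σ a α j m m f g x * h x) volume) ∧
        Summable (fun j : {j : ℤ // C₀ ≤ |(j : ℝ)|} => pieceForm ρ φ σ a α j m m f g h) ∧
        ‖stationaryForm ρ φ σ a α C₀ m f g h‖
          ≤ C * (2 : ℝ) ^ (-(δ * (m : ℝ))) * ‖f‖ * ‖g‖ * ‖h‖) ∧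
    -- no decay for `α = 2`
    (∀ a : ℝ, a ≠ -1 → a ≠ 0 →
      ∀ ρ φ : ℝ → ℝ, IsSpatialCutoff ρ → IsFrequencyCutoff φ → ρ 1 ≠ 0 → φ 1 ≠ 0 →
      ∀ σ : ℝ, (σ = 1 ∨ σ = -1) →
      ∀ C₀ : ℝ, ∃ c : ℝ, 0 < c ∧ ∃ m₀ : ℕ, ∀ m : ℕ, m₀ ≤ m →
      ∃ (f g : Lp ℂ 2 (volume : Measure ℝ)) (h : Lp ℂ ∞ (volume : Measure ℝ)),
        c * ‖f‖ * ‖g‖ * ‖h‖ < ‖stationaryForm ρ φ σ a 2 C₀ m f g h‖) := by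
  exact ⟨⟨1 / 80, by norm_num, fun a ha α hα hα1 hα2 => exists_stationaryForm_le ha hα hα1 hα2⟩,
    fun a _ ha0 ρ φ hρ hφ hρ1 hφ1 σ hσ C₀ => exists_stationaryForm_two_gt ha0 hρ hφ hρ1 hφ1 hσ C₀⟩
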